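/- Let $\eta=\mathrm{diag}(1,-1,-1,-1)$, $\Lambda>0$, and let $\phi:\mathbb R^{1,3}\to\mathbb R^4$ denote smooth fields, regarded as sections of the trivial bundle. The 1-jet bundle has the 24 coordinates $y^I=(x^\mu,u^i,u^i_\mu)$, and $j^1\phi(x)=(x,\phi(x),\partial_\mu\phi^i(x))$. A dot contracts internal indices, and spacetime indices are raised with $\eta$. All coefficient functions below are smooth functions of $t\in[0,\infty)$, evaluated at $t=u\cdot u/\Lambda^2$ (or $\phi\cdot\phi/\Lambda^2$); $'$ is $d/dt$. *Metrics.* An invariant 1-jet metric is a smooth symmetric $(0,2)$-tensor $g$ on the 1-jet bundle (possibly degenerate) that is invariant under the prolonged actions of $\mathbb R^{1,3}\rtimes O(1,3)$ and $O(4)$ and is truncated at four derivatives: with $\delta_s(x,u,u_\mu)=(s^{-1}x,u,su_\mu)$, every component of $s^2\,\delta_s^*g$ is a polynomial in $s$ of degree at most 4. Its Lagrangian is $\mathcal L[\phi,g]=\frac12\langle\eta^{-1},(j^1\phi)^*g\rangle$. For coefficient functions $c=(V,A_0,\dots,K_4)$ let $g_c$ be the symmetric tensor $$g_c=\Lambda^4g_{\mu\nu}dx^\mu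 dx^\nu+2\Lambda^2g_{\mu j}dx^\mu du^j+2\Lambda g_{\mu j}^\nu dx^\mu du^j_\nu+g_{ij}du^idu^j+\tfrac2\Lambda g_{ij}^\mu du^i_\mu du^j+\tfrac1{\Lambda^2}g_{ij}^{\mu\nu}du^i_\mu du^j_\nu,$$ where the off-diagonal $u_\mu u$ block is understood to be symmetrised in $i,j$, that is, $g_{ij}^\mu$ enters it as $\frac12(g_{ij}^\mu+g_{ji}^\mu)$, and \begin{align*} g_{ij}^{\mu\nu}&=\eta^{\mu\nu}\delta_{ij}A_0+\eta^{\mu\nu}\tfrac{u_iu_j}{\Lambda^2}A_1,\\ g_{ij}^\mu&=\tfrac{u_i^\mu u_j}{\Lambda^3}B_0+\tfrac{u_iu_j^\mu}{\Lambda^3}B_1+\delta_{ij}\tfrac{u\cdot u^\mu}{\Lambda^3}B_2+\tfrac{u_iu_j(u\cdot u^\mu)}{\Lambda^5}B_3,\\ g_{ij}&=\delta_{ij}C_0+\tfrac{u_iu_j}{\Lambda^2}C_1+\delta_{ij}\tfrac{u_\rho\cdot u^\rho}{\Lambda^4}D_0+\tfrac{u_{i\rho}u_j^\rho}{\Lambda^4}D_1+\Big[\delta_{ij}\tfrac{(u\cdot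 u_\rho)^2}{\Lambda^6}+\tfrac{u_iu_j(u_\rho\cdot u^\rho)}{\Lambda^6}\Big]\tfrac{D_2}2\\ &\quad+\tfrac{(u_iu_{j\rho}+u_ju_{i\rho})(u\cdot u^\rho)}{2\Lambda^6}D_3+\tfrac{u_iu_j(u\cdot u_\rho)^2}{\Lambda^8}D_4,\\ g_{\mu j}^\nu&=\delta_\mu^\nu\tfrac{u_j}{\Lambda}E+\tfrac{u_j(u^\nu\cdot u_\mu)}{\Lambda^5}F_{10}+\tfrac{u_j^\nu(u\cdot u_\mu)+(u\cdot u^\nu)u_{j\mu}}{2\Lambda^5}F_{11}+\tfrac{u_j(u\cdot u^\nu)(u\cdot u_\mu)}{\Lambda^7}F_{12}\\ &\quad+\delta_\mu^\nu\tfrac{u_j(u_\rho\cdot u^\rho)}{\Lambda^5}F_{20}+\delta_\mu^\nu\tfrac{u_{j\rho}(u\cdot u^\rho)}{\Lambda^5}F_{21}+\delta_\mu^\nu\tfrac{u_j(u\cdot u_\rho)^2}{\Lambda^7}F_{22},\\ g_{\mu j}&=\tfrac{u_{j\mu}}{\Lambda^2}G_0+\tfrac{u_j(u\cdot u_\mu)}{\Lambda^4}G_1+\tfrac{u_{j\mu}(u_\rho\cdot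 u^\rho)}{\Lambda^6}H_0+\tfrac{u_{j\rho}(u_\mu\cdot u^\rho)}{\Lambda^6}H_1+\Big[\tfrac{u_j(u\cdot u_\mu)(u_\rho\cdot u^\rho)+u_{j\mu}(u\cdot u_\rho)^2}{\Lambda^8}\Big]\tfrac{H_2}2\\ &\quad+\Big[\tfrac{u_j(u_\mu\cdot u_\rho)(u\cdot u^\rho)+u_{j\rho}(u\cdot u_\mu)(u\cdot u^\rho)}{\Lambda^8}\Big]\tfrac{H_3}2+\tfrac{u_j(u\cdot u_\mu)(u\cdot u_\rho)^2}{\Lambda^{10}}H_4,\\ g_{\mu\nu}&=-\tfrac12\eta_{\mu\nu}V+\Big[\tfrac{u_\mu\cdot u_\nu}{\Lambda^4}+\tfrac{\eta_{\mu\nu}}4\tfrac{u_\rho\cdot u^\rho}{\Lambda^4}\Big]\Big(\tfrac{J_0}2+\tfrac{u_\sigma\cdot u^\sigma}{\Lambda^4}\tfrac{K_0}2\Big)\\ &\quad+\Big[\tfrac{(u\cdot u_\mu)(u\cdot u_\nu)}{\Lambda^6}+\tfrac{\eta_{\mu\nu}}4\tfrac{(u\cdot u_\rho)^2}{\Lambda^6}\Big]\Big(\tfrac{J_1}2+\tfrac{(u\cdot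 u_\sigma)^2}{\Lambda^6}\tfrac{K_4}2\Big)\\ &\quad+\Big[\tfrac{(u_\sigma\cdot u_\mu)(u^\sigma\cdot u_\nu)}{\Lambda^8}+\tfrac{\eta_{\mu\nu}}4\tfrac{(u_\sigma\cdot u_\rho)^2}{\Lambda^8}\Big]\tfrac{K_1}2\\ &\quad+\Big[\tfrac{(u\cdot u_\mu)(u\cdot u_\nu)(u_\sigma\cdot u^\sigma)}{\Lambda^{10}}+\tfrac{\eta_{\mu\nu}}4\tfrac{(u\cdot u_\rho)^2(u_\sigma\cdot u^\sigma)}{\Lambda^{10}}+\tfrac{(u_\mu\cdot u_\nu)(u\cdot u_\sigma)^2}{\Lambda^{10}}\Big]\tfrac{K_2}3\\ &\quad+\Big[\tfrac{(u\cdot u_\mu)(u^\sigma\cdot u_\nu)+(u^\sigma\cdot u_\mu)(u\cdot u_\nu)}{2\Lambda^7}+\tfrac{\eta_{\mu\nu}}4\tfrac{(u\cdot u_\rho)(u^\sigma\cdot u^\rho)}{\Lambda^7}\Big]\tfrac{u\cdot u_\sigma}{\Lambda^3}\tfrac{K_3}2. \end{align*} *Operators.* Put $O_a=\partial_\mu\phi\cdot\partial^\mu\phi$,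 $O_b=(\partial_\mu\phi\cdot\phi)^2$, $O_1=\partial_\mu\partial_\nu\phi\cdot\partial^\mu\partial^\nu\phi$, $O_2=(\partial_\mu\partial_\nu\phi\cdot\phi)(\partial^\mu\partial^\nu\phi\cdot\phi)$, $O_3=(\partial_\mu\partial_\nu\phi\cdot\partial^\mu\phi)(\partial^\nu\phi\cdot\phi)$, $O_4=(\partial_\mu\partial_\nu\phi\cdot\phi)(\partial^\mu\phi\cdot\partial^\nu\phi)$, $O_5=O_a^2$, $O_6=(\partial_\mu\phi\cdot\partial_\nu\phi)^2$, $O_7=(\partial_\mu\partial_\nu\phi\cdot\phi)(\partial^\mu\phi\cdot\phi)(\partial^\nu\phi\cdot\phi)$, $O_8=O_aO_b$, $O_9=(\partial_\mu\phi\cdot\partial_\nu\phi)(\partial^\mu\phi\cdot\phi)(\partial^\nu\phi\cdot\phi)$, $O_{10}=O_b^2$; and $O_E=\square\phi\cdot\phi$, $O_{20}=O_EO_a$, $O_{21}=(\square\phi\cdot\partial_\mu\phi)(\partial^\mu\phi\cdot\phi)$, $O_{22}=O_EO_b$. For coefficient functions $\mathcal F=(\mathcal F_a,\mathcal F_b,\mathcal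 V,\mathcal F_1,\dots,\mathcal F_{10})$ let $$\mathcal L_{\mathcal F}=\tfrac12O_a\mathcal F_a+O_b\mathcal F_b-\mathcal V+\tfrac{O_1\mathcal F_1}{\Lambda^2}+\tfrac{O_2\mathcal F_2+\dots+O_6\mathcal F_6}{\Lambda^4}+\tfrac{O_7\mathcal F_7+O_8\mathcal F_8+O_9\mathcal F_9}{\Lambda^6}+\tfrac{O_{10}\mathcal F_{10}}{\Lambda^8}.$$ Write $L\simeq L'$ if $L-L'=\partial_\mu K^\mu$ with $K^\mu$ a smooth function of finitely many derivatives of $\phi$ (without explicit dependence on $x$). *Theorem.* 1. Every $g_c$ is an invariant 1-jet metric, and for every invariant 1-jet metric $g$ there is $c$ with $\mathcal L[\phi,g]=\mathcal L[\phi,g_c]$ for all $\phi$. 2. For all $c$ and $\phi$, \begin{align*} \mathcal L[\phi,g_c]&=O_a\tfrac{C_0+2G_0+J_0}2+\tfrac{O_b}{\Lambda^2}\tfrac{C_1+2G_1+J_1}2+O_EE-\Lambda^4V+\tfrac{O_1}{\Lambda^2}\tfrac{A_0}2+\tfrac{O_2}{\Lambda^4}\tfrac{A_1}2\\ &+\tfrac{O_3}{\Lambda^4}\tfrac{B_0+B_1+2B_2+2F_{11}}2+\tfrac{O_4}{\Lambda^4}\tfrac{B_0+B_1+2F_{10}}2+\tfrac{O_{20}}{\Lambda^4}F_{20}+\tfrac{O_{21}}{\Lambda^4}F_{21}\\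 &+\tfrac{O_5}{\Lambda^4}\tfrac{D_0+2H_0+K_0}2+\tfrac{O_6}{\Lambda^4}\tfrac{D_1+2H_1+K_1}2+\tfrac{O_7}{\Lambda^6}(B_3+F_{12})+\tfrac{O_{22}}{\Lambda^6}F_{22}\\ &+\tfrac{O_8}{\Lambda^6}\tfrac{D_2+2H_2+K_2}2+\tfrac{O_9}{\Lambda^6}\tfrac{D_3+2H_3+K_3}2+\tfrac{O_{10}}{\Lambda^8}\tfrac{D_4+2H_4+K_4}2. \end{align*} 3. The $E,F_{20},F_{21},F_{22}$ terms are removable by integration by parts: for every coefficient function $e$, \begin{align*} O_Ee&\simeq-O_ae-\tfrac2{\Lambda^2}O_be',& O_{20}e&\simeq-O_5e-2O_3e-\tfrac2{\Lambda^2}O_8e',\\ O_{21}e&\simeq-O_3e-O_4e-O_6e-\tfrac2{\Lambda^2}O_9e',& O_{22}e&\simeq-O_8e-2O_7e-2O_9e-\tfrac2{\Lambda^2}O_{10}e'. \end{align*} Consequently $\mathcal L[\cdot,g_c]\simeq\mathcal L_{\mathcal F}$ with $\mathcal F_a=C_0+2G_0+J_0-2E$, $\mathcal F_b=\frac{C_1+2G_1+J_1-4E'}{2\Lambda^2}$,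 $\mathcal V=\Lambda^4V$, $\mathcal F_1=\frac{A_0}2$, $\mathcal F_2=\frac{A_1}2$, $\mathcal F_3=\frac{B_0+B_1+2B_2+2F_{11}-4F_{20}-2F_{21}}2$, $\mathcal F_4=\frac{B_0+B_1+2F_{10}-2F_{21}}2$, $\mathcal F_5=\frac{D_0+2H_0+K_0-2F_{20}}2$, $\mathcal F_6=\frac{D_1+2H_1+K_1-2F_{21}}2$, $\mathcal F_7=B_3+F_{12}-2F_{22}$, $\mathcal F_8=\frac{D_2+2H_2+K_2-4F_{20}'-2F_{22}}2$, $\mathcal F_9=\frac{D_3+2H_3+K_3-4F_{21}'-4F_{22}}2$, $\mathcal F_{10}=\frac{D_4+2H_4+K_4-4F_{22}'}2$. 4. The $\mathcal L_{\mathcal F}$ form a Green's basis. Each is a local (smooth in finitely many derivatives of $\phi$), $O(4)$- and Poincaré-invariant Lagrangian with at most four derivatives (its value at $x$ on the rescaled field $y\mapsto\phi(x+s(y-x))$ is a polynomial in $s$ of degree at most 4). Every such Lagrangian is $\simeq\mathcal L_{\mathcal F}$ for some $\mathcal F$. If $\mathcal L_{\mathcal F}\simeq0$ then $\mathcal F=0$;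 in particular there is no redundancy left among the box-free operators. 5. For every $\mathcal F$ there is $c$ with $E=F_{20}=F_{21}=F_{22}=0$ and $\mathcal L[\phi,g_c]=\mathcal L_{\mathcal F}[\phi]$ for all $\phi$. If $\mathcal F_1$ is not identically zero, there is $c$ such that $\mathcal L[\cdot,g_c]\simeq\mathcal L_{\mathcal F}$ and $\det g_c$ is not identically zero. -/

import Mathlib

open scoped ContDiff Matrix
open Set

namespace HiggsJet

noncomputable section

/-! ### Spacetime, fields and the 1-jet bundle in fibred coordinates -/

/-- Minkowski spacetime, with coordinates `x^μ`, `μ = 0, 1, 2, 3`. -/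
abbrev Spacetime := Fin 4 → ℝ

/-- The fibre: four real scalars `u^i`. -/
abbrev FieldSpace := Fin 4 → ℝ

/-- The Minkowski metric `η = diag(1, -1, -1, -1)`; it is its own inverse, so the same matrix
also serves as `η^{μν}`. -/
def mink : Matrix (Fin 4) (Fin 4) ℝ := Matrix.diagonal ![1, -1, -1, -1]

/-- Lorentz matrices, that is, elements of `O(1,3)`. -/
def IsLorentz (M : Matrix (Fin 4) (Fin 4) ℝ) : Prop := Mᵀ * mink * M = mink

/-- Partial derivative `∂_μ f`. -/
def pd (μ : Fin 4) (f : Spacetime → ℝ) (x : Spacetime) : ℝ := fderiv ℝ f x (Pi.single μ 1)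

/-- First derivatives `∂_μ φ^i` of a field, as a vector in `i`. -/
def d1 (φ : Spacetime → FieldSpace) (x : Spacetime) (μ : Fin 4) : FieldSpace :=
  fun i => pd μ (fun y => φ y i) x

/-- Second derivatives `∂_μ ∂_ν φ^i` of a field, as a vector in `i`. -/
def d2 (φ : Spacetime → FieldSpace) (x : Spacetime) (μ ν : Fin 4) : FieldSpace :=
  fun i => pd μ (fun y => d1 φ y ν i) x

/-- Labels of the 24 fibred coordinates `y^I = (x^μ, u^i, u^i_μ)` of the 1-jet bundle; the label
of `u^i_μ` is `(μ, i)`. -/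
abbrev JetIdx := Fin 4 ⊕ Fin 4 ⊕ (Fin 4 × Fin 4)

/-- The 1-jet bundle of the trivial bundle `ℝ^{1,3} × ℝ^4 → ℝ^{1,3}`, in its coordinates. -/
abbrev J1 := JetIdx → ℝ

/-- The coordinates `x^μ`. -/
def xc (p : J1) : Spacetime := fun μ => p (Sum.inl μ)

/-- The coordinates `u^i`. -/
def uc (p : J1) : FieldSpace := fun i => p (Sum.inr (Sum.inl i))

/-- The coordinates `u^i_μ`, as a vector in `i` for every `μ`. -/
def wc (p : J1) (μ : Fin 4) : FieldSpace := fun i => p (Sum.inr (Sum.inr (μ, i)))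

/-- The point of the 1-jet bundle with given coordinates. -/
def mkJ1 (x : Spacetime) (u : FieldSpace) (w : Fin 4 → FieldSpace) : J1 :=
  Sum.elim x (Sum.elim u (fun q => w q.1 q.2))

/-- The prolongation `j¹φ` of the section `x ↦ (x, φ(x))`. -/
def j1 (φ : Spacetime → FieldSpace) (x : Spacetime) : J1 := mkJ1 x (φ x) (d1 φ x)

/-! ### Tensors on the 1-jet bundle -/

/-- A `(0,2)`-tensor field `g_{IJ} dy^I ⊗ dy^J` on the 1-jet bundle, through its components. -/
abbrev JetTensor := J1 → Matrix JetIdx JetIdx ℝ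

/-- Pull-back of a `(0,2)`-tensor field along a map of the 1-jet bundle to itself. -/
def pullbackJ (f : J1 → J1) (g : JetTensor) : JetTensor := fun p =>
  Matrix.of fun I J => ∑ K, ∑ L,
    g (f p) K L * fderiv ℝ f p (Pi.single I 1) K * fderiv ℝ f p (Pi.single J 1) L

/-- The components `((j¹φ)^* g)_{ρσ}` of the pull-back to spacetime along `j¹φ`. -/
def pullbackST (g : JetTensor) (φ : Spacetime → FieldSpace) (x : Spacetime) (ρ σ : Fin 4) : ℝ :=
  ∑ I, ∑ J, g (j1 φ x) I J * pd ρ (fun y => j1 φ y I) x * pd σ (fun y => j1 φ y J) x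

/-- A Lagrangian, as a functional of the field with values in functions on spacetime. -/
abbrev Lagrangian := (Spacetime → FieldSpace) → Spacetime → ℝ

/-- The Lagrangian `(1/2) ⟨η⁻¹, (j¹φ)^* g⟩`. -/
def jetLagrangian (g : JetTensor) : Lagrangian := fun φ x =>
  (1 / 2) * ∑ ρ, ∑ σ, mink ρ σ * pullbackST g φ x ρ σ

/-- Prolongation to the 1-jet bundle of the symmetry `(x, u) ↦ (M x + a, O u)`. -/
def prolong (O M : Matrix (Fin 4) (Fin 4) ℝ) (a : Spacetime) (p : J1) : J1 :=
  mkJ1 (M *ᵥ xc p + a) (O *ᵥ uc p) (fun μ => O *ᵥ (∑ ν, M⁻¹ ν μ • wc p ν))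

/-- Prolongation to the 1-jet bundle of the rescaling `x ↦ s⁻¹ x`; it multiplies every
derivative coordinate by `s`. -/
def dilate (s : ℝ) (p : J1) : J1 := mkJ1 (s⁻¹ • xc p) (uc p) (fun μ => s • wc p μ)

/-- Smooth symmetric `(0,2)`-tensors on the 1-jet bundle that are invariant under the
prolonged actions of the Poincaré group `ℝ^{1,3} ⋊ O(1,3)` and of `O(4)`, and whose
pull-backs contain at most four derivatives. For the last condition derivatives are counted with
the rescaling of spacetime: a component with `n` legs `dx` and `m` legs `du_μ` that has degree
`d` in the coordinates `u_μ` contributes the power `s ^ (2 - n + m + d)`, and `2 - n + m + d` is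
the number of derivatives in the corresponding terms of the Lagrangian. -/
structure IsInvariantJetMetric (g : JetTensor) : Prop where
  smooth : ∀ I J, ContDiff ℝ ∞ (fun p => g p I J)
  symm : ∀ p, (g p).IsSymm
  invariant : ∀ O ∈ Matrix.orthogonalGroup (Fin 4) ℝ, ∀ M, IsLorentz M → ∀ a,
    pullbackJ (prolong O M a) g = g
  atMostFour : ∀ p I J, ∃ q : Polynomial ℝ, q.natDegree ≤ 4 ∧
    ∀ s : ℝ, s ≠ 0 → s ^ 2 * pullbackJ (dilate s) g p I J = q.eval s

/-! ### The `O(4)`-symmetric 1-jet metric -/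

/-- Labels of the coefficient functions of the metric. -/
inductive MetricLabel
  | V | A0 | A1 | B0 | B1 | B2 | B3 | C0 | C1 | D0 | D1 | D2 | D3 | D4 | E
  | F10 | F11 | F12 | F20 | F21 | F22 | G0 | G1 | H0 | H1 | H2 | H3 | H4
  | J0 | J1 | K0 | K1 | K2 | K3 | K4

/-- A family of functions of `t = (u·u)/Λ² ∈ [0, ∞)`, smooth up to the end point `0`. -/
def SmoothCoeffs {ι : Type} (c : ι → ℝ → ℝ) : Prop := ∀ l, ContDiffOn ℝ ∞ (c l) (Ici 0)

section Metric

variable (Λ : ℝ) (c : MetricLabel → ℝ → ℝ) (p : J1)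

/-- A coefficient function evaluated at `(u·u)/Λ²`. -/
def cf (l : MetricLabel) : ℝ := c l ((uc p ⬝ᵥ uc p) / Λ ^ 2)

/-- `u^i_μ` with its spacetime index raised. -/
def wUp (μ : Fin 4) : FieldSpace := ∑ ν, mink μ ν • wc p ν

/-- `u · u_μ`. -/
def sDn (μ : Fin 4) : ℝ := uc p ⬝ᵥ wc p μ

/-- `u · u^μ`. -/
def sUp (μ : Fin 4) : ℝ := uc p ⬝ᵥ wUp p μ

/-- `u_ρ · u^ρ`. -/
def ww : ℝ := ∑ ρ, wc p ρ ⬝ᵥ wUp p ρ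

/-- `(u · u_ρ)² = (u · u_ρ)(u · u^ρ)`. -/
def ss : ℝ := ∑ ρ, sDn p ρ * sUp p ρ

/-- Kronecker delta. -/
def kd (i j : Fin 4) : ℝ := if i = j then 1 else 0

/-- `g_{ij}^{μν}`. -/
def gDD (i j μ ν : Fin 4) : ℝ :=
  mink μ ν * kd i j * cf Λ c p .A0 + mink μ ν * (uc p i * uc p j / Λ ^ 2) * cf Λ c p .A1

/-- `g_{ij}^μ`. -/
def gDU (i j μ : Fin 4) : ℝ :=
  wUp p μ i * uc p j / Λ ^ 3 * cf Λ c p .B0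
  + uc p i * wUp p μ j / Λ ^ 3 * cf Λ c p .B1
  + kd i j * sUp p μ / Λ ^ 3 * cf Λ c p .B2
  + uc p i * uc p j * sUp p μ / Λ ^ 5 * cf Λ c p .B3

/-- `g_{ij}`. -/
def gUU (i j : Fin 4) : ℝ :=
  kd i j * cf Λ c p .C0 + uc p i * uc p j / Λ ^ 2 * cf Λ c p .C1
  + kd i j * ww p / Λ ^ 4 * cf Λ c p .D0
  + (∑ ρ, wc p ρ i * wUp p ρ j) / Λ ^ 4 * cf Λ c p .D1
  + (kd i j * ss p / Λ ^ 6 + uc p i * uc p j * ww p / Λ ^ 6) * (cf Λ c p .D2 / 2)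
  + (∑ ρ, (uc p i * wc p ρ j + uc p j * wc p ρ i) * sUp p ρ) / (2 * Λ ^ 6) * cf Λ c p .D3
  + uc p i * uc p j * ss p / Λ ^ 8 * cf Λ c p .D4

/-- `g_{μj}^ν`. -/
def gXD (μ j ν : Fin 4) : ℝ :=
  kd μ ν * (uc p j / Λ) * cf Λ c p .E
  + uc p j * (wUp p ν ⬝ᵥ wc p μ) / Λ ^ 5 * cf Λ c p .F10
  + (wUp p ν j * sDn p μ + sUp p ν * wc p μ j) / (2 * Λ ^ 5) * cf Λ c p .F11
  + uc p j * sUp p ν * sDn p μ / Λ ^ 7 * cf Λ c p .F12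
  + kd μ ν * (uc p j * ww p / Λ ^ 5) * cf Λ c p .F20
  + kd μ ν * ((∑ ρ, wc p ρ j * sUp p ρ) / Λ ^ 5) * cf Λ c p .F21
  + kd μ ν * (uc p j * ss p / Λ ^ 7) * cf Λ c p .F22

/-- `g_{μj}`. -/
def gXU (μ j : Fin 4) : ℝ :=
  wc p μ j / Λ ^ 2 * cf Λ c p .G0 + uc p j * sDn p μ / Λ ^ 4 * cf Λ c p .G1
  + wc p μ j * ww p / Λ ^ 6 * cf Λ c p .H0
  + (∑ ρ, wc p ρ j * (wc p μ ⬝ᵥ wUp p ρ)) / Λ ^ 6 * cf Λ c p .H1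
  + (uc p j * sDn p μ * ww p / Λ ^ 8 + wc p μ j * ss p / Λ ^ 8) * (cf Λ c p .H2 / 2)
  + (uc p j * (∑ ρ, (wc p μ ⬝ᵥ wc p ρ) * sUp p ρ) / Λ ^ 8
      + (∑ ρ, wc p ρ j * sDn p μ * sUp p ρ) / Λ ^ 8) * (cf Λ c p .H3 / 2)
  + uc p j * sDn p μ * ss p / Λ ^ 10 * cf Λ c p .H4

/-- `g_{μν}`. -/
def gXX (μ ν : Fin 4) : ℝ :=
  -(1 / 2) * mink μ ν * cf Λ c p .V
  + ((wc p μ ⬝ᵥ wc p ν) / Λ ^ 4 + mink μ ν / 4 * (ww p / Λ ^ 4)) * (cf Λ c p .J0 / 2)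
  + (sDn p μ * sDn p ν / Λ ^ 6 + mink μ ν / 4 * (ss p / Λ ^ 6)) * (cf Λ c p .J1 / 2)
  + ((wc p μ ⬝ᵥ wc p ν) / Λ ^ 4 + mink μ ν / 4 * (ww p / Λ ^ 4)) * (ww p / Λ ^ 4)
      * (cf Λ c p .K0 / 2)
  + ((∑ σ, (wc p σ ⬝ᵥ wc p μ) * (wUp p σ ⬝ᵥ wc p ν)) / Λ ^ 8
      + mink μ ν / 4 * ((∑ σ, ∑ ρ, (wc p σ ⬝ᵥ wc p ρ) * (wUp p σ ⬝ᵥ wUp p ρ)) / Λ ^ 8))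
      * (cf Λ c p .K1 / 2)
  + (sDn p μ * sDn p ν * ww p / Λ ^ 10 + mink μ ν / 4 * (ss p * ww p / Λ ^ 10)
      + (wc p μ ⬝ᵥ wc p ν) * ss p / Λ ^ 10) * (cf Λ c p .K2 / 3)
  + (∑ σ, ((sDn p μ * (wUp p σ ⬝ᵥ wc p ν) + (wUp p σ ⬝ᵥ wc p μ) * sDn p ν) / (2 * Λ ^ 7)
      + mink μ ν / 4 * ((∑ ρ, sDn p ρ * (wUp p σ ⬝ᵥ wUp p ρ)) / Λ ^ 7))
      * (sDn p σ / Λ ^ 3)) * (cf Λ c p .K3 / 2)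
  + (sDn p μ * sDn p ν / Λ ^ 6 + mink μ ν / 4 * (ss p / Λ ^ 6)) * (ss p / Λ ^ 6)
      * (cf Λ c p .K4 / 2)

/-- The metric
`Λ⁴ g_{μν} dx dx + 2 Λ² g_{μj} dx du + 2 Λ g_{μj}^ν dx du_ν + g_{ij} du du
+ (2/Λ) g_{ij}^μ du_μ du + (1/Λ²) g_{ij}^{μν} du_μ du_ν`, as a symmetric tensor. Since
`g_{ij}^μ` is not symmetric in `i, j` and occurs in both off-diagonal blocks with the same order
of `i, j`, only its symmetric part survives in the symmetric tensor. -/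
def higgsMetric : Matrix JetIdx JetIdx ℝ := Matrix.of fun I J =>
  match I, J with
  | .inl μ, .inl ν => Λ ^ 4 * gXX Λ c p μ ν
  | .inl μ, .inr (.inl j) => Λ ^ 2 * gXU Λ c p μ j
  | .inr (.inl i), .inl ν => Λ ^ 2 * gXU Λ c p ν i
  | .inl μ, .inr (.inr (ν, j)) => Λ * gXD Λ c p μ j ν
  | .inr (.inr (μ, i)), .inl ν => Λ * gXD Λ c p ν i μ
  | .inr (.inl i), .inr (.inl j) => gUU Λ c p i j
  | .inr (.inr (μ, i)), .inr (.inl j) => (gDU Λ c p i j μ + gDU Λ c p j i μ) / 2 / Λ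
  | .inr (.inl i), .inr (.inr (ν, j)) => (gDU Λ c p i j ν + gDU Λ c p j i ν) / 2 / Λ
  | .inr (.inr (μ, i)), .inr (.inr (ν, j)) => gDD Λ c p i j μ ν / Λ ^ 2

end Metric

/-! ### Operators -/

section Operators

variable (φ : Spacetime → FieldSpace) (x : Spacetime)

/-- `(φ·φ)/Λ²`. -/
def tt (Λ : ℝ) : ℝ := (φ x ⬝ᵥ φ x) / Λ ^ 2

/-- `∂^μ φ`. -/
def d1Up (μ : Fin 4) : FieldSpace := ∑ ν, mink μ ν • d1 φ x ν

/-- `∂^μ ∂^ν φ`. -/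
def d2Up (μ ν : Fin 4) : FieldSpace := ∑ ρ, ∑ σ, (mink μ ρ * mink ν σ) • d2 φ x ρ σ

/-- `□φ = ∂_μ ∂^μ φ`. -/
def box : FieldSpace := ∑ μ, ∑ ν, mink μ ν • d2 φ x μ ν

/-- `∂_μφ·∂^μφ`. -/
def opA : ℝ := ∑ μ, d1 φ x μ ⬝ᵥ d1Up φ x μ

/-- `(∂_μφ·φ)²`. -/
def opB : ℝ := ∑ μ, (d1 φ x μ ⬝ᵥ φ x) * (d1Up φ x μ ⬝ᵥ φ x)

/-- `∂_μ∂_νφ·∂^μ∂^νφ`. -/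
def op1 : ℝ := ∑ μ, ∑ ν, d2 φ x μ ν ⬝ᵥ d2Up φ x μ ν

/-- `(∂_μ∂_νφ·φ)(∂^μ∂^νφ·φ)`. -/
def op2 : ℝ := ∑ μ, ∑ ν, (d2 φ x μ ν ⬝ᵥ φ x) * (d2Up φ x μ ν ⬝ᵥ φ x)

/-- `(∂_μ∂_νφ·∂^μφ)(∂^νφ·φ)`. -/
def op3 : ℝ := ∑ μ, ∑ ν, (d2 φ x μ ν ⬝ᵥ d1Up φ x μ) * (d1Up φ x ν ⬝ᵥ φ x)

/-- `(∂_μ∂_νφ·φ)(∂^μφ·∂^νφ)`. -/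
def op4 : ℝ := ∑ μ, ∑ ν, (d2 φ x μ ν ⬝ᵥ φ x) * (d1Up φ x μ ⬝ᵥ d1Up φ x ν)

/-- `(∂_μφ·∂^μφ)²`. -/
def op5 : ℝ := opA φ x ^ 2

/-- `(∂_μφ·∂_νφ)²`. -/
def op6 : ℝ := ∑ μ, ∑ ν, (d1 φ x μ ⬝ᵥ d1 φ x ν) * (d1Up φ x μ ⬝ᵥ d1Up φ x ν)

/-- `(∂_μ∂_νφ·φ)(∂^μφ·φ)(∂^νφ·φ)`. -/
def op7 : ℝ := ∑ μ, ∑ ν,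
  (d2 φ x μ ν ⬝ᵥ φ x) * (d1Up φ x μ ⬝ᵥ φ x) * (d1Up φ x ν ⬝ᵥ φ x)

/-- `(∂_μφ·∂^μφ)(∂_νφ·φ)²`. -/
def op8 : ℝ := opA φ x * opB φ x

/-- `(∂_μφ·∂_νφ)(∂^μφ·φ)(∂^νφ·φ)`. -/
def op9 : ℝ := ∑ μ, ∑ ν,
  (d1 φ x μ ⬝ᵥ d1 φ x ν) * (d1Up φ x μ ⬝ᵥ φ x) * (d1Up φ x ν ⬝ᵥ φ x)

/-- `(∂_μφ·φ)⁴`. -/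
def op10 : ℝ := opB φ x ^ 2

/-- `□φ·φ`. -/
def opE : ℝ := box φ x ⬝ᵥ φ x

/-- `(□φ·φ)(∂_μφ·∂^μφ)`. -/
def op20 : ℝ := opE φ x * opA φ x

/-- `(□φ·∂_μφ)(∂^μφ·φ)`. -/
def op21 : ℝ := ∑ μ, (box φ x ⬝ᵥ d1 φ x μ) * (d1Up φ x μ ⬝ᵥ φ x)

/-- `(□φ·φ)(∂_μφ·φ)²`. -/
def op22 : ℝ := opE φ x * opB φ x

end Operators

/-- Labels of the coefficient functions `F_a, F_b, V, F_1, …, F_10` of the box-free basis. -/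
inductive GreenLabel
  | Fa | Fb | V | F1 | F2 | F3 | F4 | F5 | F6 | F7 | F8 | F9 | F10

/-- The box-free Lagrangian with up to four derivatives. -/
def greenLagrangian (Λ : ℝ) (f : GreenLabel → ℝ → ℝ) : Lagrangian := fun φ x =>
  (1 / 2) * opA φ x * f .Fa (tt φ x Λ) + opB φ x * f .Fb (tt φ x Λ) - f .V (tt φ x Λ)
  + 1 / Λ ^ 2 * op1 φ x * f .F1 (tt φ x Λ)
  + 1 / Λ ^ 4 * op2 φ x * f .F2 (tt φ x Λ)
  + 1 / Λ ^ 4 * op3 φ x * f .F3 (tt φ x Λ)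
  + 1 / Λ ^ 4 * op4 φ x * f .F4 (tt φ x Λ)
  + 1 / Λ ^ 4 * op5 φ x * f .F5 (tt φ x Λ)
  + 1 / Λ ^ 4 * op6 φ x * f .F6 (tt φ x Λ)
  + 1 / Λ ^ 6 * op7 φ x * f .F7 (tt φ x Λ)
  + 1 / Λ ^ 6 * op8 φ x * f .F8 (tt φ x Λ)
  + 1 / Λ ^ 6 * op9 φ x * f .F9 (tt φ x Λ)
  + 1 / Λ ^ 8 * op10 φ x * f .F10 (tt φ x Λ)

/-- The right-hand side of the pull-back formula: the Lagrangian of the metric with coefficient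
functions `c`, before integration by parts. -/
def pulledBackForm (Λ : ℝ) (c : MetricLabel → ℝ → ℝ) : Lagrangian := fun φ x =>
  let k : MetricLabel → ℝ := fun l => c l (tt φ x Λ)
  opA φ x * ((k .C0 + 2 * k .G0 + k .J0) / 2)
  + opB φ x / Λ ^ 2 * ((k .C1 + 2 * k .G1 + k .J1) / 2)
  + opE φ x * k .E
  - Λ ^ 4 * k .V
  + op1 φ x / Λ ^ 2 * (k .A0 / 2)
  + op2 φ x / Λ ^ 4 * (k .A1 / 2)
  + op3 φ x / Λ ^ 4 * ((k .B0 + k .B1 + 2 * k .B2 + 2 * k .F11) / 2)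
  + op4 φ x / Λ ^ 4 * ((k .B0 + k .B1 + 2 * k .F10) / 2)
  + op20 φ x / Λ ^ 4 * k .F20
  + op21 φ x / Λ ^ 4 * k .F21
  + op5 φ x / Λ ^ 4 * ((k .D0 + 2 * k .H0 + k .K0) / 2)
  + op6 φ x / Λ ^ 4 * ((k .D1 + 2 * k .H1 + k .K1) / 2)
  + op7 φ x / Λ ^ 6 * (k .B3 + k .F12)
  + op22 φ x / Λ ^ 6 * k .F22
  + op8 φ x / Λ ^ 6 * ((k .D2 + 2 * k .H2 + k .K2) / 2)
  + op9 φ x / Λ ^ 6 * ((k .D3 + 2 * k .H3 + k .K3) / 2)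
  + op10 φ x / Λ ^ 8 * ((k .D4 + 2 * k .H4 + k .K4) / 2)

/-- Derivative of a coefficient function with respect to its argument `t ∈ [0, ∞)`. -/
def dt (e : ℝ → ℝ) (t : ℝ) : ℝ := derivWithin e (Ici 0) t

/-- The coefficient functions in the box-free basis after integration by parts. -/
def reducedCoeffs (Λ : ℝ) (c : MetricLabel → ℝ → ℝ) : GreenLabel → ℝ → ℝ
  | .Fa => fun t => c .C0 t + 2 * c .G0 t + c .J0 t - 2 * c .E t
  | .Fb => fun t => (c .C1 t + 2 * c .G1 t + c .J1 t - 4 * dt (c .E) t) / (2 * Λ ^ 2)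
  | .V => fun t => Λ ^ 4 * c .V t
  | .F1 => fun t => c .A0 t / 2
  | .F2 => fun t => c .A1 t / 2
  | .F3 => fun t => (c .B0 t + c .B1 t + 2 * c .B2 t + 2 * c .F11 t
      - 4 * c .F20 t - 2 * c .F21 t) / 2
  | .F4 => fun t => (c .B0 t + c .B1 t + 2 * c .F10 t - 2 * c .F21 t) / 2
  | .F5 => fun t => (c .D0 t + 2 * c .H0 t + c .K0 t - 2 * c .F20 t) / 2
  | .F6 => fun t => (c .D1 t + 2 * c .H1 t + c .K1 t - 2 * c .F21 t) / 2
  | .F7 => fun t => c .B3 t + c .F12 t - 2 * c .F22 t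
  | .F8 => fun t => (c .D2 t + 2 * c .H2 t + c .K2 t - 4 * dt (c .F20) t - 2 * c .F22 t) / 2
  | .F9 => fun t => (c .D3 t + 2 * c .H3 t + c .K3 t - 4 * dt (c .F21) t - 4 * c .F22 t) / 2
  | .F10 => fun t => (c .D4 t + 2 * c .H4 t + c .K4 t - 4 * dt (c .F22) t) / 2

/-! ### Local Lagrangians and integration by parts -/

/-- Values of the derivatives of orders `0, …, r` of a field at a point. -/
abbrev JetSpace (r : ℕ) :=
  (m : Fin (r + 1)) → ContinuousMultilinearMap ℝ (fun _ : Fin (m : ℕ) => Spacetime) FieldSpace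

/-- The derivatives of orders `0, …, r` of `φ` at `x`. -/
def jet (r : ℕ) (φ : Spacetime → FieldSpace) (x : Spacetime) : JetSpace r :=
  fun m => iteratedFDeriv ℝ (m : ℕ) φ x

/-- `L` is a total derivative `∂_μ K^μ`, where `K^μ` is a smooth function of finitely many
derivatives of the field. -/
def IsTotalDerivative (L : Lagrangian) : Prop :=
  ∃ (r : ℕ) (K : JetSpace r → Spacetime), ContDiff ℝ ∞ K ∧
    ∀ φ : Spacetime → FieldSpace, ContDiff ℝ ∞ φ → ∀ x,
      L φ x = ∑ μ, pd μ (fun y => K (jet r φ y) μ) x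

/-- Equality up to integration by parts. -/
def IBPEquiv (L L' : Lagrangian) : Prop := IsTotalDerivative (fun φ x => L φ x - L' φ x)

/-- Local Lagrangians (smooth functions of finitely many derivatives of the field) that are
invariant under `O(4)` and the Poincaré group and contain at most four derivatives: a term
with `d` derivatives scales with `s ^ d` when `φ` is replaced by `y ↦ φ(x + s (y - x))`. -/
structure IsInvariantLagrangian (L : Lagrangian) : Prop where
  isLocal : ∃ (r : ℕ) (l : JetSpace r → ℝ), ContDiff ℝ ∞ l ∧
    ∀ φ : Spacetime → FieldSpace, ContDiff ℝ ∞ φ → ∀ x, L φ x = l (jet r φ x)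
  internal : ∀ O ∈ Matrix.orthogonalGroup (Fin 4) ℝ, ∀ φ : Spacetime → FieldSpace,
    ContDiff ℝ ∞ φ → ∀ x, L (fun y => O *ᵥ φ y) x = L φ x
  poincare : ∀ M, IsLorentz M → ∀ (a : Spacetime) (φ : Spacetime → FieldSpace),
    ContDiff ℝ ∞ φ → ∀ x, L (fun y => φ (M *ᵥ y + a)) x = L φ (M *ᵥ x + a)
  atMostFour : ∀ φ : Spacetime → FieldSpace, ContDiff ℝ ∞ φ → ∀ x,
    ∃ q : Polynomial ℝ, q.natDegree ≤ 4 ∧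
      ∀ s : ℝ, L (fun y => φ (x + s • (y - x))) x = q.eval s

/-- The family of Lagrangians `green f`, with smooth coefficient functions `f`, is a Green's
basis: every invariant Lagrangian with at most four derivatives is one of them up to integration
by parts, and no non-zero choice of coefficients gives a total derivative. -/
structure IsGreenBasis {ι : Type} (green : (ι → ℝ → ℝ) → Lagrangian) : Prop where
  invariant : ∀ f, SmoothCoeffs f → IsInvariantLagrangian (green f)
  complete : ∀ L, IsInvariantLagrangian L → ∃ f, SmoothCoeffs f ∧ IBPEquiv L (green f)
  nonredundant : ∀ f, SmoothCoeffs f → IsTotalDerivative (green f) →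
    ∀ l, ∀ t, 0 ≤ t → f l t = 0

end

end HiggsJet

open HiggsJet

open scoped ContDiff Matrix
open Set
open HiggsJet
namespace HiggsJet
noncomputable section

/-! ### The Minkowski signs -/

/-- The diagonal entries of the Minkowski metric. -/
def et (μ : Fin 4) : ℝ := ![1, -1, -1, -1] μ

theorem mink_apply (μ ν : Fin 4) : mink μ ν = if μ = ν then et μ else 0 := by
  simp only [mink, Matrix.diagonal_apply, et]

theorem et_mul_self (μ : Fin 4) : et μ * et μ = 1 := by
  fin_cases μ <;> simp [et]

theorem et_ne_zero (μ : Fin 4) : et μ ≠ 0 := by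
  fin_cases μ <;> simp [et]

theorem sum_mink_mul (μ : Fin 4) (f : Fin 4 → ℝ) : ∑ ν, mink μ ν * f ν = et μ * f μ := by
  simp [mink_apply]

theorem sum_mink_smul (μ : Fin 4) (f : Fin 4 → FieldSpace) :
    ∑ ν, mink μ ν • f ν = et μ • f μ := by
  simp [mink_apply]

theorem wUp_eq (p : J1) (μ : Fin 4) : wUp p μ = et μ • wc p μ := sum_mink_smul μ (wc p)

theorem sUp_eq (p : J1) (μ : Fin 4) : sUp p μ = et μ * sDn p μ := by
  simp [sUp, sDn, wUp_eq]

theorem d1Up_eq (φ : Spacetime → FieldSpace) (x : Spacetime) (μ : Fin 4) :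
    d1Up φ x μ = et μ • d1 φ x μ := sum_mink_smul μ (d1 φ x)

theorem d2Up_eq (φ : Spacetime → FieldSpace) (x : Spacetime) (μ ν : Fin 4) :
    d2Up φ x μ ν = (et μ * et ν) • d2 φ x μ ν := by
  simp only [d2Up, mul_smul, ← Finset.smul_sum, sum_mink_smul]

theorem box_eq (φ : Spacetime → FieldSpace) (x : Spacetime) :
    box φ x = ∑ μ, et μ • d2 φ x μ μ := by
  simp only [box, sum_mink_smul]

/-! ### Partial derivatives -/

section pd

variable {f g : Spacetime → ℝ} {a b : Spacetime → FieldSpace} {x : Spacetime} {μ ν : Fin 4}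

theorem pd_add (hf : ContDiff ℝ ∞ f) (hg : ContDiff ℝ ∞ g) :
    pd μ (fun y => f y + g y) x = pd μ f x + pd μ g x := by
  unfold pd
  rw [fderiv_fun_add (hf.differentiable (by simp) x) (hg.differentiable (by simp) x)]
  rfl

theorem pd_mul (hf : ContDiff ℝ ∞ f) (hg : ContDiff ℝ ∞ g) :
    pd μ (fun y => f y * g y) x = pd μ f x * g x + f x * pd μ g x := by
  unfold pd
  rw [fderiv_fun_mul (hf.differentiable (by simp) x) (hg.differentiable (by simp) x)]
  simp
  ring

theorem pd_const (c : ℝ) : pd μ (fun _ => c) x = 0 := by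
  simp [pd]

theorem pd_const_mul (c : ℝ) (hf : ContDiff ℝ ∞ f) :
    pd μ (fun y => c * f y) x = c * pd μ f x := by
  rw [pd_mul contDiff_const hf, pd_const]; ring

theorem pd_sum {ι : Type*} {s : Finset ι} {F : ι → Spacetime → ℝ}
    (h : ∀ i, ContDiff ℝ ∞ (F i)) :
    pd μ (fun y => ∑ i ∈ s, F i y) x = ∑ i ∈ s, pd μ (F i) x := by
  unfold pd
  rw [fderiv_fun_sum (fun i _ => (h i).differentiable (by simp) x)]
  simp

theorem contDiff_pd (hf : ContDiff ℝ ∞ f) : ContDiff ℝ ∞ (pd μ f) := by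
  unfold pd
  exact (hf.fderiv_right (m := ∞) (by simp)).clm_apply contDiff_const

theorem pd_comm (hf : ContDiff ℝ ∞ f) : pd μ (pd ν f) x = pd ν (pd μ f) x := by
  have h := (hf.contDiffAt (x := x)).isSymmSndFDerivAt
    (by rw [minSmoothness_of_isRCLikeNormedField]; exact WithTop.coe_le_coe.2 le_top)
  have hd : DifferentiableAt ℝ (fderiv ℝ f) x :=
    (hf.fderiv_right (m := ∞) (by simp)).differentiable (by simp) x
  have key : ∀ α β : Fin 4, pd α (pd β f) x
      = fderiv ℝ (fderiv ℝ f) x (Pi.single α 1) (Pi.single β 1) := by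
    intro α β
    unfold pd
    rw [fderiv_clm_apply hd (differentiableAt_const _)]
    simp
  rw [key, key]
  exact h _ _

theorem pd_coord (i : Fin 4) : pd μ (fun y : Spacetime => y i) x = if i = μ then 1 else 0 := by
  unfold pd
  rw [show (fun y : Spacetime => y i) = (ContinuousLinearMap.proj (R := ℝ) i :
    Spacetime →L[ℝ] ℝ) from rfl, ContinuousLinearMap.fderiv]
  simp [Pi.single_apply]

/-- Partial derivative of a vector-valued function. -/
def pdv (μ : Fin 4) (a : Spacetime → FieldSpace) (x : Spacetime) : FieldSpace :=
  fun i => pd μ (fun y => a y i) x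

theorem contDiff_comp_apply (ha : ContDiff ℝ ∞ a) (i : Fin 4) :
    ContDiff ℝ ∞ (fun y => a y i) := contDiff_pi.1 ha i

theorem contDiff_pdv (ha : ContDiff ℝ ∞ a) : ContDiff ℝ ∞ (pdv μ a) :=
  contDiff_pi.2 fun i => contDiff_pd (contDiff_comp_apply ha i)

theorem pdv_comm (ha : ContDiff ℝ ∞ a) : pdv μ (pdv ν a) x = pdv ν (pdv μ a) x :=
  funext fun i => pd_comm (contDiff_comp_apply ha i)

theorem contDiff_dot (ha : ContDiff ℝ ∞ a) (hb : ContDiff ℝ ∞ b) :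
    ContDiff ℝ ∞ (fun y => a y ⬝ᵥ b y) := by
  unfold dotProduct
  exact ContDiff.sum fun i _ => (contDiff_comp_apply ha i).mul (contDiff_comp_apply hb i)

theorem pd_dot (ha : ContDiff ℝ ∞ a) (hb : ContDiff ℝ ∞ b) :
    pd μ (fun y => a y ⬝ᵥ b y) x = pdv μ a x ⬝ᵥ b x + a x ⬝ᵥ pdv μ b x := by
  unfold dotProduct
  rw [pd_sum (fun i => (contDiff_comp_apply ha i).mul (contDiff_comp_apply hb i)),
    ← Finset.sum_add_distrib]
  exact Finset.sum_congr rfl fun i _ =>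
    pd_mul (contDiff_comp_apply ha i) (contDiff_comp_apply hb i)

end pd

section fields

variable {φ : Spacetime → FieldSpace}

theorem contDiff_d1 (h : ContDiff ℝ ∞ φ) (μ : Fin 4) : ContDiff ℝ ∞ (fun y => d1 φ y μ) :=
  contDiff_pdv h

theorem contDiff_d2 (h : ContDiff ℝ ∞ φ) (μ ν : Fin 4) : ContDiff ℝ ∞ (fun y => d2 φ y μ ν) :=
  contDiff_pdv (contDiff_d1 h ν)

/-- Third derivatives. -/
def d3 (φ : Spacetime → FieldSpace) (x : Spacetime) (μ ν ρ : Fin 4) : FieldSpace :=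
  pdv μ (fun y => d2 φ y ν ρ) x

/-- Fourth derivatives. -/
def d4 (φ : Spacetime → FieldSpace) (x : Spacetime) (μ ν ρ σ : Fin 4) : FieldSpace :=
  pdv μ (fun y => d3 φ y ν ρ σ) x

theorem contDiff_d3 (h : ContDiff ℝ ∞ φ) (μ ν ρ : Fin 4) :
    ContDiff ℝ ∞ (fun y => d3 φ y μ ν ρ) := contDiff_pdv (contDiff_d2 h ν ρ)

theorem d2_comm (h : ContDiff ℝ ∞ φ) (x : Spacetime) (μ ν : Fin 4) :
    d2 φ x μ ν = d2 φ x ν μ := pdv_comm h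

theorem d3_comm_left (h : ContDiff ℝ ∞ φ) (x : Spacetime) (μ ν ρ : Fin 4) :
    d3 φ x μ ν ρ = d3 φ x ν μ ρ := pdv_comm (contDiff_d1 h ρ)

theorem d3_comm_right (h : ContDiff ℝ ∞ φ) (x : Spacetime) (μ ν ρ : Fin 4) :
    d3 φ x μ ν ρ = d3 φ x μ ρ ν := by
  unfold d3
  congr 1
  exact funext fun y => d2_comm h y ν ρ

theorem d4_comm_left (h : ContDiff ℝ ∞ φ) (x : Spacetime) (μ ν ρ σ : Fin 4) :
    d4 φ x μ ν ρ σ = d4 φ x ν μ ρ σ := pdv_comm (contDiff_d2 h ρ σ)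

theorem d4_comm_mid (h : ContDiff ℝ ∞ φ) (x : Spacetime) (μ ν ρ σ : Fin 4) :
    d4 φ x μ ν ρ σ = d4 φ x μ ρ ν σ := by
  unfold d4
  congr 1
  exact funext fun y => d3_comm_left h y ν ρ σ

theorem d4_comm_right (h : ContDiff ℝ ∞ φ) (x : Spacetime) (μ ν ρ σ : Fin 4) :
    d4 φ x μ ν ρ σ = d4 φ x μ ν σ ρ := by
  unfold d4
  congr 1
  exact funext fun y => d3_comm_right h y ν ρ σ

end fields

/-! ### Local functionals -/

/-- A functional of the field that is a smooth function of finitely many derivatives. -/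
def IsLocalFn (L : Lagrangian) : Prop :=
  ∃ (r : ℕ) (l : JetSpace r → ℝ), ContDiff ℝ ∞ l ∧
    ∀ φ : Spacetime → FieldSpace, ContDiff ℝ ∞ φ → ∀ x, L φ x = l (jet r φ x)

/-- Forgetting the derivatives of order greater than `r`. -/
def jetRestrict {r r' : ℕ} (h : r ≤ r') : JetSpace r' →L[ℝ] JetSpace r :=
  ContinuousLinearMap.pi fun m : Fin (r + 1) =>
    ContinuousLinearMap.proj (R := ℝ) (φ := fun m : Fin (r' + 1) =>
      ContinuousMultilinearMap ℝ (fun _ : Fin (m : ℕ) => Spacetime) FieldSpace)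
      (Fin.castLE (by omega) m)

theorem jetRestrict_jet {r r' : ℕ} (h : r ≤ r') (φ : Spacetime → FieldSpace) (x : Spacetime) :
    jetRestrict h (jet r' φ x) = jet r φ x := rfl

/-- The total derivative in the direction `v`, on jets. -/
def jetShift (r : ℕ) (v : Spacetime) : JetSpace (r + 1) →L[ℝ] JetSpace r :=
  ContinuousLinearMap.pi fun m : Fin (r + 1) =>
    (ContinuousLinearMap.apply ℝ (ContinuousMultilinearMap ℝ (fun _ : Fin (m : ℕ) => Spacetime)
        FieldSpace) v).comp
      ((continuousMultilinearCurryLeftEquiv ℝ (fun _ : Fin ((m : ℕ) + 1) => Spacetime)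
        FieldSpace).toContinuousLinearEquiv.toContinuousLinearMap.comp
      (show JetSpace (r + 1) →L[ℝ] ContinuousMultilinearMap ℝ
          (fun _ : Fin ((m : ℕ) + 1) => Spacetime) FieldSpace from
        ContinuousLinearMap.proj (R := ℝ) (φ := fun m : Fin (r + 1 + 1) =>
          ContinuousMultilinearMap ℝ (fun _ : Fin (m : ℕ) => Spacetime) FieldSpace) m.succ))

theorem contDiff_jet {φ : Spacetime → FieldSpace} (h : ContDiff ℝ ∞ φ) (r : ℕ) :
    ContDiff ℝ ∞ (jet r φ) := by
  refine contDiff_pi.2 fun m => ?_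
  exact h.iteratedFDeriv_right (m := ∞) (by norm_cast)

theorem fderiv_jet {φ : Spacetime → FieldSpace} (h : ContDiff ℝ ∞ φ) (r : ℕ)
    (x v : Spacetime) : fderiv ℝ (jet r φ) x v = jetShift r v (jet (r + 1) φ x) := by
  have hd : ∀ m : Fin (r + 1), DifferentiableAt ℝ (fun y => jet r φ y m) x := fun m =>
    ((contDiff_pi.1 (contDiff_jet h r)) m).differentiable (by simp) x
  funext m
  rw [show fderiv ℝ (jet r φ) x v m
    = fderiv ℝ (fun y => jet r φ y m) x v by
      rw [show jet r φ = fun y m => jet r φ y m from rfl, fderiv_pi hd]; rfl]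
  ext w i
  have : jetShift r v (jet (r + 1) φ x) m w i
      = (iteratedFDeriv ℝ ((m : ℕ) + 1) φ x) (Fin.cons v w) i := rfl
  rw [this, iteratedFDeriv_succ_apply_left]
  rfl

namespace IsLocalFn

variable {L L' : Lagrangian}

theorem contDiff (h : IsLocalFn L) {φ : Spacetime → FieldSpace} (hφ : ContDiff ℝ ∞ φ) :
    ContDiff ℝ ∞ (L φ) := by
  obtain ⟨r, l, hl, hL⟩ := h
  rw [show L φ = fun x => l (jet r φ x) from funext (hL φ hφ)]
  exact hl.comp (contDiff_jet hφ r)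

theorem map₂ (h : IsLocalFn L) (h' : IsLocalFn L') {F : ℝ × ℝ → ℝ} (hF : ContDiff ℝ ∞ F) :
    IsLocalFn (fun φ x => F (L φ x, L' φ x)) := by
  obtain ⟨r, l, hl, hL⟩ := h
  obtain ⟨r', l', hl', hL'⟩ := h'
  refine ⟨max r r', fun j => F (l (jetRestrict (le_max_left r r') j),
    l' (jetRestrict (le_max_right r r') j)), ?_, ?_⟩
  · exact hF.comp ((hl.comp (jetRestrict _).contDiff).prodMk (hl'.comp (jetRestrict _).contDiff))
  · intro φ hφ x
    simp only [jetRestrict_jet, hL φ hφ, hL' φ hφ]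

theorem add (h : IsLocalFn L) (h' : IsLocalFn L') : IsLocalFn (fun φ x => L φ x + L' φ x) :=
  map₂ h h' (F := fun p => p.1 + p.2) (contDiff_fst.add contDiff_snd)

theorem mul (h : IsLocalFn L) (h' : IsLocalFn L') : IsLocalFn (fun φ x => L φ x * L' φ x) :=
  map₂ h h' (F := fun p => p.1 * p.2) (contDiff_fst.mul contDiff_snd)

theorem const (c : ℝ) : IsLocalFn (fun _ _ => c) :=
  ⟨0, fun _ => c, contDiff_const, fun _ _ _ => rfl⟩

theorem sum {ι : Type*} {s : Finset ι} {K : ι → Lagrangian} (h : ∀ i, IsLocalFn (K i)) :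
    IsLocalFn (fun φ x => ∑ i ∈ s, K i φ x) := by
  classical
  induction s using Finset.induction_on with
  | empty => simpa using const 0
  | insert a s ha ih => simpa [Finset.sum_insert ha] using (h a).add ih

protected theorem pd (h : IsLocalFn L) (μ : Fin 4) : IsLocalFn (fun φ x => pd μ (L φ) x) := by
  obtain ⟨r, l, hl, hL⟩ := h
  refine ⟨r + 1, fun j => fderiv ℝ l (jetRestrict (Nat.le_succ r) j)
    (jetShift r (Pi.single μ 1) j), ?_, fun φ hφ x => ?_⟩
  · exact ((hl.fderiv_right (m := ∞) (by simp)).comp (jetRestrict _).contDiff).clm_apply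
      (jetShift _ _).contDiff
  · beta_reduce
    rw [jetRestrict_jet, ← fderiv_jet hφ, show L φ = l ∘ jet r φ from funext (hL φ hφ)]
    unfold HiggsJet.pd
    rw [fderiv_comp x (hl.differentiable (by simp) _)
      ((contDiff_jet hφ r).differentiable (by simp) x)]
    rfl

theorem field (i : Fin 4) : IsLocalFn (fun φ x => φ x i) := by
  refine ⟨0, fun j => j 0 0 i, ?_, fun φ _ x => ?_⟩
  · exact ((ContinuousLinearMap.proj (R := ℝ) (φ := fun _ : Fin 4 => ℝ) i).comp
      ((ContinuousMultilinearMap.apply ℝ _ FieldSpace 0).comp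
        (ContinuousLinearMap.proj (R := ℝ) (φ := fun m : Fin (0 + 1) =>
          ContinuousMultilinearMap ℝ (fun _ : Fin (m : ℕ) => Spacetime) FieldSpace) 0))).contDiff
  · simp [jet]

theorem d1 (μ i : Fin 4) : IsLocalFn (fun φ x => d1 φ x μ i) := (field i).pd μ

theorem d2 (μ ν i : Fin 4) : IsLocalFn (fun φ x => d2 φ x μ ν i) := (d1 ν i).pd μ

theorem d3 (μ ν ρ i : Fin 4) : IsLocalFn (fun φ x => d3 φ x μ ν ρ i) := (d2 ν ρ i).pd μ

/-- A vector-valued functional with local components. -/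
def _root_.HiggsJet.IsLocalVec (v : (Spacetime → FieldSpace) → Spacetime → FieldSpace) : Prop :=
  ∀ i, IsLocalFn (fun φ x => v φ x i)

theorem dot {v w : (Spacetime → FieldSpace) → Spacetime → FieldSpace} (hv : IsLocalVec v)
    (hw : IsLocalVec w) : IsLocalFn (fun φ x => v φ x ⬝ᵥ w φ x) :=
  sum fun i => (hv i).mul (hw i)

theorem congr (h : IsLocalFn L) (hL : ∀ φ, ContDiff ℝ ∞ φ → ∀ x, L' φ x = L φ x) :
    IsLocalFn L' := by
  obtain ⟨r, l, hl, hl'⟩ := h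
  exact ⟨r, l, hl, fun φ hφ x => (hL φ hφ x).trans (hl' φ hφ x)⟩

end IsLocalFn

theorem isLocalVec_field : IsLocalVec (fun φ x => φ x) := IsLocalFn.field
theorem isLocalVec_d1 (μ : Fin 4) : IsLocalVec (fun φ x => d1 φ x μ) := IsLocalFn.d1 μ
theorem isLocalVec_d2 (μ ν : Fin 4) : IsLocalVec (fun φ x => d2 φ x μ ν) := IsLocalFn.d2 μ ν
theorem isLocalVec_d3 (μ ν ρ : Fin 4) : IsLocalVec (fun φ x => d3 φ x μ ν ρ) :=
  IsLocalFn.d3 μ ν ρ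

theorem tt_nonneg (φ : Spacetime → FieldSpace) (x : Spacetime) (Λ : ℝ) : 0 ≤ tt φ x Λ :=
  div_nonneg (Finset.sum_nonneg fun _ _ => mul_self_nonneg _) (sq_nonneg _)

theorem dot_self_nonneg' (u : FieldSpace) : 0 ≤ u ⬝ᵥ u :=
  Finset.sum_nonneg fun _ _ => mul_self_nonneg _

theorem contDiff_dot_self : ContDiff ℝ ∞ (fun u : FieldSpace => u ⬝ᵥ u) := by
  unfold dotProduct
  fun_prop

theorem contDiff_coeff {E : Type*} [NormedAddCommGroup E] [NormedSpace ℝ E] {e : ℝ → ℝ}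
    (he : ContDiffOn ℝ ∞ e (Ici 0)) (Λ : ℝ) {u : E → FieldSpace} (hu : ContDiff ℝ ∞ u) :
    ContDiff ℝ ∞ (fun p => e ((u p ⬝ᵥ u p) / Λ ^ 2)) := by
  rw [← contDiffOn_univ]
  exact he.comp ((contDiff_dot_self.comp hu).div_const _).contDiffOn
    (fun p _ => div_nonneg (dot_self_nonneg' _) (sq_nonneg _))

theorem isLocalFn_coeff {e : ℝ → ℝ} (he : ContDiffOn ℝ ∞ e (Ici 0)) (Λ : ℝ) :
    IsLocalFn (fun φ x => e (tt φ x Λ)) := by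
  refine ⟨0, fun j => e ((j 0 0 ⬝ᵥ j 0 0) / Λ ^ 2), contDiff_coeff he Λ ?_, fun φ _ x => ?_⟩
  · exact ((ContinuousMultilinearMap.apply ℝ _ FieldSpace 0).comp
        (ContinuousLinearMap.proj (R := ℝ) (φ := fun m : Fin (0 + 1) =>
          ContinuousMultilinearMap ℝ (fun _ : Fin (m : ℕ) => Spacetime) FieldSpace) 0)).contDiff
  · simp [jet, tt]

theorem pd_coeff {e : ℝ → ℝ} (he : ContDiffOn ℝ ∞ e (Ici 0)) (Λ : ℝ)
    {φ : Spacetime → FieldSpace} (hφ : ContDiff ℝ ∞ φ) (x : Spacetime) (μ : Fin 4) :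
    pd μ (fun y => e (tt φ y Λ)) x
      = dt e (tt φ x Λ) * (2 * (d1 φ x μ ⬝ᵥ φ x) / Λ ^ 2) := by
  have h1 : HasDerivWithinAt e (dt e (tt φ x Λ)) (Ici 0) (tt φ x Λ) :=
    ((he.differentiableOn (by simp)) _ (tt_nonneg φ x Λ)).hasDerivWithinAt
  have h2c : ContDiff ℝ ∞ (fun y => tt φ y Λ) := (contDiff_dot_self.comp hφ).div_const _
  have h2 := ((h2c.differentiable (by simp)) x).hasFDerivAt
  have h3 := h1.comp_hasFDerivWithinAt x (h2.hasFDerivWithinAt (s := univ))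
    (fun y _ => tt_nonneg φ y Λ)
  rw [hasFDerivWithinAt_univ] at h3
  have h4 : pd μ (fun y => tt φ y Λ) x = 2 * (d1 φ x μ ⬝ᵥ φ x) / Λ ^ 2 := by
    have : (fun y => tt φ y Λ) = fun y => (Λ ^ 2)⁻¹ * (φ y ⬝ᵥ φ y) := by
      funext y; unfold tt; ring
    rw [this, pd_const_mul _ (contDiff_dot hφ hφ), pd_dot hφ hφ, dotProduct_comm (φ x)]
    change (Λ ^ 2)⁻¹ * (d1 φ x μ ⬝ᵥ φ x + d1 φ x μ ⬝ᵥ φ x) = _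
    ring
  unfold pd at h4 ⊢
  rw [show (fun y => e (tt φ y Λ)) = e ∘ fun y => tt φ y Λ from rfl, h3.fderiv, ← h4]
  simp

/-! ### Total derivatives -/

theorem isTotalDerivative_of_local {L : Lagrangian} (K : Fin 4 → Lagrangian)
    (hK : ∀ μ, IsLocalFn (K μ))
    (h : ∀ φ, ContDiff ℝ ∞ φ → ∀ x, L φ x = ∑ μ, pd μ (K μ φ) x) : IsTotalDerivative L := by
  choose r l hl hL using hK
  have hr : ∀ μ, r μ ≤ ∑ ν, r ν := fun μ =>
    Finset.single_le_sum (f := r) (fun _ _ => Nat.zero_le _) (Finset.mem_univ μ)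
  refine ⟨∑ ν, r ν, fun j μ => l μ (jetRestrict (hr μ) j), ?_, fun φ hφ x => ?_⟩
  · exact contDiff_pi.2 fun μ => (hl μ).comp (jetRestrict _).contDiff
  · rw [h φ hφ]
    refine Finset.sum_congr rfl fun μ _ => ?_
    congr 1
    exact funext fun y => hL μ φ hφ y

theorem IsTotalDerivative.exists_local {L : Lagrangian} (h : IsTotalDerivative L) :
    ∃ K : Fin 4 → Lagrangian, (∀ μ, IsLocalFn (K μ)) ∧
      ∀ φ, ContDiff ℝ ∞ φ → ∀ x, L φ x = ∑ μ, pd μ (K μ φ) x := by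
  obtain ⟨r, K, hK, h⟩ := h
  exact ⟨fun μ φ y => K (jet r φ y) μ,
    fun μ => ⟨r, fun j => K j μ, contDiff_pi.1 hK μ, fun _ _ _ => rfl⟩, h⟩

theorem IsTotalDerivative.congr {L L' : Lagrangian} (h : IsTotalDerivative L)
    (h' : ∀ φ, ContDiff ℝ ∞ φ → ∀ x, L' φ x = L φ x) : IsTotalDerivative L' := by
  obtain ⟨r, K, hK, h⟩ := h
  exact ⟨r, K, hK, fun φ hφ x => (h' φ hφ x).trans (h φ hφ x)⟩

theorem IsTotalDerivative.add {L L' : Lagrangian} (h : IsTotalDerivative L)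
    (h' : IsTotalDerivative L') : IsTotalDerivative (fun φ x => L φ x + L' φ x) := by
  obtain ⟨K, hK, h⟩ := h.exists_local
  obtain ⟨K', hK', h'⟩ := h'.exists_local
  refine isTotalDerivative_of_local (fun μ φ x => K μ φ x + K' μ φ x)
    (fun μ => (hK μ).add (hK' μ)) fun φ hφ x => ?_
  simp only [pd_add ((hK _).contDiff hφ) ((hK' _).contDiff hφ), Finset.sum_add_distrib,
    h φ hφ, h' φ hφ]

theorem IsTotalDerivative.const_mul {L : Lagrangian} (h : IsTotalDerivative L) (c : ℝ) :
    IsTotalDerivative (fun φ x => c * L φ x) := by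
  obtain ⟨K, hK, h⟩ := h.exists_local
  refine isTotalDerivative_of_local (fun μ φ x => c * K μ φ x)
    (fun μ => (IsLocalFn.const c).mul (hK μ)) fun φ hφ x => ?_
  simp only [pd_const_mul c ((hK _).contDiff hφ), h φ hφ, Finset.mul_sum]

theorem isTotalDerivative_zero : IsTotalDerivative (fun _ _ => 0) :=
  isTotalDerivative_of_local (fun _ _ _ => 0) (fun _ => IsLocalFn.const 0)
    (fun φ _ x => by simp [pd_const])

theorem IBPEquiv.of_eq {L L' : Lagrangian}
    (h : ∀ φ, ContDiff ℝ ∞ φ → ∀ x, L φ x = L' φ x) : IBPEquiv L L' :=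
  isTotalDerivative_zero.congr fun φ hφ x => by simp [h φ hφ x]

theorem IBPEquiv.trans {L L' L'' : Lagrangian} (h : IBPEquiv L L') (h' : IBPEquiv L' L'') :
    IBPEquiv L L'' :=
  (IsTotalDerivative.add h h').congr fun φ _ x => by ring

theorem IBPEquiv.add {L₁ L₁' L₂ L₂' : Lagrangian} (h₁ : IBPEquiv L₁ L₁')
    (h₂ : IBPEquiv L₂ L₂') :
    IBPEquiv (fun φ x => L₁ φ x + L₂ φ x) (fun φ x => L₁' φ x + L₂' φ x) :=
  (IsTotalDerivative.add h₁ h₂).congr fun φ _ x => by ring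

theorem IBPEquiv.const_mul {L L' : Lagrangian} (h : IBPEquiv L L') (c : ℝ) :
    IBPEquiv (fun φ x => c * L φ x) (fun φ x => c * L' φ x) :=
  (IsTotalDerivative.const_mul h c).congr fun φ _ x => by ring

/-! ### The metric as a bilinear form -/

/-- The Minkowski product of covectors. -/
def mdot (a b : Fin 4 → ℝ) : ℝ := ∑ ρ, et ρ * (a ρ * b ρ)

/-- The product of field-valued covectors. -/
def tdot (v w : Fin 4 → FieldSpace) : ℝ := ∑ ρ, et ρ * (v ρ ⬝ᵥ w ρ)

/-- Contraction of a field-valued covector with a field. -/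
def col (w : Fin 4 → FieldSpace) (v : FieldSpace) : Fin 4 → ℝ := fun ρ => w ρ ⬝ᵥ v

/-- Contraction of a field-valued covector with a vector. -/
def alongVec (w : Fin 4 → FieldSpace) (ξ : Spacetime) : FieldSpace := ∑ μ, ξ μ • w μ

/-- The field `(u · u^σ) u_σ`. -/
def zvec (p : J1) : FieldSpace := ∑ σ, (et σ * sDn p σ) • wc p σ

/-- `(u_σ · u_ρ)²`. -/
def gramSq (p : J1) : ℝ := ∑ ρ, et ρ * mdot (col (wc p) (wc p ρ)) (col (wc p) (wc p ρ))

/-- The bilinear form of a matrix of components. -/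
def tform (g : Matrix JetIdx JetIdx ℝ) (X Y : J1) : ℝ := ∑ I, ∑ J, g I J * X I * Y J

theorem sDn_eq_col (p : J1) : sDn p = col (wc p) (uc p) := by
  funext μ; simp [sDn, col, dotProduct_comm]

theorem ww_eq (p : J1) : ww p = tdot (wc p) (wc p) := by
  simp [ww, tdot, wUp_eq]

theorem ss_eq (p : J1) : ss p = mdot (sDn p) (sDn p) := by
  simp only [ss, mdot, sUp_eq]
  exact Finset.sum_congr rfl fun _ _ => by ring

theorem zvec_dot (p : J1) (v : FieldSpace) :
    zvec p ⬝ᵥ v = mdot (sDn p) (col (wc p) v) := by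
  simp only [zvec, sum_dotProduct, smul_dotProduct, mdot, col, smul_eq_mul]
  exact Finset.sum_congr rfl fun _ _ => by ring

section forms

variable (Λ : ℝ) (c : MetricLabel → ℝ → ℝ) (p : J1)

def formXX (ξ ζ : Spacetime) : ℝ :=
  let a := alongVec (wc p) ξ;
  let b := alongVec (wc p) ζ;
  let u := uc p;
  (-(1 / 2)) * mdot ξ ζ * cf Λ c p .V
  + ((a ⬝ᵥ b) / Λ ^ 4 + mdot ξ ζ / 4 * (ww p / Λ ^ 4)) * (cf Λ c p .J0 / 2)
  + ((a ⬝ᵥ u) * (b ⬝ᵥ u) / Λ ^ 6 + mdot ξ ζ / 4 * (ss p / Λ ^ 6)) * (cf Λ c p .J1 / 2)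
  + ((a ⬝ᵥ b) / Λ ^ 4 + mdot ξ ζ / 4 * (ww p / Λ ^ 4)) * (ww p / Λ ^ 4) * (cf Λ c p .K0 / 2)
  + (mdot (col (wc p) a) (col (wc p) b) / Λ ^ 8 + mdot ξ ζ / 4 * (gramSq p / Λ ^ 8))
      * (cf Λ c p .K1 / 2)
  + ((a ⬝ᵥ u) * (b ⬝ᵥ u) * ww p / Λ ^ 10 + mdot ξ ζ / 4 * (ss p * ww p / Λ ^ 10)
      + (a ⬝ᵥ b) * ss p / Λ ^ 10) * (cf Λ c p .K2 / 3)
  + (((a ⬝ᵥ u) * (zvec p ⬝ᵥ b) + (zvec p ⬝ᵥ a) * (b ⬝ᵥ u)) / 2 / Λ ^ 10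
      + mdot ξ ζ / 4 * (zvec p ⬝ᵥ zvec p) / Λ ^ 10) * (cf Λ c p .K3 / 2)
  + ((a ⬝ᵥ u) * (b ⬝ᵥ u) / Λ ^ 6 + mdot ξ ζ / 4 * (ss p / Λ ^ 6)) * (ss p / Λ ^ 6)
      * (cf Λ c p .K4 / 2)

def formXU (ξ : Spacetime) (v : FieldSpace) : ℝ :=
  let a := alongVec (wc p) ξ;
  let u := uc p;
  (a ⬝ᵥ v) / Λ ^ 2 * cf Λ c p .G0 + (u ⬝ᵥ v) * (a ⬝ᵥ u) / Λ ^ 4 * cf Λ c p .G1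
  + (a ⬝ᵥ v) * ww p / Λ ^ 6 * cf Λ c p .H0
  + mdot (col (wc p) v) (col (wc p) a) / Λ ^ 6 * cf Λ c p .H1
  + ((u ⬝ᵥ v) * (a ⬝ᵥ u) * ww p + (a ⬝ᵥ v) * ss p) / Λ ^ 8 * (cf Λ c p .H2 / 2)
  + ((u ⬝ᵥ v) * (zvec p ⬝ᵥ a) + (a ⬝ᵥ u) * (zvec p ⬝ᵥ v)) / Λ ^ 8 * (cf Λ c p .H3 / 2)
  + (u ⬝ᵥ v) * (a ⬝ᵥ u) * ss p / Λ ^ 10 * cf Λ c p .H4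

def formXD (ξ : Spacetime) (h : Fin 4 → FieldSpace) : ℝ :=
  let a := alongVec (wc p) ξ;
  let b := alongVec h ξ;
  let u := uc p;
  (b ⬝ᵥ u) / Λ * cf Λ c p .E
  + mdot (col (wc p) a) (col h u) / Λ ^ 5 * cf Λ c p .F10
  + (tdot (wc p) h * (a ⬝ᵥ u) + mdot (col (wc p) u) (col h a)) / (2 * Λ ^ 5) * cf Λ c p .F11
  + mdot (col (wc p) u) (col h u) * (a ⬝ᵥ u) / Λ ^ 7 * cf Λ c p .F12
  + (b ⬝ᵥ u) * ww p / Λ ^ 5 * cf Λ c p .F20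
  + (zvec p ⬝ᵥ b) / Λ ^ 5 * cf Λ c p .F21
  + (b ⬝ᵥ u) * ss p / Λ ^ 7 * cf Λ c p .F22

def formUU (v v' : FieldSpace) : ℝ :=
  let u := uc p;
  (v ⬝ᵥ v') * cf Λ c p .C0 + (u ⬝ᵥ v) * (u ⬝ᵥ v') / Λ ^ 2 * cf Λ c p .C1
  + (v ⬝ᵥ v') * ww p / Λ ^ 4 * cf Λ c p .D0
  + mdot (col (wc p) v) (col (wc p) v') / Λ ^ 4 * cf Λ c p .D1
  + ((v ⬝ᵥ v') * ss p + (u ⬝ᵥ v) * (u ⬝ᵥ v') * ww p) / Λ ^ 6 * (cf Λ c p .D2 / 2)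
  + ((u ⬝ᵥ v) * (zvec p ⬝ᵥ v') + (u ⬝ᵥ v') * (zvec p ⬝ᵥ v)) / (2 * Λ ^ 6) * cf Λ c p .D3
  + (u ⬝ᵥ v) * (u ⬝ᵥ v') * ss p / Λ ^ 8 * cf Λ c p .D4

def formDU (h : Fin 4 → FieldSpace) (v : FieldSpace) : ℝ :=
  let u := uc p;
  (tdot (wc p) h * (u ⬝ᵥ v) + mdot (col h u) (col (wc p) v)) / 2 / Λ ^ 3
      * (cf Λ c p .B0 + cf Λ c p .B1)
  + mdot (col (wc p) u) (col h v) / Λ ^ 3 * cf Λ c p .B2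
  + (u ⬝ᵥ v) * mdot (col (wc p) u) (col h u) / Λ ^ 5 * cf Λ c p .B3

def formDD (h h' : Fin 4 → FieldSpace) : ℝ :=
  tdot h h' * cf Λ c p .A0 + mdot (col h (uc p)) (col h' (uc p)) / Λ ^ 2 * cf Λ c p .A1

def metricForm (X Y : J1) : ℝ :=
  Λ ^ 4 * formXX Λ c p (xc X) (xc Y)
  + Λ ^ 2 * (formXU Λ c p (xc X) (uc Y) + formXU Λ c p (xc Y) (uc X))
  + Λ * (formXD Λ c p (xc X) (wc Y) + formXD Λ c p (xc Y) (wc X))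
  + formUU Λ c p (uc X) (uc Y)
  + (formDU Λ c p (wc X) (uc Y) + formDU Λ c p (wc Y) (uc X)) / Λ
  + formDD Λ c p (wc X) (wc Y) / Λ ^ 2

theorem xc_add (X Y : J1) : xc (X + Y) = xc X + xc Y := rfl
theorem uc_add (X Y : J1) : uc (X + Y) = uc X + uc Y := rfl
theorem wc_add (X Y : J1) : wc (X + Y) = wc X + wc Y := rfl
theorem xc_smul (r : ℝ) (X : J1) : xc (r • X) = r • xc X := rfl
theorem uc_smul (r : ℝ) (X : J1) : uc (r • X) = r • uc X := rfl
theorem wc_smul (r : ℝ) (X : J1) : wc (r • X) = r • wc X := rfl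

theorem mdot_comm (a b : Fin 4 → ℝ) : mdot a b = mdot b a :=
  Finset.sum_congr rfl fun _ _ => by ring
theorem tdot_comm (a b : Fin 4 → FieldSpace) : tdot a b = tdot b a :=
  Finset.sum_congr rfl fun _ _ => by rw [dotProduct_comm]
theorem mdot_add_right (a b b' : Fin 4 → ℝ) : mdot a (b + b') = mdot a b + mdot a b' := by
  simp [mdot, mul_add, Finset.sum_add_distrib]
theorem mdot_add_left (a a' b : Fin 4 → ℝ) : mdot (a + a') b = mdot a b + mdot a' b := by
  simp [mdot, mul_add, add_mul, Finset.sum_add_distrib]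
theorem mdot_smul_right (r : ℝ) (a b : Fin 4 → ℝ) : mdot a (r • b) = r * mdot a b := by
  simp only [mdot, Pi.smul_apply, smul_eq_mul, Finset.mul_sum]
  exact Finset.sum_congr rfl fun _ _ => by ring
theorem mdot_smul_left (r : ℝ) (a b : Fin 4 → ℝ) : mdot (r • a) b = r * mdot a b := by
  rw [mdot_comm, mdot_smul_right, mdot_comm]
theorem tdot_add_right (a b b' : Fin 4 → FieldSpace) :
    tdot a (b + b') = tdot a b + tdot a b' := by
  simp [tdot, mul_add, Finset.sum_add_distrib]
theorem tdot_smul_right (r : ℝ) (a b : Fin 4 → FieldSpace) : tdot a (r • b) = r * tdot a b := by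
  simp only [tdot, Pi.smul_apply, dotProduct_smul, smul_eq_mul, Finset.mul_sum]
  exact Finset.sum_congr rfl fun _ _ => by ring
theorem tdot_add_left (a a' b : Fin 4 → FieldSpace) :
    tdot (a + a') b = tdot a b + tdot a' b := by
  rw [tdot_comm, tdot_add_right, tdot_comm, tdot_comm b]
theorem tdot_smul_left (r : ℝ) (a b : Fin 4 → FieldSpace) : tdot (r • a) b = r * tdot a b := by
  rw [tdot_comm, tdot_smul_right, tdot_comm]
theorem col_add_right (w : Fin 4 → FieldSpace) (v v' : FieldSpace) :
    col w (v + v') = col w v + col w v' := by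
  funext; simp [col]
theorem col_add_left (w w' : Fin 4 → FieldSpace) (v : FieldSpace) :
    col (w + w') v = col w v + col w' v := by
  funext; simp [col]
theorem col_smul_right (r : ℝ) (w : Fin 4 → FieldSpace) (v : FieldSpace) :
    col w (r • v) = r • col w v := by
  funext; simp [col]
theorem col_smul_left (r : ℝ) (w : Fin 4 → FieldSpace) (v : FieldSpace) :
    col (r • w) v = r • col w v := by
  funext; simp [col]
theorem alongVec_add_right (w : Fin 4 → FieldSpace) (v v' : Spacetime) :
    alongVec w (v + v') = alongVec w v + alongVec w v' := by
  simp [alongVec, add_smul, Finset.sum_add_distrib]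
theorem alongVec_add_left (w w' : Fin 4 → FieldSpace) (v : Spacetime) :
    alongVec (w + w') v = alongVec w v + alongVec w' v := by
  simp [alongVec, Finset.sum_add_distrib]
theorem alongVec_smul_right (r : ℝ) (w : Fin 4 → FieldSpace) (v : Spacetime) :
    alongVec w (r • v) = r • alongVec w v := by
  simp [alongVec, Finset.smul_sum, mul_smul]
theorem alongVec_smul_left (r : ℝ) (w : Fin 4 → FieldSpace) (v : Spacetime) :
    alongVec (r • w) v = r • alongVec w v := by
  simp [alongVec, Finset.smul_sum, smul_comm r]

theorem metricForm_add_left (X X' Y : J1) :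
    metricForm Λ c p (X + X') Y = metricForm Λ c p X Y + metricForm Λ c p X' Y := by
  simp only [metricForm, formXX, formXU, formXD, formUU, formDU, formDD, xc_add, uc_add, wc_add,
    mdot_add_right, mdot_add_left, tdot_add_right, tdot_add_left, col_add_right, col_add_left,
    alongVec_add_right, alongVec_add_left, add_dotProduct, dotProduct_add]
  ring

theorem metricForm_add_right (X X' Y : J1) :
    metricForm Λ c p Y (X + X') = metricForm Λ c p Y X + metricForm Λ c p Y X' := by
  simp only [metricForm, formXX, formXU, formXD, formUU, formDU, formDD, xc_add, uc_add, wc_add,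
    mdot_add_right, mdot_add_left, tdot_add_right, tdot_add_left, col_add_right, col_add_left,
    alongVec_add_right, alongVec_add_left, add_dotProduct, dotProduct_add]
  ring

theorem metricForm_smul_left (r : ℝ) (X Y : J1) :
    metricForm Λ c p (r • X) Y = r * metricForm Λ c p X Y := by
  simp only [metricForm, formXX, formXU, formXD, formUU, formDU, formDD, xc_smul, uc_smul,
    wc_smul, mdot_smul_right, mdot_smul_left, tdot_smul_right, tdot_smul_left, col_smul_right,
    col_smul_left, alongVec_smul_right, alongVec_smul_left, smul_dotProduct, dotProduct_smul,
    smul_eq_mul]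
  ring

theorem metricForm_smul_right (r : ℝ) (X Y : J1) :
    metricForm Λ c p Y (r • X) = r * metricForm Λ c p Y X := by
  simp only [metricForm, formXX, formXU, formXD, formUU, formDU, formDD, xc_smul, uc_smul,
    wc_smul, mdot_smul_right, mdot_smul_left, tdot_smul_right, tdot_smul_left, col_smul_right,
    col_smul_left, alongVec_smul_right, alongVec_smul_left, smul_dotProduct, dotProduct_smul,
    smul_eq_mul]
  ring

theorem xc_single_x (μ : Fin 4) : xc (Pi.single (Sum.inl μ) 1) = Pi.single μ 1 := by
  funext ν; simp [xc, Pi.single_apply]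
theorem xc_single_r (q : Fin 4 ⊕ (Fin 4 × Fin 4)) : xc (Pi.single (Sum.inr q) 1) = 0 := by
  funext ν; simp [xc, Pi.single_apply]
theorem uc_single_x (μ : Fin 4) : uc (Pi.single (Sum.inl μ) 1) = 0 := by
  funext ν; simp [uc, Pi.single_apply]
theorem uc_single_u (i : Fin 4) : uc (Pi.single (Sum.inr (Sum.inl i)) 1) = Pi.single i 1 := by
  funext ν; simp [uc, Pi.single_apply]
theorem uc_single_w (q : Fin 4 × Fin 4) : uc (Pi.single (Sum.inr (Sum.inr q)) 1) = 0 := by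
  funext ν; simp [uc, Pi.single_apply]
theorem wc_single_x (μ : Fin 4) : wc (Pi.single (Sum.inl μ) 1) = 0 := by
  funext ν; funext; simp [wc, Pi.single_apply]
theorem wc_single_u (i : Fin 4) : wc (Pi.single (Sum.inr (Sum.inl i)) 1) = 0 := by
  funext ν; funext; simp [wc, Pi.single_apply]
theorem wc_single_w (μ i : Fin 4) :
    wc (Pi.single (Sum.inr (Sum.inr (μ, i))) 1) = Pi.single μ (Pi.single i 1) := by
  funext ν j
  by_cases h : ν = μ
  · subst h; simp [wc, Pi.single_apply]
  · simp [wc, Pi.single_apply, h]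

theorem alongVec_single (w : Fin 4 → FieldSpace) (μ : Fin 4) :
    alongVec w (Pi.single μ 1) = w μ := by
  simp [alongVec, Pi.single_apply]
theorem alongVec_zero_right (w : Fin 4 → FieldSpace) : alongVec w 0 = 0 := by simp [alongVec]
theorem alongVec_zero_left (v : Spacetime) : alongVec 0 v = 0 := by simp [alongVec]
theorem mdot_single (μ : Fin 4) (a : Fin 4 → ℝ) (r : ℝ) :
    mdot a (Pi.single μ r) = et μ * (a μ * r) := by
  simp [mdot, Pi.single_apply]
theorem mdot_single_left (μ : Fin 4) (a : Fin 4 → ℝ) (r : ℝ) :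
    mdot (Pi.single μ r) a = et μ * (r * a μ) := by
  simp [mdot, Pi.single_apply]
theorem tdot_single (μ : Fin 4) (w : Fin 4 → FieldSpace) (v : FieldSpace) :
    tdot w (Pi.single μ v) = et μ * (w μ ⬝ᵥ v) := by
  rw [tdot, Finset.sum_eq_single μ]
  · simp
  · intro ν _ h; simp [Pi.single_eq_of_ne h]
  · simp
theorem tdot_single_left (μ : Fin 4) (w : Fin 4 → FieldSpace) (v : FieldSpace) :
    tdot (Pi.single μ v) w = et μ * (v ⬝ᵥ w μ) := by
  rw [tdot_comm, tdot_single, dotProduct_comm]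
theorem col_single (μ : Fin 4) (v v' : FieldSpace) :
    col (Pi.single μ v) v' = Pi.single μ (v ⬝ᵥ v') := by
  funext ν
  by_cases h : ν = μ
  · subst h; simp [col]
  · simp [col, h]
theorem col_zero_right (w : Fin 4 → FieldSpace) : col w 0 = 0 := by funext; simp [col]
theorem col_zero_left (v : FieldSpace) : col 0 v = 0 := by funext; simp [col]
theorem mdot_zero_right (a : Fin 4 → ℝ) : mdot a 0 = 0 := by simp [mdot]
theorem mdot_zero_left (a : Fin 4 → ℝ) : mdot 0 a = 0 := by simp [mdot]
theorem tdot_zero_right (a : Fin 4 → FieldSpace) : tdot a 0 = 0 := by simp [tdot]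
theorem tdot_zero_left (a : Fin 4 → FieldSpace) : tdot 0 a = 0 := by simp [tdot]

theorem col_apply (w : Fin 4 → FieldSpace) (v : FieldSpace) (ρ : Fin 4) :
    col w v ρ = w ρ ⬝ᵥ v := rfl

theorem gramSq_eq : (∑ σ, ∑ ρ, (wc p σ ⬝ᵥ wc p ρ) * (wUp p σ ⬝ᵥ wUp p ρ)) = gramSq p := by
  simp only [gramSq, mdot, col, wUp_eq, smul_dotProduct, dotProduct_smul, smul_eq_mul,
    Finset.mul_sum]
  rw [Finset.sum_comm]
  exact Finset.sum_congr rfl fun _ _ => Finset.sum_congr rfl fun _ _ => by ring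

theorem sum_wUp_mul (a b : FieldSpace) :
    (∑ σ, (wc p σ ⬝ᵥ a) * (wUp p σ ⬝ᵥ b)) = mdot (col (wc p) a) (col (wc p) b) := by
  simp only [mdot, col, wUp_eq, smul_dotProduct, smul_eq_mul]
  exact Finset.sum_congr rfl fun _ _ => by ring

theorem dot_uc (μ : Fin 4) : wc p μ ⬝ᵥ uc p = sDn p μ := dotProduct_comm _ _

theorem zvec_dot' (v : FieldSpace) : zvec p ⬝ᵥ v = ∑ σ, (wUp p σ ⬝ᵥ v) * sDn p σ := by
  simp only [zvec_dot, mdot, col, wUp_eq, smul_dotProduct, smul_eq_mul]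
  exact Finset.sum_congr rfl fun _ _ => by ring

theorem zvec_dot_zvec :
    zvec p ⬝ᵥ zvec p = ∑ σ, (∑ ρ, sDn p ρ * (wUp p σ ⬝ᵥ wUp p ρ)) * sDn p σ := by
  rw [zvec_dot']
  refine Finset.sum_congr rfl fun σ _ => ?_
  rw [dotProduct_comm, zvec_dot']
  congr 1
  refine Finset.sum_congr rfl fun ρ _ => ?_
  simp only [wUp_eq, smul_dotProduct, dotProduct_smul, smul_eq_mul, dotProduct_comm (wc p ρ)]
  ring

theorem formXX_single (μ ν : Fin 4) :
    formXX Λ c p (Pi.single μ 1) (Pi.single ν 1) = gXX Λ c p μ ν := by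
  have hm : mdot (Pi.single μ 1) (Pi.single ν 1) = mink μ ν := by
    rw [mdot_single, mink_apply, Pi.single_apply]
    by_cases h : μ = ν
    · simp [h]
    · simp [h, Ne.symm h]
  have h3 : (∑ σ, ((sDn p μ * (wUp p σ ⬝ᵥ wc p ν) + (wUp p σ ⬝ᵥ wc p μ) * sDn p ν)
      / (2 * Λ ^ 7) + mink μ ν / 4 * ((∑ ρ, sDn p ρ * (wUp p σ ⬝ᵥ wUp p ρ)) / Λ ^ 7))
      * (sDn p σ / Λ ^ 3))
      = ((sDn p μ * (zvec p ⬝ᵥ wc p ν) + (zvec p ⬝ᵥ wc p μ) * sDn p ν) / 2 / Λ ^ 10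
      + mink μ ν / 4 * (zvec p ⬝ᵥ zvec p) / Λ ^ 10) := by
    rw [zvec_dot_zvec, zvec_dot', zvec_dot']
    simp only [Finset.mul_sum, Finset.sum_div, Finset.sum_mul, ← Finset.sum_add_distrib]
    refine Finset.sum_congr rfl fun σ _ => ?_
    rw [add_mul]
    congr 1
    · ring
    · rw [Finset.sum_mul]
      exact Finset.sum_congr rfl fun _ _ => by ring
  have hk : (∑ σ, (wc p σ ⬝ᵥ wc p μ) * (wUp p σ ⬝ᵥ wc p ν))
      = mdot (col (wc p) (wc p μ)) (col (wc p) (wc p ν)) := sum_wUp_mul p _ _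
  simp only [formXX, gXX, h3, hk, gramSq_eq, alongVec_single, hm, dot_uc]

theorem formXU_single (μ j : Fin 4) :
    formXU Λ c p (Pi.single μ 1) (Pi.single j 1) = gXU Λ c p μ j := by
  have h1 : (∑ ρ, wc p ρ j * (wc p μ ⬝ᵥ wUp p ρ))
      = mdot (col (wc p) (Pi.single j 1)) (col (wc p) (wc p μ)) := by
    rw [← sum_wUp_mul]
    exact Finset.sum_congr rfl fun _ _ => by simp [dotProduct_comm]
  have h2 : (∑ ρ, (wc p μ ⬝ᵥ wc p ρ) * sUp p ρ) = zvec p ⬝ᵥ wc p μ := by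
    rw [zvec_dot, mdot]
    refine Finset.sum_congr rfl fun ρ _ => ?_
    rw [sUp_eq, col, dotProduct_comm]; ring
  have h3 : (∑ ρ, wc p ρ j * sDn p μ * sUp p ρ) = sDn p μ * (zvec p ⬝ᵥ Pi.single j 1) := by
    rw [zvec_dot, mdot, Finset.mul_sum]
    refine Finset.sum_congr rfl fun ρ _ => ?_
    rw [sUp_eq, col, dotProduct_single_one]; ring
  simp only [formXU, gXU, h1, h2, h3, alongVec_single, dotProduct_single_one, dot_uc]
  ring

theorem formXD_single (μ j ν : Fin 4) :
    formXD Λ c p (Pi.single μ 1) (Pi.single ν (Pi.single j 1)) = gXD Λ c p μ j ν := by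
  have h1 : (∑ ρ, wc p ρ j * (et ρ * sDn p ρ)) = zvec p j := by
    rw [← dotProduct_single_one (zvec p) j, zvec_dot, mdot]
    refine Finset.sum_congr rfl fun ρ _ => ?_
    rw [col, dotProduct_single_one]; ring
  simp only [formXD, gXD, alongVec_single, col_single, mdot_single, tdot_single,
    dotProduct_single_one, single_one_dotProduct, wUp_eq, sUp_eq, smul_dotProduct, smul_eq_mul,
    Pi.smul_apply, col_apply, dot_uc, kd, h1]
  by_cases h : μ = ν
  · subst h
    simp only [Pi.single_eq_same, single_one_dotProduct, dotProduct_single_one, if_true]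
    ring
  · simp only [Pi.single_eq_of_ne h, dotProduct_zero, zero_dotProduct, if_neg h]
    ring

theorem formUU_single (i j : Fin 4) :
    formUU Λ c p (Pi.single i 1) (Pi.single j 1) = gUU Λ c p i j := by
  have h1 : (∑ ρ, wc p ρ i * wUp p ρ j)
      = mdot (col (wc p) (Pi.single i 1)) (col (wc p) (Pi.single j 1)) := by
    rw [← sum_wUp_mul]
    exact Finset.sum_congr rfl fun _ _ => by simp
  have h2 : (∑ ρ, (uc p i * wc p ρ j + uc p j * wc p ρ i) * sUp p ρ)
      = uc p i * (zvec p ⬝ᵥ Pi.single j 1) + uc p j * (zvec p ⬝ᵥ Pi.single i 1) := by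
    simp only [zvec_dot, mdot, Finset.mul_sum, ← Finset.sum_add_distrib]
    refine Finset.sum_congr rfl fun ρ _ => ?_
    rw [sUp_eq, col, dotProduct_single_one, col, dotProduct_single_one]; ring
  have hk : (Pi.single i 1 : FieldSpace) ⬝ᵥ Pi.single j 1 = kd i j := by
    simp [kd, Pi.single_apply, eq_comm]
  simp only [formUU, gUU, h1, h2, hk, dotProduct_single_one]
  ring

theorem formDU_single (i j μ : Fin 4) :
    formDU Λ c p (Pi.single μ (Pi.single i 1)) (Pi.single j 1)
      = (gDU Λ c p i j μ + gDU Λ c p j i μ) / 2 := by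
  have hk : (Pi.single i 1 : FieldSpace) ⬝ᵥ Pi.single j 1 = kd i j := by
    simp [kd, Pi.single_apply, eq_comm]
  have hk' : kd j i = kd i j := by simp [kd, eq_comm]
  simp only [formDU, gDU, hk', col_single, mdot_single, mdot_single_left, tdot_single, hk,
    dotProduct_single_one, single_one_dotProduct, wUp_eq, sUp_eq, smul_eq_mul,
    Pi.smul_apply, col_apply, dot_uc]
  ring

theorem formDD_single (i j μ ν : Fin 4) :
    formDD Λ c p (Pi.single μ (Pi.single i 1)) (Pi.single ν (Pi.single j 1))
      = gDD Λ c p i j μ ν := by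
  have hk : (Pi.single i 1 : FieldSpace) ⬝ᵥ Pi.single j 1 = kd i j := by
    simp [kd, Pi.single_apply, eq_comm]
  simp only [formDD, gDD, tdot_single, col_single, mdot_single, mink_apply]
  by_cases h : μ = ν
  · subst h
    simp only [if_true, Pi.single_eq_same, hk, single_one_dotProduct]
    ring
  · simp [h, Ne.symm h]

theorem metricForm_single (I J : JetIdx) :
    metricForm Λ c p (Pi.single I 1) (Pi.single J 1) = higgsMetric Λ c p I J := by
  have z1 : ∀ ζ, formXX Λ c p 0 ζ = 0 := fun ζ => by
    simp [formXX, alongVec_zero_right, mdot_zero_left, col_zero_right]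
  have z1' : ∀ ζ, formXX Λ c p ζ 0 = 0 := fun ζ => by
    simp [formXX, alongVec_zero_right, mdot_zero_right, col_zero_right]
  have z2 : ∀ v, formXU Λ c p 0 v = 0 := fun v => by
    simp [formXU, alongVec_zero_right, mdot_zero_right, col_zero_right]
  have z2' : ∀ v, formXU Λ c p v 0 = 0 := fun v => by
    simp [formXU, mdot_zero_left, col_zero_right]
  have z3 : ∀ v, formXD Λ c p 0 v = 0 := fun v => by
    simp [formXD, alongVec_zero_right, mdot_zero_left, mdot_zero_right, col_zero_right]
  have z3' : ∀ v, formXD Λ c p v 0 = 0 := fun v => by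
    simp [formXD, alongVec_zero_left, mdot_zero_right, col_zero_left, tdot_zero_right]
  have z4 : ∀ v, formUU Λ c p 0 v = 0 := fun v => by
    simp [formUU, mdot_zero_left, col_zero_right]
  have z4' : ∀ v, formUU Λ c p v 0 = 0 := fun v => by
    simp [formUU, mdot_zero_right, col_zero_right]
  have z5 : ∀ v, formDU Λ c p 0 v = 0 := fun v => by
    simp [formDU, mdot_zero_left, mdot_zero_right, col_zero_left, tdot_zero_right]
  have z5' : ∀ v, formDU Λ c p v 0 = 0 := fun v => by
    simp [formDU, mdot_zero_right, col_zero_right]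
  have z6 : ∀ v, formDD Λ c p 0 v = 0 := fun v => by
    simp [formDD, mdot_zero_left, col_zero_left, tdot_zero_left]
  have z6' : ∀ v, formDD Λ c p v 0 = 0 := fun v => by
    simp [formDD, mdot_zero_right, col_zero_left, tdot_zero_right]
  rcases I with μ | i | ⟨μ, i⟩ <;> rcases J with ν | j | ⟨ν, j⟩ <;>
  simp only [metricForm, higgsMetric, Matrix.of_apply, xc_single_x, xc_single_r, uc_single_x,
    uc_single_u, uc_single_w, wc_single_x, wc_single_u, wc_single_w, z1, z1', z2, z2', z3, z3',
    z4, z4', z5, z5', z6, z6', formXX_single, formXU_single, formXD_single, formUU_single,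
    formDU_single, formDD_single] <;> ring

theorem tform_higgsMetric (X Y : J1) :
    tform (higgsMetric Λ c p) X Y = metricForm Λ c p X Y := by
  let B : J1 →ₗ[ℝ] J1 →ₗ[ℝ] ℝ := LinearMap.mk₂ ℝ (metricForm Λ c p)
    (metricForm_add_left Λ c p) (metricForm_smul_left Λ c p)
    (fun X Y Y' => metricForm_add_right Λ c p Y Y' X)
    (fun r X Y => metricForm_smul_right Λ c p r Y X)
  have hX : ∀ X : J1, X = ∑ I, X I • (Pi.single I 1 : J1) := fun X => by
    conv_lhs => rw [← Finset.univ_sum_single X]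
    exact Finset.sum_congr rfl fun I _ => by rw [← Pi.single_smul]; simp
  have h : B X Y = ∑ I, ∑ J, X I * (Y J * higgsMetric Λ c p I J) := by
    conv_lhs => rw [hX X, hX Y]
    simp only [map_sum, map_smul, LinearMap.sum_apply, LinearMap.smul_apply, smul_eq_mul,
      ← metricForm_single]
    rw [Finset.sum_comm]
    simp only [Finset.mul_sum]
    exact Finset.sum_congr rfl fun I _ => Finset.sum_congr rfl fun J _ => by
      rw [mul_left_comm]; rfl
  change _ = B X Y
  rw [h]
  exact Finset.sum_congr rfl fun I _ => Finset.sum_congr rfl fun J _ => by ring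

end forms

/-! ### Lorentz and orthogonal invariance -/

theorem mdot_eq (a b : Fin 4 → ℝ) : mdot a b = a ⬝ᵥ (mink *ᵥ b) := by
  simp only [mdot, dotProduct, Matrix.mulVec, sum_mink_mul]
  exact Finset.sum_congr rfl fun _ _ => by ring

theorem mink_mul_mink : mink * mink = 1 := by
  ext i j
  rw [Matrix.mul_apply, sum_mink_mul, mink_apply, Matrix.one_apply]
  split_ifs with h
  · exact et_mul_self i
  · simp

theorem mink_transpose : minkᵀ = mink := by simp [mink]

namespace IsLorentz

variable {M : Matrix (Fin 4) (Fin 4) ℝ}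

theorem left_inv (h : IsLorentz M) : (mink * Mᵀ * mink) * M = 1 := by
  rw [Matrix.mul_assoc, Matrix.mul_assoc, ← Matrix.mul_assoc Mᵀ, h, mink_mul_mink]

theorem right_inv (h : IsLorentz M) : M * (mink * Mᵀ * mink) = 1 :=
  mul_eq_one_comm.1 h.left_inv

theorem inv_eq (h : IsLorentz M) : M⁻¹ = mink * Mᵀ * mink :=
  Matrix.inv_eq_right_inv h.right_inv

theorem inv_mul (h : IsLorentz M) : M⁻¹ * M = 1 := by rw [h.inv_eq, h.left_inv]

theorem mul_inv (h : IsLorentz M) : M * M⁻¹ = 1 := by rw [h.inv_eq, h.right_inv]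

protected theorem inv (h : IsLorentz M) : IsLorentz M⁻¹ := by
  unfold IsLorentz
  have h1 : (M⁻¹)ᵀ * Mᵀ = 1 := by rw [← Matrix.transpose_mul, h.mul_inv, Matrix.transpose_one]
  calc (M⁻¹)ᵀ * mink * M⁻¹ = (M⁻¹)ᵀ * (Mᵀ * mink * M) * M⁻¹ := by rw [show Mᵀ * mink * M = mink from h]
    _ = ((M⁻¹)ᵀ * Mᵀ) * mink * (M * M⁻¹) := by simp only [Matrix.mul_assoc]
    _ = mink := by rw [h1, h.mul_inv]; simp

theorem transpose (h : IsLorentz M) : M * mink * Mᵀ = mink := by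
  have h1 := h.right_inv
  calc M * mink * Mᵀ = M * (mink * Mᵀ * mink) * mink := by
        simp only [Matrix.mul_assoc, mink_mul_mink, Matrix.mul_one]
    _ = mink := by rw [h1, Matrix.one_mul]

theorem mdot_mulVec (h : IsLorentz M) (a b : Fin 4 → ℝ) : mdot (M *ᵥ a) (M *ᵥ b) = mdot a b := by
  rw [mdot_eq, mdot_eq, ← Matrix.vecMul_transpose, ← Matrix.dotProduct_mulVec, Matrix.mulVec_mulVec,
    Matrix.mulVec_mulVec, show Mᵀ * mink * M = mink from h]

theorem mdot_vecMul (h : IsLorentz M) (a b : Fin 4 → ℝ) : mdot (a ᵥ* M) (b ᵥ* M) = mdot a b := by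
  rw [mdot_eq, mdot_eq, ← Matrix.dotProduct_mulVec, ← Matrix.mulVec_transpose M b,
    Matrix.mulVec_mulVec, Matrix.mulVec_mulVec, h.transpose]

end IsLorentz

theorem orthogonal_dot {O : Matrix (Fin 4) (Fin 4) ℝ} (hO : O ∈ Matrix.orthogonalGroup (Fin 4) ℝ)
    (a b : FieldSpace) : (O *ᵥ a) ⬝ᵥ (O *ᵥ b) = a ⬝ᵥ b := by
  rw [← Matrix.vecMul_transpose, ← Matrix.dotProduct_mulVec, Matrix.mulVec_mulVec,
    show Oᵀ * O = 1 from (Matrix.mem_orthogonalGroup_iff' _ _).1 hO, Matrix.one_mulVec]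

/-- Transformation of a field-valued covector. -/
def covAct (O N : Matrix (Fin 4) (Fin 4) ℝ) (w : Fin 4 → FieldSpace) : Fin 4 → FieldSpace :=
  fun μ => O *ᵥ (∑ ν, N ν μ • w ν)

section covAct

variable {O N : Matrix (Fin 4) (Fin 4) ℝ}

theorem col_covAct (hO : O ∈ Matrix.orthogonalGroup (Fin 4) ℝ) (w : Fin 4 → FieldSpace)
    (v : FieldSpace) : col (covAct O N w) (O *ᵥ v) = col w v ᵥ* N := by
  funext μ
  simp only [col, covAct, orthogonal_dot hO, sum_dotProduct, smul_dotProduct, Matrix.vecMul]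
  exact Finset.sum_congr rfl fun _ _ => mul_comm _ _

theorem mdot_col_covAct (hO : O ∈ Matrix.orthogonalGroup (Fin 4) ℝ) (hN : IsLorentz N)
    (w w' : Fin 4 → FieldSpace) (v v' : FieldSpace) :
    mdot (col (covAct O N w) (O *ᵥ v)) (col (covAct O N w') (O *ᵥ v'))
      = mdot (col w v) (col w' v') := by
  rw [col_covAct hO, col_covAct hO, hN.mdot_vecMul]

/-- Contraction of two Lorentz indices commutes with the transformation. -/
theorem sum_contract (hN : IsLorentz N) (B : Fin 4 → Fin 4 → ℝ) :
    ∑ ρ, et ρ * (∑ ν, ∑ κ, N ν ρ * N κ ρ * B ν κ) = ∑ ρ, et ρ * B ρ ρ := by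
  have h : ∀ ν κ, ∑ ρ, et ρ * (N ν ρ * N κ ρ) = mink ν κ := fun ν κ => by
    have := congrFun (congrFun hN.transpose ν) κ
    rw [← this, Matrix.mul_assoc, Matrix.mul_apply]
    refine Finset.sum_congr rfl fun ρ _ => ?_
    rw [Matrix.mul_apply, sum_mink_mul, Matrix.transpose_apply]; ring
  calc _ = ∑ ν, ∑ κ, (∑ ρ, et ρ * (N ν ρ * N κ ρ)) * B ν κ := by
        simp only [Finset.mul_sum, Finset.sum_mul]
        rw [Finset.sum_comm]
        refine Finset.sum_congr rfl fun ν _ => ?_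
        rw [Finset.sum_comm]
        exact Finset.sum_congr rfl fun κ _ => Finset.sum_congr rfl fun ρ _ => by ring
    _ = _ := by
        simp only [h, sum_mink_mul]

theorem tdot_covAct (hO : O ∈ Matrix.orthogonalGroup (Fin 4) ℝ) (hN : IsLorentz N)
    (w w' : Fin 4 → FieldSpace) : tdot (covAct O N w) (covAct O N w') = tdot w w' := by
  rw [tdot, tdot, ← sum_contract hN fun ν κ => w ν ⬝ᵥ w' κ]
  refine Finset.sum_congr rfl fun ρ _ => ?_
  congr 1
  simp only [covAct, orthogonal_dot hO, sum_dotProduct, dotProduct_sum, smul_dotProduct,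
    dotProduct_smul, smul_eq_mul, Finset.mul_sum]
  rw [Finset.sum_comm]
  exact Finset.sum_congr rfl fun κ _ => Finset.sum_congr rfl fun ρ _ => by ring

theorem alongVec_covAct {M : Matrix (Fin 4) (Fin 4) ℝ} (h : N * M = 1) (w : Fin 4 → FieldSpace)
    (ξ : Spacetime) : alongVec (covAct O N w) (M *ᵥ ξ) = O *ᵥ alongVec w ξ := by
  have h' : ∀ ν, ∑ μ, N ν μ * (M *ᵥ ξ) μ = ξ ν := fun ν => by
    have := congrFun (Matrix.mulVec_mulVec ξ N M) ν
    rwa [h, Matrix.one_mulVec] at this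
  simp only [alongVec, covAct, ← Matrix.mulVec_smul, ← Matrix.mulVec_sum]
  congr 1
  simp only [Finset.smul_sum, smul_smul]
  rw [Finset.sum_comm]
  refine Finset.sum_congr rfl fun ν _ => ?_
  rw [← Finset.sum_smul, ← h' ν]
  congr 1
  exact Finset.sum_congr rfl fun _ _ => mul_comm _ _

end covAct

/-! ### Invariance of the metric -/

section prolong

variable {O M : Matrix (Fin 4) (Fin 4) ℝ} (a : Spacetime) (p : J1)

theorem xc_prolong : xc (prolong O M a p) = M *ᵥ xc p + a := rfl
theorem uc_prolong : uc (prolong O M a p) = O *ᵥ uc p := rfl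
theorem wc_prolong : wc (prolong O M a p) = covAct O M⁻¹ (wc p) := rfl

theorem sDn_prolong (hO : O ∈ Matrix.orthogonalGroup (Fin 4) ℝ) :
    sDn (prolong O M a p) = sDn p ᵥ* M⁻¹ := by
  rw [sDn_eq_col, wc_prolong, uc_prolong, col_covAct hO, sDn_eq_col]

theorem ww_prolong (hO : O ∈ Matrix.orthogonalGroup (Fin 4) ℝ) (hM : IsLorentz M) :
    ww (prolong O M a p) = ww p := by
  rw [ww_eq, wc_prolong, tdot_covAct hO hM.inv, ww_eq]

theorem ss_prolong (hO : O ∈ Matrix.orthogonalGroup (Fin 4) ℝ) (hM : IsLorentz M) :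
    ss (prolong O M a p) = ss p := by
  rw [ss_eq, sDn_prolong a p hO, hM.inv.mdot_vecMul, ss_eq]

theorem zvec_prolong (hO : O ∈ Matrix.orthogonalGroup (Fin 4) ℝ) (hM : IsLorentz M) :
    zvec (prolong O M a p) = O *ᵥ zvec p := by
  refine eq_of_sub_eq_zero (dotProduct_self_eq_zero.1 ?_)
  have key : ∀ v, zvec (prolong O M a p) ⬝ᵥ (O *ᵥ v) = (O *ᵥ zvec p) ⬝ᵥ (O *ᵥ v) := fun v => by
    rw [zvec_dot, sDn_prolong a p hO, wc_prolong, col_covAct hO, hM.inv.mdot_vecMul,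
      orthogonal_dot hO, zvec_dot]
  have hv : ∀ v, O *ᵥ (Oᵀ *ᵥ v) = v := fun v => by
    rw [Matrix.mulVec_mulVec, show O * Oᵀ = 1 from (Matrix.mem_orthogonalGroup_iff _ _).1 hO,
      Matrix.one_mulVec]
  rw [sub_dotProduct, ← hv (zvec (prolong O M a p) - O *ᵥ zvec p), key, sub_self]

theorem gramSq_prolong (hO : O ∈ Matrix.orthogonalGroup (Fin 4) ℝ) (hM : IsLorentz M) :
    gramSq (prolong O M a p) = gramSq p := by
  have h2 : ∀ (ρ : Fin 4), wc (prolong O M a p) ρ = O *ᵥ (∑ ν, M⁻¹ ν ρ • wc p ν) := fun _ => rfl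
  unfold gramSq
  rw [← sum_contract hM.inv fun ν κ => mdot (col (wc p) (wc p ν)) (col (wc p) (wc p κ))]
  refine Finset.sum_congr rfl fun ρ _ => ?_
  congr 1
  rw [h2, wc_prolong, mdot_col_covAct hO hM.inv]
  have h3 : col (wc p) (∑ ν, M⁻¹ ν ρ • wc p ν) = ∑ ν, M⁻¹ ν ρ • col (wc p) (wc p ν) := by
    funext σ
    simp [col, dotProduct_sum]
  have hl : ∀ (f : Fin 4 → Fin 4 → ℝ) (b : Fin 4 → ℝ),
      mdot (∑ ν, M⁻¹ ν ρ • f ν) b = ∑ ν, M⁻¹ ν ρ * mdot (f ν) b := fun f b => by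
    simp only [mdot, Finset.sum_apply, Pi.smul_apply, smul_eq_mul, Finset.mul_sum, Finset.sum_mul]
    rw [Finset.sum_comm]
    exact Finset.sum_congr rfl fun _ _ => Finset.sum_congr rfl fun _ _ => by ring
  rw [h3, hl]
  refine Finset.sum_congr rfl fun ν _ => ?_
  rw [mdot_comm, hl, Finset.mul_sum]
  refine Finset.sum_congr rfl fun κ _ => ?_
  rw [mdot_comm (col (wc p) (wc p κ))]
  ring

theorem cf_prolong (hO : O ∈ Matrix.orthogonalGroup (Fin 4) ℝ) (Λ : ℝ)
    (c : MetricLabel → ℝ → ℝ) : cf Λ c (prolong O M a p) = cf Λ c p := by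
  funext l
  simp only [cf, uc_prolong, orthogonal_dot hO]

theorem metricForm_prolong (hO : O ∈ Matrix.orthogonalGroup (Fin 4) ℝ) (hM : IsLorentz M)
    (Λ : ℝ) (c : MetricLabel → ℝ → ℝ) (X Y : J1) :
    metricForm Λ c (prolong O M a p) (prolong O M 0 X) (prolong O M 0 Y)
      = metricForm Λ c p X Y := by
  simp only [metricForm, formXX, formXU, formXD, formUU, formDU, formDD, xc_prolong, uc_prolong,
    wc_prolong, add_zero, cf_prolong a p hO, alongVec_covAct hM.inv_mul, mdot_col_covAct hO hM.inv,
    tdot_covAct hO hM.inv, ww_prolong a p hO hM, ss_prolong a p hO hM, zvec_prolong a p hO hM,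
    gramSq_prolong a p hO hM, orthogonal_dot hO, hM.mdot_mulVec]

/-- The linear part of a prolonged symmetry. -/
def prolongLin (O M : Matrix (Fin 4) (Fin 4) ℝ) : J1 →L[ℝ] J1 :=
  LinearMap.toContinuousLinearMap
    { toFun := prolong O M 0
      map_add' := fun X Y => by
        funext I
        rcases I with μ | i | ⟨μ, i⟩
        · simp [prolong, mkJ1, xc_add, Matrix.mulVec_add]
        · simp [prolong, mkJ1, uc_add, Matrix.mulVec_add]
        · simp [prolong, mkJ1, wc_add, Matrix.mulVec_add, Finset.sum_add_distrib]
      map_smul' := fun r X => by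
        funext I
        rcases I with μ | i | ⟨μ, i⟩
        · simp [prolong, mkJ1, xc_smul, Matrix.mulVec_smul]
        · simp [prolong, mkJ1, uc_smul, Matrix.mulVec_smul]
        · simp only [prolong, mkJ1, wc_smul, Sum.elim_inr, Pi.smul_apply, smul_comm _ r,
            ← Finset.smul_sum, Matrix.mulVec_smul]
          rfl }

theorem prolongLin_apply (X : J1) : prolongLin O M X = prolong O M 0 X := rfl

theorem prolong_eq : prolong O M a = fun p => prolongLin O M p + mkJ1 a 0 0 := by
  funext p I
  rcases I with μ | i | ⟨μ, i⟩ <;> simp [prolongLin_apply, prolong, mkJ1]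

theorem fderiv_prolong (X : J1) : fderiv ℝ (prolong O M a) p X = prolong O M 0 X := by
  rw [prolong_eq, fderiv_add_const, ContinuousLinearMap.fderiv, prolongLin_apply]

theorem pullbackJ_apply (f : J1 → J1) (g : JetTensor) (p : J1) (I J : JetIdx) :
    pullbackJ f g p I J
      = tform (g (f p)) (fderiv ℝ f p (Pi.single I 1)) (fderiv ℝ f p (Pi.single J 1)) := rfl

theorem pullbackJ_prolong_higgsMetric (hO : O ∈ Matrix.orthogonalGroup (Fin 4) ℝ)
    (hM : IsLorentz M) (Λ : ℝ) (c : MetricLabel → ℝ → ℝ) :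
    pullbackJ (prolong O M a) (higgsMetric Λ c) = higgsMetric Λ c := by
  funext p I J
  rw [pullbackJ_apply, tform_higgsMetric, fderiv_prolong, fderiv_prolong,
    metricForm_prolong a p hO hM, metricForm_single]

end prolong

/-! ### The pulled-back Lagrangian -/

/-- The prolonged coordinate vector field. -/
def tangent (φ : Spacetime → FieldSpace) (x : Spacetime) (ρ : Fin 4) : J1 :=
  fun I => pd ρ (fun y => j1 φ y I) x

theorem xc_tangent (φ : Spacetime → FieldSpace) (x : Spacetime) (ρ : Fin 4) :
    xc (tangent φ x ρ) = Pi.single ρ 1 := by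
  funext μ
  change pd ρ (fun y : Spacetime => y μ) x = _
  rw [pd_coord, Pi.single_apply]

theorem uc_tangent (φ : Spacetime → FieldSpace) (x : Spacetime) (ρ : Fin 4) :
    uc (tangent φ x ρ) = d1 φ x ρ := rfl

theorem wc_tangent (φ : Spacetime → FieldSpace) (x : Spacetime) (ρ : Fin 4) :
    wc (tangent φ x ρ) = d2 φ x ρ := rfl

theorem jetLagrangian_eq (g : JetTensor) (φ : Spacetime → FieldSpace) (x : Spacetime) :
    jetLagrangian g φ x
      = (1 / 2) * ∑ ρ, et ρ * tform (g (j1 φ x)) (tangent φ x ρ) (tangent φ x ρ) := by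
  unfold jetLagrangian
  simp only [sum_mink_mul]
  rfl

section ops

variable (φ : Spacetime → FieldSpace) (x : Spacetime)

theorem opA_eq : opA φ x = ww (j1 φ x) := by
  simp only [opA, ww_eq, tdot, d1Up_eq, dotProduct_smul, smul_eq_mul]; rfl

theorem opB_eq : opB φ x = ss (j1 φ x) := by
  simp only [opB, ss_eq, mdot, d1Up_eq, smul_dotProduct, smul_eq_mul]
  refine Finset.sum_congr rfl fun ρ _ => ?_
  rw [dotProduct_comm]
  change (sDn (j1 φ x) ρ) * (et ρ * sDn (j1 φ x) ρ) = _
  ring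

theorem op1_eq : op1 φ x = ∑ μ, ∑ ν, et μ * et ν * (d2 φ x μ ν ⬝ᵥ d2 φ x μ ν) := by
  simp only [op1, d2Up_eq, dotProduct_smul, smul_eq_mul]

theorem op2_eq : op2 φ x = ∑ μ, ∑ ν, et μ * et ν * (d2 φ x μ ν ⬝ᵥ φ x) ^ 2 := by
  simp only [op2, d2Up_eq, smul_dotProduct, smul_eq_mul]
  exact Finset.sum_congr rfl fun _ _ => Finset.sum_congr rfl fun _ _ => by ring

theorem op3_eq : op3 φ x = ∑ μ, ∑ ν, et μ * et ν * ((d2 φ x μ ν ⬝ᵥ d1 φ x μ)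
    * (d1 φ x ν ⬝ᵥ φ x)) := by
  simp only [op3, d1Up_eq, smul_dotProduct, dotProduct_smul, smul_eq_mul]
  exact Finset.sum_congr rfl fun _ _ => Finset.sum_congr rfl fun _ _ => by ring

theorem op4_eq : op4 φ x = ∑ μ, ∑ ν, et μ * et ν * ((d2 φ x μ ν ⬝ᵥ φ x)
    * (d1 φ x μ ⬝ᵥ d1 φ x ν)) := by
  simp only [op4, d1Up_eq, smul_dotProduct, dotProduct_smul, smul_eq_mul]
  exact Finset.sum_congr rfl fun _ _ => Finset.sum_congr rfl fun _ _ => by ring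

theorem op6_eq : op6 φ x = ∑ μ, ∑ ν, et μ * et ν * (d1 φ x μ ⬝ᵥ d1 φ x ν) ^ 2 := by
  simp only [op6, d1Up_eq, smul_dotProduct, dotProduct_smul, smul_eq_mul]
  exact Finset.sum_congr rfl fun _ _ => Finset.sum_congr rfl fun _ _ => by ring

theorem op7_eq : op7 φ x = ∑ μ, ∑ ν, et μ * et ν * ((d2 φ x μ ν ⬝ᵥ φ x)
    * (d1 φ x μ ⬝ᵥ φ x) * (d1 φ x ν ⬝ᵥ φ x)) := by
  simp only [op7, d1Up_eq, smul_dotProduct, smul_eq_mul]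
  exact Finset.sum_congr rfl fun _ _ => Finset.sum_congr rfl fun _ _ => by ring

theorem op9_eq : op9 φ x = ∑ μ, ∑ ν, et μ * et ν * ((d1 φ x μ ⬝ᵥ d1 φ x ν)
    * (d1 φ x μ ⬝ᵥ φ x) * (d1 φ x ν ⬝ᵥ φ x)) := by
  simp only [op9, d1Up_eq, smul_dotProduct, smul_eq_mul]
  exact Finset.sum_congr rfl fun _ _ => Finset.sum_congr rfl fun _ _ => by ring

theorem opE_eq : opE φ x = ∑ μ, et μ * (d2 φ x μ μ ⬝ᵥ φ x) := by
  simp only [opE, box_eq, sum_dotProduct, smul_dotProduct, smul_eq_mul]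

theorem op21_eq : op21 φ x = ∑ μ, ∑ ν, et μ * et ν * ((d2 φ x μ μ ⬝ᵥ d1 φ x ν)
    * (d1 φ x ν ⬝ᵥ φ x)) := by
  simp only [op21, box_eq, d1Up_eq, sum_dotProduct, smul_dotProduct, smul_eq_mul, Finset.sum_mul]
  rw [Finset.sum_comm]
  exact Finset.sum_congr rfl fun _ _ => Finset.sum_congr rfl fun _ _ => by ring

end ops

section pullback

variable (Λ : ℝ) (c : MetricLabel → ℝ → ℝ) (φ : Spacetime → FieldSpace) (x : Spacetime)

theorem wc_j1 : wc (j1 φ x) = d1 φ x := rfl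
theorem uc_j1 : uc (j1 φ x) = φ x := rfl

theorem sDn_j1 (μ : Fin 4) : sDn (j1 φ x) μ = d1 φ x μ ⬝ᵥ φ x := dotProduct_comm _ _

theorem cf_j1 (l : MetricLabel) : cf Λ c (j1 φ x) l = c l (tt φ x Λ) := rfl

theorem op6_eq_gramSq : op6 φ x = gramSq (j1 φ x) := by
  simp only [op6_eq, gramSq, mdot, col, wc_j1, Finset.mul_sum]
  refine Finset.sum_congr rfl fun μ _ => Finset.sum_congr rfl fun ν _ => ?_
  rw [dotProduct_comm]; ring

theorem op9_eq_zvec : op9 φ x = zvec (j1 φ x) ⬝ᵥ zvec (j1 φ x) := by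
  simp only [op9_eq, zvec, dotProduct_sum, sum_dotProduct, smul_dotProduct, dotProduct_smul,
    smul_eq_mul, wc_j1, sDn_j1]
  refine Finset.sum_congr rfl fun μ _ => ?_
  rw [Finset.mul_sum]
  refine Finset.sum_congr rfl fun ν _ => ?_
  rw [dotProduct_comm (d1 φ x μ) (d1 φ x ν)]; ring

theorem sum_zvec_dot :
    ∑ ρ, et ρ * ((d1 φ x ρ ⬝ᵥ φ x) * (zvec (j1 φ x) ⬝ᵥ d1 φ x ρ)) = op9 φ x := by
  rw [op9_eq_zvec]
  conv_rhs => enter [1]; rw [zvec]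
  simp only [sum_dotProduct, smul_dotProduct, smul_eq_mul, sDn_j1, wc_j1]
  refine Finset.sum_congr rfl fun ρ _ => ?_
  rw [dotProduct_comm (zvec _)]; ring

theorem sum_et_dot_d1 : ∑ ρ, et ρ * (d1 φ x ρ ⬝ᵥ d1 φ x ρ) = opA φ x := by
  rw [opA_eq, ww_eq]; rfl

theorem sum_et_dot_sq : ∑ ρ, et ρ * ((d1 φ x ρ ⬝ᵥ φ x) * (d1 φ x ρ ⬝ᵥ φ x)) = opB φ x := by
  rw [opB_eq, ss_eq, mdot]
  simp only [sDn_j1]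

theorem sum_gram : ∑ ρ, et ρ * mdot (col (d1 φ x) (d1 φ x ρ)) (col (d1 φ x) (d1 φ x ρ))
    = op6 φ x := (op6_eq_gramSq φ x).symm

theorem sum_et_sq : ∑ ρ, et ρ * (et ρ) = 4 := by
  simp only [et_mul_self]; norm_num

theorem trace_formXX : ∑ ρ, et ρ * formXX Λ c (j1 φ x) (Pi.single ρ 1) (Pi.single ρ 1)
    = -2 * c .V (tt φ x Λ) + opA φ x / Λ ^ 4 * c .J0 (tt φ x Λ)
      + opB φ x / Λ ^ 6 * c .J1 (tt φ x Λ) + op5 φ x / Λ ^ 8 * c .K0 (tt φ x Λ)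
      + op6 φ x / Λ ^ 8 * c .K1 (tt φ x Λ) + op8 φ x / Λ ^ 10 * c .K2 (tt φ x Λ)
      + op9 φ x / Λ ^ 10 * c .K3 (tt φ x Λ) + op10 φ x / Λ ^ 12 * c .K4 (tt φ x Λ) := by
  have e := fun ρ => et_mul_self ρ
  have key : ∀ ρ, et ρ * formXX Λ c (j1 φ x) (Pi.single ρ 1) (Pi.single ρ 1)
      = et ρ * et ρ * (-(1 / 2) * c .V (tt φ x Λ) + opA φ x / Λ ^ 4 / 4 * (c .J0 (tt φ x Λ) / 2)
        + opB φ x / Λ ^ 6 / 4 * (c .J1 (tt φ x Λ) / 2)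
        + opA φ x / Λ ^ 8 / 4 * opA φ x * (c .K0 (tt φ x Λ) / 2)
        + op6 φ x / Λ ^ 8 / 4 * (c .K1 (tt φ x Λ) / 2)
        + opB φ x * opA φ x / Λ ^ 10 / 4 * (c .K2 (tt φ x Λ) / 3)
        + op9 φ x / Λ ^ 10 / 4 * (c .K3 (tt φ x Λ) / 2)
        + opB φ x * opB φ x / Λ ^ 12 / 4 * (c .K4 (tt φ x Λ) / 2))
      + et ρ * (d1 φ x ρ ⬝ᵥ d1 φ x ρ) * (1 / Λ ^ 4 * (c .J0 (tt φ x Λ) / 2)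
        + opA φ x / Λ ^ 8 * (c .K0 (tt φ x Λ) / 2) + opB φ x / Λ ^ 10 * (c .K2 (tt φ x Λ) / 3))
      + et ρ * ((d1 φ x ρ ⬝ᵥ φ x) * (d1 φ x ρ ⬝ᵥ φ x)) * (1 / Λ ^ 6 * (c .J1 (tt φ x Λ) / 2)
        + opA φ x / Λ ^ 10 * (c .K2 (tt φ x Λ) / 3) + opB φ x / Λ ^ 12 * (c .K4 (tt φ x Λ) / 2))
      + et ρ * mdot (col (d1 φ x) (d1 φ x ρ)) (col (d1 φ x) (d1 φ x ρ))
        * (1 / Λ ^ 8 * (c .K1 (tt φ x Λ) / 2))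
      + et ρ * ((d1 φ x ρ ⬝ᵥ φ x) * (zvec (j1 φ x) ⬝ᵥ d1 φ x ρ))
        * (1 / Λ ^ 10 * (c .K3 (tt φ x Λ) / 2)) := fun ρ => by
    simp only [formXX, alongVec_single, mdot_single, ← opA_eq, ← opB_eq, wc_j1, uc_j1, cf_j1,
      ← op6_eq_gramSq, ← op9_eq_zvec, Pi.single_eq_same]
    ring
  simp only [key, Finset.sum_add_distrib, ← Finset.sum_mul, sum_et_sq, sum_et_dot_d1,
    sum_et_dot_sq, sum_gram, sum_zvec_dot, op5, op8, op10]
  ring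

theorem trace_formXU : ∑ ρ, et ρ * formXU Λ c (j1 φ x) (Pi.single ρ 1) (d1 φ x ρ)
    = opA φ x / Λ ^ 2 * c .G0 (tt φ x Λ)
      + opB φ x / Λ ^ 4 * c .G1 (tt φ x Λ) + op5 φ x / Λ ^ 6 * c .H0 (tt φ x Λ)
      + op6 φ x / Λ ^ 6 * c .H1 (tt φ x Λ) + op8 φ x / Λ ^ 8 * c .H2 (tt φ x Λ)
      + op9 φ x / Λ ^ 8 * c .H3 (tt φ x Λ) + op10 φ x / Λ ^ 10 * c .H4 (tt φ x Λ) := by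
  have key : ∀ ρ, et ρ * formXU Λ c (j1 φ x) (Pi.single ρ 1) (d1 φ x ρ)
      = et ρ * (d1 φ x ρ ⬝ᵥ d1 φ x ρ) * (1 / Λ ^ 2 * c .G0 (tt φ x Λ)
        + opA φ x / Λ ^ 6 * c .H0 (tt φ x Λ) + opB φ x / Λ ^ 8 * (c .H2 (tt φ x Λ) / 2))
      + et ρ * ((d1 φ x ρ ⬝ᵥ φ x) * (d1 φ x ρ ⬝ᵥ φ x)) * (1 / Λ ^ 4 * c .G1 (tt φ x Λ)
        + opA φ x / Λ ^ 8 * (c .H2 (tt φ x Λ) / 2) + opB φ x / Λ ^ 10 * c .H4 (tt φ x Λ))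
      + et ρ * mdot (col (d1 φ x) (d1 φ x ρ)) (col (d1 φ x) (d1 φ x ρ))
        * (1 / Λ ^ 6 * c .H1 (tt φ x Λ))
      + et ρ * ((d1 φ x ρ ⬝ᵥ φ x) * (zvec (j1 φ x) ⬝ᵥ d1 φ x ρ))
        * (1 / Λ ^ 8 * c .H3 (tt φ x Λ)) := fun ρ => by
    simp only [formXU, alongVec_single, ← opA_eq, ← opB_eq, wc_j1, uc_j1, cf_j1,
      dotProduct_comm (φ x)]
    ring
  simp only [key, Finset.sum_add_distrib, ← Finset.sum_mul, sum_et_dot_d1,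
    sum_et_dot_sq, sum_gram, sum_zvec_dot, op5, op8, op10]
  ring

theorem trace_formUU : ∑ ρ, et ρ * formUU Λ c (j1 φ x) (d1 φ x ρ) (d1 φ x ρ)
    = opA φ x * c .C0 (tt φ x Λ)
      + opB φ x / Λ ^ 2 * c .C1 (tt φ x Λ) + op5 φ x / Λ ^ 4 * c .D0 (tt φ x Λ)
      + op6 φ x / Λ ^ 4 * c .D1 (tt φ x Λ) + op8 φ x / Λ ^ 6 * c .D2 (tt φ x Λ)
      + op9 φ x / Λ ^ 6 * c .D3 (tt φ x Λ) + op10 φ x / Λ ^ 8 * c .D4 (tt φ x Λ) := by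
  have key : ∀ ρ, et ρ * formUU Λ c (j1 φ x) (d1 φ x ρ) (d1 φ x ρ)
      = et ρ * (d1 φ x ρ ⬝ᵥ d1 φ x ρ) * (c .C0 (tt φ x Λ)
        + opA φ x / Λ ^ 4 * c .D0 (tt φ x Λ) + opB φ x / Λ ^ 6 * (c .D2 (tt φ x Λ) / 2))
      + et ρ * ((d1 φ x ρ ⬝ᵥ φ x) * (d1 φ x ρ ⬝ᵥ φ x)) * (1 / Λ ^ 2 * c .C1 (tt φ x Λ)
        + opA φ x / Λ ^ 6 * (c .D2 (tt φ x Λ) / 2) + opB φ x / Λ ^ 8 * c .D4 (tt φ x Λ))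
      + et ρ * mdot (col (d1 φ x) (d1 φ x ρ)) (col (d1 φ x) (d1 φ x ρ))
        * (1 / Λ ^ 4 * c .D1 (tt φ x Λ))
      + et ρ * ((d1 φ x ρ ⬝ᵥ φ x) * (zvec (j1 φ x) ⬝ᵥ d1 φ x ρ))
        * (1 / Λ ^ 6 * c .D3 (tt φ x Λ)) := fun ρ => by
    simp only [formUU, ← opA_eq, ← opB_eq, wc_j1, uc_j1, cf_j1, dotProduct_comm (φ x)]
    ring
  simp only [key, Finset.sum_add_distrib, ← Finset.sum_mul, sum_et_dot_d1,
    sum_et_dot_sq, sum_gram, sum_zvec_dot, op5, op8, op10]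
  ring

variable {φ}

theorem trace_op3 (hφ : ContDiff ℝ ∞ φ) :
    ∑ ρ, et ρ * (tdot (d1 φ x) (d2 φ x ρ) * (d1 φ x ρ ⬝ᵥ φ x)) = op3 φ x := by
  simp only [op3_eq, tdot, Finset.sum_mul, Finset.mul_sum]
  rw [Finset.sum_comm]
  refine Finset.sum_congr rfl fun μ _ => Finset.sum_congr rfl fun ν _ => ?_
  rw [dotProduct_comm, d2_comm hφ]; ring

theorem trace_op3' :
    ∑ ρ, et ρ * mdot (col (d1 φ x) (φ x)) (col (d2 φ x ρ) (d1 φ x ρ)) = op3 φ x := by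
  simp only [op3_eq, mdot, col, Finset.mul_sum]
  refine Finset.sum_congr rfl fun μ _ => Finset.sum_congr rfl fun ν _ => ?_
  ring

theorem trace_op4 : ∑ ρ, et ρ * mdot (col (d1 φ x) (d1 φ x ρ)) (col (d2 φ x ρ) (φ x))
    = op4 φ x := by
  simp only [op4_eq, mdot, col, Finset.mul_sum]
  refine Finset.sum_congr rfl fun μ _ => Finset.sum_congr rfl fun ν _ => ?_
  rw [dotProduct_comm (d1 φ x μ)]; ring

theorem trace_op7 : ∑ ρ, et ρ * (mdot (col (d1 φ x) (φ x)) (col (d2 φ x ρ) (φ x))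
    * (d1 φ x ρ ⬝ᵥ φ x)) = op7 φ x := by
  simp only [op7_eq, mdot, col, Finset.mul_sum, Finset.sum_mul]
  refine Finset.sum_congr rfl fun μ _ => Finset.sum_congr rfl fun ν _ => ?_
  ring

theorem trace_op21 : ∑ ρ, et ρ * (zvec (j1 φ x) ⬝ᵥ d2 φ x ρ ρ) = op21 φ x := by
  simp only [op21_eq, zvec_dot, mdot, col, Finset.mul_sum, wc_j1, sDn_j1]
  refine Finset.sum_congr rfl fun μ _ => Finset.sum_congr rfl fun ν _ => ?_
  rw [dotProduct_comm (d1 φ x ν) (d2 φ x μ μ)]; ring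

theorem trace_formXD (hφ : ContDiff ℝ ∞ φ) :
    ∑ ρ, et ρ * formXD Λ c (j1 φ x) (Pi.single ρ 1) (d2 φ x ρ)
    = opE φ x / Λ * c .E (tt φ x Λ) + op4 φ x / Λ ^ 5 * c .F10 (tt φ x Λ)
      + op3 φ x / Λ ^ 5 * c .F11 (tt φ x Λ) + op7 φ x / Λ ^ 7 * c .F12 (tt φ x Λ)
      + op20 φ x / Λ ^ 5 * c .F20 (tt φ x Λ) + op21 φ x / Λ ^ 5 * c .F21 (tt φ x Λ)
      + op22 φ x / Λ ^ 7 * c .F22 (tt φ x Λ) := by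
  have key : ∀ ρ, et ρ * formXD Λ c (j1 φ x) (Pi.single ρ 1) (d2 φ x ρ)
      = et ρ * (d2 φ x ρ ρ ⬝ᵥ φ x) * (1 / Λ * c .E (tt φ x Λ)
        + opA φ x / Λ ^ 5 * c .F20 (tt φ x Λ) + opB φ x / Λ ^ 7 * c .F22 (tt φ x Λ))
      + et ρ * mdot (col (d1 φ x) (d1 φ x ρ)) (col (d2 φ x ρ) (φ x))
        * (1 / Λ ^ 5 * c .F10 (tt φ x Λ))
      + et ρ * (tdot (d1 φ x) (d2 φ x ρ) * (d1 φ x ρ ⬝ᵥ φ x))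
        * (1 / (2 * Λ ^ 5) * c .F11 (tt φ x Λ))
      + et ρ * mdot (col (d1 φ x) (φ x)) (col (d2 φ x ρ) (d1 φ x ρ))
        * (1 / (2 * Λ ^ 5) * c .F11 (tt φ x Λ))
      + et ρ * (mdot (col (d1 φ x) (φ x)) (col (d2 φ x ρ) (φ x)) * (d1 φ x ρ ⬝ᵥ φ x))
        * (1 / Λ ^ 7 * c .F12 (tt φ x Λ))
      + et ρ * (zvec (j1 φ x) ⬝ᵥ d2 φ x ρ ρ) * (1 / Λ ^ 5 * c .F21 (tt φ x Λ)) := fun ρ => by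
    simp only [formXD, alongVec_single, ← opA_eq, ← opB_eq, wc_j1, uc_j1, cf_j1]
    ring
  simp only [key, Finset.sum_add_distrib, ← Finset.sum_mul, ← opE_eq, trace_op4, trace_op3 x hφ,
    trace_op3' x, trace_op7, trace_op21, op20, op22]
  ring

theorem trace_formDU (hφ : ContDiff ℝ ∞ φ) :
    ∑ ρ, et ρ * formDU Λ c (j1 φ x) (d2 φ x ρ) (d1 φ x ρ)
    = (op3 φ x + op4 φ x) / 2 / Λ ^ 3 * (c .B0 (tt φ x Λ) + c .B1 (tt φ x Λ))
      + op3 φ x / Λ ^ 3 * c .B2 (tt φ x Λ) + op7 φ x / Λ ^ 5 * c .B3 (tt φ x Λ) := by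
  have key : ∀ ρ, et ρ * formDU Λ c (j1 φ x) (d2 φ x ρ) (d1 φ x ρ)
      = et ρ * mdot (col (d1 φ x) (d1 φ x ρ)) (col (d2 φ x ρ) (φ x))
        * (1 / 2 / Λ ^ 3 * (c .B0 (tt φ x Λ) + c .B1 (tt φ x Λ)))
      + et ρ * (tdot (d1 φ x) (d2 φ x ρ) * (d1 φ x ρ ⬝ᵥ φ x))
        * (1 / 2 / Λ ^ 3 * (c .B0 (tt φ x Λ) + c .B1 (tt φ x Λ)))
      + et ρ * mdot (col (d1 φ x) (φ x)) (col (d2 φ x ρ) (d1 φ x ρ))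
        * (1 / Λ ^ 3 * c .B2 (tt φ x Λ))
      + et ρ * (mdot (col (d1 φ x) (φ x)) (col (d2 φ x ρ) (φ x)) * (d1 φ x ρ ⬝ᵥ φ x))
        * (1 / Λ ^ 5 * c .B3 (tt φ x Λ)) := fun ρ => by
    simp only [formDU, wc_j1, uc_j1, cf_j1, dotProduct_comm (φ x),
      mdot_comm (col (d2 φ x ρ) (φ x)) (col (d1 φ x) (d1 φ x ρ))]
    ring
  simp only [key, Finset.sum_add_distrib, ← Finset.sum_mul, trace_op4, trace_op3 x hφ,
    trace_op3' x, trace_op7]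
  ring

theorem trace_formDD : ∑ ρ, et ρ * formDD Λ c (j1 φ x) (d2 φ x ρ) (d2 φ x ρ)
    = op1 φ x * c .A0 (tt φ x Λ) + op2 φ x / Λ ^ 2 * c .A1 (tt φ x Λ) := by
  have h1 : ∑ ρ, et ρ * tdot (d2 φ x ρ) (d2 φ x ρ) = op1 φ x := by
    simp only [op1_eq, tdot, Finset.mul_sum]
    exact Finset.sum_congr rfl fun μ _ => Finset.sum_congr rfl fun ν _ => by ring
  have h2 : ∑ ρ, et ρ * mdot (col (d2 φ x ρ) (φ x)) (col (d2 φ x ρ) (φ x)) = op2 φ x := by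
    simp only [op2_eq, mdot, col, Finset.mul_sum]
    exact Finset.sum_congr rfl fun μ _ => Finset.sum_congr rfl fun ν _ => by ring
  have key : ∀ ρ, et ρ * formDD Λ c (j1 φ x) (d2 φ x ρ) (d2 φ x ρ)
      = et ρ * tdot (d2 φ x ρ) (d2 φ x ρ) * c .A0 (tt φ x Λ)
      + et ρ * mdot (col (d2 φ x ρ) (φ x)) (col (d2 φ x ρ) (φ x))
        * (1 / Λ ^ 2 * c .A1 (tt φ x Λ)) := fun ρ => by
    simp only [formDD, wc_j1, uc_j1, cf_j1]
    ring
  simp only [key, Finset.sum_add_distrib, ← Finset.sum_mul, h1, h2]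
  ring

theorem jetLagrangian_higgsMetric (hΛ : Λ ≠ 0) (hφ : ContDiff ℝ ∞ φ) :
    jetLagrangian (higgsMetric Λ c) φ x = pulledBackForm Λ c φ x := by
  have key : ∀ ρ, et ρ * tform (higgsMetric Λ c (j1 φ x)) (tangent φ x ρ) (tangent φ x ρ)
      = et ρ * formXX Λ c (j1 φ x) (Pi.single ρ 1) (Pi.single ρ 1) * Λ ^ 4
      + et ρ * formXU Λ c (j1 φ x) (Pi.single ρ 1) (d1 φ x ρ) * (2 * Λ ^ 2)
      + et ρ * formXD Λ c (j1 φ x) (Pi.single ρ 1) (d2 φ x ρ) * (2 * Λ)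
      + et ρ * formUU Λ c (j1 φ x) (d1 φ x ρ) (d1 φ x ρ)
      + et ρ * formDU Λ c (j1 φ x) (d2 φ x ρ) (d1 φ x ρ) * (2 / Λ)
      + et ρ * formDD Λ c (j1 φ x) (d2 φ x ρ) (d2 φ x ρ) * (1 / Λ ^ 2) := fun ρ => by
    rw [tform_higgsMetric]
    simp only [metricForm, xc_tangent, uc_tangent, wc_tangent]
    ring
  rw [jetLagrangian_eq]
  simp only [key, Finset.sum_add_distrib, ← Finset.sum_mul, trace_formXX, trace_formXU,
    trace_formXD Λ c x hφ, trace_formUU, trace_formDU Λ c x hφ, trace_formDD, pulledBackForm]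
  field_simp
  ring

end pullback

/-! ### Smoothness and the number of derivatives -/

section smooth

theorem contDiff_uc : ContDiff ℝ ∞ uc := by
  refine contDiff_pi.2 fun i => ?_
  exact (ContinuousLinearMap.proj (R := ℝ) (φ := fun _ : JetIdx => ℝ) (Sum.inr (Sum.inl i))).contDiff

theorem contDiff_wc (μ : Fin 4) : ContDiff ℝ ∞ (fun p => wc p μ) := by
  refine contDiff_pi.2 fun i => ?_
  exact (ContinuousLinearMap.proj (R := ℝ) (φ := fun _ : JetIdx => ℝ)
    (Sum.inr (Sum.inr (μ, i)))).contDiff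

theorem contDiff_dotProduct {E : Type*} [NormedAddCommGroup E] [NormedSpace ℝ E]
    {a b : E → FieldSpace} (ha : ContDiff ℝ ∞ a) (hb : ContDiff ℝ ∞ b) :
    ContDiff ℝ ∞ (fun p => a p ⬝ᵥ b p) := by
  unfold dotProduct
  exact ContDiff.sum fun i _ => (contDiff_pi.1 ha i).mul (contDiff_pi.1 hb i)

theorem contDiff_higgsMetric (Λ : ℝ) {c : MetricLabel → ℝ → ℝ} (hc : SmoothCoeffs c)
    (I J : JetIdx) : ContDiff ℝ ∞ (fun p => higgsMetric Λ c p I J) := by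
  have hcf : ∀ l, ContDiff ℝ ∞ (fun p => cf Λ c p l) := fun l =>
    contDiff_coeff (hc l) Λ contDiff_uc
  have hu : ∀ i, ContDiff ℝ ∞ (fun p => uc p i) := contDiff_pi.1 contDiff_uc
  have hw : ∀ μ i, ContDiff ℝ ∞ (fun p => wc p μ i) := fun μ => contDiff_pi.1 (contDiff_wc μ)
  have hs : ∀ μ, ContDiff ℝ ∞ (fun p => sDn p μ) := fun μ =>
    contDiff_dotProduct contDiff_uc (contDiff_wc μ)
  have hg : ∀ μ ν, ContDiff ℝ ∞ (fun p => wc p μ ⬝ᵥ wc p ν) := fun μ ν =>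
    contDiff_dotProduct (contDiff_wc μ) (contDiff_wc ν)
  have hss : ContDiff ℝ ∞ ss := by
    rw [show ss = fun p => mdot (sDn p) (sDn p) from funext ss_eq]
    unfold mdot; fun_prop
  have hww : ContDiff ℝ ∞ ww := by
    rw [show ww = fun p => tdot (wc p) (wc p) from funext ww_eq]
    unfold tdot; fun_prop
  have hXX : ∀ μ ν, ContDiff ℝ ∞ (fun p => gXX Λ c p μ ν) := fun μ ν => by
    simp only [gXX, wUp_eq, dotProduct_smul, smul_dotProduct, smul_eq_mul]
    fun_prop
  have hXU : ∀ μ j, ContDiff ℝ ∞ (fun p => gXU Λ c p μ j) := fun μ j => by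
    simp only [gXU, wUp_eq, sUp_eq, dotProduct_smul, smul_dotProduct, smul_eq_mul]
    fun_prop
  have hXD : ∀ μ j ν, ContDiff ℝ ∞ (fun p => gXD Λ c p μ j ν) := fun μ j ν => by
    simp only [gXD, wUp_eq, sUp_eq, dotProduct_smul, smul_dotProduct, smul_eq_mul, Pi.smul_apply]
    fun_prop
  have hUU : ∀ i j, ContDiff ℝ ∞ (fun p => gUU Λ c p i j) := fun i j => by
    simp only [gUU, wUp_eq, sUp_eq, smul_eq_mul, Pi.smul_apply]
    fun_prop
  have hDU : ∀ i j μ, ContDiff ℝ ∞ (fun p => gDU Λ c p i j μ) := fun i j μ => by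
    simp only [gDU, wUp_eq, sUp_eq, smul_eq_mul, Pi.smul_apply]
    fun_prop
  have hDD : ∀ i j μ ν, ContDiff ℝ ∞ (fun p => gDD Λ c p i j μ ν) := fun i j μ ν => by
    simp only [gDD]
    fun_prop
  rcases I with μ | i | ⟨μ, i⟩ <;> rcases J with ν | j | ⟨ν, j⟩ <;>
  simp only [higgsMetric, Matrix.of_apply] <;> fun_prop

end smooth

/-- Functions that agree with a polynomial of degree at most `n` away from the origin. -/
def PolyLE (n : ℕ) (F : ℝ → ℝ) : Prop :=
  ∃ q : Polynomial ℝ, q.natDegree ≤ n ∧ ∀ s : ℝ, s ≠ 0 → F s = q.eval s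

namespace PolyLE

variable {n m : ℕ} {F G : ℝ → ℝ}

theorem add (hF : PolyLE n F) (hG : PolyLE n G) : PolyLE n (fun s => F s + G s) := by
  obtain ⟨p, hp, hp'⟩ := hF
  obtain ⟨q, hq, hq'⟩ := hG
  exact ⟨p + q, (Polynomial.natDegree_add_le _ _).trans (max_le hp hq),
    fun s hs => by beta_reduce; rw [hp' s hs, hq' s hs, Polynomial.eval_add]⟩

theorem monomial (a : ℝ) {k : ℕ} (hk : k ≤ n) : PolyLE n (fun s => a * s ^ k) :=
  ⟨Polynomial.C a * Polynomial.X ^ k, (Polynomial.natDegree_C_mul_X_pow_le a k).trans hk,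
    fun s _ => by simp⟩

theorem congr (hF : PolyLE n F) (h : ∀ s, s ≠ 0 → G s = F s) : PolyLE n G := by
  obtain ⟨p, hp, hp'⟩ := hF
  exact ⟨p, hp, fun s hs => by rw [h s hs, hp' s hs]⟩

/-- Three even powers. -/
theorem of_three {a b c : ℝ} (h : ∀ s, s ≠ 0 → F s = a + b * s ^ 2 + c * s ^ 4) : PolyLE 4 F :=
  (((monomial a (Nat.zero_le 4)).add (monomial b (by norm_num : 2 ≤ 4))).add
    (monomial c (le_refl 4))).congr fun s hs => by rw [h s hs]; ring

end PolyLE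

section dilate

variable (s : ℝ) (p : J1)

theorem uc_dilate : uc (dilate s p) = uc p := rfl
theorem wc_dilate (μ : Fin 4) : wc (dilate s p) μ = s • wc p μ := rfl

theorem sDn_dilate (μ : Fin 4) : sDn (dilate s p) μ = s * sDn p μ := by
  simp [sDn, uc_dilate, wc_dilate]

theorem wUp_dilate (μ : Fin 4) : wUp (dilate s p) μ = s • wUp p μ := by
  simp only [wUp_eq, wc_dilate, smul_comm s]

theorem sUp_dilate (μ : Fin 4) : sUp (dilate s p) μ = s * sUp p μ := by
  simp [sUp, uc_dilate, wUp_dilate]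

theorem ww_dilate : ww (dilate s p) = s ^ 2 * ww p := by
  simp only [ww, wc_dilate, wUp_dilate, dotProduct_smul, smul_dotProduct, smul_eq_mul,
    Finset.mul_sum]
  exact Finset.sum_congr rfl fun _ _ => by ring

theorem ss_dilate : ss (dilate s p) = s ^ 2 * ss p := by
  simp only [ss, sDn_dilate, sUp_dilate, Finset.mul_sum]
  exact Finset.sum_congr rfl fun _ _ => by ring

theorem cf_dilate (Λ : ℝ) (c : MetricLabel → ℝ → ℝ) : cf Λ c (dilate s p) = cf Λ c p := rfl

/-- The dilation as a linear map. -/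
def dilateLin : J1 →L[ℝ] J1 :=
  LinearMap.toContinuousLinearMap
    { toFun := dilate s
      map_add' := fun X Y => by
        funext I
        rcases I with μ | i | ⟨μ, i⟩ <;> simp [dilate, mkJ1, xc_add, uc_add, wc_add, mul_add]
      map_smul' := fun r X => by
        funext I
        rcases I with μ | i | ⟨μ, i⟩ <;> simp [dilate, mkJ1, xc_smul, uc_smul, wc_smul] <;> ring }

theorem fderiv_dilate (X : J1) : fderiv ℝ (dilate s) p X = dilate s X := by
  rw [show dilate s = dilateLin s from rfl, ContinuousLinearMap.fderiv]

/-- The weight of a coordinate direction under the dilation. -/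
def dilateWeight : JetIdx → ℝ
  | .inl _ => s⁻¹
  | .inr (.inl _) => 1
  | .inr (.inr _) => s

theorem dilate_apply (X : J1) (I : JetIdx) : dilate s X I = dilateWeight s I * X I := by
  rcases I with μ | i | ⟨μ, i⟩ <;> simp [dilate, mkJ1, dilateWeight, xc, uc, wc]

theorem pullbackJ_dilate (g : JetTensor) (I J : JetIdx) :
    pullbackJ (dilate s) g p I J
      = g (dilate s p) I J * (dilateWeight s I * dilateWeight s J) := by
  simp only [pullbackJ, Matrix.of_apply, fderiv_dilate, dilate_apply, Pi.single_apply, mul_ite,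
    mul_one, mul_zero, Finset.sum_ite_eq', Finset.mem_univ, if_true, ite_mul, zero_mul]
  ring

theorem atMostFour_higgsMetric (Λ : ℝ) (c : MetricLabel → ℝ → ℝ) (I J : JetIdx) :
    PolyLE 4 (fun s => s ^ 2 * pullbackJ (dilate s) (higgsMetric Λ c) p I J) := by
  have e0 : ∀ μ ν, ∃ a b d, ∀ s, gXX Λ c (dilate s p) μ ν = a + b * s ^ 2 + d * s ^ 4 :=
   fun μ ν => ⟨-(1 / 2) * mink μ ν * cf Λ c p .V,
      (((wc p μ ⬝ᵥ wc p ν) / Λ ^ 4 + mink μ ν / 4 * (ww p / Λ ^ 4)) * (cf Λ c p .J0 / 2)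
        + (sDn p μ * sDn p ν / Λ ^ 6 + mink μ ν / 4 * (ss p / Λ ^ 6)) * (cf Λ c p .J1 / 2)),
      (gXX Λ c p μ ν - (-(1 / 2) * mink μ ν * cf Λ c p .V)
        - (((wc p μ ⬝ᵥ wc p ν) / Λ ^ 4 + mink μ ν / 4 * (ww p / Λ ^ 4)) * (cf Λ c p .J0 / 2)
        + (sDn p μ * sDn p ν / Λ ^ 6 + mink μ ν / 4 * (ss p / Λ ^ 6)) * (cf Λ c p .J1 / 2)))
, fun s => by
    have h1 : (∑ σ, (wc (dilate s p) σ ⬝ᵥ wc (dilate s p) μ)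
        * (wUp (dilate s p) σ ⬝ᵥ wc (dilate s p) ν))
        = s ^ 4 * ∑ σ, (wc p σ ⬝ᵥ wc p μ) * (wUp p σ ⬝ᵥ wc p ν) := by
      simp only [wc_dilate, wUp_dilate, dotProduct_smul, smul_dotProduct, smul_eq_mul,
        Finset.mul_sum]
      exact Finset.sum_congr rfl fun _ _ => by ring
    have h2 : (∑ σ, ∑ ρ, (wc (dilate s p) σ ⬝ᵥ wc (dilate s p) ρ)
        * (wUp (dilate s p) σ ⬝ᵥ wUp (dilate s p) ρ))
        = s ^ 4 * ∑ σ, ∑ ρ, (wc p σ ⬝ᵥ wc p ρ) * (wUp p σ ⬝ᵥ wUp p ρ) := by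
      simp only [wc_dilate, wUp_dilate, dotProduct_smul, smul_dotProduct, smul_eq_mul,
        Finset.mul_sum]
      exact Finset.sum_congr rfl fun _ _ => Finset.sum_congr rfl fun _ _ => by ring
    have h3 : (∑ σ, ((sDn (dilate s p) μ * (wUp (dilate s p) σ ⬝ᵥ wc (dilate s p) ν)
        + (wUp (dilate s p) σ ⬝ᵥ wc (dilate s p) μ) * sDn (dilate s p) ν) / (2 * Λ ^ 7)
        + mink μ ν / 4 * ((∑ ρ, sDn (dilate s p) ρ
          * (wUp (dilate s p) σ ⬝ᵥ wUp (dilate s p) ρ)) / Λ ^ 7)) * (sDn (dilate s p) σ / Λ ^ 3))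
        = s ^ 4 * (∑ σ, ((sDn p μ * (wUp p σ ⬝ᵥ wc p ν) + (wUp p σ ⬝ᵥ wc p μ) * sDn p ν)
          / (2 * Λ ^ 7)
        + mink μ ν / 4 * ((∑ ρ, sDn p ρ * (wUp p σ ⬝ᵥ wUp p ρ)) / Λ ^ 7))
          * (sDn p σ / Λ ^ 3)) := by
      have h4 : ∀ σ, (∑ ρ, sDn (dilate s p) ρ * (wUp (dilate s p) σ ⬝ᵥ wUp (dilate s p) ρ))
          = s ^ 3 * (∑ ρ, sDn p ρ * (wUp p σ ⬝ᵥ wUp p ρ)) := fun σ => by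
        simp only [sDn_dilate, wUp_dilate, dotProduct_smul, smul_dotProduct, smul_eq_mul,
          Finset.mul_sum]
        exact Finset.sum_congr rfl fun _ _ => by ring
      simp only [h4]
      simp only [sDn_dilate, wc_dilate, wUp_dilate, dotProduct_smul, smul_dotProduct,
        smul_eq_mul]
      rw [Finset.mul_sum]
      exact Finset.sum_congr rfl fun _ _ => by ring
    simp only [gXX, h1, h2, h3]
    simp only [sDn_dilate, wc_dilate, ww_dilate, ss_dilate, cf_dilate, dotProduct_smul,
      smul_dotProduct, smul_eq_mul]
    ring⟩
  have e1 : ∀ μ j, ∃ a b, ∀ s, gXU Λ c (dilate s p) μ j = a * s + b * s ^ 3 := fun μ j => ⟨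
      (wc p μ j / Λ ^ 2 * cf Λ c p .G0 + uc p j * sDn p μ / Λ ^ 4 * cf Λ c p .G1),
      (gXU Λ c p μ j - (wc p μ j / Λ ^ 2 * cf Λ c p .G0
        + uc p j * sDn p μ / Λ ^ 4 * cf Λ c p .G1)), fun s => by
    have h1 : (∑ ρ, wc (dilate s p) ρ j * (wc (dilate s p) μ ⬝ᵥ wUp (dilate s p) ρ))
        = s ^ 3 * ∑ ρ, wc p ρ j * (wc p μ ⬝ᵥ wUp p ρ) := by
      simp only [wc_dilate, wUp_dilate, dotProduct_smul, smul_dotProduct, smul_eq_mul,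
        Finset.mul_sum, Pi.smul_apply]
      exact Finset.sum_congr rfl fun _ _ => by ring
    have h2 : (∑ ρ, (wc (dilate s p) μ ⬝ᵥ wc (dilate s p) ρ) * sUp (dilate s p) ρ)
        = s ^ 3 * ∑ ρ, (wc p μ ⬝ᵥ wc p ρ) * sUp p ρ := by
      simp only [wc_dilate, sUp_dilate, dotProduct_smul, smul_dotProduct, smul_eq_mul,
        Finset.mul_sum, Pi.smul_apply]
      exact Finset.sum_congr rfl fun _ _ => by ring
    have h3 : (∑ ρ, wc (dilate s p) ρ j * sDn (dilate s p) μ * sUp (dilate s p) ρ)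
        = s ^ 3 * ∑ ρ, wc p ρ j * sDn p μ * sUp p ρ := by
      simp only [wc_dilate, sUp_dilate, sDn_dilate, smul_eq_mul, Finset.mul_sum, Pi.smul_apply]
      exact Finset.sum_congr rfl fun _ _ => by ring
    simp only [gXU, h1, h2, h3]
    simp only [sDn_dilate, wc_dilate, ww_dilate, ss_dilate, cf_dilate, uc_dilate, smul_eq_mul,
      Pi.smul_apply]
    ring⟩
  have e2 : ∀ μ j ν, ∃ a b, ∀ s, gXD Λ c (dilate s p) μ j ν = a + b * s ^ 2 := fun μ j ν => ⟨
      kd μ ν * (uc p j / Λ) * cf Λ c p .E,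
      gXD Λ c p μ j ν - kd μ ν * (uc p j / Λ) * cf Λ c p .E, fun s => by
    have h1 : (∑ ρ, wc (dilate s p) ρ j * sUp (dilate s p) ρ)
        = s ^ 2 * ∑ ρ, wc p ρ j * sUp p ρ := by
      simp only [wc_dilate, sUp_dilate, smul_eq_mul, Finset.mul_sum, Pi.smul_apply]
      exact Finset.sum_congr rfl fun _ _ => by ring
    simp only [gXD, h1]
    simp only [sDn_dilate, sUp_dilate, wc_dilate, wUp_dilate, ww_dilate, ss_dilate, cf_dilate,
      uc_dilate, smul_eq_mul, Pi.smul_apply, dotProduct_smul, smul_dotProduct]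
    ring⟩
  have e3 : ∀ i j, ∃ a b, ∀ s, gUU Λ c (dilate s p) i j = a + b * s ^ 2 := fun i j => ⟨
      (kd i j * cf Λ c p .C0 + uc p i * uc p j / Λ ^ 2 * cf Λ c p .C1),
      (gUU Λ c p i j - (kd i j * cf Λ c p .C0 + uc p i * uc p j / Λ ^ 2 * cf Λ c p .C1)),
      fun s => by
    have h1 : (∑ ρ, wc (dilate s p) ρ i * wUp (dilate s p) ρ j)
        = s ^ 2 * ∑ ρ, wc p ρ i * wUp p ρ j := by
      simp only [wc_dilate, wUp_dilate, smul_eq_mul, Finset.mul_sum, Pi.smul_apply]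
      exact Finset.sum_congr rfl fun _ _ => by ring
    have h2 : (∑ ρ, (uc (dilate s p) i * wc (dilate s p) ρ j
        + uc (dilate s p) j * wc (dilate s p) ρ i) * sUp (dilate s p) ρ)
        = s ^ 2 * ∑ ρ, (uc p i * wc p ρ j + uc p j * wc p ρ i) * sUp p ρ := by
      simp only [wc_dilate, sUp_dilate, uc_dilate, smul_eq_mul, Finset.mul_sum, Pi.smul_apply]
      exact Finset.sum_congr rfl fun _ _ => by ring
    simp only [gUU, h1, h2]
    simp only [ww_dilate, ss_dilate, cf_dilate, uc_dilate]
    ring⟩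
  have e4 : ∀ s i j μ, gDU Λ c (dilate s p) i j μ = gDU Λ c p i j μ * s := fun s i j μ => by
    simp only [gDU, sUp_dilate, wUp_dilate, cf_dilate, uc_dilate, smul_eq_mul, Pi.smul_apply]
    ring
  have e5 : ∀ s, gDD Λ c (dilate s p) = gDD Λ c p := fun s => rfl
  simp only [pullbackJ_dilate]
  rcases I with μ | i | ⟨μ, i⟩ <;> rcases J with ν | j | ⟨ν, j⟩
  · obtain ⟨a, b, d, h⟩ := e0 μ ν
    refine PolyLE.of_three (a := Λ ^ 4 * a) (b := Λ ^ 4 * b) (c := Λ ^ 4 * d) fun s hs => ?_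
    simp only [higgsMetric, Matrix.of_apply, h, dilateWeight]
    field_simp
  · obtain ⟨a, b, h⟩ := e1 μ j
    refine PolyLE.of_three (a := 0) (b := Λ ^ 2 * a) (c := Λ ^ 2 * b) fun s hs => ?_
    simp only [higgsMetric, Matrix.of_apply, h, dilateWeight]
    field_simp
    ring
  · obtain ⟨a, b, h⟩ := e2 μ j ν
    refine PolyLE.of_three (a := 0) (b := Λ * a) (c := Λ * b) fun s hs => ?_
    simp only [higgsMetric, Matrix.of_apply, h, dilateWeight]
    field_simp
    ring
  · obtain ⟨a, b, h⟩ := e1 ν i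
    refine PolyLE.of_three (a := 0) (b := Λ ^ 2 * a) (c := Λ ^ 2 * b) fun s hs => ?_
    simp only [higgsMetric, Matrix.of_apply, h, dilateWeight]
    field_simp
    ring
  · obtain ⟨a, b, h⟩ := e3 i j
    refine PolyLE.of_three (a := 0) (b := a) (c := b) fun s hs => ?_
    simp only [higgsMetric, Matrix.of_apply, h, dilateWeight]
    ring
  · refine PolyLE.of_three (a := 0) (b := 0)
      (c := (gDU Λ c p i j ν + gDU Λ c p j i ν) / 2 / Λ) fun s hs => ?_
    simp only [higgsMetric, Matrix.of_apply, e4, dilateWeight]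
    ring
  · obtain ⟨a, b, h⟩ := e2 ν i μ
    refine PolyLE.of_three (a := 0) (b := Λ * a) (c := Λ * b) fun s hs => ?_
    simp only [higgsMetric, Matrix.of_apply, h, dilateWeight]
    field_simp
    ring
  · refine PolyLE.of_three (a := 0) (b := 0)
      (c := (gDU Λ c p i j μ + gDU Λ c p j i μ) / 2 / Λ) fun s hs => ?_
    simp only [higgsMetric, Matrix.of_apply, e4, dilateWeight]
    ring
  · refine PolyLE.of_three (a := 0) (b := 0) (c := gDD Λ c p i j μ ν / Λ ^ 2) fun s hs => ?_
    simp only [higgsMetric, Matrix.of_apply, e5, dilateWeight]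
    ring

theorem kd_comm (i j : Fin 4) : kd i j = kd j i := by simp [kd, eq_comm]

theorem mink_comm (μ ν : Fin 4) : mink μ ν = mink ν μ :=
  congrFun (congrFun mink_transpose ν) μ

theorem gXX_comm (Λ : ℝ) (c : MetricLabel → ℝ → ℝ) (μ ν : Fin 4) :
    gXX Λ c p μ ν = gXX Λ c p ν μ := by
  have h1 : ∀ σ α β, (wc p σ ⬝ᵥ wc p α) * (wUp p σ ⬝ᵥ wc p β)
      = (wc p σ ⬝ᵥ wc p β) * (wUp p σ ⬝ᵥ wc p α) := fun σ α β => by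
    simp only [wUp_eq, smul_dotProduct, smul_eq_mul]
    ring
  have h2 : ∀ σ, sDn p μ * (wUp p σ ⬝ᵥ wc p ν) + (wUp p σ ⬝ᵥ wc p μ) * sDn p ν
      = sDn p ν * (wUp p σ ⬝ᵥ wc p μ) + (wUp p σ ⬝ᵥ wc p ν) * sDn p μ := fun σ => by ring
  simp only [gXX]
  rw [mink_comm μ ν, dotProduct_comm (wc p μ) (wc p ν), mul_comm (sDn p μ) (sDn p ν)]
  simp only [h1 _ μ ν, h2]

theorem gUU_comm (Λ : ℝ) (c : MetricLabel → ℝ → ℝ) (i j : Fin 4) :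
    gUU Λ c p i j = gUU Λ c p j i := by
  have h1 : ∀ ρ, wc p ρ i * wUp p ρ j = wc p ρ j * wUp p ρ i := fun ρ => by
    simp only [wUp_eq, Pi.smul_apply, smul_eq_mul]
    ring
  have h2 : ∀ ρ, (uc p i * wc p ρ j + uc p j * wc p ρ i) * sUp p ρ
      = (uc p j * wc p ρ i + uc p i * wc p ρ j) * sUp p ρ := fun ρ => by ring
  simp only [gUU]
  rw [kd_comm i j, mul_comm (uc p i) (uc p j), Finset.sum_congr rfl fun ρ _ => h1 ρ,
    Finset.sum_congr rfl fun ρ _ => h2 ρ]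

theorem isSymm_higgsMetric (Λ : ℝ) (c : MetricLabel → ℝ → ℝ) : (higgsMetric Λ c p).IsSymm := by
  ext I J
  rw [Matrix.transpose_apply]
  rcases I with μ | i | ⟨μ, i⟩ <;> rcases J with ν | j | ⟨ν, j⟩ <;>
    simp only [higgsMetric, Matrix.of_apply]
  · rw [gXX_comm]
  · rw [gUU_comm]
  · rw [add_comm]
  · rw [add_comm]
  · simp only [gDD]
    rw [mink_comm, kd_comm, mul_comm (uc p i)]

theorem isInvariantJetMetric_higgsMetric (Λ : ℝ) {c : MetricLabel → ℝ → ℝ}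
    (hc : SmoothCoeffs c) : IsInvariantJetMetric (higgsMetric Λ c) where
  smooth := contDiff_higgsMetric Λ hc
  symm p := isSymm_higgsMetric p Λ c
  invariant O hO M hM a := by
    funext p
    rw [pullbackJ_prolong_higgsMetric a hO hM Λ c]
  atMostFour p I J := atMostFour_higgsMetric p Λ c I J

end dilate

/-! ### Integration by parts -/

/-- A local function together with its total derivatives. -/
structure HasTotal (L : Lagrangian) (D : Fin 4 → Lagrangian) : Prop where
  isLocal : IsLocalFn L
  pd_eq : ∀ φ, ContDiff ℝ ∞ φ → ∀ x μ, pd μ (L φ) x = D μ φ x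

theorem HasTotal.mul {L L' : Lagrangian} {D D' : Fin 4 → Lagrangian} (h : HasTotal L D)
    (h' : HasTotal L' D') : HasTotal (fun φ x => L φ x * L' φ x)
      (fun μ φ x => D μ φ x * L' φ x + L φ x * D' μ φ x) where
  isLocal := h.isLocal.mul h'.isLocal
  pd_eq φ hφ x μ := by
    rw [pd_mul (h.isLocal.contDiff hφ) (h'.isLocal.contDiff hφ), h.pd_eq φ hφ, h'.pd_eq φ hφ]

theorem HasTotal.dot {v w : (Spacetime → FieldSpace) → Spacetime → FieldSpace}
    (hv : IsLocalVec v) (hw : IsLocalVec w) :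
    HasTotal (fun φ x => v φ x ⬝ᵥ w φ x)
      (fun μ φ x => pdv μ (v φ) x ⬝ᵥ w φ x + v φ x ⬝ᵥ pdv μ (w φ) x) where
  isLocal := IsLocalFn.dot hv hw
  pd_eq φ hφ x μ := by
    rw [pd_dot (contDiff_pi.2 fun i => (hv i).contDiff hφ)
      (contDiff_pi.2 fun i => (hw i).contDiff hφ)]

theorem HasTotal.coeff {e : ℝ → ℝ} (he : ContDiffOn ℝ ∞ e (Ici 0)) (Λ : ℝ) :
    HasTotal (fun φ x => e (tt φ x Λ))
      (fun μ φ x => dt e (tt φ x Λ) * (2 * (d1 φ x μ ⬝ᵥ φ x) / Λ ^ 2)) where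
  isLocal := isLocalFn_coeff he Λ
  pd_eq _ hφ x μ := pd_coeff he Λ hφ x μ

theorem hasTotal_d1_field (ν : Fin 4) : HasTotal (fun φ x => d1 φ x ν ⬝ᵥ φ x)
    (fun μ φ x => d2 φ x μ ν ⬝ᵥ φ x + d1 φ x ν ⬝ᵥ d1 φ x μ) :=
  HasTotal.dot (isLocalVec_d1 ν) isLocalVec_field

theorem hasTotal_d1_d1 (ν ρ : Fin 4) : HasTotal (fun φ x => d1 φ x ν ⬝ᵥ d1 φ x ρ)
    (fun μ φ x => d2 φ x μ ν ⬝ᵥ d1 φ x ρ + d1 φ x ν ⬝ᵥ d2 φ x μ ρ) :=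
  HasTotal.dot (isLocalVec_d1 ν) (isLocalVec_d1 ρ)

theorem hasTotal_d2_field (ν ρ : Fin 4) : HasTotal (fun φ x => d2 φ x ν ρ ⬝ᵥ φ x)
    (fun μ φ x => d3 φ x μ ν ρ ⬝ᵥ φ x + d2 φ x ν ρ ⬝ᵥ d1 φ x μ) :=
  HasTotal.dot (isLocalVec_d2 ν ρ) isLocalVec_field

theorem hasTotal_d2_d1 (ν ρ σ : Fin 4) : HasTotal (fun φ x => d2 φ x ν ρ ⬝ᵥ d1 φ x σ)
    (fun μ φ x => d3 φ x μ ν ρ ⬝ᵥ d1 φ x σ + d2 φ x ν ρ ⬝ᵥ d2 φ x μ σ) :=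
  HasTotal.dot (isLocalVec_d2 ν ρ) (isLocalVec_d1 σ)

theorem hasTotal_d3_field (ν ρ σ : Fin 4) : HasTotal (fun φ x => d3 φ x ν ρ σ ⬝ᵥ φ x)
    (fun μ φ x => d4 φ x μ ν ρ σ ⬝ᵥ φ x + d3 φ x ν ρ σ ⬝ᵥ d1 φ x μ) :=
  HasTotal.dot (isLocalVec_d3 ν ρ σ) isLocalVec_field

/-- Contraction `F_{μν} η^{μμ} η^{νν}` of a doubly indexed quantity. -/
def dsum (F : Fin 4 → Fin 4 → ℝ) : ℝ := ∑ μ, ∑ ν, et μ * et ν * F μ ν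

theorem dsum_swap (F : Fin 4 → Fin 4 → ℝ) : dsum F = dsum fun μ ν => F ν μ := by
  unfold dsum
  rw [Finset.sum_comm]
  exact Finset.sum_congr rfl fun _ _ => Finset.sum_congr rfl fun _ _ => by ring

theorem dsum_congr {F G : Fin 4 → Fin 4 → ℝ} (h : ∀ μ ν, F μ ν = G μ ν) : dsum F = dsum G := by
  rw [show F = G from funext fun μ => funext fun ν => h μ ν]

theorem isTotalDerivative_dsum {K : Fin 4 → Fin 4 → Lagrangian}
    {D : Fin 4 → Fin 4 → Fin 4 → Lagrangian} (h : ∀ μ ν, HasTotal (K μ ν) (D μ ν)) :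
    IsTotalDerivative (fun φ x => dsum fun μ ν => D μ ν μ φ x) := by
  have hl : ∀ μ ν, IsLocalFn (fun φ x => et μ * et ν * K μ ν φ x) := fun μ ν =>
    (IsLocalFn.const _).mul (h μ ν).isLocal
  refine isTotalDerivative_of_local (fun μ φ x => ∑ ν, et μ * et ν * K μ ν φ x)
    (fun μ => IsLocalFn.sum fun ν => hl μ ν) fun φ hφ x => ?_
  unfold dsum
  refine Finset.sum_congr rfl fun μ _ => ?_
  rw [pd_sum fun ν => (hl μ ν).contDiff hφ]
  refine Finset.sum_congr rfl fun ν _ => ?_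
  rw [pd_const_mul _ ((h μ ν).isLocal.contDiff hφ), (h μ ν).pd_eq φ hφ]

theorem isTotalDerivative_sum {K : Fin 4 → Lagrangian}
    {D : Fin 4 → Fin 4 → Lagrangian} (h : ∀ μ, HasTotal (K μ) (D μ)) :
    IsTotalDerivative (fun φ x => ∑ μ, et μ * D μ μ φ x) := by
  have hl : ∀ μ, IsLocalFn (fun φ x => et μ * K μ φ x) := fun μ =>
    (IsLocalFn.const _).mul (h μ).isLocal
  refine isTotalDerivative_of_local (fun μ φ x => et μ * K μ φ x) hl fun φ hφ x => ?_
  refine Finset.sum_congr rfl fun μ _ => ?_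
  rw [pd_const_mul _ ((h μ).isLocal.contDiff hφ), (h μ).pd_eq φ hφ]

section ops

variable (φ : Spacetime → FieldSpace) (x : Spacetime)

/-- `□²φ·φ`. -/
def opBoxBox : ℝ := dsum fun μ ν => d4 φ x μ μ ν ν ⬝ᵥ φ x

/-- `∂_μ□φ·∂^μφ`. -/
def opGradBox : ℝ := dsum fun μ ν => d3 φ x μ ν ν ⬝ᵥ d1 φ x μ

/-- `(∂_μ□φ·φ)(∂^μφ·φ)`. -/
def opGradBoxField : ℝ := dsum fun μ ν => (d3 φ x μ ν ν ⬝ᵥ φ x) * (d1 φ x μ ⬝ᵥ φ x)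

/-- `□φ·□φ`. -/
def opBoxSq : ℝ := dsum fun μ ν => d2 φ x μ μ ⬝ᵥ d2 φ x ν ν

theorem opA_sum : opA φ x = ∑ μ, et μ * (d1 φ x μ ⬝ᵥ d1 φ x μ) := by
  rw [opA_eq, ww_eq]; rfl

theorem opB_sum : opB φ x = ∑ μ, et μ * (d1 φ x μ ⬝ᵥ φ x) ^ 2 := by
  rw [opB_eq, ss_eq, mdot]
  refine Finset.sum_congr rfl fun μ _ => ?_
  rw [dotProduct_comm (d1 φ x μ)]
  change et μ * (sDn (j1 φ x) μ * sDn (j1 φ x) μ) = et μ * sDn (j1 φ x) μ ^ 2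
  ring

theorem op3_eq' {φ : Spacetime → FieldSpace} (hφ : ContDiff ℝ ∞ φ) :
    op3 φ x = dsum fun μ ν => (d2 φ x μ ν ⬝ᵥ d1 φ x ν) * (d1 φ x μ ⬝ᵥ φ x) := by
  rw [dsum_swap, op3_eq]
  exact dsum_congr fun μ ν => by rw [d2_comm hφ x ν μ]

theorem op21_eq' : op21 φ x = dsum fun μ ν =>
    (d2 φ x ν ν ⬝ᵥ d1 φ x μ) * (d1 φ x μ ⬝ᵥ φ x) := by
  rw [dsum_swap, op21_eq]; rfl

theorem opGradBox_eq {φ : Spacetime → FieldSpace} (hφ : ContDiff ℝ ∞ φ) :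
    opGradBox φ x = dsum fun μ ν => d3 φ x μ μ ν ⬝ᵥ d1 φ x ν := by
  rw [dsum_swap, opGradBox]
  exact dsum_congr fun μ ν => by rw [(d3_comm_left hφ x μ ν ν).trans (d3_comm_right hφ x ν μ ν)]

theorem opGradBoxField_eq {φ : Spacetime → FieldSpace} (hφ : ContDiff ℝ ∞ φ) :
    opGradBoxField φ x = dsum fun μ ν => (d3 φ x μ μ ν ⬝ᵥ φ x) * (d1 φ x ν ⬝ᵥ φ x) := by
  rw [dsum_swap, opGradBoxField]
  exact dsum_congr fun μ ν => by rw [(d3_comm_left hφ x μ ν ν).trans (d3_comm_right hφ x ν μ ν)]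

end ops

variable {e : ℝ → ℝ}

theorem ibp_opE (he : ContDiffOn ℝ ∞ e (Ici 0)) (Λ : ℝ) :
    IBPEquiv (fun φ x => opE φ x * e (tt φ x Λ))
      (fun φ x => - opA φ x * e (tt φ x Λ) - 2 * opB φ x / Λ ^ 2 * dt e (tt φ x Λ)) := by
  refine (isTotalDerivative_sum fun μ =>
    (hasTotal_d1_field μ).mul (HasTotal.coeff he Λ)).congr fun φ hφ x => ?_
  simp only [opE_eq, opA_sum, opB_sum, Fin.sum_univ_four]
  ring

theorem ibp_op20 (he : ContDiffOn ℝ ∞ e (Ici 0)) (Λ : ℝ) :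
    IBPEquiv (fun φ x => op20 φ x * e (tt φ x Λ))
      (fun φ x => - op5 φ x * e (tt φ x Λ) - 2 * op3 φ x * e (tt φ x Λ)
        - 2 * op8 φ x / Λ ^ 2 * dt e (tt φ x Λ)) := by
  refine (isTotalDerivative_dsum fun μ ν =>
    ((hasTotal_d1_field μ).mul (hasTotal_d1_d1 ν ν)).mul (HasTotal.coeff he Λ)).congr
    fun φ hφ x => ?_
  have hc : ∀ μ ν, d1 φ x ν ⬝ᵥ d2 φ x μ ν = d2 φ x μ ν ⬝ᵥ d1 φ x ν :=
    fun μ ν => dotProduct_comm _ _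
  simp only [op20, op5, op8, op3_eq' x hφ, opE_eq, opA_sum, opB_sum, dsum, hc, Fin.sum_univ_four]
  ring

theorem ibp_op21 (he : ContDiffOn ℝ ∞ e (Ici 0)) (Λ : ℝ) :
    IBPEquiv (fun φ x => op21 φ x * e (tt φ x Λ))
      (fun φ x => - op3 φ x * e (tt φ x Λ) - op4 φ x * e (tt φ x Λ)
        - op6 φ x * e (tt φ x Λ) - 2 * op9 φ x / Λ ^ 2 * dt e (tt φ x Λ)) := by
  refine (isTotalDerivative_dsum fun μ ν =>
    ((hasTotal_d1_d1 μ ν).mul (hasTotal_d1_field ν)).mul (HasTotal.coeff he Λ)).congr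
    fun φ hφ x => ?_
  have hc : ∀ μ ν, d1 φ x μ ⬝ᵥ d2 φ x μ ν = d2 φ x μ ν ⬝ᵥ d1 φ x μ :=
    fun μ ν => dotProduct_comm _ _
  have hg : ∀ μ ν, d1 φ x ν ⬝ᵥ d1 φ x μ = d1 φ x μ ⬝ᵥ d1 φ x ν := fun μ ν => dotProduct_comm _ _
  simp only [op21_eq, op3_eq, op4_eq, op6_eq, op9_eq, dsum, hc, Fin.sum_univ_four,
    hg 0 1, hg 0 2, hg 0 3, hg 1 2, hg 1 3, hg 2 3]
  ring

theorem ibp_op22 (he : ContDiffOn ℝ ∞ e (Ici 0)) (Λ : ℝ) :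
    IBPEquiv (fun φ x => op22 φ x * e (tt φ x Λ))
      (fun φ x => - op8 φ x * e (tt φ x Λ) - 2 * op7 φ x * e (tt φ x Λ)
        - 2 * op9 φ x * e (tt φ x Λ) - 2 * op10 φ x / Λ ^ 2 * dt e (tt φ x Λ)) := by
  refine (isTotalDerivative_dsum fun μ ν =>
    ((hasTotal_d1_field μ).mul ((hasTotal_d1_field ν).mul (hasTotal_d1_field ν))).mul
      (HasTotal.coeff he Λ)).congr fun φ hφ x => ?_
  have hg : ∀ μ ν, d1 φ x ν ⬝ᵥ d1 φ x μ = d1 φ x μ ⬝ᵥ d1 φ x ν := fun μ ν => dotProduct_comm _ _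
  simp only [op22, op8, op10, op7_eq, op9_eq, opE_eq, opA_sum, opB_sum, dsum, Fin.sum_univ_four,
    hg 0 1, hg 0 2, hg 0 3, hg 1 2, hg 1 3, hg 2 3]
  ring

theorem ibp_opBoxBox (he : ContDiffOn ℝ ∞ e (Ici 0)) (Λ : ℝ) :
    IBPEquiv (fun φ x => opBoxBox φ x * e (tt φ x Λ))
      (fun φ x => - opGradBox φ x * e (tt φ x Λ)
        - 2 * opGradBoxField φ x / Λ ^ 2 * dt e (tt φ x Λ)) := by
  refine (isTotalDerivative_dsum fun μ ν =>
    (hasTotal_d3_field μ ν ν).mul (HasTotal.coeff he Λ)).congr fun φ hφ x => ?_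
  simp only [opBoxBox, opGradBox, opGradBoxField, dsum, Fin.sum_univ_four]
  ring

theorem ibp_opGradBox (he : ContDiffOn ℝ ∞ e (Ici 0)) (Λ : ℝ) :
    IBPEquiv (fun φ x => opGradBox φ x * e (tt φ x Λ))
      (fun φ x => - op1 φ x * e (tt φ x Λ) - 2 * op3 φ x / Λ ^ 2 * dt e (tt φ x Λ)) := by
  refine (isTotalDerivative_dsum fun μ ν =>
    (hasTotal_d2_d1 μ ν ν).mul (HasTotal.coeff he Λ)).congr fun φ hφ x => ?_
  simp only [opGradBox_eq x hφ, op1_eq, op3_eq' x hφ, dsum, Fin.sum_univ_four]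
  ring

theorem ibp_opBoxSq (he : ContDiffOn ℝ ∞ e (Ici 0)) (Λ : ℝ) :
    IBPEquiv (fun φ x => opBoxSq φ x * e (tt φ x Λ))
      (fun φ x => - opGradBox φ x * e (tt φ x Λ)
        - 2 * op21 φ x / Λ ^ 2 * dt e (tt φ x Λ)) := by
  refine (isTotalDerivative_dsum fun μ ν =>
    (hasTotal_d2_d1 ν ν μ).mul (HasTotal.coeff he Λ)).congr fun φ hφ x => ?_
  have hg : ∀ μ ν, d2 φ x ν ν ⬝ᵥ d2 φ x μ μ = d2 φ x μ μ ⬝ᵥ d2 φ x ν ν :=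
    fun μ ν => dotProduct_comm _ _
  simp only [opGradBox, opBoxSq, op21_eq', dsum, Fin.sum_univ_four,
    hg 0 1, hg 0 2, hg 0 3, hg 1 2, hg 1 3, hg 2 3]
  ring

theorem ibp_opGradBoxField (he : ContDiffOn ℝ ∞ e (Ici 0)) (Λ : ℝ) :
    IBPEquiv (fun φ x => opGradBoxField φ x * e (tt φ x Λ))
      (fun φ x => - op3 φ x * e (tt φ x Λ) - op2 φ x * e (tt φ x Λ) - op4 φ x * e (tt φ x Λ)
        - 2 * op7 φ x / Λ ^ 2 * dt e (tt φ x Λ)) := by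
  refine (isTotalDerivative_dsum fun μ ν =>
    ((hasTotal_d2_field μ ν).mul (hasTotal_d1_field ν)).mul (HasTotal.coeff he Λ)).congr
    fun φ hφ x => ?_
  have hg : ∀ μ ν, d1 φ x ν ⬝ᵥ d1 φ x μ = d1 φ x μ ⬝ᵥ d1 φ x ν := fun μ ν => dotProduct_comm _ _
  simp only [opGradBoxField_eq x hφ, op2_eq, op3_eq, op4_eq, op7_eq, dsum, Fin.sum_univ_four,
    hg 0 1, hg 0 2, hg 0 3, hg 1 2, hg 1 3, hg 2 3]
  ring

theorem ibp_opE_sq (he : ContDiffOn ℝ ∞ e (Ici 0)) (Λ : ℝ) :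
    IBPEquiv (fun φ x => opE φ x ^ 2 * e (tt φ x Λ))
      (fun φ x => - opGradBoxField φ x * e (tt φ x Λ) - op21 φ x * e (tt φ x Λ)
        - op20 φ x * e (tt φ x Λ) - 2 * op22 φ x / Λ ^ 2 * dt e (tt φ x Λ)) := by
  refine (isTotalDerivative_dsum fun μ ν =>
    ((hasTotal_d2_field ν ν).mul (hasTotal_d1_field μ)).mul (HasTotal.coeff he Λ)).congr
    fun φ hφ x => ?_
  simp only [opGradBoxField, op20, op22, op21_eq', opE_eq, opA_sum, opB_sum, dsum,
    Fin.sum_univ_four]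
  ring

/-! ### The reduction to the box-free Lagrangians -/

theorem ContDiffOn.dt (he : ContDiffOn ℝ ∞ e (Ici 0)) : ContDiffOn ℝ ∞ (dt e) (Ici 0) :=
  he.derivWithin (uniqueDiffOn_Ici 0) (by simp)

theorem smoothCoeffs_reducedCoeffs (Λ : ℝ) {c : MetricLabel → ℝ → ℝ} (hc : SmoothCoeffs c) :
    SmoothCoeffs (reducedCoeffs Λ c) := by
  have hd := fun l => ContDiffOn.dt (hc l)
  have hC0 := hc .C0
  intro l
  cases l <;> simp only [reducedCoeffs, sub_eq_add_neg, div_eq_mul_inv]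
  all_goals
    repeat' first
      | exact hc _
      | exact hd _
      | exact contDiffOn_const
      | apply ContDiffOn.add
      | apply ContDiffOn.neg
      | apply ContDiffOn.mul

theorem ibp_jetLagrangian (Λ : ℝ) (hΛ : Λ ≠ 0) {c : MetricLabel → ℝ → ℝ} (hc : SmoothCoeffs c) :
    IBPEquiv (jetLagrangian (higgsMetric Λ c)) (greenLagrangian Λ (reducedCoeffs Λ c)) := by
  refine (((ibp_opE (hc .E) Λ).add (((ibp_op20 (hc .F20) Λ).const_mul (1 / Λ ^ 4)).add
    (((ibp_op21 (hc .F21) Λ).const_mul (1 / Λ ^ 4)).add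
      ((ibp_op22 (hc .F22) Λ).const_mul (1 / Λ ^ 6)))))).congr fun φ hφ x => ?_
  rw [jetLagrangian_higgsMetric Λ c x hΛ hφ]
  simp only [pulledBackForm, greenLagrangian, reducedCoeffs]
  field_simp
  ring

/-! ### Lagrangians of invariant metrics -/

theorem contDiff_affine (M : Matrix (Fin 4) (Fin 4) ℝ) (a : Spacetime) :
    ContDiff ℝ ∞ (fun y : Spacetime => M *ᵥ y + a) :=
  (Matrix.mulVecLin M).toContinuousLinearMap.contDiff.add contDiff_const

theorem pdv_affine {f : Spacetime → FieldSpace} (hf : ContDiff ℝ ∞ f)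
    (M : Matrix (Fin 4) (Fin 4) ℝ) (a : Spacetime) (μ : Fin 4) (x : Spacetime) :
    pdv μ (fun y => f (M *ᵥ y + a)) x = ∑ ν, M ν μ • pdv ν f (M *ᵥ x + a) := by
  have hM : HasFDerivAt (fun y : Spacetime => M *ᵥ y + a)
      (Matrix.mulVecLin M).toContinuousLinearMap x :=
    (Matrix.mulVecLin M).toContinuousLinearMap.hasFDerivAt.add_const a
  funext i
  have hi := ((contDiff_comp_apply hf i).differentiable (by simp) (M *ᵥ x + a)).hasFDerivAt
  have h := hi.comp x hM
  simp only [pdv, pd, Finset.sum_apply, Pi.smul_apply, smul_eq_mul]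
  rw [show (fun y => f (M *ᵥ y + a) i) = (fun y => f y i) ∘ fun y => M *ᵥ y + a from rfl, h.fderiv,
    ContinuousLinearMap.comp_apply]
  have : (Matrix.mulVecLin M).toContinuousLinearMap (Pi.single μ 1)
      = ∑ ν, M ν μ • (Pi.single ν (1 : ℝ) : Spacetime) := by
    change M *ᵥ Pi.single μ 1 = _
    rw [Matrix.mulVec_single_one]
    funext ν
    simp [Finset.sum_apply, Pi.single_apply, Matrix.col_apply]
  rw [this, map_sum]
  exact Finset.sum_congr rfl fun ν _ => by rw [map_smul, smul_eq_mul]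

theorem contDiff_mulVec (O : Matrix (Fin 4) (Fin 4) ℝ) {f : Spacetime → FieldSpace}
    (hf : ContDiff ℝ ∞ f) : ContDiff ℝ ∞ (fun y => O *ᵥ f y) :=
  (Matrix.mulVecLin O).toContinuousLinearMap.contDiff.comp hf

theorem pdv_mulVec {f : Spacetime → FieldSpace} (hf : ContDiff ℝ ∞ f)
    (O : Matrix (Fin 4) (Fin 4) ℝ) (μ : Fin 4) (x : Spacetime) :
    pdv μ (fun y => O *ᵥ f y) x = O *ᵥ pdv μ f x := by
  funext i
  simp only [pdv, Matrix.mulVec, dotProduct]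
  rw [pd_sum fun j => contDiff_const.mul (contDiff_comp_apply hf j)]
  exact Finset.sum_congr rfl fun j _ => pd_const_mul _ (contDiff_comp_apply hf j)

theorem pdv_sum_smul {f : Fin 4 → Spacetime → FieldSpace} (hf : ∀ ν, ContDiff ℝ ∞ (f ν))
    (c : Fin 4 → ℝ) (μ : Fin 4) (x : Spacetime) :
    pdv μ (fun y => ∑ ν, c ν • f ν y) x = ∑ ν, c ν • pdv μ (f ν) x := by
  funext i
  simp only [pdv, Finset.sum_apply, Pi.smul_apply, smul_eq_mul]
  rw [pd_sum fun j => contDiff_const.mul (contDiff_comp_apply (hf j) i)]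
  exact Finset.sum_congr rfl fun j _ => pd_const_mul _ (contDiff_comp_apply (hf j) i)

section affine

variable (M : Matrix (Fin 4) (Fin 4) ℝ) (a x : Spacetime)

theorem contDiff_comp_affine {φ : Spacetime → FieldSpace} (hφ : ContDiff ℝ ∞ φ) :
    ContDiff ℝ ∞ (fun y => φ (M *ᵥ y + a)) := hφ.comp (contDiff_affine M a)

theorem d1_affine {φ : Spacetime → FieldSpace} (hφ : ContDiff ℝ ∞ φ) (μ : Fin 4) :
    d1 (fun y => φ (M *ᵥ y + a)) x μ = ∑ ν, M ν μ • d1 φ (M *ᵥ x + a) ν :=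
  pdv_affine hφ M a μ x

theorem d2_affine {φ : Spacetime → FieldSpace} (hφ : ContDiff ℝ ∞ φ) (μ ν : Fin 4) :
    d2 (fun y => φ (M *ᵥ y + a)) x μ ν
      = ∑ α, ∑ β, (M α μ * M β ν) • d2 φ (M *ᵥ x + a) α β := by
  change pdv μ (fun y => d1 (fun y => φ (M *ᵥ y + a)) y ν) x = _
  rw [show (fun y => d1 (fun y => φ (M *ᵥ y + a)) y ν)
    = fun y => ∑ β, M β ν • (fun z => d1 φ (M *ᵥ z + a) β) y from
    funext fun y => d1_affine M a y hφ ν,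
    pdv_sum_smul (fun β => contDiff_comp_affine M a (contDiff_d1 hφ β)), Finset.sum_comm]
  refine Finset.sum_congr rfl fun β _ => ?_
  rw [pdv_affine (contDiff_d1 hφ β), Finset.smul_sum]
  refine Finset.sum_congr rfl fun α _ => ?_
  rw [smul_smul, mul_comm]
  rfl

theorem d1_mulVec {φ : Spacetime → FieldSpace} (hφ : ContDiff ℝ ∞ φ)
    (O : Matrix (Fin 4) (Fin 4) ℝ) (μ : Fin 4) :
    d1 (fun y => O *ᵥ φ y) x μ = O *ᵥ d1 φ x μ := pdv_mulVec hφ O μ x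

theorem d2_mulVec {φ : Spacetime → FieldSpace} (hφ : ContDiff ℝ ∞ φ)
    (O : Matrix (Fin 4) (Fin 4) ℝ) (μ ν : Fin 4) :
    d2 (fun y => O *ᵥ φ y) x μ ν = O *ᵥ d2 φ x μ ν := by
  change pdv μ (fun y => d1 (fun y => O *ᵥ φ y) y ν) x = _
  rw [show (fun y => d1 (fun y => O *ᵥ φ y) y ν) = fun y => O *ᵥ d1 φ y ν from
    funext fun y => d1_mulVec y hφ O ν, pdv_mulVec (contDiff_d1 hφ ν)]
  rfl

end affine

theorem IsLocalFn.comp {ι : Type*} [Fintype ι] {F : (ι → ℝ) → ℝ} (hF : ContDiff ℝ ∞ F)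
    {K : ι → Lagrangian} (hK : ∀ i, IsLocalFn (K i)) :
    IsLocalFn (fun φ x => F fun i => K i φ x) := by
  choose r l hl hL using hK
  have hr : ∀ i, r i ≤ ∑ j, r j := fun i =>
    Finset.single_le_sum (f := r) (fun _ _ => Nat.zero_le _) (Finset.mem_univ i)
  refine ⟨∑ j, r j, fun j => F fun i => l i (jetRestrict (hr i) j), ?_, fun φ hφ x => ?_⟩
  · exact hF.comp (contDiff_pi.2 fun i => (hl i).comp (jetRestrict _).contDiff)
  · simp only [jetRestrict_jet, hL _ φ hφ]

/-- The bilinear form of a matrix of components, bundled. -/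
def tformBilin (g : Matrix JetIdx JetIdx ℝ) : J1 →ₗ[ℝ] J1 →ₗ[ℝ] ℝ :=
  LinearMap.mk₂ ℝ (tform g)
    (fun X X' Y => by
      simp only [tform, Pi.add_apply, mul_add, add_mul, Finset.sum_add_distrib])
    (fun c X Y => by
      simp only [tform, Pi.smul_apply, smul_eq_mul, Finset.mul_sum]
      exact Finset.sum_congr rfl fun _ _ => Finset.sum_congr rfl fun _ _ => by ring)
    (fun X Y Y' => by
      simp only [tform, Pi.add_apply, mul_add, add_mul, Finset.sum_add_distrib])
    (fun c X Y => by
      simp only [tform, Pi.smul_apply, smul_eq_mul, Finset.mul_sum]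
      exact Finset.sum_congr rfl fun _ _ => Finset.sum_congr rfl fun _ _ => by ring)

theorem tformBilin_apply (g : Matrix JetIdx JetIdx ℝ) (X Y : J1) :
    tformBilin g X Y = tform g X Y := rfl

theorem tform_sum_smul (g : Matrix JetIdx JetIdx ℝ) (c d : Fin 4 → ℝ) (X Y : Fin 4 → J1) :
    tform g (∑ α, c α • X α) (∑ β, d β • Y β) = ∑ α, ∑ β, c α * d β * tform g (X α) (Y β) := by
  rw [← tformBilin_apply]
  simp only [map_sum, map_smul, LinearMap.sum_apply, LinearMap.smul_apply, smul_eq_mul,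
    tformBilin_apply, Finset.mul_sum]
  rw [Finset.sum_comm]
  exact Finset.sum_congr rfl fun _ _ => Finset.sum_congr rfl fun _ _ => by ring

theorem isLorentz_one : IsLorentz 1 := by simp [IsLorentz]

namespace IsInvariantJetMetric

variable {g : JetTensor}

theorem tform_prolong (hg : IsInvariantJetMetric g) {O M : Matrix (Fin 4) (Fin 4) ℝ}
    (hO : O ∈ Matrix.orthogonalGroup (Fin 4) ℝ) (hM : IsLorentz M) (a : Spacetime) (p X Y : J1) :
    tform (g (prolong O M a p)) (prolong O M 0 X) (prolong O M 0 Y) = tform (g p) X Y := by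
  have h : (tformBilin (g (prolong O M a p))).compl₁₂ (prolongLin O M).toLinearMap
      (prolongLin O M).toLinearMap = tformBilin (g p) := by
    refine LinearMap.ext_basis (Pi.basisFun ℝ JetIdx) (Pi.basisFun ℝ JetIdx) fun I J => ?_
    have := congrFun (congrFun (congrFun (hg.invariant O hO M hM a) p) I) J
    rw [pullbackJ_apply, fderiv_prolong, fderiv_prolong] at this
    simp only [Pi.basisFun_apply]
    refine this.trans ?_
    change _ = tform (g p) _ _
    simp [tform, Pi.single_apply]
  exact LinearMap.congr_fun (LinearMap.congr_fun h X) Y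

theorem apply_mkJ1 (hg : IsInvariantJetMetric g) (p : J1) : g p = g (mkJ1 0 (uc p) (wc p)) := by
  have h1 : prolong 1 1 (-xc p) p = mkJ1 0 (uc p) (wc p) := by
    funext I
    rcases I with μ | i | ⟨μ, i⟩ <;>
      simp [prolong, mkJ1, Matrix.one_apply, Finset.sum_apply, Matrix.one_mulVec]
  have h2 : ∀ X : J1, prolong 1 1 0 X = X := fun X => by
    funext I
    rcases I with μ | i | ⟨μ, i⟩ <;>
      simp [prolong, mkJ1, Matrix.one_apply, Finset.sum_apply, Matrix.one_mulVec, xc, uc, wc]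
  ext I J
  have := hg.tform_prolong (one_mem _) isLorentz_one (-xc p) p (Pi.single I 1) (Pi.single J 1)
  rw [h1, h2, h2] at this
  simpa [tform, Pi.single_apply] using this.symm

theorem internal (hg : IsInvariantJetMetric g) {O : Matrix (Fin 4) (Fin 4) ℝ} (hO : O ∈ Matrix.orthogonalGroup (Fin 4) ℝ)
    {φ : Spacetime → FieldSpace} (hφ : ContDiff ℝ ∞ φ) (x : Spacetime) :
    jetLagrangian g (fun y => O *ᵥ φ y) x = jetLagrangian g φ x := by
  have h1 : j1 (fun y => O *ᵥ φ y) x = prolong O 1 0 (j1 φ x) := by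
    funext I
    rcases I with μ | i | ⟨μ, i⟩
    · simp [prolong, mkJ1, j1, xc]
    · simp [prolong, mkJ1, j1]; rfl
    · simp [prolong, mkJ1, j1, d1_mulVec x hφ, Matrix.one_apply]; rfl
  have h2 : ∀ ρ, tangent (fun y => O *ᵥ φ y) x ρ = prolong O 1 0 (tangent φ x ρ) := fun ρ => by
    funext I
    rcases I with μ | i | ⟨μ, i⟩
    · change xc (tangent _ x ρ) μ = (1 *ᵥ xc (tangent φ x ρ) + 0) μ
      simp [xc_tangent, Matrix.one_apply, Pi.single_apply]
    · change uc (tangent _ x ρ) i = (O *ᵥ uc (tangent φ x ρ)) i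
      rw [uc_tangent, uc_tangent, d1_mulVec x hφ]
    · change wc (tangent _ x ρ) μ i
        = (O *ᵥ ∑ ν, (1 : Matrix (Fin 4) (Fin 4) ℝ)⁻¹ ν μ • wc (tangent φ x ρ) ν) i
      rw [wc_tangent, wc_tangent, d2_mulVec x hφ]
      simp [Matrix.one_apply]
  simp only [jetLagrangian_eq, h1, h2, hg.tform_prolong hO isLorentz_one]

theorem poincare (hg : IsInvariantJetMetric g) {M : Matrix (Fin 4) (Fin 4) ℝ} (hM : IsLorentz M) (a : Spacetime)
    {φ : Spacetime → FieldSpace} (hφ : ContDiff ℝ ∞ φ) (x : Spacetime) :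
    jetLagrangian g (fun y => φ (M *ᵥ y + a)) x = jetLagrangian g φ (M *ᵥ x + a) := by
  have hinv : ∀ α μ, ∑ ν, M⁻¹ ν μ * M α ν = if α = μ then 1 else 0 := fun α μ => by
    have := congrFun (congrFun hM.mul_inv α) μ
    rw [Matrix.mul_apply, Matrix.one_apply] at this
    rw [← this]
    exact Finset.sum_congr rfl fun _ _ => mul_comm _ _
  have h1 : prolong 1 M a (j1 (fun y => φ (M *ᵥ y + a)) x) = j1 φ (M *ᵥ x + a) := by
    funext I
    rcases I with μ | i | ⟨μ, i⟩
    · rfl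
    · change ((1 : Matrix (Fin 4) (Fin 4) ℝ) *ᵥ φ (M *ᵥ x + a)) i = φ (M *ᵥ x + a) i
      rw [Matrix.one_mulVec]
    · change ((1 : Matrix (Fin 4) (Fin 4) ℝ) *ᵥ ∑ ν, M⁻¹ ν μ • d1 _ x ν) i = d1 φ (M *ᵥ x + a) μ i
      simp only [Matrix.one_mulVec, d1_affine M a x hφ, Finset.smul_sum, smul_smul]
      rw [Finset.sum_comm]
      simp only [← Finset.sum_smul, hinv, ite_smul, one_smul, zero_smul, Finset.sum_ite_eq',
        Finset.mem_univ, if_true]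
  have h2 : ∀ ρ, prolong 1 M 0 (tangent (fun y => φ (M *ᵥ y + a)) x ρ)
      = ∑ α, M α ρ • tangent φ (M *ᵥ x + a) α := fun ρ => by
    funext I
    simp only [Finset.sum_apply, Pi.smul_apply, smul_eq_mul]
    rcases I with μ | i | ⟨μ, i⟩
    · change (M *ᵥ xc (tangent _ x ρ) + 0) μ = ∑ α, M α ρ * xc (tangent φ (M *ᵥ x + a) α) μ
      simp [xc_tangent, Pi.single_apply, Matrix.col_apply]
    · change ((1 : Matrix (Fin 4) (Fin 4) ℝ) *ᵥ d1 _ x ρ) i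
        = ∑ α, M α ρ * d1 φ (M *ᵥ x + a) α i
      simp [Matrix.one_mulVec, d1_affine M a x hφ, Finset.sum_apply]
    · change ((1 : Matrix (Fin 4) (Fin 4) ℝ) *ᵥ ∑ ν, M⁻¹ ν μ • d2 _ x ρ ν) i
        = ∑ α, M α ρ * d2 φ (M *ᵥ x + a) α μ i
      simp only [Matrix.one_mulVec, d2_affine M a x hφ, Finset.smul_sum, smul_smul]
      rw [Finset.sum_comm, Finset.sum_apply]
      refine Finset.sum_congr rfl fun α _ => ?_
      rw [Finset.sum_comm]
      have : ∀ β, ∑ ν, (M⁻¹ ν μ * (M α ρ * M β ν)) • d2 φ (M *ᵥ x + a) α β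
          = if β = μ then M α ρ • d2 φ (M *ᵥ x + a) α β else 0 := fun β => by
        rw [← Finset.sum_smul, show ∑ ν, M⁻¹ ν μ * (M α ρ * M β ν)
          = M α ρ * ∑ ν, M⁻¹ ν μ * M β ν by
            rw [Finset.mul_sum]; exact Finset.sum_congr rfl fun _ _ => by ring, hinv]
        split_ifs <;> simp
      simp only [this, Finset.sum_ite_eq', Finset.mem_univ, if_true, Pi.smul_apply, smul_eq_mul]
  simp only [jetLagrangian_eq]
  congr 1
  rw [← sum_contract hM fun α β => tform (g (j1 φ (M *ᵥ x + a))) (tangent φ (M *ᵥ x + a) α)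
    (tangent φ (M *ᵥ x + a) β)]
  refine Finset.sum_congr rfl fun ρ _ => ?_
  rw [← hg.tform_prolong (one_mem _) hM a, h1, h2, tform_sum_smul]

theorem isLocalFn (hg : IsInvariantJetMetric g) : IsLocalFn (jetLagrangian g) := by
  have h0 : ∀ φ x, j1 φ x = mkJ1 x (φ x) (d1 φ x) := fun _ _ => rfl
  let K : JetIdx → Lagrangian := fun I φ x => mkJ1 0 (φ x) (d1 φ x) I
  have hK : ∀ I, IsLocalFn (K I) := fun I => by
    rcases I with μ | i | ⟨μ, i⟩
    · exact IsLocalFn.const 0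
    · exact IsLocalFn.field i
    · exact IsLocalFn.d1 μ i
  have hT : ∀ ρ I, IsLocalFn (fun φ x => tangent φ x ρ I) := fun ρ I => by
    rcases I with μ | i | ⟨μ, i⟩
    · refine (IsLocalFn.const ((Pi.single ρ 1 : Spacetime) μ)).congr fun φ _ x => ?_
      rw [← xc_tangent φ x ρ]; rfl
    · exact IsLocalFn.d1 ρ i
    · exact IsLocalFn.d2 ρ μ i
  have : IsLocalFn (fun φ x => (1 / 2) * ∑ ρ, et ρ * ∑ I, ∑ J,
      g (fun L => K L φ x) I J * tangent φ x ρ I * tangent φ x ρ J) :=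
    (IsLocalFn.const _).mul (IsLocalFn.sum fun ρ => (IsLocalFn.const _).mul
      (IsLocalFn.sum fun I => IsLocalFn.sum fun J =>
        ((IsLocalFn.comp (hg.smooth I J) hK).mul (hT ρ I)).mul (hT ρ J)))
  refine this.congr fun φ _ x => ?_
  rw [jetLagrangian_eq, hg.apply_mkJ1]
  rfl

theorem atMostFour_jetLagrangian (hg : IsInvariantJetMetric g) {φ : Spacetime → FieldSpace} (hφ : ContDiff ℝ ∞ φ)
    (x : Spacetime) : ∃ q : Polynomial ℝ, q.natDegree ≤ 4 ∧
      ∀ s : ℝ, jetLagrangian g (fun y => φ (x + s • (y - x))) x = q.eval s := by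
  choose q hq hq' using hg.atMostFour (j1 φ x)
  have hfun : ∀ s : ℝ, (fun y => φ (x + s • (y - x)))
      = fun y => φ ((s • (1 : Matrix (Fin 4) (Fin 4) ℝ)) *ᵥ y + (x - s • x)) := fun s => by
    funext y
    rw [Matrix.smul_mulVec, Matrix.one_mulVec, smul_sub]
    congr 1
    abel
  have hx : ∀ s : ℝ, (s • (1 : Matrix (Fin 4) (Fin 4) ℝ)) *ᵥ x + (x - s • x) = x := fun s => by
    rw [Matrix.smul_mulVec, Matrix.one_mulVec]; abel
  have hd1 : ∀ (s : ℝ) μ, d1 (fun y => φ (x + s • (y - x))) x μ = s • d1 φ x μ := fun s μ => by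
    rw [hfun, d1_affine _ _ _ hφ, hx]
    simp [Matrix.one_apply]
  have hd2 : ∀ (s : ℝ) μ ν, d2 (fun y => φ (x + s • (y - x))) x μ ν = (s * s) • d2 φ x μ ν :=
    fun s μ ν => by
    rw [hfun, d2_affine _ _ _ hφ, hx]
    simp [Matrix.one_apply]
  have hφx : ∀ s : ℝ, φ (x + s • (x - x)) = φ x := fun s => by simp
  have hT : ∀ (s : ℝ) ρ, tangent (fun y => φ (x + s • (y - x))) x ρ
      = mkJ1 (Pi.single ρ 1) (s • d1 φ x ρ) (fun μ => (s * s) • d2 φ x ρ μ) := fun s ρ => by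
    funext I
    rcases I with μ | i | ⟨μ, i⟩
    · exact congrFun (xc_tangent _ x ρ) μ
    · exact congrFun (hd1 s ρ) i
    · exact congrFun (hd2 s ρ μ) i
  have hL : ∀ s : ℝ, jetLagrangian g (fun y => φ (x + s • (y - x))) x
      = (1 / 2) * ∑ ρ, et ρ * tform (g (mkJ1 0 (φ x) (fun μ => s • d1 φ x μ)))
        (mkJ1 (Pi.single ρ 1) (s • d1 φ x ρ) (fun μ => (s * s) • d2 φ x ρ μ))
        (mkJ1 (Pi.single ρ 1) (s • d1 φ x ρ) (fun μ => (s * s) • d2 φ x ρ μ)) := fun s => by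
    rw [jetLagrangian_eq]
    simp only [hT]
    rw [hg.apply_mkJ1]
    have : mkJ1 0 (uc (j1 (fun y => φ (x + s • (y - x))) x))
        (wc (j1 (fun y => φ (x + s • (y - x))) x))
        = mkJ1 0 (φ x) (fun μ => s • d1 φ x μ) := by
      change mkJ1 0 (φ (x + s • (x - x))) (d1 (fun y => φ (x + s • (y - x))) x) = _
      rw [hφx]
      congr 1
      exact funext (hd1 s)
    rw [this]
  let Q : Polynomial ℝ := ∑ ρ, ∑ I, ∑ J,
    Polynomial.C ((1 / 2) * et ρ * tangent φ x ρ I * tangent φ x ρ J) * q I J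
  refine ⟨Q, ?_, fun s => ?_⟩
  · refine Polynomial.natDegree_sum_le_of_forall_le _ _ fun ρ _ =>
      Polynomial.natDegree_sum_le_of_forall_le _ _ fun I _ =>
      Polynomial.natDegree_sum_le_of_forall_le _ _ fun J _ =>
      (Polynomial.natDegree_C_mul_le _ _).trans (hq I J)
  · have hcont : Continuous fun s : ℝ => jetLagrangian g (fun y => φ (x + s • (y - x))) x := by
      simp only [hL]
      have hm : ∀ {u : ℝ → FieldSpace} {w : ℝ → Fin 4 → FieldSpace} {ξ : Spacetime},
          Continuous u → Continuous w → ∀ I, Continuous fun s => mkJ1 ξ (u s) (w s) I := by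
        intro u w ξ hu hw I
        rcases I with μ | i | ⟨μ, i⟩
        · exact continuous_const
        · exact (continuous_apply i).comp hu
        · exact (continuous_apply i).comp ((continuous_apply μ).comp hw)
      have hg' : ∀ I J, Continuous fun s : ℝ =>
          g (mkJ1 0 (φ x) (fun μ => s • d1 φ x μ)) I J := fun I J =>
        (hg.smooth I J).continuous.comp (continuous_pi (hm continuous_const (by fun_prop)))
      simp only [tform]
      refine continuous_const.mul (continuous_finset_sum _ fun ρ _ => continuous_const.mul
        (continuous_finset_sum _ fun I _ => continuous_finset_sum _ fun J _ =>
          ((hg' I J).mul (hm (by fun_prop) (by fun_prop) I)).mul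
            (hm (by fun_prop) (by fun_prop) J)))
    refine congrFun (hcont.ext_on (dense_compl_singleton (0 : ℝ)) Q.continuous fun s hs => ?_) s
    have hs : s ≠ 0 := hs
    have hdil : ∀ ρ, mkJ1 (Pi.single ρ 1) (s • d1 φ x ρ) (fun μ => (s * s) • d2 φ x ρ μ)
        = s • dilate s (tangent φ x ρ) := fun ρ => by
      funext I
      rcases I with μ | i | ⟨μ, i⟩
      · change (Pi.single ρ 1 : Spacetime) μ = s * (s⁻¹ * xc (tangent φ x ρ) μ)
        rw [xc_tangent, mul_inv_cancel_left₀ hs]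
      · rfl
      · change (s * s) * _ = s * (s * _)
        rw [mul_assoc]; rfl
    have hgd : g (mkJ1 0 (φ x) (fun μ => s • d1 φ x μ)) = g (dilate s (j1 φ x)) :=
      (hg.apply_mkJ1 (dilate s (j1 φ x))).symm
    beta_reduce
    rw [hL]
    simp only [Q, Polynomial.eval_finset_sum, Polynomial.eval_mul, Polynomial.eval_C, ← hq' _ _ s hs,
      pullbackJ_dilate, hdil, hgd, tform, Finset.mul_sum, Pi.smul_apply, smul_eq_mul,
      dilate_apply]
    exact Finset.sum_congr rfl fun _ _ => Finset.sum_congr rfl fun _ _ =>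
      Finset.sum_congr rfl fun _ _ => by ring

theorem isInvariantLagrangian (hg : IsInvariantJetMetric g) : IsInvariantLagrangian (jetLagrangian g) where
  isLocal := hg.isLocalFn
  internal _ hO _ hφ x := hg.internal hO hφ x
  poincare _ hM a _ hφ x := hg.poincare hM a hφ x
  atMostFour _ hφ x := hg.atMostFour_jetLagrangian hφ x

end IsInvariantJetMetric

/-! ### Box-free Lagrangians from metrics -/

/-- A metric whose Lagrangian is a given box-free Lagrangian. -/
def greenMetricCoeffs (Λ : ℝ) (f : GreenLabel → ℝ → ℝ) : MetricLabel → ℝ → ℝ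
  | .V => fun t => f .V t / Λ ^ 4
  | .A0 => fun t => 2 * f .F1 t
  | .A1 => fun t => 2 * f .F2 t
  | .B0 => fun t => 2 * f .F4 t
  | .B2 => fun t => f .F3 t - f .F4 t
  | .B3 => f .F7
  | .J0 => f .Fa
  | .J1 => fun t => 2 * Λ ^ 2 * f .Fb t
  | .K0 => fun t => 2 * f .F5 t
  | .K1 => fun t => 2 * f .F6 t
  | .K2 => fun t => 2 * f .F8 t
  | .K3 => fun t => 2 * f .F9 t
  | .K4 => fun t => 2 * f .F10 t
  | _ => 0

theorem smoothCoeffs_greenMetricCoeffs (Λ : ℝ) {f : GreenLabel → ℝ → ℝ} (hf : SmoothCoeffs f) :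
    SmoothCoeffs (greenMetricCoeffs Λ f) := by
  intro l
  cases l <;> simp only [greenMetricCoeffs, sub_eq_add_neg, div_eq_mul_inv]
  all_goals
    repeat' first
      | exact hf _
      | exact contDiffOn_const
      | apply ContDiffOn.add
      | apply ContDiffOn.neg
      | apply ContDiffOn.mul

theorem jetLagrangian_greenMetricCoeffs (Λ : ℝ) (hΛ : Λ ≠ 0) (f : GreenLabel → ℝ → ℝ)
    {φ : Spacetime → FieldSpace} (hφ : ContDiff ℝ ∞ φ) (x : Spacetime) :
    jetLagrangian (higgsMetric Λ (greenMetricCoeffs Λ f)) φ x = greenLagrangian Λ f φ x := by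
  rw [jetLagrangian_higgsMetric Λ _ x hΛ hφ]
  simp only [pulledBackForm, greenLagrangian, greenMetricCoeffs, Pi.zero_apply]
  field_simp
  ring

theorem IsInvariantLagrangian.congr {L L' : Lagrangian} (h : IsInvariantLagrangian L)
    (hL : ∀ φ, ContDiff ℝ ∞ φ → ∀ x, L' φ x = L φ x) : IsInvariantLagrangian L' where
  isLocal := IsLocalFn.congr h.isLocal hL
  internal O hO φ hφ x := by
    rw [hL _ (contDiff_mulVec O hφ), hL φ hφ, h.internal O hO φ hφ]
  poincare M hM a φ hφ x := by
    rw [hL _ (contDiff_comp_affine M a hφ), hL φ hφ, h.poincare M hM a φ hφ]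
  atMostFour φ hφ x := by
    obtain ⟨q, hq, hq'⟩ := h.atMostFour φ hφ x
    refine ⟨q, hq, fun s => ?_⟩
    have h1 : ContDiff ℝ ∞ (fun y => φ (x + s • (y - x))) :=
      hφ.comp (by fun_prop)
    rw [hL _ h1, hq']

theorem isInvariantLagrangian_greenLagrangian (Λ : ℝ) (hΛ : Λ ≠ 0) {f : GreenLabel → ℝ → ℝ}
    (hf : SmoothCoeffs f) : IsInvariantLagrangian (greenLagrangian Λ f) :=
  (isInvariantJetMetric_higgsMetric Λ
    (smoothCoeffs_greenMetricCoeffs Λ hf)).isInvariantLagrangian.congr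
    fun _ hφ x => (jetLagrangian_greenMetricCoeffs Λ hΛ f hφ x).symm

/-! ### Non-degenerate metrics -/

/-- Coefficients of a metric with a given box-free Lagrangian up to integration by parts,
with `C_0 = 1` and constant `E`. -/
def nondegCoeffs (Λ : ℝ) (f : GreenLabel → ℝ → ℝ) (κ : ℝ) : MetricLabel → ℝ → ℝ
  | .C0 => fun _ => 1
  | .E => fun _ => κ
  | .J0 => fun t => f .Fa t - 1 + 2 * κ
  | l => greenMetricCoeffs Λ f l

theorem smoothCoeffs_nondegCoeffs (Λ : ℝ) {f : GreenLabel → ℝ → ℝ} (hf : SmoothCoeffs f)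
    (κ : ℝ) : SmoothCoeffs (nondegCoeffs Λ f κ) := by
  have h := smoothCoeffs_greenMetricCoeffs Λ hf
  intro l
  cases l
  case C0 => exact contDiffOn_const
  case E => exact contDiffOn_const
  case J0 => exact ((hf .Fa).sub contDiffOn_const).add contDiffOn_const
  all_goals
    simp only [nondegCoeffs]
    exact h _

theorem ibp_nondegCoeffs (Λ : ℝ) (hΛ : Λ ≠ 0) {f : GreenLabel → ℝ → ℝ} (hf : SmoothCoeffs f)
    (κ : ℝ) : IBPEquiv (jetLagrangian (higgsMetric Λ (nondegCoeffs Λ f κ)))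
      (greenLagrangian Λ f) := by
  refine (ibp_jetLagrangian Λ hΛ (smoothCoeffs_nondegCoeffs Λ hf κ)).trans
    (IBPEquiv.of_eq fun φ _ x => ?_)
  have h0 : ∀ t, dt (0 : ℝ → ℝ) t = 0 := fun t => by
    change derivWithin (fun _ => (0 : ℝ)) _ _ = 0
    simp
  have h1 : ∀ t, dt (fun _ => κ) t = 0 := fun t => by simp [dt]
  simp only [greenLagrangian, reducedCoeffs, nondegCoeffs, greenMetricCoeffs, h0, h1,
    Pi.zero_apply]
  field_simp
  ring

/-- The point of the 1-jet bundle with `u = r e_0` and vanishing derivatives. -/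
def restPoint (r : ℝ) : J1 := mkJ1 0 (Pi.single 0 r) 0

theorem metricForm_restPoint (Λ : ℝ) (hΛ : Λ ≠ 0) (c : MetricLabel → ℝ → ℝ) (r : ℝ) (X Y : J1) :
    metricForm Λ c (restPoint r) X Y
      = -(1 / 2) * Λ ^ 4 * mdot (xc X) (xc Y) * c .V (r ^ 2 / Λ ^ 2)
      + (alongVec (wc Y) (xc X) 0 * r + alongVec (wc X) (xc Y) 0 * r) * c .E (r ^ 2 / Λ ^ 2)
      + (uc X ⬝ᵥ uc Y) * c .C0 (r ^ 2 / Λ ^ 2)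
      + (r ^ 2 * uc X 0 * uc Y 0) / Λ ^ 2 * c .C1 (r ^ 2 / Λ ^ 2)
      + (tdot (wc X) (wc Y) * c .A0 (r ^ 2 / Λ ^ 2)
        + r ^ 2 * mdot (fun μ => wc X μ 0) (fun μ => wc Y μ 0) / Λ ^ 2 * c .A1 (r ^ 2 / Λ ^ 2))
        / Λ ^ 2 := by
  have hw : wc (restPoint r) = 0 := rfl
  have hu : uc (restPoint r) = Pi.single 0 r := rfl
  have e1 : ∀ ξ, alongVec (0 : Fin 4 → FieldSpace) ξ = 0 := fun ξ => by simp [alongVec]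
  have e2 : ∀ v, col (0 : Fin 4 → FieldSpace) v = 0 := fun v => by
    funext; simp [col]
  have e3 : ∀ a, mdot 0 a = 0 := fun a => by simp [mdot]
  have e3' : ∀ a, mdot a 0 = 0 := fun a => by simp [mdot]
  have e4 : ∀ a, tdot 0 a = 0 := fun a => by simp [tdot]
  have e5 : ww (restPoint r) = 0 := by rw [ww_eq, hw, e4]
  have e6 : sDn (restPoint r) = 0 := by rw [sDn_eq_col, hw, e2]
  have e7 : ss (restPoint r) = 0 := by rw [ss_eq, e6, e3]
  have e8 : zvec (restPoint r) = 0 := by simp [zvec, e6]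
  have e9 : gramSq (restPoint r) = 0 := by simp [gramSq, hw, e2, e3]
  have e10 : ∀ h : Fin 4 → FieldSpace, col h (Pi.single 0 r) = r • fun μ => h μ 0 := fun h => by
    funext μ; simp [col, mul_comm]
  have e11 : ∀ a b : Fin 4 → ℝ, mdot (r • a) (r • b) = r ^ 2 * mdot a b := fun a b => by
    simp only [mdot, Pi.smul_apply, smul_eq_mul, Finset.mul_sum]
    exact Finset.sum_congr rfl fun _ _ => by ring
  have e12 : cf Λ c (restPoint r) = fun l => c l (r ^ 2 / Λ ^ 2) := by
    funext l
    simp [cf, hu, sq]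
  simp only [metricForm, formXX, formXU, formXD, formUU, formDU, formDD, hw, hu, e1, e2, e3, e3', e4,
    e5, e7, e8, e9, e10, e11, e12, zero_dotProduct, dotProduct_zero, dotProduct_single,
    single_dotProduct, smul_zero, Pi.zero_apply]
  field_simp
  ring

theorem det_restPoint_ne_zero (Λ : ℝ) (hΛ : Λ ≠ 0) (f : GreenLabel → ℝ → ℝ) {r κ : ℝ}
    (hF : f .F1 (r ^ 2 / Λ ^ 2) ≠ 0)
    (hκ : f .V (r ^ 2 / Λ ^ 2) * (f .F1 (r ^ 2 / Λ ^ 2)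
      + r ^ 2 / Λ ^ 2 * f .F2 (r ^ 2 / Λ ^ 2)) / Λ ^ 2 + (r * κ) ^ 2 ≠ 0) :
    (higgsMetric Λ (nondegCoeffs Λ f κ) (restPoint r)).det ≠ 0 := by
  intro hdet
  obtain ⟨Y, hY, hY0⟩ := Matrix.exists_mulVec_eq_zero_iff.2 hdet
  have key : ∀ I, metricForm Λ (nondegCoeffs Λ f κ) (restPoint r) (Pi.single I 1) Y = 0 :=
    fun I => by
    rw [← tform_higgsMetric]
    refine Eq.trans ?_ (congrFun hY0 I)
    simp [tform, Matrix.mulVec, dotProduct, Pi.single_apply]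
  simp only [metricForm_restPoint Λ hΛ] at key
  generalize htdef : r ^ 2 / Λ ^ 2 = t at *
  have hX : ∀ μ, -(1 / 2) * et μ * xc Y μ * f .V t + wc Y μ 0 * r * κ = 0 := fun μ => by
    have := key (.inl μ)
    simp only [xc_single_x, uc_single_x, wc_single_x, alongVec_single, nondegCoeffs,
      greenMetricCoeffs, mdot_single_left] at this
    simp [alongVec, tdot, mdot] at this
    rw [← this]
    field_simp
  have hU : ∀ i, uc Y i = 0 := fun i => by
    have := key (.inr (.inl i))
    simp only [xc_single_r, uc_single_u, wc_single_u, nondegCoeffs, greenMetricCoeffs] at this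
    simpa [alongVec, tdot, mdot] using this
  have hW : ∀ μ i, xc Y μ * (if i = 0 then r else 0) * κ
      + et μ * (wc Y μ i * 2 * f .F1 t
        + (if i = 0 then r else 0) * r * wc Y μ 0 / Λ ^ 2 * 2 * f .F2 t) / Λ ^ 2 = 0 := fun μ i => by
    have := key (.inr (.inr (μ, i)))
    simp only [xc_single_r, uc_single_w, wc_single_w, nondegCoeffs, greenMetricCoeffs] at this
    have h1 : alongVec (Pi.single μ (Pi.single i 1) : Fin 4 → FieldSpace) (xc Y) 0
        = xc Y μ * if i = 0 then 1 else 0 := by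
      rw [alongVec, Finset.sum_apply, Finset.sum_eq_single μ]
      · simp [Pi.single_apply, eq_comm]
      · intro ν _ hν; simp [Pi.single_eq_of_ne hν]
      · simp
    have h2 : mdot (fun ν => (Pi.single μ (Pi.single i 1) : Fin 4 → FieldSpace) ν 0)
        (fun ν => wc Y ν 0) = et μ * (if i = 0 then 1 else 0) * wc Y μ 0 := by
      rw [mdot, Finset.sum_eq_single μ]
      · simp [Pi.single_apply, eq_comm]
      · intro ν _ hν; simp [Pi.single_eq_of_ne hν]
      · simp
    rw [h1, h2, tdot_single_left] at this
    simp [alongVec, mdot] at this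
    split_ifs at this ⊢ <;> linear_combination this
  apply hY
  have hw : ∀ μ i, i ≠ 0 → wc Y μ i = 0 := fun μ i hi => by
    have := hW μ i
    simp only [if_neg hi] at this
    simpa [et_ne_zero, hF, hΛ] using this
  have h0 : ∀ μ, xc Y μ = 0 ∧ wc Y μ 0 = 0 := fun μ => by
    have a := hX μ
    have b := hW μ 0
    simp only [if_true] at b
    have e := et_mul_self μ
    rw [← htdef] at a b hκ
    rw [htdef] at a b hκ
    have hk : f .V t * (f .F1 t + t * f .F2 t) / Λ ^ 2 + (r * κ) ^ 2 ≠ 0 := hκ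
    have b' : xc Y μ * r * κ + et μ * wc Y μ 0 * (2 * (f .F1 t + t * f .F2 t) / Λ ^ 2) = 0 := by
      rw [← b, ← htdef]
      field_simp
    constructor
    · refine (mul_eq_zero.1 ?_).resolve_right hk
      linear_combination (-2 * et μ * (f .F1 t + t * f .F2 t) / Λ ^ 2) * a + r * κ * b'
        - f .V t * xc Y μ * ((f .F1 t + t * f .F2 t) / Λ ^ 2) * e
    · refine (mul_eq_zero.1 ?_).resolve_right hk
      linear_combination r * κ * a + (et μ * f .V t / 2) * b'
        - f .V t * wc Y μ 0 * ((f .F1 t + t * f .F2 t) / Λ ^ 2) * e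
  funext I
  rcases I with μ | i | ⟨μ, i⟩
  · exact (h0 μ).1
  · exact hU i
  · by_cases hi : i = 0
    · subst hi; exact (h0 μ).2
    · exact hw μ i hi

theorem exists_nondegenerate (Λ : ℝ) (hΛ : 0 < Λ) {f : GreenLabel → ℝ → ℝ} (hf : SmoothCoeffs f)
    (h : ∃ t, 0 ≤ t ∧ f .F1 t ≠ 0) : ∃ c, SmoothCoeffs c ∧
      (∃ p, (higgsMetric Λ c p).det ≠ 0) ∧
      IBPEquiv (jetLagrangian (higgsMetric Λ c)) (greenLagrangian Λ f) := by
  obtain ⟨t, ht, htF⟩ : ∃ t, 0 < t ∧ f .F1 t ≠ 0 := by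
    obtain ⟨t, ht, htF⟩ := h
    have h1 : ∀ᶠ s in nhdsWithin t (Ici 0), f .F1 s ≠ 0 :=
      ((hf .F1).continuousOn t ht).eventually_ne htF
    have h2 : ∀ᶠ s in nhdsWithin t (Ioi t), f .F1 s ≠ 0 :=
      h1.filter_mono (nhdsWithin_mono t fun s (hs : t < s) => ht.trans hs.le)
    obtain ⟨s, hs, hs'⟩ := (h2.and self_mem_nhdsWithin).exists
    exact ⟨s, ht.trans_lt hs', hs⟩
  have hr : (Real.sqrt t * Λ) ^ 2 / Λ ^ 2 = t := by
    rw [mul_pow, Real.sq_sqrt ht.le, mul_div_cancel_right₀ _ (pow_ne_zero 2 hΛ.ne')]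
  have hr0 : Real.sqrt t * Λ ≠ 0 := mul_ne_zero (Real.sqrt_ne_zero'.2 ht) hΛ.ne'
  obtain ⟨κ, hκ⟩ : ∃ κ, f .V t * (f .F1 t + t * f .F2 t) / Λ ^ 2
      + (Real.sqrt t * Λ * κ) ^ 2 ≠ 0 := by
    by_cases h0 : f .V t * (f .F1 t + t * f .F2 t) / Λ ^ 2 = 0
    · exact ⟨1, by rw [h0, zero_add, mul_one]; exact pow_ne_zero 2 hr0⟩
    · exact ⟨0, by simpa using h0⟩
  exact ⟨nondegCoeffs Λ f κ, smoothCoeffs_nondegCoeffs Λ hf κ,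
    ⟨restPoint (Real.sqrt t * Λ), det_restPoint_ne_zero Λ hΛ.ne' f (by rwa [hr])
      (by rwa [hr])⟩, ibp_nondegCoeffs Λ hΛ.ne' hf κ⟩

/-! ### Integrals of total derivatives over a torus -/

theorem IsLocalFn.translate {L : Lagrangian} (h : IsLocalFn L) {φ : Spacetime → FieldSpace}
    (hφ : ContDiff ℝ ∞ φ) {v : Spacetime} (hv : ∀ x, φ (x + v) = φ x) (x : Spacetime) :
    L φ (x + v) = L φ x := by
  obtain ⟨r, l, -, hL⟩ := h
  rw [hL φ hφ, hL φ hφ]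
  congr 1
  funext m
  simp only [jet]
  rw [← iteratedFDeriv_comp_add_right]
  simp only [hv]

theorem hasDerivAt_update_pd {g : Spacetime → ℝ} (hg : ContDiff ℝ ∞ g) (μ : Fin 4)
    (x : Spacetime) (s : ℝ) :
    HasDerivAt (fun s => g (Function.update x μ s)) (pd μ g (Function.update x μ s)) s :=
  ((hg.differentiable (by simp) _).hasFDerivAt).comp_hasDerivAt s (hasDerivAt_update x μ s)

theorem pd_eq_of_hasDerivAt {g : Spacetime → ℝ} (hg : ContDiff ℝ ∞ g) {μ : Fin 4}
    {x : Spacetime} {d : ℝ} (h : HasDerivAt (fun s => g (Function.update x μ s)) d (x μ)) :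
    pd μ g x = d := by
  have := hasDerivAt_update_pd hg μ x (x μ)
  rw [Function.update_eq_self] at this
  exact this.unique h

/-- A point of the plane of the coordinates `x^1, x^2`. -/
def planePoint (x y : ℝ) : Spacetime := ![0, x, y, 0]

theorem planePoint_update_one (x y s : ℝ) :
    Function.update (planePoint x y) 1 s = planePoint s y := by
  funext μ; fin_cases μ <;> simp [planePoint]

theorem planePoint_update_two (x y s : ℝ) :
    Function.update (planePoint x y) 2 s = planePoint x s := by
  funext μ; fin_cases μ <;> simp [planePoint]

theorem continuous_planePoint : Continuous fun p : ℝ × ℝ => planePoint p.1 p.2 := by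
  refine continuous_pi fun μ => ?_
  fin_cases μ <;> simp [planePoint] <;> fun_prop

theorem update_add_eq (x : Spacetime) (μ : Fin 4) (s c : ℝ) :
    Function.update x μ (s + c) = Function.update x μ s + c • (Pi.single μ 1 : Spacetime) := by
  funext ν
  by_cases h : ν = μ
  · subst h; simp
  · simp [h]

/-- Fields that depend on `x^1, x^2` only, with period `2π`. -/
structure IsPlaneWave (φ : Spacetime → FieldSpace) : Prop where
  smooth : ContDiff ℝ ∞ φ
  inv0 : ∀ (c : ℝ) x, φ (x + c • (Pi.single 0 1 : Spacetime)) = φ x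
  inv3 : ∀ (c : ℝ) x, φ (x + c • (Pi.single 3 1 : Spacetime)) = φ x
  per1 : ∀ x, φ (x + (2 * Real.pi) • (Pi.single 1 1 : Spacetime)) = φ x
  per2 : ∀ x, φ (x + (2 * Real.pi) • (Pi.single 2 1 : Spacetime)) = φ x

/-- The integral over a period cell. -/
def torusIntegral (F : ℝ → ℝ → ℝ) : ℝ :=
  ∫ y in (0 : ℝ)..2 * Real.pi, ∫ x in (0 : ℝ)..2 * Real.pi, F x y

theorem torusIntegral_swap {F : ℝ → ℝ → ℝ} (hF : Continuous fun p : ℝ × ℝ => F p.1 p.2) :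
    torusIntegral F = ∫ x in (0 : ℝ)..2 * Real.pi, ∫ y in (0 : ℝ)..2 * Real.pi, F x y := by
  unfold torusIntegral
  rw [MeasureTheory.intervalIntegral_intervalIntegral_swap]
  have h : Continuous (Function.uncurry fun y x => F x y) := hF.comp continuous_swap
  have hi : MeasureTheory.IntegrableOn (Function.uncurry fun y x => F x y)
      (uIcc 0 (2 * Real.pi) ×ˢ uIcc 0 (2 * Real.pi)) (MeasureTheory.volume.prod MeasureTheory.volume) :=
    h.continuousOn.integrableOn_compact (isCompact_uIcc.prod isCompact_uIcc)
  exact hi.mono_set (prod_mono uIoc_subset_uIcc uIoc_subset_uIcc)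

theorem IsTotalDerivative.torusIntegral_eq_zero {L : Lagrangian} (hL : IsTotalDerivative L)
    {φ : Spacetime → FieldSpace} (h : IsPlaneWave φ) :
    torusIntegral (fun x y => L φ (planePoint x y)) = 0 := by
  obtain ⟨K, hK, hL⟩ := hL.exists_local
  have hφ := h.smooth
  have hKs : ∀ μ, ContDiff ℝ ∞ (K μ φ) := fun μ => (hK μ).contDiff hφ
  have hzero : ∀ μ, (∀ (c : ℝ) x, φ (x + c • (Pi.single μ 1 : Spacetime)) = φ x) → ∀ x,
      pd μ (K μ φ) x = 0 := fun μ hμ x => by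
    refine pd_eq_of_hasDerivAt (hKs μ) ?_
    have : (fun s => K μ φ (Function.update x μ s)) = fun _ => K μ φ (Function.update x μ 0) := by
      funext s
      rw [← zero_add s, update_add_eq, (hK μ).translate hφ (hμ s)]
    rw [this]
    exact hasDerivAt_const _ _
  have hpd : ∀ μ, Continuous fun p : ℝ × ℝ => pd μ (K μ φ) (planePoint p.1 p.2) := fun μ =>
    (contDiff_pd (hKs μ)).continuous.comp continuous_planePoint
  have h1 : torusIntegral (fun x y => pd 1 (K 1 φ) (planePoint x y)) = 0 := by
    unfold torusIntegral
    have : ∀ y, ∫ x in (0 : ℝ)..2 * Real.pi, pd 1 (K 1 φ) (planePoint x y) = 0 := fun y => by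
      rw [intervalIntegral.integral_eq_sub_of_hasDerivAt (f := fun x => K 1 φ (planePoint x y))]
      · have := (hK 1).translate hφ h.per1 (Function.update (planePoint 0 y) 1 0)
        rw [← update_add_eq, planePoint_update_one, planePoint_update_one, zero_add] at this
        rw [this, sub_self]
      · intro x _
        have := hasDerivAt_update_pd (hKs 1) 1 (planePoint 0 y) x
        simpa only [planePoint_update_one] using this
      · exact ((hpd 1).comp (continuous_id.prodMk continuous_const)).intervalIntegrable _ _
    simp only [this, intervalIntegral.integral_zero]
  have h2 : torusIntegral (fun x y => pd 2 (K 2 φ) (planePoint x y)) = 0 := by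
    rw [torusIntegral_swap (hpd 2)]
    have : ∀ x, ∫ y in (0 : ℝ)..2 * Real.pi, pd 2 (K 2 φ) (planePoint x y) = 0 := fun x => by
      rw [intervalIntegral.integral_eq_sub_of_hasDerivAt (f := fun y => K 2 φ (planePoint x y))]
      · have := (hK 2).translate hφ h.per2 (Function.update (planePoint x 0) 2 0)
        rw [← update_add_eq, planePoint_update_two, planePoint_update_two, zero_add] at this
        rw [this, sub_self]
      · intro y _
        have := hasDerivAt_update_pd (hKs 2) 2 (planePoint x 0) y
        simpa only [planePoint_update_two] using this
      · exact ((hpd 2).comp (continuous_const.prodMk continuous_id)).intervalIntegrable _ _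
    simp only [this, intervalIntegral.integral_zero]
  have hsum : torusIntegral (fun x y => L φ (planePoint x y))
      = torusIntegral (fun x y => pd 1 (K 1 φ) (planePoint x y))
        + torusIntegral (fun x y => pd 2 (K 2 φ) (planePoint x y)) := by
    have h1x : ∀ y, IntervalIntegrable (fun x => pd 1 (K 1 φ) (planePoint x y))
        MeasureTheory.volume 0 (2 * Real.pi) := fun y =>
      ((hpd 1).comp (continuous_id.prodMk continuous_const)).intervalIntegrable _ _
    have h2x : ∀ y, IntervalIntegrable (fun x => pd 2 (K 2 φ) (planePoint x y))
        MeasureTheory.volume 0 (2 * Real.pi) := fun y =>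
      ((hpd 2).comp (continuous_id.prodMk continuous_const)).intervalIntegrable _ _
    have hc : ∀ μ, Continuous fun y => ∫ x in (0 : ℝ)..2 * Real.pi,
        pd μ (K μ φ) (planePoint x y) := fun μ =>
      intervalIntegral.continuous_parametric_intervalIntegral_of_continuous'
        (f := fun y x => pd μ (K μ φ) (planePoint x y)) ((hpd μ).comp continuous_swap) _ _
    unfold torusIntegral
    rw [← intervalIntegral.integral_add ((hc 1).intervalIntegrable _ _)
      ((hc 2).intervalIntegrable _ _)]
    congr 1
    funext y
    rw [← intervalIntegral.integral_add (h1x y) (h2x y)]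
    congr 1
    funext x
    beta_reduce
    rw [hL φ hφ, Fin.sum_univ_four, hzero 0 h.inv0, hzero 3 h.inv3]
    ring
  rw [hsum, h1, h2, add_zero]

theorem continuous_torusIntegral {H : ℝ → ℝ → ℝ → ℝ}
    (hH : Continuous fun p : ℝ × ℝ × ℝ => H p.1 p.2.1 p.2.2) :
    Continuous fun ε => torusIntegral (H ε) := by
  unfold torusIntegral
  have h1 : Continuous fun q : ℝ × ℝ => ∫ x in (0 : ℝ)..2 * Real.pi, H q.1 x q.2 :=
    intervalIntegral.continuous_parametric_intervalIntegral_of_continuous'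
      (f := fun (q : ℝ × ℝ) x => H q.1 x q.2)
      (hH.comp ((continuous_fst.comp continuous_fst).prodMk
        (continuous_snd.prodMk (continuous_snd.comp continuous_fst)))) _ _
  exact intervalIntegral.continuous_parametric_intervalIntegral_of_continuous'
    (f := fun ε y => ∫ x in (0 : ℝ)..2 * Real.pi, H ε x y) h1 _ _

theorem torusIntegral_zero_of_scaled {H : ℝ → ℝ → ℝ → ℝ}
    (hH : Continuous fun p : ℝ × ℝ × ℝ => H p.1 p.2.1 p.2.2)
    (h : ∀ ε, ε ≠ 0 → torusIntegral (H ε) = 0) : torusIntegral (H 0) = 0 :=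
  congrFun ((continuous_torusIntegral hH).ext_on (dense_compl_singleton (0 : ℝ))
    continuous_const fun ε hε => h ε hε) 0

theorem torusIntegral_const_mul (c : ℝ) (F : ℝ → ℝ → ℝ) :
    torusIntegral (fun x y => c * F x y) = c * torusIntegral F := by
  simp only [torusIntegral, intervalIntegral.integral_const_mul]

open Real in
theorem integral_trig (a0 a1 a2 a3 a4 a5 a6 b0 b1 b2 b3 b4 b5 : ℝ) :
    ∫ x in (0 : ℝ)..2 * π, (a0 + a1 * sin x + a2 * sin x ^ 2 + a3 * sin x ^ 3 + a4 * sin x ^ 4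
      + a5 * sin x ^ 5 + a6 * sin x ^ 6 + cos x * (b0 + b1 * sin x + b2 * sin x ^ 2
      + b3 * sin x ^ 3 + b4 * sin x ^ 4 + b5 * sin x ^ 5))
      = π * (2 * a0 + a2 + 3 / 4 * a4 + 5 / 8 * a6) := by
  have hd : ∀ x, HasDerivAt (fun x => a0 * x + a1 * (-cos x) + a2 * (x / 2 - sin x * cos x / 2)
      + a3 * (-cos x + cos x ^ 3 / 3) + a4 * (3 * x / 8 - 3 / 8 * (sin x * cos x)
        - (sin x ^ 3 * cos x) / 4)
      + a5 * (-cos x + 2 / 3 * cos x ^ 3 - cos x ^ 5 / 5)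
      + a6 * (5 / 16 * x - 5 / 16 * (sin x * cos x) - 5 / 24 * (sin x ^ 3 * cos x)
        - (sin x ^ 5 * cos x) / 6)
      + (b0 * sin x + b1 * (sin x ^ 2 / 2) + b2 * (sin x ^ 3 / 3) + b3 * (sin x ^ 4 / 4)
        + b4 * (sin x ^ 5 / 5) + b5 * (sin x ^ 6 / 6)))
      (a0 + a1 * sin x + a2 * sin x ^ 2 + a3 * sin x ^ 3 + a4 * sin x ^ 4
      + a5 * sin x ^ 5 + a6 * sin x ^ 6 + cos x * (b0 + b1 * sin x + b2 * sin x ^ 2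
      + b3 * sin x ^ 3 + b4 * sin x ^ 4 + b5 * sin x ^ 5)) x := fun x => by
    have i := hasDerivAt_id' x
    have s := hasDerivAt_sin x
    have c := hasDerivAt_cos x
    have sc := s.fun_mul c
    have s3c := (s.fun_pow 3).fun_mul c
    have s5c := (s.fun_pow 5).fun_mul c
    have h := ((((((((i.const_mul a0).fun_add (c.fun_neg.const_mul a1)).fun_add
      (((i.div_const 2).fun_sub (sc.div_const 2)).const_mul a2)).fun_add
      ((c.fun_neg.fun_add ((c.fun_pow 3).div_const 3)).const_mul a3)).fun_add
      (((((i.const_mul 3).div_const 8).fun_sub (sc.const_mul (3 / 8))).fun_sub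
        (s3c.div_const 4)).const_mul a4)).fun_add
      (((c.fun_neg.fun_add ((c.fun_pow 3).const_mul (2 / 3))).fun_sub
        ((c.fun_pow 5).div_const 5)).const_mul a5)).fun_add
      (((((i.const_mul (5 / 16)).fun_sub (sc.const_mul (5 / 16))).fun_sub
        (s3c.const_mul (5 / 24))).fun_sub (s5c.div_const 6)).const_mul a6)).fun_add
      ((((((s.const_mul b0).fun_add (((s.fun_pow 2).div_const 2).const_mul b1)).fun_add
        (((s.fun_pow 3).div_const 3).const_mul b2)).fun_add
        (((s.fun_pow 4).div_const 4).const_mul b3)).fun_add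
        (((s.fun_pow 5).div_const 5).const_mul b4)).fun_add
        (((s.fun_pow 6).div_const 6).const_mul b5)))
    refine h.congr_deriv ?_
    have e := sin_sq_add_cos_sq x
    simp only [Nat.cast_ofNat, Nat.add_one_sub_one]
    linear_combination (-(1 / 2) * a2 - a4 * (3 / 8 + 3 / 4 * sin x ^ 2)
      - a6 * (5 / 16 + 5 / 8 * sin x ^ 2 + 5 / 6 * sin x ^ 4)
      - a3 * sin x - a5 * sin x * (1 - cos x ^ 2 + sin x ^ 2)) * e
  rw [intervalIntegral.integral_eq_sub_of_hasDerivAt (fun x _ => hd x)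
    (by apply Continuous.intervalIntegrable; fun_prop)]
  simp only [sin_two_pi, cos_two_pi, sin_zero, cos_zero]
  ring

/-! ### Plane waves -/

/-- A periodic function of two variables with its derivatives up to second order. -/
structure Wave where
  f : ℝ → ℝ → ℝ
  f1 : ℝ → ℝ → ℝ
  f2 : ℝ → ℝ → ℝ
  f11 : ℝ → ℝ → ℝ
  f12 : ℝ → ℝ → ℝ
  f22 : ℝ → ℝ → ℝ
  smooth : ContDiff ℝ ∞ fun p : ℝ × ℝ => f p.1 p.2
  per1 : ∀ x y, f (x + 2 * Real.pi) y = f x y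
  per2 : ∀ x y, f x (y + 2 * Real.pi) = f x y
  deriv1 : ∀ x y, HasDerivAt (fun s => f s y) (f1 x y) x
  deriv2 : ∀ x y, HasDerivAt (fun s => f x s) (f2 x y) y
  deriv11 : ∀ x y, HasDerivAt (fun s => f1 s y) (f11 x y) x
  deriv12 : ∀ x y, HasDerivAt (fun s => f2 s y) (f12 x y) x
  deriv21 : ∀ x y, HasDerivAt (fun s => f1 x s) (f12 x y) y
  deriv22 : ∀ x y, HasDerivAt (fun s => f2 x s) (f22 x y) y

namespace Wave

variable (W : Wave)

/-- The wave as a function on spacetime. -/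
def fn (x : Spacetime) : ℝ := W.f (x 1) (x 2)

theorem contDiff_fn : ContDiff ℝ ∞ W.fn :=
  W.smooth.comp ((contDiff_apply ℝ ℝ (1 : Fin 4)).prodMk (contDiff_apply ℝ ℝ (2 : Fin 4)))

/-- First derivatives. -/
def grad (x y : ℝ) : Fin 4 → ℝ := ![0, W.f1 x y, W.f2 x y, 0]

/-- Second derivatives. -/
def hess (x y : ℝ) : Fin 4 → Fin 4 → ℝ :=
  ![0, ![0, W.f11 x y, W.f12 x y, 0], ![0, W.f12 x y, W.f22 x y, 0], 0]

theorem pd_plane {g g1 g2 : ℝ → ℝ → ℝ} (hg : ContDiff ℝ ∞ fun x : Spacetime => g (x 1) (x 2))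
    (h1 : ∀ x y, HasDerivAt (fun s => g s y) (g1 x y) x)
    (h2 : ∀ x y, HasDerivAt (fun s => g x s) (g2 x y) y) (μ : Fin 4) (x : Spacetime) :
    pd μ (fun x => g (x 1) (x 2)) x = (![0, g1 (x 1) (x 2), g2 (x 1) (x 2), 0] : Fin 4 → ℝ) μ := by
  refine pd_eq_of_hasDerivAt hg ?_
  fin_cases μ
  · simpa using hasDerivAt_const _ _
  · simpa using h1 (x 1) (x 2)
  · simpa using h2 (x 1) (x 2)
  · simpa using hasDerivAt_const _ _

theorem pd_fn (μ : Fin 4) : pd μ W.fn = fun x => W.grad (x 1) (x 2) μ :=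
  funext fun x => pd_plane W.contDiff_fn W.deriv1 W.deriv2 μ x

theorem pd_pd_fn (μ ν : Fin 4) (x : Spacetime) :
    pd μ (pd ν W.fn) x = W.hess (x 1) (x 2) μ ν := by
  have hs := contDiff_pd W.contDiff_fn (μ := ν)
  rw [pd_fn] at hs ⊢
  fin_cases ν
  · simp only [grad, hess]
    rw [show (fun x : Spacetime => ![0, W.f1 (x 1) (x 2), W.f2 (x 1) (x 2), 0]
      (⟨0, by norm_num⟩ : Fin 4)) = fun _ => (0 : ℝ) from rfl, pd_const]
    fin_cases μ <;> simp
  · refine (pd_plane (g := W.f1) hs W.deriv11 W.deriv21 μ x).trans ?_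
    fin_cases μ <;> simp [hess]
  · refine (pd_plane (g := W.f2) hs W.deriv12 W.deriv22 μ x).trans ?_
    fin_cases μ <;> simp [hess]
  · simp only [grad, hess]
    rw [show (fun x : Spacetime => ![0, W.f1 (x 1) (x 2), W.f2 (x 1) (x 2), 0]
      (⟨3, by norm_num⟩ : Fin 4)) = fun _ => (0 : ℝ) from rfl, pd_const]
    fin_cases μ <;> simp

theorem continuous_grad (μ : Fin 4) : Continuous fun p : ℝ × ℝ => W.grad p.1 p.2 μ := by
  have := (contDiff_pd W.contDiff_fn (μ := μ)).continuous.comp continuous_planePoint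
  rw [pd_fn] at this
  exact this

theorem continuous_hess (μ ν : Fin 4) : Continuous fun p : ℝ × ℝ => W.hess p.1 p.2 μ ν := by
  have := (contDiff_pd (contDiff_pd W.contDiff_fn (μ := ν)) (μ := μ)).continuous.comp
    continuous_planePoint
  rw [show pd μ (pd ν W.fn) = fun x => W.hess (x 1) (x 2) μ ν from
    funext fun x => W.pd_pd_fn μ ν x] at this
  exact this

end Wave

/-- The field `r e_0 + ε (b, a, c, 0)`. -/
def waveField (a b c : Wave) (r ε : ℝ) (x : Spacetime) : FieldSpace :=
  ![r + ε * b.fn x, ε * a.fn x, ε * c.fn x, 0]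

/-- Its first derivatives at unit amplitude. -/
def waveD1 (a b c : Wave) (x y : ℝ) (μ : Fin 4) : FieldSpace :=
  ![b.grad x y μ, a.grad x y μ, c.grad x y μ, 0]

/-- Its second derivatives at unit amplitude. -/
def waveD2 (a b c : Wave) (x y : ℝ) (μ ν : Fin 4) : FieldSpace :=
  ![b.hess x y μ ν, a.hess x y μ ν, c.hess x y μ ν, 0]

section waveField

variable (a b c : Wave) (r ε : ℝ)

theorem d1_waveField (x : Spacetime) (μ : Fin 4) :
    d1 (waveField a b c r ε) x μ = ε • waveD1 a b c (x 1) (x 2) μ := by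
  funext i
  fin_cases i
  · change pd μ (fun y => r + ε * b.fn y) x = ε * b.grad (x 1) (x 2) μ
    rw [pd_add contDiff_const (contDiff_const.mul b.contDiff_fn), pd_const,
      pd_const_mul _ b.contDiff_fn, b.pd_fn, zero_add]
  · change pd μ (fun y => ε * a.fn y) x = ε * a.grad (x 1) (x 2) μ
    rw [pd_const_mul _ a.contDiff_fn, a.pd_fn]
  · change pd μ (fun y => ε * c.fn y) x = ε * c.grad (x 1) (x 2) μ
    rw [pd_const_mul _ c.contDiff_fn, c.pd_fn]
  · change pd μ (fun y => 0) x = ε * 0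
    rw [pd_const, mul_zero]

theorem d2_waveField (x : Spacetime) (μ ν : Fin 4) :
    d2 (waveField a b c r ε) x μ ν = ε • waveD2 a b c (x 1) (x 2) μ ν := by
  have h : ∀ W : Wave, pd μ (fun y => ε * W.grad (y 1) (y 2) ν) x
      = ε * W.hess (x 1) (x 2) μ ν := fun W => by
    rw [← W.pd_pd_fn μ ν x, W.pd_fn ν, pd_const_mul]
    rw [← W.pd_fn ν]
    exact contDiff_pd W.contDiff_fn
  funext i
  simp only [d2, d1_waveField]
  fin_cases i
  · exact h b
  · exact h a
  · exact h c
  · change pd μ (fun y => ε * 0) x = ε * 0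
    rw [pd_const, mul_zero]

theorem isPlaneWave_waveField : IsPlaneWave (waveField a b c r ε) where
  smooth := by
    refine contDiff_pi.2 fun i => ?_
    have ha := a.contDiff_fn
    have hb := b.contDiff_fn
    have hc := c.contDiff_fn
    fin_cases i
    · exact contDiff_const.add (contDiff_const.mul hb)
    · exact contDiff_const.mul ha
    · exact contDiff_const.mul hc
    · exact contDiff_const
  inv0 s x := by simp [waveField, Wave.fn]
  inv3 s x := by simp [waveField, Wave.fn]
  per1 x := by simp [waveField, Wave.fn, Wave.per1]
  per2 x := by simp [waveField, Wave.fn, Wave.per2]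

end waveField

/-! ### Homogeneous parts of the box-free Lagrangian -/

section parts

variable (Λ : ℝ) (f : GreenLabel → ℝ → ℝ) (u : FieldSpace) (w : Fin 4 → FieldSpace)
  (h : Fin 4 → Fin 4 → FieldSpace)

/-- The part of second order in derivatives of the field. -/
def greenPart2 : ℝ :=
  (1 / 2) * (∑ μ, et μ * (w μ ⬝ᵥ w μ)) * f .Fa ((u ⬝ᵥ u) / Λ ^ 2)
  + (∑ μ, et μ * (w μ ⬝ᵥ u) ^ 2) * f .Fb ((u ⬝ᵥ u) / Λ ^ 2)
  + 1 / Λ ^ 2 * (dsum fun μ ν => h μ ν ⬝ᵥ h μ ν) * f .F1 ((u ⬝ᵥ u) / Λ ^ 2)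
  + 1 / Λ ^ 4 * (dsum fun μ ν => (h μ ν ⬝ᵥ u) ^ 2) * f .F2 ((u ⬝ᵥ u) / Λ ^ 2)

/-- The part of third order in derivatives of the field. -/
def greenPart3 : ℝ :=
  1 / Λ ^ 4 * (dsum fun μ ν => (h μ ν ⬝ᵥ w μ) * (w ν ⬝ᵥ u)) * f .F3 ((u ⬝ᵥ u) / Λ ^ 2)
  + 1 / Λ ^ 4 * (dsum fun μ ν => (h μ ν ⬝ᵥ u) * (w μ ⬝ᵥ w ν)) * f .F4 ((u ⬝ᵥ u) / Λ ^ 2)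
  + 1 / Λ ^ 6 * (dsum fun μ ν => (h μ ν ⬝ᵥ u) * (w μ ⬝ᵥ u) * (w ν ⬝ᵥ u))
    * f .F7 ((u ⬝ᵥ u) / Λ ^ 2)

/-- The part of fourth order in derivatives of the field. -/
def greenPart4 : ℝ :=
  1 / Λ ^ 4 * (∑ μ, et μ * (w μ ⬝ᵥ w μ)) ^ 2 * f .F5 ((u ⬝ᵥ u) / Λ ^ 2)
  + 1 / Λ ^ 4 * (dsum fun μ ν => (w μ ⬝ᵥ w ν) ^ 2) * f .F6 ((u ⬝ᵥ u) / Λ ^ 2)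
  + 1 / Λ ^ 6 * ((∑ μ, et μ * (w μ ⬝ᵥ w μ)) * (∑ μ, et μ * (w μ ⬝ᵥ u) ^ 2))
    * f .F8 ((u ⬝ᵥ u) / Λ ^ 2)
  + 1 / Λ ^ 6 * (dsum fun μ ν => (w μ ⬝ᵥ w ν) * (w μ ⬝ᵥ u) * (w ν ⬝ᵥ u))
    * f .F9 ((u ⬝ᵥ u) / Λ ^ 2)
  + 1 / Λ ^ 8 * (∑ μ, et μ * (w μ ⬝ᵥ u) ^ 2) ^ 2 * f .F10 ((u ⬝ᵥ u) / Λ ^ 2)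

theorem dsum_const_mul (r : ℝ) (F : Fin 4 → Fin 4 → ℝ) :
    (dsum fun μ ν => r * F μ ν) = r * dsum F := by
  simp only [dsum, Finset.mul_sum]
  exact Finset.sum_congr rfl fun _ _ => Finset.sum_congr rfl fun _ _ => by ring

theorem greenPart2_smul (ε : ℝ) : greenPart2 Λ f u (fun μ => ε • w μ) (fun μ ν => ε • h μ ν)
    = ε ^ 2 * greenPart2 Λ f u w h := by
  simp only [greenPart2, dsum, Fin.sum_univ_four, smul_dotProduct, dotProduct_smul, smul_eq_mul]
  ring

theorem greenPart3_smul (ε : ℝ) : greenPart3 Λ f u (fun μ => ε • w μ) (fun μ ν => ε • h μ ν)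
    = ε ^ 3 * greenPart3 Λ f u w h := by
  simp only [greenPart3, dsum, Fin.sum_univ_four, smul_dotProduct, dotProduct_smul, smul_eq_mul]
  ring

theorem greenPart4_smul (ε : ℝ) : greenPart4 Λ f u (fun μ => ε • w μ)
    = ε ^ 4 * greenPart4 Λ f u w := by
  simp only [greenPart4, dsum, Fin.sum_univ_four, smul_dotProduct, dotProduct_smul, smul_eq_mul]
  ring

theorem greenLagrangian_eq_parts (φ : Spacetime → FieldSpace) (x : Spacetime) :
    greenLagrangian Λ f φ x = greenPart2 Λ f (φ x) (d1 φ x) (d2 φ x)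
      + greenPart3 Λ f (φ x) (d1 φ x) (d2 φ x) + greenPart4 Λ f (φ x) (d1 φ x)
      - f .V (tt φ x Λ) := by
  simp only [greenLagrangian, greenPart2, greenPart3, greenPart4, op5, op8, op10, opA_sum,
    opB_sum, op1_eq, op2_eq, op3_eq, op4_eq, op6_eq, op7_eq, op9_eq, dsum, tt]
  ring

theorem continuous_coeff {f : GreenLabel → ℝ → ℝ} (hf : SmoothCoeffs f) (l : GreenLabel)
    {X : Type*} [TopologicalSpace X] {v : X → FieldSpace} (hv : Continuous v) :
    Continuous fun z => f l ((v z ⬝ᵥ v z) / Λ ^ 2) :=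
  (contDiff_coeff (hf l) Λ (u := id) contDiff_id).continuous.comp hv

variable {X : Type*} [TopologicalSpace X] {U : X → FieldSpace} {w' : X → Fin 4 → FieldSpace}
  {h' : X → Fin 4 → Fin 4 → FieldSpace}

theorem continuous_dot {U V : X → FieldSpace} (hU : Continuous U) (hV : Continuous V) :
    Continuous fun z => U z ⬝ᵥ V z := by
  unfold dotProduct; fun_prop

theorem continuous_dsum {F : X → Fin 4 → Fin 4 → ℝ} (hF : ∀ μ ν, Continuous fun z => F z μ ν) :
    Continuous fun z => dsum (F z) := by
  unfold dsum; fun_prop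

theorem continuous_greenPart2 {f : GreenLabel → ℝ → ℝ} (hf : SmoothCoeffs f) (hU : Continuous U)
    (hw : ∀ μ, Continuous fun z => w' z μ) (hh : ∀ μ ν, Continuous fun z => h' z μ ν) :
    Continuous fun z => greenPart2 Λ f (U z) (w' z) (h' z) := by
  have hc := fun l => continuous_coeff Λ hf l hU
  have e1 := fun μ ν => continuous_dot (hw μ) (hw ν)
  have e2 := fun μ => continuous_dot (hw μ) hU
  have e3 := continuous_dsum fun μ ν => continuous_dot (hh μ ν) (hh μ ν)
  have e4 := continuous_dsum fun μ ν => (continuous_dot (hh μ ν) hU).pow 2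
  unfold greenPart2
  repeat' first
    | exact hc _
    | exact continuous_const
    | exact e3
    | exact e4
    | exact e1 _ _
    | exact e2 _
    | apply Continuous.add
    | apply Continuous.mul
    | apply Continuous.pow
    | refine continuous_finsetSum _ fun _ _ => ?_

theorem continuous_greenPart3 {f : GreenLabel → ℝ → ℝ} (hf : SmoothCoeffs f) (hU : Continuous U)
    (hw : ∀ μ, Continuous fun z => w' z μ) (hh : ∀ μ ν, Continuous fun z => h' z μ ν) :
    Continuous fun z => greenPart3 Λ f (U z) (w' z) (h' z) := by
  have hc := fun l => continuous_coeff Λ hf l hU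
  have e1 := fun μ ν => continuous_dot (hw μ) (hw ν)
  have e2 := fun μ => continuous_dot (hw μ) hU
  have e5 := fun μ ν => continuous_dot (hh μ ν) hU
  have e3 := continuous_dsum fun μ ν => (continuous_dot (hh μ ν) (hw μ)).mul (e2 ν)
  have e4 := continuous_dsum fun μ ν => (e5 μ ν).mul (e1 μ ν)
  have e6 := continuous_dsum fun μ ν => ((e5 μ ν).mul (e2 μ)).mul (e2 ν)
  unfold greenPart3
  repeat' first
    | exact hc _
    | exact continuous_const
    | exact e3
    | exact e4
    | exact e6
    | exact e1 _ _
    | exact e2 _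
    | apply Continuous.add
    | apply Continuous.mul
    | apply Continuous.pow
    | refine continuous_finsetSum _ fun _ _ => ?_

theorem continuous_greenPart4 {f : GreenLabel → ℝ → ℝ} (hf : SmoothCoeffs f) (hU : Continuous U)
    (hw : ∀ μ, Continuous fun z => w' z μ) :
    Continuous fun z => greenPart4 Λ f (U z) (w' z) := by
  have hc := fun l => continuous_coeff Λ hf l hU
  have e1 := fun μ ν => continuous_dot (hw μ) (hw ν)
  have e2 := fun μ => continuous_dot (hw μ) hU
  have e3 := continuous_dsum fun μ ν => (e1 μ ν).pow 2
  have e4 := continuous_dsum fun μ ν => ((e1 μ ν).mul (e2 μ)).mul (e2 ν)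
  unfold greenPart4
  repeat' first
    | exact hc _
    | exact continuous_const
    | exact e3
    | exact e4
    | exact e1 _ _
    | exact e2 _
    | apply Continuous.add
    | apply Continuous.mul
    | apply Continuous.pow
    | refine continuous_finsetSum _ fun _ _ => ?_

end parts

section vanish

variable {Λ : ℝ} {f : GreenLabel → ℝ → ℝ} (a b c : Wave) (r : ℝ)

theorem greenLagrangian_waveField (hV : ∀ t, 0 ≤ t → f .V t = 0) (ε x y : ℝ) :
    greenLagrangian Λ f (waveField a b c r ε) (planePoint x y)
      = ε ^ 2 * greenPart2 Λ f (waveField a b c r ε (planePoint x y)) (waveD1 a b c x y)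
          (waveD2 a b c x y)
        + ε ^ 3 * greenPart3 Λ f (waveField a b c r ε (planePoint x y)) (waveD1 a b c x y)
          (waveD2 a b c x y)
        + ε ^ 4 * greenPart4 Λ f (waveField a b c r ε (planePoint x y)) (waveD1 a b c x y) := by
  rw [greenLagrangian_eq_parts, hV _ (tt_nonneg _ _ _), sub_zero, ← greenPart2_smul,
    ← greenPart3_smul, ← greenPart4_smul]
  have h1 : d1 (waveField a b c r ε) (planePoint x y) = fun μ => ε • waveD1 a b c x y μ :=
    funext fun μ => d1_waveField a b c r ε _ μ
  have h2 : d2 (waveField a b c r ε) (planePoint x y) = fun μ ν => ε • waveD2 a b c x y μ ν :=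
    funext fun μ => funext fun ν => d2_waveField a b c r ε _ μ ν
  rw [h1, h2]

theorem waveField_zero (x : Spacetime) : waveField a b c r 0 x = Pi.single 0 r := by
  funext i
  fin_cases i <;> simp [waveField]

theorem continuous_waveField :
    Continuous fun p : ℝ × ℝ × ℝ => waveField a b c r p.1 (planePoint p.2.1 p.2.2) := by
  have h : ∀ W : Wave, Continuous fun p : ℝ × ℝ × ℝ => W.fn (planePoint p.2.1 p.2.2) := fun W =>
    (W.contDiff_fn.continuous.comp continuous_planePoint).comp continuous_snd
  have ha := h a
  have hb := h b
  have hc := h c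
  refine continuous_pi fun i => ?_
  fin_cases i <;> simp [waveField] <;> fun_prop

theorem continuous_waveD1 (μ : Fin 4) :
    Continuous fun p : ℝ × ℝ × ℝ => waveD1 a b c p.2.1 p.2.2 μ := by
  have h : ∀ W : Wave, Continuous fun p : ℝ × ℝ × ℝ => W.grad p.2.1 p.2.2 μ := fun W =>
    (W.continuous_grad μ).comp continuous_snd
  refine continuous_pi fun i => ?_
  fin_cases i
  · exact h b
  · exact h a
  · exact h c
  · exact continuous_const

theorem continuous_waveD2 (μ ν : Fin 4) :
    Continuous fun p : ℝ × ℝ × ℝ => waveD2 a b c p.2.1 p.2.2 μ ν := by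
  have h : ∀ W : Wave, Continuous fun p : ℝ × ℝ × ℝ => W.hess p.2.1 p.2.2 μ ν := fun W =>
    (W.continuous_hess μ ν).comp continuous_snd
  refine continuous_pi fun i => ?_
  fin_cases i
  · exact h b
  · exact h a
  · exact h c
  · exact continuous_const

theorem torusIntegral_greenPart2 (hf : SmoothCoeffs f)
    (hT : IsTotalDerivative (greenLagrangian Λ f)) (hV : ∀ t, 0 ≤ t → f .V t = 0) :
    torusIntegral (fun x y => greenPart2 Λ f (Pi.single 0 r) (waveD1 a b c x y)
      (waveD2 a b c x y)) = 0 := by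
  have hU := continuous_waveField a b c r
  have h1 := continuous_waveD1 a b c
  have h2 := continuous_waveD2 a b c
  have p2 := continuous_greenPart2 Λ hf hU h1 h2
  have p3 := continuous_greenPart3 Λ hf hU h1 h2
  have p4 := continuous_greenPart4 Λ hf hU h1
  have := torusIntegral_zero_of_scaled (H := fun ε x y =>
    greenPart2 Λ f (waveField a b c r ε (planePoint x y)) (waveD1 a b c x y) (waveD2 a b c x y)
    + ε * greenPart3 Λ f (waveField a b c r ε (planePoint x y)) (waveD1 a b c x y)
      (waveD2 a b c x y)
    + ε ^ 2 * greenPart4 Λ f (waveField a b c r ε (planePoint x y)) (waveD1 a b c x y))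
    ((p2.add (continuous_fst.mul p3)).add ((continuous_fst.pow 2).mul p4)) fun ε hε => by
      have h := hT.torusIntegral_eq_zero (isPlaneWave_waveField a b c r ε)
      simp only [greenLagrangian_waveField a b c r hV] at h
      refine (mul_eq_zero.1 ?_).resolve_left (pow_ne_zero 2 hε)
      rw [← torusIntegral_const_mul, ← h]
      congr 1
      funext x y
      ring
  simpa [waveField_zero] using this

theorem torusIntegral_greenPart3 (hf : SmoothCoeffs f)
    (hT : IsTotalDerivative (greenLagrangian Λ f)) (hV : ∀ t, 0 ≤ t → f .V t = 0)
    (h2 : ∀ u w h, greenPart2 Λ f u w h = 0) :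
    torusIntegral (fun x y => greenPart3 Λ f (Pi.single 0 r) (waveD1 a b c x y)
      (waveD2 a b c x y)) = 0 := by
  have hU := continuous_waveField a b c r
  have d1 := continuous_waveD1 a b c
  have d2 := continuous_waveD2 a b c
  have p3 := continuous_greenPart3 Λ hf hU d1 d2
  have p4 := continuous_greenPart4 Λ hf hU d1
  have := torusIntegral_zero_of_scaled (H := fun ε x y =>
    greenPart3 Λ f (waveField a b c r ε (planePoint x y)) (waveD1 a b c x y) (waveD2 a b c x y)
    + ε * greenPart4 Λ f (waveField a b c r ε (planePoint x y)) (waveD1 a b c x y))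
    (p3.add (continuous_fst.mul p4)) fun ε hε => by
      have h := hT.torusIntegral_eq_zero (isPlaneWave_waveField a b c r ε)
      simp only [greenLagrangian_waveField a b c r hV, h2] at h
      refine (mul_eq_zero.1 ?_).resolve_left (pow_ne_zero 3 hε)
      rw [← torusIntegral_const_mul, ← h]
      congr 1
      funext x y
      ring
  simpa [waveField_zero] using this

theorem torusIntegral_greenPart4 (hf : SmoothCoeffs f)
    (hT : IsTotalDerivative (greenLagrangian Λ f)) (hV : ∀ t, 0 ≤ t → f .V t = 0)
    (h2 : ∀ u w h, greenPart2 Λ f u w h = 0) (h3 : ∀ u w h, greenPart3 Λ f u w h = 0) :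
    torusIntegral (fun x y => greenPart4 Λ f (Pi.single 0 r) (waveD1 a b c x y)) = 0 := by
  have p4 := continuous_greenPart4 Λ hf (continuous_waveField a b c r) (continuous_waveD1 a b c)
  have := torusIntegral_zero_of_scaled (H := fun ε x y =>
    greenPart4 Λ f (waveField a b c r ε (planePoint x y)) (waveD1 a b c x y)) p4 fun ε hε => by
      have h := hT.torusIntegral_eq_zero (isPlaneWave_waveField a b c r ε)
      simp only [greenLagrangian_waveField a b c r hV, h2, h3] at h
      refine (mul_eq_zero.1 ?_).resolve_left (pow_ne_zero 4 hε)
      rw [← torusIntegral_const_mul, ← h]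
      congr 1
      funext x y
      ring
  simpa [waveField_zero] using this

end vanish

/-! ### Independence of the box-free Lagrangians -/

/-- A smooth `2π`-periodic function of one variable with its first two derivatives. -/
structure PeriodicFn where
  f : ℝ → ℝ
  f' : ℝ → ℝ
  f'' : ℝ → ℝ
  smooth : ContDiff ℝ ∞ f
  per : ∀ x, f (x + 2 * Real.pi) = f x
  deriv : ∀ x, HasDerivAt f (f' x) x
  deriv' : ∀ x, HasDerivAt f' (f'' x) x

/-- Constants. -/
def PeriodicFn.const (k : ℝ) : PeriodicFn where
  f := fun _ => k
  f' := fun _ => 0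
  f'' := fun _ => 0
  smooth := contDiff_const
  per _ := rfl
  deriv x := hasDerivAt_const x k
  deriv' x := hasDerivAt_const x 0

/-- `sin (k x)`. -/
def PeriodicFn.sin (k : ℕ) : PeriodicFn where
  f := fun x => Real.sin (k * x)
  f' := fun x => k * Real.cos (k * x)
  f'' := fun x => -(k ^ 2 * Real.sin (k * x))
  smooth := Real.contDiff_sin.comp (contDiff_const.mul contDiff_id)
  per x := by
    rw [mul_add]
    exact Real.sin_add_nat_mul_two_pi _ k
  deriv x := by
    have := (Real.hasDerivAt_sin (k * x)).comp x ((hasDerivAt_id' x).const_mul (k : ℝ))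
    exact this.congr_deriv (by ring)
  deriv' x := by
    have := ((Real.hasDerivAt_cos (k * x)).comp x
      ((hasDerivAt_id' x).const_mul (k : ℝ))).const_mul (k : ℝ)
    exact this.congr_deriv (by ring)

/-- `cos (k x)`. -/
def PeriodicFn.cos (k : ℕ) : PeriodicFn where
  f := fun x => Real.cos (k * x)
  f' := fun x => -(k * Real.sin (k * x))
  f'' := fun x => -(k ^ 2 * Real.cos (k * x))
  smooth := Real.contDiff_cos.comp (contDiff_const.mul contDiff_id)
  per x := by
    rw [mul_add]
    exact Real.cos_add_nat_mul_two_pi _ k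
  deriv x := by
    have := (Real.hasDerivAt_cos (k * x)).comp x ((hasDerivAt_id' x).const_mul (k : ℝ))
    exact this.congr_deriv (by ring)
  deriv' x := by
    have := (((Real.hasDerivAt_sin (k * x)).comp x
      ((hasDerivAt_id' x).const_mul (k : ℝ))).const_mul (k : ℝ)).neg
    exact this.congr_deriv (by ring)

/-- The product of functions of the two variables. -/
def Wave.prod (p q : PeriodicFn) : Wave where
  f := fun x y => p.f x * q.f y
  f1 := fun x y => p.f' x * q.f y
  f2 := fun x y => p.f x * q.f' y
  f11 := fun x y => p.f'' x * q.f y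
  f12 := fun x y => p.f' x * q.f' y
  f22 := fun x y => p.f x * q.f'' y
  smooth := (p.smooth.comp contDiff_fst).mul (q.smooth.comp contDiff_snd)
  per1 x y := by rw [p.per]
  per2 x y := by rw [q.per]
  deriv1 x y := (p.deriv x).mul_const _
  deriv2 x y := (q.deriv y).const_mul _
  deriv11 x y := (p.deriv' x).mul_const _
  deriv12 x y := (p.deriv x).mul_const _
  deriv21 x y := (q.deriv y).const_mul _
  deriv22 x y := (q.deriv' y).const_mul _

/-- The sum of two waves. -/
def Wave.add (v w : Wave) : Wave where
  f := fun x y => v.f x y + w.f x y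
  f1 := fun x y => v.f1 x y + w.f1 x y
  f2 := fun x y => v.f2 x y + w.f2 x y
  f11 := fun x y => v.f11 x y + w.f11 x y
  f12 := fun x y => v.f12 x y + w.f12 x y
  f22 := fun x y => v.f22 x y + w.f22 x y
  smooth := v.smooth.add w.smooth
  per1 x y := by rw [v.per1, w.per1]
  per2 x y := by rw [v.per2, w.per2]
  deriv1 x y := (v.deriv1 x y).add (w.deriv1 x y)
  deriv2 x y := (v.deriv2 x y).add (w.deriv2 x y)
  deriv11 x y := (v.deriv11 x y).add (w.deriv11 x y)
  deriv12 x y := (v.deriv12 x y).add (w.deriv12 x y)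
  deriv21 x y := (v.deriv21 x y).add (w.deriv21 x y)
  deriv22 x y := (v.deriv22 x y).add (w.deriv22 x y)

/-- `0`. -/
def Wave.zero : Wave := Wave.prod (.const 0) (.const 0)
/-- `sin (k x)`. -/
def Wave.sinX (k : ℕ) : Wave := Wave.prod (.sin k) (.const 1)
/-- `cos (2 x)`. -/
def Wave.cos2X : Wave := Wave.prod (.cos 2) (.const 1)
/-- `sin y`. -/
def Wave.sinY : Wave := Wave.prod (.const 1) (.sin 1)
/-- `sin x cos y`. -/
def Wave.sinXcosY : Wave := Wave.prod (.sin 1) (.cos 1)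

theorem et_zero : et 0 = 1 := rfl
theorem et_one : et 1 = -1 := rfl
theorem et_two : et 2 = -1 := rfl
theorem et_three : et 3 = -1 := rfl

section eval

variable (Λ : ℝ) (f : GreenLabel → ℝ → ℝ) (a b c : Wave) (r x y : ℝ)

theorem dot_four (u v : FieldSpace) : u ⬝ᵥ v = u 0 * v 0 + u 1 * v 1 + u 2 * v 2 + u 3 * v 3 := by
  simp [dotProduct, Fin.sum_univ_four]

theorem waveD1_dot (μ ν : Fin 4) : waveD1 a b c x y μ ⬝ᵥ waveD1 a b c x y ν
    = b.grad x y μ * b.grad x y ν + a.grad x y μ * a.grad x y ν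
      + c.grad x y μ * c.grad x y ν := by
  simp [dot_four, waveD1]
  ring

theorem waveD1_dot_single (μ : Fin 4) : waveD1 a b c x y μ ⬝ᵥ Pi.single 0 r
    = b.grad x y μ * r := by
  simp [waveD1]

theorem waveD2_dot (μ ν : Fin 4) : waveD2 a b c x y μ ν ⬝ᵥ waveD2 a b c x y μ ν
    = b.hess x y μ ν ^ 2 + a.hess x y μ ν ^ 2 + c.hess x y μ ν ^ 2 := by
  simp [dot_four, waveD2, sq]
  ring

theorem waveD2_dot_waveD1 (μ ν : Fin 4) : waveD2 a b c x y μ ν ⬝ᵥ waveD1 a b c x y μ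
    = b.hess x y μ ν * b.grad x y μ + a.hess x y μ ν * a.grad x y μ
      + c.hess x y μ ν * c.grad x y μ := by
  simp [dot_four, waveD2, waveD1]
  ring

theorem waveD2_dot_single (μ ν : Fin 4) : waveD2 a b c x y μ ν ⬝ᵥ Pi.single 0 r
    = b.hess x y μ ν * r := by
  simp [waveD2]

theorem single_dot_self : (Pi.single 0 r : FieldSpace) ⬝ᵥ Pi.single 0 r = r ^ 2 := by
  simp [sq]

theorem greenPart2_wave :
    greenPart2 Λ f (Pi.single 0 r) (waveD1 a b c x y) (waveD2 a b c x y)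
      = -(1 / 2) * (b.f1 x y ^ 2 + b.f2 x y ^ 2 + a.f1 x y ^ 2 + a.f2 x y ^ 2
        + c.f1 x y ^ 2 + c.f2 x y ^ 2) * f .Fa (r ^ 2 / Λ ^ 2)
      - r ^ 2 * (b.f1 x y ^ 2 + b.f2 x y ^ 2) * f .Fb (r ^ 2 / Λ ^ 2)
      + 1 / Λ ^ 2 * (b.f11 x y ^ 2 + 2 * b.f12 x y ^ 2 + b.f22 x y ^ 2
        + a.f11 x y ^ 2 + 2 * a.f12 x y ^ 2 + a.f22 x y ^ 2
        + c.f11 x y ^ 2 + 2 * c.f12 x y ^ 2 + c.f22 x y ^ 2) * f .F1 (r ^ 2 / Λ ^ 2)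
      + r ^ 2 / Λ ^ 4 * (b.f11 x y ^ 2 + 2 * b.f12 x y ^ 2 + b.f22 x y ^ 2)
        * f .F2 (r ^ 2 / Λ ^ 2) := by
  simp only [greenPart2, dsum, Fin.sum_univ_four, waveD1_dot, waveD1_dot_single, waveD2_dot,
    waveD2_dot_single, single_dot_self, et_zero, et_one, et_two, et_three, Wave.grad, Wave.hess]
  simp
  ring

theorem greenPart3_wave :
    greenPart3 Λ f (Pi.single 0 r) (waveD1 a b c x y) (waveD2 a b c x y)
      = r / Λ ^ 4 * ((b.f11 x y * b.f1 x y + a.f11 x y * a.f1 x y + c.f11 x y * c.f1 x y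
          + b.f12 x y * b.f2 x y + a.f12 x y * a.f2 x y + c.f12 x y * c.f2 x y) * b.f1 x y
        + (b.f12 x y * b.f1 x y + a.f12 x y * a.f1 x y + c.f12 x y * c.f1 x y
          + b.f22 x y * b.f2 x y + a.f22 x y * a.f2 x y + c.f22 x y * c.f2 x y) * b.f2 x y)
        * f .F3 (r ^ 2 / Λ ^ 2)
      + r / Λ ^ 4 * (b.f11 x y * (b.f1 x y ^ 2 + a.f1 x y ^ 2 + c.f1 x y ^ 2)
        + 2 * b.f12 x y * (b.f1 x y * b.f2 x y + a.f1 x y * a.f2 x y + c.f1 x y * c.f2 x y)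
        + b.f22 x y * (b.f2 x y ^ 2 + a.f2 x y ^ 2 + c.f2 x y ^ 2)) * f .F4 (r ^ 2 / Λ ^ 2)
      + r ^ 3 / Λ ^ 6 * (b.f11 x y * b.f1 x y ^ 2 + 2 * b.f12 x y * b.f1 x y * b.f2 x y
        + b.f22 x y * b.f2 x y ^ 2) * f .F7 (r ^ 2 / Λ ^ 2) := by
  simp only [greenPart3, dsum, Fin.sum_univ_four, waveD1_dot, waveD1_dot_single,
    waveD2_dot_waveD1, waveD2_dot_single, single_dot_self, et_zero, et_one, et_two, et_three,
    Wave.grad, Wave.hess]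
  simp
  ring

theorem greenPart4_wave :
    greenPart4 Λ f (Pi.single 0 r) (waveD1 a b c x y)
      = 1 / Λ ^ 4 * (b.f1 x y ^ 2 + b.f2 x y ^ 2 + a.f1 x y ^ 2 + a.f2 x y ^ 2
        + c.f1 x y ^ 2 + c.f2 x y ^ 2) ^ 2 * f .F5 (r ^ 2 / Λ ^ 2)
      + 1 / Λ ^ 4 * ((b.f1 x y ^ 2 + a.f1 x y ^ 2 + c.f1 x y ^ 2) ^ 2
        + 2 * (b.f1 x y * b.f2 x y + a.f1 x y * a.f2 x y + c.f1 x y * c.f2 x y) ^ 2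
        + (b.f2 x y ^ 2 + a.f2 x y ^ 2 + c.f2 x y ^ 2) ^ 2) * f .F6 (r ^ 2 / Λ ^ 2)
      + r ^ 2 / Λ ^ 6 * (b.f1 x y ^ 2 + b.f2 x y ^ 2 + a.f1 x y ^ 2 + a.f2 x y ^ 2
        + c.f1 x y ^ 2 + c.f2 x y ^ 2) * (b.f1 x y ^ 2 + b.f2 x y ^ 2) * f .F8 (r ^ 2 / Λ ^ 2)
      + r ^ 2 / Λ ^ 6 * ((b.f1 x y ^ 2 + a.f1 x y ^ 2 + c.f1 x y ^ 2) * b.f1 x y ^ 2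
        + 2 * (b.f1 x y * b.f2 x y + a.f1 x y * a.f2 x y + c.f1 x y * c.f2 x y)
          * b.f1 x y * b.f2 x y
        + (b.f2 x y ^ 2 + a.f2 x y ^ 2 + c.f2 x y ^ 2) * b.f2 x y ^ 2) * f .F9 (r ^ 2 / Λ ^ 2)
      + r ^ 4 / Λ ^ 8 * (b.f1 x y ^ 2 + b.f2 x y ^ 2) ^ 2 * f .F10 (r ^ 2 / Λ ^ 2) := by
  simp only [greenPart4, dsum, Fin.sum_univ_four, waveD1_dot, waveD1_dot_single,
    single_dot_self, et_zero, et_one, et_two, et_three, Wave.grad, Wave.hess]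
  simp
  ring

end eval

open Real in
theorem torusIntegral_trig {F : ℝ → ℝ → ℝ} (a0 a1 a2 a3 a4 a5 a6 : ℝ → ℝ) (p0 p2 p4 : ℝ)
    (hF : ∀ x y, F x y = a0 y + a1 y * sin x + a2 y * sin x ^ 2 + a3 y * sin x ^ 3
      + a4 y * sin x ^ 4 + a5 y * sin x ^ 5 + a6 y * sin x ^ 6)
    (hG : ∀ y, 2 * a0 y + a2 y + 3 / 4 * a4 y + 5 / 8 * a6 y
      = p0 + p2 * sin y ^ 2 + p4 * sin y ^ 4) :
    torusIntegral F = π ^ 2 * (2 * p0 + p2 + 3 / 4 * p4) := by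
  have h1 : ∀ y, ∫ x in (0 : ℝ)..2 * π, F x y = π * (p0 + p2 * sin y ^ 2 + p4 * sin y ^ 4) :=
    fun y => by
    rw [← hG, ← integral_trig (a0 y) (a1 y) (a2 y) (a3 y) (a4 y) (a5 y) (a6 y) 0 0 0 0 0 0]
    refine intervalIntegral.integral_congr fun x _ => ?_
    rw [hF]
    ring
  unfold torusIntegral
  simp only [h1, intervalIntegral.integral_const_mul]
  rw [show ∫ y in (0 : ℝ)..2 * π, (p0 + p2 * sin y ^ 2 + p4 * sin y ^ 4)
    = π * (2 * p0 + p2 + 3 / 4 * p4) by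
      have := integral_trig p0 0 p2 0 p4 0 0 0 0 0 0 0 0
      simp only [zero_mul, add_zero, mul_zero] at this
      rw [this]]
  ring

section tests

open Real

variable {Λ : ℝ} {f : GreenLabel → ℝ → ℝ}

theorem pi_sq_mul_eq_zero {s : ℝ} (h : π ^ 2 * s = 0) : s = 0 :=
  (mul_eq_zero.1 h).resolve_left (pow_ne_zero 2 pi_ne_zero)

theorem green_V_eq_zero (hΛ : 0 < Λ) (hT : IsTotalDerivative (greenLagrangian Λ f)) (t : ℝ)
    (ht : 0 ≤ t) : f .V t = 0 := by
  obtain ⟨K, hK, h⟩ := hT.exists_local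
  let φ : Spacetime → FieldSpace := fun _ => Pi.single 0 (√t * Λ)
  have hφ : ContDiff ℝ ∞ φ := contDiff_const
  have h1 : d1 φ = fun _ _ => 0 := by
    funext x μ i; exact pd_const _
  have h2 : d2 φ = fun _ _ _ => 0 := by
    funext x μ ν i; simp only [d2, h1]; exact pd_const _
  have h3 : tt φ 0 Λ = t := by
    simp only [tt, φ, single_dot_self]
    rw [mul_pow, sq_sqrt ht, mul_div_cancel_right₀ _ (pow_ne_zero 2 hΛ.ne')]
  have h4 : ∀ μ, pd μ (K μ φ) 0 = 0 := fun μ => by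
    have : K μ φ = fun _ => K μ φ 0 := funext fun x => by
      have := (hK μ).translate hφ (v := x) (fun _ => rfl) 0
      rwa [zero_add] at this
    rw [this, pd_const]
  have := h φ hφ 0
  rw [greenLagrangian_eq_parts, h3] at this
  simpa [h1, h2, h4, greenPart2, greenPart3, greenPart4, dsum] using this

variable (Λ f) in
/-- The coefficients of the terms of second order vanish. -/
theorem green_order_two (hΛ : Λ ≠ 0) {r : ℝ} (hr : r ≠ 0)
    (h : ∀ a b c : Wave, torusIntegral (fun x y => greenPart2 Λ f (Pi.single 0 r)
      (waveD1 a b c x y) (waveD2 a b c x y)) = 0) :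
    f .Fa (r ^ 2 / Λ ^ 2) = 0 ∧ f .Fb (r ^ 2 / Λ ^ 2) = 0 ∧ f .F1 (r ^ 2 / Λ ^ 2) = 0
      ∧ f .F2 (r ^ 2 / Λ ^ 2) = 0 := by
  simp only [greenPart2_wave] at h
  generalize f .Fa (r ^ 2 / Λ ^ 2) = Fa at *
  generalize f .Fb (r ^ 2 / Λ ^ 2) = Fb at *
  generalize f .F1 (r ^ 2 / Λ ^ 2) = F1 at *
  generalize f .F2 (r ^ 2 / Λ ^ 2) = F2 at *
  have e1 := pi_sq_mul_eq_zero ((torusIntegral_trig (fun _ => -(1 / 2) * Fa) 0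
    (fun _ => 1 / 2 * Fa + 1 / Λ ^ 2 * F1) 0 0 0 0 (-(1 / 2) * Fa + 1 / Λ ^ 2 * F1) 0 0
    (fun x y => by
      have e := sin_sq_add_cos_sq x
      simp only [Wave.sinX, Wave.zero, Wave.prod, PeriodicFn.const, PeriodicFn.sin]
      simp
      grind) (fun y => by simp; ring)).symm.trans (h (.sinX 1) .zero .zero))
  have e2 := pi_sq_mul_eq_zero ((torusIntegral_trig (fun _ => -2 * Fa) 0
    (fun _ => 8 * Fa + 64 / Λ ^ 2 * F1) 0 (fun _ => -8 * Fa - 64 / Λ ^ 2 * F1) 0 0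
    (-2 * Fa + 16 / Λ ^ 2 * F1) 0 0
    (fun x y => by
      have e := sin_sq_add_cos_sq x
      simp only [Wave.sinX, Wave.zero, Wave.prod, PeriodicFn.const, PeriodicFn.sin]
      simp [sin_two_mul, cos_two_mul]
      grind) (fun y => by simp; ring)).symm.trans (h (.sinX 2) .zero .zero))
  have e3 := pi_sq_mul_eq_zero ((torusIntegral_trig (fun _ => -(1 / 2) * (Fa + 2 * r ^ 2 * Fb)) 0
    (fun _ => 1 / 2 * (Fa + 2 * r ^ 2 * Fb) + (1 / Λ ^ 2 * F1 + r ^ 2 / Λ ^ 4 * F2)) 0 0 0 0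
    (-(1 / 2) * (Fa + 2 * r ^ 2 * Fb) + (1 / Λ ^ 2 * F1 + r ^ 2 / Λ ^ 4 * F2)) 0 0
    (fun x y => by
      have e := sin_sq_add_cos_sq x
      simp only [Wave.sinX, Wave.zero, Wave.prod, PeriodicFn.const, PeriodicFn.sin]
      simp
      grind) (fun y => by simp; ring)).symm.trans (h .zero (.sinX 1) .zero))
  have e4 := pi_sq_mul_eq_zero ((torusIntegral_trig (fun _ => -2 * (Fa + 2 * r ^ 2 * Fb)) 0
    (fun _ => 8 * (Fa + 2 * r ^ 2 * Fb) + 64 * (1 / Λ ^ 2 * F1 + r ^ 2 / Λ ^ 4 * F2)) 0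
    (fun _ => -8 * (Fa + 2 * r ^ 2 * Fb) - 64 * (1 / Λ ^ 2 * F1 + r ^ 2 / Λ ^ 4 * F2)) 0 0
    (-2 * (Fa + 2 * r ^ 2 * Fb) + 16 * (1 / Λ ^ 2 * F1 + r ^ 2 / Λ ^ 4 * F2)) 0 0
    (fun x y => by
      have e := sin_sq_add_cos_sq x
      simp only [Wave.sinX, Wave.zero, Wave.prod, PeriodicFn.const, PeriodicFn.sin]
      simp [sin_two_mul, cos_two_mul]
      grind) (fun y => by simp; ring)).symm.trans (h .zero (.sinX 2) .zero))
  have hF1 : 1 / Λ ^ 2 * F1 = 0 := by linear_combination (-1 / 6) * e1 + (1 / 24) * e2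
  have hFa : Fa = 0 := by linear_combination 2 * hF1 - e1
  have hF2 : r ^ 2 / Λ ^ 4 * F2 = 0 := by
    linear_combination (-1 / 6) * e3 + (1 / 24) * e4 - hF1
  have hFb : r ^ 2 * Fb = 0 := by linear_combination hF2 + hF1 - (1 / 2) * e3 - (1 / 2) * hFa
  refine ⟨hFa, ?_, ?_, ?_⟩
  · simpa [hr] using hFb
  · simpa [hΛ] using hF1
  · simpa [hΛ, hr] using hF2

variable (Λ f) in
/-- The coefficients of the terms of third order vanish. -/
theorem green_order_three (hΛ : Λ ≠ 0) {r : ℝ} (hr : r ≠ 0)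
    (h : ∀ a b c : Wave, torusIntegral (fun x y => greenPart3 Λ f (Pi.single 0 r)
      (waveD1 a b c x y) (waveD2 a b c x y)) = 0) :
    f .F3 (r ^ 2 / Λ ^ 2) = 0 ∧ f .F4 (r ^ 2 / Λ ^ 2) = 0 ∧ f .F7 (r ^ 2 / Λ ^ 2) = 0 := by
  simp only [greenPart3_wave] at h
  generalize hA : r / Λ ^ 4 * f .F3 (r ^ 2 / Λ ^ 2) = A at *
  generalize hB : r / Λ ^ 4 * f .F4 (r ^ 2 / Λ ^ 2) = B at *
  generalize hC : r ^ 3 / Λ ^ 6 * f .F7 (r ^ 2 / Λ ^ 2) = C at *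
  have hc : ∀ k X F : ℝ, k * X * F = X * (k * F) := fun k X F => by ring
  simp only [hc, hA, hB, hC] at h
  have e1 := pi_sq_mul_eq_zero ((torusIntegral_trig
    (fun _ => -4 * B) 0 (fun _ => 4 * A + 12 * B - 64 * (A + B + C)) 0
    (fun _ => -4 * A - 8 * B + 192 * (A + B + C)) 0 (fun _ => -128 * (A + B + C))
    (A - 2 * B) 0 0
    (fun x y => by
      have e := sin_sq_add_cos_sq x
      simp only [Wave.sinX, Wave.cos2X, Wave.zero, Wave.prod, PeriodicFn.const, PeriodicFn.sin,
        PeriodicFn.cos]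
      simp [sin_two_mul, cos_two_mul]
      grind) (fun y => by simp; ring)).symm.trans (h (.sinX 1) .cos2X .zero))
  have e2 := pi_sq_mul_eq_zero ((torusIntegral_trig
    (fun y => -4 * B * (1 - sin y ^ 2)) 0
    (fun y => 4 * A * (1 - 2 * sin y ^ 2) + 12 * B * (1 - sin y ^ 2) - 64 * (A + B + C)) 0
    (fun y => -4 * A * (1 - 2 * sin y ^ 2) - 8 * B * (1 - sin y ^ 2) + 192 * (A + B + C)) 0
    (fun _ => -128 * (A + B + C)) (A - 2 * B) (-2 * A + 2 * B) 0
    (fun x y => by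
      have e := sin_sq_add_cos_sq x
      have e' := sin_sq_add_cos_sq y
      simp only [Wave.sinXcosY, Wave.cos2X, Wave.zero, Wave.prod, PeriodicFn.const, PeriodicFn.sin,
        PeriodicFn.cos]
      simp [sin_two_mul, cos_two_mul]
      grind) (fun y => by simp; ring)).symm.trans (h .sinXcosY .cos2X .zero))
  have e3 := pi_sq_mul_eq_zero ((torusIntegral_trig
    (fun y => (A + B + C) * (-4 * (1 - sin y ^ 2)))
    (fun y => (A + B + C) * (32 * cos y - (1 - sin y ^ 2) * cos y + 2 * sin y ^ 2 * cos y))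
    (fun y => (A + B + C) * (-44 - 28 * sin y ^ 2))
    (fun y => (A + B + C) * (-112 * cos y + (1 - sin y ^ 2) * cos y - 3 * sin y ^ 2 * cos y))
    (fun y => (A + B + C) * (176 + 24 * sin y ^ 2))
    (fun y => (A + B + C) * (80 * cos y))
    (fun _ => (A + B + C) * (-128)) 0 (-2 * (A + B + C)) 0
    (fun x y => by
      have e := sin_sq_add_cos_sq x
      have e' := sin_sq_add_cos_sq y
      simp only [Wave.sinXcosY, Wave.cos2X, Wave.zero, Wave.prod, Wave.add, PeriodicFn.const,
        PeriodicFn.sin, PeriodicFn.cos]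
      simp [sin_two_mul, cos_two_mul]
      grind) (fun y => by simp; ring)).symm.trans (h .zero (Wave.cos2X.add .sinXcosY) .zero))
  have hB0 : B = 0 := by linarith
  have hA0 : A = 0 := by linarith
  have hC0 : C = 0 := by linarith
  refine ⟨?_, ?_, ?_⟩
  · simpa [hr, hΛ] using hA.trans hA0
  · simpa [hr, hΛ] using hB.trans hB0
  · simpa [hr, hΛ] using hC.trans hC0

variable (Λ f) in
/-- The coefficients of the terms of fourth order vanish. -/
theorem green_order_four (hΛ : Λ ≠ 0) {r : ℝ} (hr : r ≠ 0)
    (h : ∀ a b c : Wave, torusIntegral (fun x y => greenPart4 Λ f (Pi.single 0 r)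
      (waveD1 a b c x y)) = 0) :
    f .F5 (r ^ 2 / Λ ^ 2) = 0 ∧ f .F6 (r ^ 2 / Λ ^ 2) = 0 ∧ f .F8 (r ^ 2 / Λ ^ 2) = 0
      ∧ f .F9 (r ^ 2 / Λ ^ 2) = 0 ∧ f .F10 (r ^ 2 / Λ ^ 2) = 0 := by
  simp only [greenPart4_wave] at h
  generalize hA : 1 / Λ ^ 4 * f .F5 (r ^ 2 / Λ ^ 2) = A at *
  generalize hB : 1 / Λ ^ 4 * f .F6 (r ^ 2 / Λ ^ 2) = B at *
  generalize hC : r ^ 2 / Λ ^ 6 * f .F8 (r ^ 2 / Λ ^ 2) = C at *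
  generalize hD : r ^ 2 / Λ ^ 6 * f .F9 (r ^ 2 / Λ ^ 2) = D at *
  generalize hE : r ^ 4 / Λ ^ 8 * f .F10 (r ^ 2 / Λ ^ 2) = E at *
  have ev : ∀ {a b c : Wave} (P Q R : ℝ), (∀ x y, (b.f1 x y ^ 2 + b.f2 x y ^ 2 + a.f1 x y ^ 2
      + a.f2 x y ^ 2 + c.f1 x y ^ 2 + c.f2 x y ^ 2) ^ 2 * A
      + ((b.f1 x y ^ 2 + a.f1 x y ^ 2 + c.f1 x y ^ 2) ^ 2
        + 2 * (b.f1 x y * b.f2 x y + a.f1 x y * a.f2 x y + c.f1 x y * c.f2 x y) ^ 2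
        + (b.f2 x y ^ 2 + a.f2 x y ^ 2 + c.f2 x y ^ 2) ^ 2) * B
      + (b.f1 x y ^ 2 + b.f2 x y ^ 2 + a.f1 x y ^ 2 + a.f2 x y ^ 2
        + c.f1 x y ^ 2 + c.f2 x y ^ 2) * (b.f1 x y ^ 2 + b.f2 x y ^ 2) * C
      + ((b.f1 x y ^ 2 + a.f1 x y ^ 2 + c.f1 x y ^ 2) * b.f1 x y ^ 2
        + 2 * (b.f1 x y * b.f2 x y + a.f1 x y * a.f2 x y + c.f1 x y * c.f2 x y)
          * b.f1 x y * b.f2 x y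
        + (b.f2 x y ^ 2 + a.f2 x y ^ 2 + c.f2 x y ^ 2) * b.f2 x y ^ 2) * D
      + (b.f1 x y ^ 2 + b.f2 x y ^ 2) ^ 2 * E
      = P * cos x ^ 4 + Q * (cos x ^ 2 * cos y ^ 2) + R * cos y ^ 4) →
      3 * P + 2 * Q + 3 * R = 0 := fun {a b c} P Q R hP => by
    have := pi_sq_mul_eq_zero ((torusIntegral_trig
      (fun y => P + Q * (1 - sin y ^ 2) + R * (1 - 2 * sin y ^ 2 + sin y ^ 4)) 0
      (fun y => -2 * P - Q * (1 - sin y ^ 2)) 0 (fun y => P) 0 0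
      (3 / 4 * P + Q + 2 * R) (-Q - 4 * R) (2 * R)
      (fun x y => by
        refine Eq.trans (b := P * cos x ^ 4 + Q * (cos x ^ 2 * cos y ^ 2) + R * cos y ^ 4) ?_ ?_
        · rw [← hP, ← hA, ← hB, ← hC, ← hD, ← hE]
          ring
        have e := sin_sq_add_cos_sq x
        have e' := sin_sq_add_cos_sq y
        simp
        grind) (fun y => by simp; ring)).symm.trans (h a b c))
    linarith
  have e1 := ev (a := .sinX 1) (b := .zero) (c := .zero) (A + B) 0 0 fun x y => by
    simp only [Wave.sinX, Wave.zero, Wave.prod, PeriodicFn.const, PeriodicFn.sin]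
    simp; ring
  have e2 := ev (a := .sinX 1) (b := .zero) (c := .sinY) (A + B) (2 * A) (A + B) fun x y => by
    simp only [Wave.sinX, Wave.sinY, Wave.zero, Wave.prod, PeriodicFn.const, PeriodicFn.sin]
    simp; ring
  have e3 := ev (a := .zero) (b := .sinX 1) (c := .zero) (A + B + C + D + E) 0 0 fun x y => by
    simp only [Wave.sinX, Wave.zero, Wave.prod, PeriodicFn.const, PeriodicFn.sin]
    simp; ring
  have e4 := ev (a := .sinX 1) (b := .sinX 1) (c := .zero)
    (4 * A + 4 * B + 2 * C + 2 * D + E) 0 0 fun x y => by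
    simp only [Wave.sinX, Wave.zero, Wave.prod, PeriodicFn.const, PeriodicFn.sin]
    simp; ring
  have e5 := ev (a := .sinY) (b := .sinX 1) (c := .zero)
    (A + B + C + D + E) (2 * A + C) (A + B) fun x y => by
    simp only [Wave.sinX, Wave.sinY, Wave.zero, Wave.prod, PeriodicFn.const, PeriodicFn.sin]
    simp; ring
  have hA0 : A = 0 := by linarith
  have hB0 : B = 0 := by linarith
  have hE0 : E = 0 := by linarith
  have hC0 : C = 0 := by linarith
  have hD0 : D = 0 := by linarith
  refine ⟨?_, ?_, ?_, ?_, ?_⟩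
  · simpa [hr, hΛ] using hA.trans hA0
  · simpa [hr, hΛ] using hB.trans hB0
  · simpa [hr, hΛ] using hC.trans hC0
  · simpa [hr, hΛ] using hD.trans hD0
  · simpa [hr, hΛ] using hE.trans hE0

theorem eq_zero_of_pos {e : ℝ → ℝ} (he : ContDiffOn ℝ ∞ e (Ici 0)) (h : ∀ t, 0 < t → e t = 0)
    (t : ℝ) (ht : 0 ≤ t) : e t = 0 := by
  have h1 : Filter.Tendsto e (nhdsWithin t (Ioi t)) (nhds (e t)) :=
    (he.continuousOn t ht).mono_left (nhdsWithin_mono t fun s (hs : t < s) => ht.trans hs.le)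
  have h2 : Filter.Tendsto e (nhdsWithin t (Ioi t)) (nhds 0) :=
    tendsto_const_nhds.congr' (Filter.eventually_of_mem self_mem_nhdsWithin
      fun s (hs : t < s) => (h s (ht.trans_lt hs)).symm)
  exact tendsto_nhds_unique h1 h2

/-- No box-free Lagrangian with non-zero coefficients is a total derivative. -/
theorem green_nonredundant (hΛ : 0 < Λ) (hf : SmoothCoeffs f)
    (hT : IsTotalDerivative (greenLagrangian Λ f)) (l : GreenLabel) (t : ℝ) (ht : 0 ≤ t) :
    f l t = 0 := by
  have hV := green_V_eq_zero hΛ hT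
  have hr : ∀ t, 0 < t → √t * Λ ≠ 0 ∧ (√t * Λ) ^ 2 / Λ ^ 2 = t := fun t ht =>
    ⟨mul_ne_zero (sqrt_ne_zero'.2 ht) hΛ.ne', by
      rw [mul_pow, sq_sqrt ht.le, mul_div_cancel_right₀ _ (pow_ne_zero 2 hΛ.ne')]⟩
  have o2 := fun t ht => green_order_two Λ f hΛ.ne' (hr t ht).1 fun a b c =>
    torusIntegral_greenPart2 a b c _ hf hT hV
  have hnn : ∀ u : FieldSpace, 0 ≤ (u ⬝ᵥ u) / Λ ^ 2 := fun u =>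
    div_nonneg (dot_self_nonneg' u) (sq_nonneg _)
  have hFa := eq_zero_of_pos (hf .Fa) fun t ht => (hr t ht).2 ▸ (o2 t ht).1
  have hFb := eq_zero_of_pos (hf .Fb) fun t ht => (hr t ht).2 ▸ (o2 t ht).2.1
  have hF1 := eq_zero_of_pos (hf .F1) fun t ht => (hr t ht).2 ▸ (o2 t ht).2.2.1
  have hF2 := eq_zero_of_pos (hf .F2) fun t ht => (hr t ht).2 ▸ (o2 t ht).2.2.2
  have h2 : ∀ u w h, greenPart2 Λ f u w h = 0 := fun u w h => by
    simp [greenPart2, hFa _ (hnn u), hFb _ (hnn u), hF1 _ (hnn u), hF2 _ (hnn u)]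
  have o3 := fun t ht => green_order_three Λ f hΛ.ne' (hr t ht).1 fun a b c =>
    torusIntegral_greenPart3 a b c _ hf hT hV h2
  have hF3 := eq_zero_of_pos (hf .F3) fun t ht => (hr t ht).2 ▸ (o3 t ht).1
  have hF4 := eq_zero_of_pos (hf .F4) fun t ht => (hr t ht).2 ▸ (o3 t ht).2.1
  have hF7 := eq_zero_of_pos (hf .F7) fun t ht => (hr t ht).2 ▸ (o3 t ht).2.2
  have h3 : ∀ u w h, greenPart3 Λ f u w h = 0 := fun u w h => by
    simp [greenPart3, hF3 _ (hnn u), hF4 _ (hnn u), hF7 _ (hnn u)]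
  have o4 := fun t ht => green_order_four Λ f hΛ.ne' (hr t ht).1 fun a b c =>
    torusIntegral_greenPart4 a b c _ hf hT hV h2 h3
  cases l
  case Fa => exact hFa t ht
  case Fb => exact hFb t ht
  case V => exact hV t ht
  case F1 => exact hF1 t ht
  case F2 => exact hF2 t ht
  case F3 => exact hF3 t ht
  case F4 => exact hF4 t ht
  case F7 => exact hF7 t ht
  case F5 => exact eq_zero_of_pos (hf .F5) (fun t ht => (hr t ht).2 ▸ (o4 t ht).1) t ht
  case F6 => exact eq_zero_of_pos (hf .F6) (fun t ht => (hr t ht).2 ▸ (o4 t ht).2.1) t ht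
  case F8 => exact eq_zero_of_pos (hf .F8) (fun t ht => (hr t ht).2 ▸ (o4 t ht).2.2.1) t ht
  case F9 => exact eq_zero_of_pos (hf .F9) (fun t ht => (hr t ht).2 ▸ (o4 t ht).2.2.2.1) t ht
  case F10 => exact eq_zero_of_pos (hf .F10) (fun t ht => (hr t ht).2 ▸ (o4 t ht).2.2.2.2) t ht

end tests

/-! ### Smooth even functions -/

section hadamard

open intervalIntegral MeasureTheory Filter Topology

/-- Moments `∫₀¹ t^k f(t r) dt`. -/
def rayMoment (k : ℕ) (f : ℝ → ℝ) (r : ℝ) : ℝ := ∫ t in (0 : ℝ)..1, t ^ k * f (t * r)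

theorem hasDerivAt_rayMoment {f : ℝ → ℝ} (hf : ContDiff ℝ ∞ f) (k : ℕ) (r : ℝ) :
    HasDerivAt (rayMoment k f) (rayMoment (k + 1) (deriv f) r) r := by
  have hc : Continuous f := hf.continuous
  have hc' : Continuous (deriv f) := hf.continuous_deriv (by simp)
  obtain ⟨C, hC⟩ := (isCompact_Icc (a := -(|r| + 1)) (b := |r| + 1)).exists_bound_of_continuousOn
    hc'.continuousOn
  have hcF : ∀ x, Continuous (fun t : ℝ => t ^ k * f (t * x)) := fun x => by fun_prop
  have hcF' : ∀ x, Continuous (fun t : ℝ => t ^ (k + 1) * deriv f (t * x)) := fun x => by fun_prop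
  refine (hasDerivAt_integral_of_dominated_loc_of_deriv_le
    (F := fun x t => t ^ k * f (t * x)) (F' := fun x t => t ^ (k + 1) * deriv f (t * x))
    (bound := fun _ => C) (Metric.ball_mem_nhds r one_pos)
    (Eventually.of_forall fun x => (hcF x).aestronglyMeasurable) ((hcF r).intervalIntegrable _ _)
    (hcF' r).aestronglyMeasurable (Eventually.of_forall fun t ht x hx => ?_)
    intervalIntegrable_const (Eventually.of_forall fun t _ x _ => ?_)).2
  · rw [uIoc_of_le zero_le_one] at ht
    have hx' : |x| ≤ |r| + 1 := by
      have := abs_sub_abs_le_abs_sub x r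
      rw [Metric.mem_ball, Real.dist_eq] at hx
      linarith
    have htx : |t * x| ≤ |r| + 1 := by
      rw [abs_mul, abs_of_pos ht.1]
      nlinarith [abs_nonneg x, ht.1, ht.2]
    rw [norm_mul]
    have h1 : ‖t ^ (k + 1)‖ ≤ 1 := by
      rw [Real.norm_eq_abs, abs_of_nonneg (pow_nonneg ht.1.le _)]
      exact pow_le_one₀ ht.1.le ht.2
    have h2 := hC (t * x) (abs_le.1 htx)
    nlinarith [norm_nonneg (t ^ (k + 1)), norm_nonneg (deriv f (t * x))]
  · have h1 : HasDerivAt f (deriv f (t * x)) (t * x) :=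
      (hf.differentiable (by simp) _).hasDerivAt
    have h2 : HasDerivAt (fun x : ℝ => t * x) t x := by simpa using (hasDerivAt_id x).const_mul t
    exact ((h1.comp x h2).const_mul (t ^ k)).congr_deriv (by ring)

theorem contDiff_deriv {f : ℝ → ℝ} (hf : ContDiff ℝ ∞ f) : ContDiff ℝ ∞ (deriv f) :=
  (contDiff_infty_iff_deriv.1 hf).2

theorem contDiff_rayMoment {f : ℝ → ℝ} (hf : ContDiff ℝ ∞ f) (k : ℕ) :
    ContDiff ℝ ∞ (rayMoment k f) := by
  rw [contDiff_infty]
  intro n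
  induction n generalizing f k with
  | zero =>
    exact contDiff_zero.2 (continuous_iff_continuousAt.2
      fun r => (hasDerivAt_rayMoment hf k r).continuousAt)
  | succ n ih =>
    rw [show ((n + 1 : ℕ) : WithTop ℕ∞) = (n : WithTop ℕ∞) + 1 by simp, contDiff_succ_iff_deriv]
    refine ⟨fun r => (hasDerivAt_rayMoment hf k r).differentiableAt, by simp, ?_⟩
    rw [show deriv (rayMoment k f) = rayMoment (k + 1) (deriv f) from
      funext fun r => (hasDerivAt_rayMoment hf k r).deriv]
    exact ih (contDiff_deriv hf) (k + 1)

/-- Hadamard's lemma on the line. -/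
theorem exists_eq_mul_of_zero {f : ℝ → ℝ} (hf : ContDiff ℝ ∞ f) (h0 : f 0 = 0) :
    ∃ h : ℝ → ℝ, ContDiff ℝ ∞ h ∧ ∀ r, f r = r * h r := by
  refine ⟨rayMoment 0 (deriv f), contDiff_rayMoment (contDiff_deriv hf) 0, fun r => ?_⟩
  have h := integral_eq_sub_of_hasDerivAt (a := 0) (b := 1) (f := fun t : ℝ => f (t * r))
    (f' := fun t => r * deriv f (t * r)) (fun t _ => by
      have h1 : HasDerivAt f (deriv f (t * r)) (t * r) :=
        (hf.differentiable (by simp) _).hasDerivAt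
      have h2 : HasDerivAt (fun t : ℝ => t * r) r t := by
        simpa using (hasDerivAt_id t).mul_const r
      exact (h1.comp t h2).congr_deriv (mul_comm _ _))
    (Continuous.intervalIntegrable (by
      have := hf.continuous_deriv (by simp)
      fun_prop) _ _)
  rw [intervalIntegral.integral_const_mul] at h
  simp only [one_mul, zero_mul, h0, sub_zero] at h
  simp only [rayMoment, pow_zero, one_mul]
  exact h.symm

theorem eq_of_mul_eq {f g : ℝ → ℝ} (hf : Continuous f) (hg : Continuous g)
    (h : ∀ r, r ≠ 0 → f r = g r) (r : ℝ) : f r = g r := by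
  have : Dense ({0}ᶜ : Set ℝ) := dense_compl_singleton 0
  exact congrFun (Continuous.ext_on this hf hg fun r hr => h r hr) r

theorem eq_zero_of_odd {f : ℝ → ℝ} (h : ∀ r, f (-r) = -f r) : f 0 = 0 := by
  have := h 0
  rw [neg_zero] at this
  linarith

theorem odd_deriv {f : ℝ → ℝ} (he : ∀ r, f (-r) = f r) (r : ℝ) :
    deriv f (-r) = -deriv f r := by
  have h : f = fun r => f (-r) := funext fun r => (he r).symm
  have h2 := congrFun (congrArg deriv h) (-r)
  rw [deriv_comp_neg] at h2
  simpa using h2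

/-- An odd smooth function is `r` times an even smooth function. -/
theorem exists_even_of_odd {f : ℝ → ℝ} (hf : ContDiff ℝ ∞ f) (ho : ∀ r, f (-r) = -f r) :
    ∃ h : ℝ → ℝ, ContDiff ℝ ∞ h ∧ (∀ r, h (-r) = h r) ∧ ∀ r, f r = r * h r := by
  obtain ⟨h, hh, hr⟩ := exists_eq_mul_of_zero hf (eq_zero_of_odd ho)
  refine ⟨h, hh, eq_of_mul_eq (hh.continuous.comp continuous_neg) hh.continuous fun r h0 => ?_, hr⟩
  have := ho r
  rw [hr, hr r] at this
  have h2 : r * h (-r) = r * h r := by linarith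
  exact mul_left_cancel₀ h0 h2

/-- An even smooth function that vanishes at `0` is `r²` times an even smooth function. -/
theorem exists_even_of_even {f : ℝ → ℝ} (hf : ContDiff ℝ ∞ f) (he : ∀ r, f (-r) = f r)
    (h0 : f 0 = 0) :
    ∃ h : ℝ → ℝ, ContDiff ℝ ∞ h ∧ (∀ r, h (-r) = h r) ∧ ∀ r, f r = r ^ 2 * h r := by
  obtain ⟨h, hh, hr⟩ := exists_eq_mul_of_zero hf h0
  have ho : ∀ r, h (-r) = -h r := by
    refine eq_of_mul_eq (hh.continuous.comp continuous_neg) hh.continuous.neg fun r h0 => ?_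
    have := he r
    rw [hr, hr r] at this
    have h2 : r * h (-r) = r * -h r := by linarith
    exact mul_left_cancel₀ h0 h2
  obtain ⟨k, hk, hke, hk'⟩ := exists_even_of_odd hh ho
  exact ⟨k, hk, hke, fun r => by rw [hr, hk']; ring⟩

theorem hasDerivWithinAt_comp_sqrt {f h : ℝ → ℝ} (hf : ContDiff ℝ ∞ f) (hh : Continuous h)
    (hr : ∀ r, deriv f r = r * h r) (t : ℝ) (ht : t ∈ Ici (0 : ℝ)) :
    HasDerivWithinAt (fun t => f (√t)) (1 / 2 * h (√t)) (Ici 0) t := by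
  have pos : ∀ t : ℝ, 0 < t → HasDerivAt (fun t => f (√t)) (1 / 2 * h (√t)) t := by
    intro t ht
    have h1 : HasDerivAt f (deriv f (√t)) (√t) := (hf.differentiable (by simp) _).hasDerivAt
    refine (h1.comp t (Real.hasDerivAt_sqrt ht.ne')).congr_deriv ?_
    rw [hr]
    have := (Real.sqrt_pos.2 ht).ne'
    field_simp
  rcases (mem_Ici.1 ht).eq_or_lt with rfl | h0
  · refine hasDerivWithinAt_Ici_of_tendsto_deriv (s := Ioi 0)
      (fun t ht => (pos t ht).differentiableAt.differentiableWithinAt)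
      (hf.continuous.comp Real.continuous_sqrt).continuousWithinAt self_mem_nhdsWithin ?_
    have hc : Continuous (fun t => 1 / 2 * h (√t)) := by fun_prop
    refine Tendsto.congr' ?_ (hc.continuousWithinAt (s := Ioi 0) (x := 0))
    filter_upwards [self_mem_nhdsWithin] with t ht
    exact (pos t ht).deriv.symm
  · exact (pos t h0).hasDerivWithinAt

/-- Whitney's theorem: an even smooth function is a smooth function of `r²`. -/
theorem contDiffOn_comp_sqrt {f : ℝ → ℝ} (hf : ContDiff ℝ ∞ f) (he : ∀ r, f (-r) = f r) :
    ContDiffOn ℝ ∞ (fun t => f (√t)) (Ici 0) := by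
  rw [contDiffOn_infty]
  intro n
  induction n generalizing f with
  | zero => exact contDiffOn_zero.2 (hf.continuous.comp Real.continuous_sqrt).continuousOn
  | succ n ih =>
    obtain ⟨h, hh, hhe, hr⟩ := exists_even_of_odd (contDiff_deriv hf) (odd_deriv he)
    rw [show ((n + 1 : ℕ) : WithTop ℕ∞) = (n : WithTop ℕ∞) + 1 by simp,
      contDiffOn_succ_iff_derivWithin (uniqueDiffOn_Ici 0)]
    have hd := hasDerivWithinAt_comp_sqrt hf hh.continuous hr
    refine ⟨fun t ht => (hd t ht).differentiableWithinAt, by simp, ?_⟩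
    refine ContDiffOn.congr (f := fun t => 1 / 2 * h (√t)) (contDiffOn_const.mul (ih hh hhe)) ?_
    exact fun t ht => (hd t ht).derivWithin (uniqueDiffOn_Ici 0 t ht)

theorem exists_coeff_of_even {f : ℝ → ℝ} (hf : ContDiff ℝ ∞ f) (he : ∀ r, f (-r) = f r) :
    ∃ g : ℝ → ℝ, ContDiffOn ℝ ∞ g (Ici 0) ∧ ∀ r, f r = g (r ^ 2) := by
  refine ⟨_, contDiffOn_comp_sqrt hf he, fun r => ?_⟩
  simp only [Real.sqrt_sq_eq_abs]
  rcases abs_choice r with h | h <;> rw [h]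
  exact (he r).symm

theorem exists_coeff_of_even_sq {f : ℝ → ℝ} (hf : ContDiff ℝ ∞ f) (he : ∀ r, f (-r) = f r)
    (h0 : f 0 = 0) :
    ∃ g : ℝ → ℝ, ContDiffOn ℝ ∞ g (Ici 0) ∧ ∀ r, f r = r ^ 2 * g (r ^ 2) := by
  obtain ⟨h, hh, hhe, hr⟩ := exists_even_of_even hf he h0
  obtain ⟨g, hg, hg'⟩ := exists_coeff_of_even hh hhe
  exact ⟨g, hg, fun r => by rw [hr, hg']⟩

theorem exists_coeff_of_even_pow_four {f : ℝ → ℝ} (hf : ContDiff ℝ ∞ f) (he : ∀ r, f (-r) = f r)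
    (h0 : f 0 = 0) (h2 : deriv (deriv f) 0 = 0) :
    ∃ g : ℝ → ℝ, ContDiffOn ℝ ∞ g (Ici 0) ∧ ∀ r, f r = r ^ 4 * g (r ^ 2) := by
  obtain ⟨h, hh, hhe, hr⟩ := exists_even_of_even hf he h0
  have hd : ∀ {k : ℝ → ℝ}, ContDiff ℝ ∞ k → ∀ r, HasDerivAt k (deriv k r) r := fun hk r =>
    (hk.differentiable (by simp) r).hasDerivAt
  have h1 : deriv f = fun r => 2 * r * h r + r ^ 2 * deriv h r := by
    rw [show f = fun r => r ^ 2 * h r from funext hr]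
    funext r
    refine HasDerivAt.deriv ?_
    simpa using (hasDerivAt_pow 2 r).fun_mul (hd hh r)
  have h3 : HasDerivAt (deriv f) (2 * h 0) 0 := by
    rw [h1]
    have e1 : HasDerivAt (fun r : ℝ => 2 * r) 2 0 := by
      simpa using (hasDerivAt_id (0 : ℝ)).const_mul 2
    simpa using (e1.fun_mul (hd hh 0)).fun_add
      ((hasDerivAt_pow 2 (0 : ℝ)).fun_mul (hd (contDiff_deriv hh) 0))
  rw [h3.deriv] at h2
  obtain ⟨g, hg, hg'⟩ := exists_coeff_of_even_sq hh hhe (by linarith)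
  exact ⟨g, hg, fun r => by rw [hr, hg']; ring⟩

end hadamard

/-- A polynomial of degree at most `4` that is `O(s⁵)` at `0` vanishes. -/
theorem polynomial_eq_zero_of_isBigO {q : Polynomial ℝ} (hq : q.natDegree ≤ 4)
    (h : (fun s => q.eval s) =O[nhds 0] (fun s : ℝ => s ^ 5)) : q = 0 := by
  by_contra hne
  obtain ⟨r, hr, hnd⟩ := Polynomial.exists_eq_pow_rootMultiplicity_mul_and_not_dvd q hne 0
  set m := q.rootMultiplicity 0
  have hm : m ≤ 4 := by
    have := Polynomial.natDegree_le_of_dvd (Polynomial.pow_rootMultiplicity_dvd q 0) hne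
    rw [map_zero, sub_zero, Polynomial.natDegree_X_pow] at this
    exact this.trans hq
  have hr0 : r.eval 0 ≠ 0 := fun h0 => hnd (Polynomial.dvd_iff_isRoot.2 h0)
  have h1 : (fun s : ℝ => s ^ m * r.eval s) =O[nhds 0] (fun s : ℝ => s ^ m * s ^ (5 - m)) := by
    refine (h.congr_left fun s => ?_).congr_right fun s => ?_
    · rw [hr]; simp
    · rw [← pow_add]; congr 1; omega
  have h2 : (fun s : ℝ => r.eval s) =O[nhdsWithin 0 {0}ᶜ] (fun s : ℝ => s ^ (5 - m)) := by
    have h3 := h1.mono (nhdsWithin_le_nhds (s := {0}ᶜ))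
    have h4 := (Asymptotics.isBigO_refl (fun s : ℝ => (s ^ m)⁻¹) (nhdsWithin 0 {0}ᶜ)).mul h3
    refine (h4.congr' ?_ ?_) <;>
    · filter_upwards [self_mem_nhdsWithin] with s hs
      have : s ^ m ≠ 0 := pow_ne_zero _ hs
      field_simp
  have h5 : Filter.Tendsto (fun s : ℝ => s ^ (5 - m)) (nhdsWithin 0 {0}ᶜ) (nhds 0) := by
    have : Continuous (fun s : ℝ => s ^ (5 - m)) := by fun_prop
    have := this.tendsto 0
    rw [zero_pow (by omega)] at this
    exact this.mono_left nhdsWithin_le_nhds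
  have h6 := h2.trans_tendsto h5
  have h7 : Filter.Tendsto (fun s : ℝ => r.eval s) (nhdsWithin 0 {0}ᶜ) (nhds (r.eval 0)) :=
    (r.continuous.tendsto 0).mono_left nhdsWithin_le_nhds
  exact hr0 (tendsto_nhds_unique h7 h6)

/-! ### Isotropic tensors of rank four -/

/-- Unit vectors. -/
def ev (a : Fin 4) : Fin 4 → ℝ := Pi.single a 1

/-- Four-linear forms on `ℝ⁴`. -/
structure FourLin (τ : (Fin 4 → ℝ) → (Fin 4 → ℝ) → (Fin 4 → ℝ) → (Fin 4 → ℝ) → ℝ) : Prop where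
  add₁ : ∀ v v' x y z, τ (v + v') x y z = τ v x y z + τ v' x y z
  smul₁ : ∀ (c : ℝ) v x y z, τ (c • v) x y z = c * τ v x y z
  add₂ : ∀ v v' x y z, τ x (v + v') y z = τ x v y z + τ x v' y z
  smul₂ : ∀ (c : ℝ) v x y z, τ x (c • v) y z = c * τ x v y z
  add₃ : ∀ v v' x y z, τ x y (v + v') z = τ x y v z + τ x y v' z
  smul₃ : ∀ (c : ℝ) v x y z, τ x y (c • v) z = c * τ x y v z
  add₄ : ∀ v v' x y z, τ x y z (v + v') = τ x y z v + τ x y z v'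
  smul₄ : ∀ (c : ℝ) v x y z, τ x y z (c • v) = c * τ x y z v

theorem eq_sum_ev (v : Fin 4 → ℝ) : v = ∑ a, v a • ev a := by
  funext i
  simp [ev, Pi.single_apply]

theorem eq_sum_of_linear {f : (Fin 4 → ℝ) → ℝ} (ha : ∀ v w, f (v + w) = f v + f w)
    (hs : ∀ (c : ℝ) v, f (c • v) = c * f v) (v : Fin 4 → ℝ) : f v = ∑ a, v a * f (ev a) := by
  conv_lhs => rw [eq_sum_ev v]
  simp only [Fin.sum_univ_four, ha, hs]

namespace FourLin

variable {τ τ' : (Fin 4 → ℝ) → (Fin 4 → ℝ) → (Fin 4 → ℝ) → (Fin 4 → ℝ) → ℝ}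

theorem swap₁₂ (h : FourLin τ) : FourLin (fun a b c d => τ b a c d) where
  add₁ v v' x y z := h.add₂ v v' x y z
  smul₁ c v x y z := h.smul₂ c v x y z
  add₂ v v' x y z := h.add₁ v v' x y z
  smul₂ c v x y z := h.smul₁ c v x y z
  add₃ v v' x y z := h.add₃ v v' y x z
  smul₃ c v x y z := h.smul₃ c v y x z
  add₄ v v' x y z := h.add₄ v v' y x z
  smul₄ c v x y z := h.smul₄ c v y x z

theorem swap₂₃ (h : FourLin τ) : FourLin (fun a b c d => τ a c b d) where
  add₁ v v' x y z := h.add₁ v v' y x z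
  smul₁ c v x y z := h.smul₁ c v y x z
  add₂ v v' x y z := h.add₃ v v' x y z
  smul₂ c v x y z := h.smul₃ c v x y z
  add₃ v v' x y z := h.add₂ v v' x y z
  smul₃ c v x y z := h.smul₂ c v x y z
  add₄ v v' x y z := h.add₄ v v' x z y
  smul₄ c v x y z := h.smul₄ c v x z y

theorem swap₃₄ (h : FourLin τ) : FourLin (fun a b c d => τ a b d c) where
  add₁ v v' x y z := h.add₁ v v' x z y
  smul₁ c v x y z := h.smul₁ c v x z y
  add₂ v v' x y z := h.add₂ v v' x z y
  smul₂ c v x y z := h.smul₂ c v x z y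
  add₃ v v' x y z := h.add₄ v v' x y z
  smul₃ c v x y z := h.smul₄ c v x y z
  add₄ v v' x y z := h.add₃ v v' x y z
  smul₄ c v x y z := h.smul₃ c v x y z

theorem apply (h : FourLin τ) (v₁ v₂ v₃ v₄ : Fin 4 → ℝ) :
    τ v₁ v₂ v₃ v₄ = ∑ a, ∑ b, ∑ c, ∑ d,
      v₁ a * (v₂ b * (v₃ c * (v₄ d * τ (ev a) (ev b) (ev c) (ev d)))) := by
  have e1 : ∀ x y z w, τ x y z w = ∑ a, x a * τ (ev a) y z w := fun x y z w =>
    eq_sum_of_linear (f := fun x => τ x y z w) (fun _ _ => h.add₁ _ _ _ _ _)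
      (fun _ _ => h.smul₁ _ _ _ _ _) x
  have e2 : ∀ x y z w, τ x y z w = ∑ a, y a * τ x (ev a) z w := fun x y z w =>
    eq_sum_of_linear (f := fun y => τ x y z w) (fun _ _ => h.add₂ _ _ _ _ _)
      (fun _ _ => h.smul₂ _ _ _ _ _) y
  have e3 : ∀ x y z w, τ x y z w = ∑ a, z a * τ x y (ev a) w := fun x y z w =>
    eq_sum_of_linear (f := fun z => τ x y z w) (fun _ _ => h.add₃ _ _ _ _ _)
      (fun _ _ => h.smul₃ _ _ _ _ _) z
  have e4 : ∀ x y z w, τ x y z w = ∑ a, w a * τ x y z (ev a) := fun x y z w =>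
    eq_sum_of_linear (f := fun w => τ x y z w) (fun _ _ => h.add₄ _ _ _ _ _)
      (fun _ _ => h.smul₄ _ _ _ _ _) w
  rw [e1]
  refine Finset.sum_congr rfl fun a _ => ?_
  rw [e2, Finset.mul_sum]
  refine Finset.sum_congr rfl fun b _ => ?_
  rw [e3, Finset.mul_sum, Finset.mul_sum]
  refine Finset.sum_congr rfl fun c _ => ?_
  rw [e4, Finset.mul_sum, Finset.mul_sum, Finset.mul_sum]

theorem ext (h : FourLin τ) (h' : FourLin τ')
    (he : ∀ a b c d, τ (ev a) (ev b) (ev c) (ev d) = τ' (ev a) (ev b) (ev c) (ev d))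
    (v₁ v₂ v₃ v₄ : Fin 4 → ℝ) : τ v₁ v₂ v₃ v₄ = τ' v₁ v₂ v₃ v₄ := by
  rw [h.apply, h'.apply]
  simp only [he]

end FourLin

/-- Reflection in the hyperplane orthogonal to `n`, for the bilinear form `diag ε`. -/
def refl (ε n v : Fin 4 → ℝ) : Fin 4 → ℝ :=
  v - (2 * (∑ i, ε i * n i * v i) / ∑ i, ε i * n i * n i) • n

/-- Invariance under the reflections in the span of the unit vectors with labels in `S`. -/
structure IsotropicOn (S : Set (Fin 4)) (ε : Fin 4 → ℝ)
    (τ : (Fin 4 → ℝ) → (Fin 4 → ℝ) → (Fin 4 → ℝ) → (Fin 4 → ℝ) → ℝ) : Prop where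
  lin : FourLin τ
  inv : ∀ n, (∀ c, c ∉ S → n c = 0) → (∑ i, ε i * n i * n i) ≠ 0 → ∀ x y z w,
    τ (refl ε n x) (refl ε n y) (refl ε n z) (refl ε n w) = τ x y z w

theorem refl_ev_flip {ε : Fin 4 → ℝ} (hε : ∀ i, ε i * ε i = 1) (c a : Fin 4) :
    refl ε (ev c) (ev a) = (if a = c then (-1 : ℝ) else 1) • ev a := by
  have hc : ε c ≠ 0 := fun h => by simpa [h] using hε c
  have h1 : ∑ i, ε i * ev c i * ev a i = if a = c then ε c else 0 := by
    simp only [ev, Pi.single_apply]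
    rcases eq_or_ne a c with rfl | h
    · simp
    · rw [if_neg h]
      refine Finset.sum_eq_zero fun i _ => ?_
      by_cases h1 : i = c
      · simp [h1, Ne.symm h]
      · simp [h1]
  have h2 : ∑ i, ε i * ev c i * ev c i = ε c := by simp [ev, Pi.single_apply]
  rw [refl, h1, h2]
  rcases eq_or_ne a c with rfl | h
  · rw [if_pos rfl, if_pos rfl, mul_div_assoc, div_self hc]
    funext i; simp; ring
  · simp [if_neg h]

theorem refl_plane_fix {ε : Fin 4 → ℝ} {a b c : Fin 4} (ha : c ≠ a) (hb : c ≠ b) :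
    refl ε (2 • ev a + ev b) (ev c) = ev c := by
  have h1 : ∑ i, ε i * (2 • ev a + ev b) i * ev c i = 0 := by
    refine Finset.sum_eq_zero fun i _ => ?_
    rcases eq_or_ne i c with rfl | h
    · simp [ev, Pi.single_apply, ha, hb]
    · simp [ev, Pi.single_apply, h]
  rw [refl, h1]
  simp

theorem sum_plane {ε : Fin 4 → ℝ} {a b : Fin 4} (hab : a ≠ b) :
    ∑ i, ε i * (2 • ev a + ev b) i * (2 • ev a + ev b) i = 4 * ε a + ε b := by
  have : ∀ i, ε i * (2 • ev a + ev b) i * (2 • ev a + ev b) i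
      = (if i = a then 4 * ε i else 0) + if i = b then ε i else 0 := by
    intro i
    by_cases h1 : i = a
    · subst h1
      simp [ev, Pi.single_apply, hab]; ring
    · by_cases h2 : i = b
      · subst h2
        simp [ev, Pi.single_apply, h1]
      · simp [ev, Pi.single_apply, h1, h2]
  simp only [this, Finset.sum_add_distrib]
  simp

theorem refl_plane_left {ε : Fin 4 → ℝ} (hε : ∀ i, ε i * ε i = 1) {a b : Fin 4} (hab : a ≠ b) :
    refl ε (2 • ev a + ev b) (ev a)
      = (1 - 8 / (4 + ε a * ε b)) • ev a + (-4 / (4 + ε a * ε b)) • ev b := by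
  have h1 : ∑ i, ε i * (2 • ev a + ev b) i * ev a i = 2 * ε a := by
    simp [ev, Pi.single_apply, hab]; ring
  rw [refl, h1, sum_plane hab]
  have h2 : (2 * (2 * ε a) / (4 * ε a + ε b)) = 4 / (4 + ε a * ε b) := by
    rcases mul_self_eq_one_iff.1 (hε a) with h | h <;>
    rcases mul_self_eq_one_iff.1 (hε b) with h' | h' <;> rw [h, h'] <;> norm_num
  rw [h2]
  funext i
  simp
  ring

theorem refl_plane_right {ε : Fin 4 → ℝ} (hε : ∀ i, ε i * ε i = 1) {a b : Fin 4} (hab : a ≠ b) :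
    refl ε (2 • ev a + ev b) (ev b)
      = (ε a * ε b * (-4 / (4 + ε a * ε b))) • ev a
        + (-(1 - 8 / (4 + ε a * ε b))) • ev b := by
  have h1 : ∑ i, ε i * (2 • ev a + ev b) i * ev b i = ε b := by
    simp [ev, Pi.single_apply, hab.symm]
  rw [refl, h1, sum_plane hab]
  have h2 : (2 * ε b / (4 * ε a + ε b)) = 2 * (ε a * ε b) / (4 + ε a * ε b) := by
    rcases mul_self_eq_one_iff.1 (hε a) with h | h <;>
    rcases mul_self_eq_one_iff.1 (hε b) with h' | h' <;> rw [h, h'] <;> norm_num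
  have h3 : 1 - 2 * (ε a * ε b) / (4 + ε a * ε b) = -(1 - 8 / (4 + ε a * ε b)) := by
    rcases mul_self_eq_one_iff.1 (hε a) with h | h <;>
    rcases mul_self_eq_one_iff.1 (hε b) with h' | h' <;> rw [h, h'] <;> norm_num
  rw [h2, ← h3]
  funext i
  simp
  ring

namespace IsotropicOn

variable {S : Set (Fin 4)} {ε : Fin 4 → ℝ}
  {τ : (Fin 4 → ℝ) → (Fin 4 → ℝ) → (Fin 4 → ℝ) → (Fin 4 → ℝ) → ℝ}

theorem swap₁₂ (h : IsotropicOn S ε τ) : IsotropicOn S ε (fun a b c d => τ b a c d) :=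
  ⟨h.lin.swap₁₂, fun n hn hne _ _ _ _ => h.inv n hn hne _ _ _ _⟩

theorem swap₂₃ (h : IsotropicOn S ε τ) : IsotropicOn S ε (fun a b c d => τ a c b d) :=
  ⟨h.lin.swap₂₃, fun n hn hne _ _ _ _ => h.inv n hn hne _ _ _ _⟩

theorem swap₃₄ (h : IsotropicOn S ε τ) : IsotropicOn S ε (fun a b c d => τ a b d c) :=
  ⟨h.lin.swap₃₄, fun n hn hne _ _ _ _ => h.inv n hn hne _ _ _ _⟩

theorem parity (h : IsotropicOn S ε τ) (hε : ∀ i, ε i * ε i = 1) {s : Fin 4} (hs : s ∈ S)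
    {a b c d : Fin 4}
    (hodd : (if a = s then (-1 : ℝ) else 1) * ((if b = s then (-1 : ℝ) else 1)
      * ((if c = s then (-1 : ℝ) else 1) * (if d = s then (-1 : ℝ) else 1))) = -1) :
    τ (ev a) (ev b) (ev c) (ev d) = 0 := by
  have h1 := h.inv (ev s) (fun c hc => by
    rw [ev, Pi.single_apply, if_neg]; rintro rfl; exact hc hs) (by
      have : ε s ≠ 0 := fun h => by simpa [h] using hε s
      simpa [ev, Pi.single_apply] using this) (ev a) (ev b) (ev c) (ev d)
  simp only [refl_ev_flip hε, h.lin.smul₁, h.lin.smul₂, h.lin.smul₃, h.lin.smul₄] at h1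
  have h2 : ∀ p q r t X : ℝ, p * (q * (r * (t * X))) = (p * (q * (r * t))) * X := fun _ _ _ _ _ => by
    ring
  rw [h2, hodd] at h1
  linarith

theorem plane (h : IsotropicOn S ε τ) (hε : ∀ i, ε i * ε i = 1) {a b : Fin 4} (ha : a ∈ S)
    (hb : b ∈ S) (hab : a ≠ b) (x y z w : Fin 4 → ℝ) :
    τ (refl ε (2 • ev a + ev b) x) (refl ε (2 • ev a + ev b) y) (refl ε (2 • ev a + ev b) z)
      (refl ε (2 • ev a + ev b) w) = τ x y z w := by
  refine h.inv _ (fun c hc => ?_) ?_ x y z w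
  · have h1 : c ≠ a := by rintro rfl; exact hc ha
    have h2 : c ≠ b := by rintro rfl; exact hc hb
    simp [ev, Pi.single_apply, h1, h2]
  · rw [sum_plane hab]
    rcases mul_self_eq_one_iff.1 (hε a) with h | h <;>
    rcases mul_self_eq_one_iff.1 (hε b) with h' | h' <;> rw [h, h'] <;> norm_num

theorem pair_eq (h : IsotropicOn S ε τ) (hε : ∀ i, ε i * ε i = 1) {a b c d : Fin 4} (ha : a ∈ S)
    (hb : b ∈ S) (hab : a ≠ b) (hca : c ≠ a) (hcb : c ≠ b) (hda : d ≠ a) (hdb : d ≠ b) :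
    ε a * τ (ev a) (ev a) (ev c) (ev d) = ε b * τ (ev b) (ev b) (ev c) (ev d) := by
  have h1 := h.plane hε ha hb hab (ev a) (ev a) (ev c) (ev d)
  rw [refl_plane_fix hca hcb, refl_plane_fix hda hdb, refl_plane_left hε hab] at h1
  simp only [h.lin.add₁, h.lin.smul₁, h.lin.add₂, h.lin.smul₂] at h1
  have p1 : τ (ev a) (ev b) (ev c) (ev d) = 0 :=
    h.parity hε ha (by simp [hab.symm, hca, hda])
  have p2 : τ (ev b) (ev a) (ev c) (ev d) = 0 :=
    h.parity hε ha (by simp [hab.symm, hca, hda])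
  rw [p1, p2] at h1
  rcases mul_self_eq_one_iff.1 (hε a) with h | h <;>
  rcases mul_self_eq_one_iff.1 (hε b) with h' | h' <;> rw [h, h'] at h1 ⊢ <;>
    norm_num at h1 <;> linarith

theorem pair_chain (h : IsotropicOn S ε τ) (hε : ∀ i, ε i * ε i = 1) (h₁ : (1 : Fin 4) ∈ S)
    (h₂ : (2 : Fin 4) ∈ S) (h₃ : (3 : Fin 4) ∈ S) {a b : Fin 4} (ha : a ∈ S) (hb : b ∈ S)
    (hab : a ≠ b) :
    ε a * ε b * τ (ev a) (ev a) (ev b) (ev b) = ε 1 * ε 2 * τ (ev 1) (ev 1) (ev 2) (ev 2) := by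
  have L1 : ∀ {a b c : Fin 4}, a ∈ S → b ∈ S → c ≠ a → c ≠ b →
      ε a * ε c * τ (ev a) (ev a) (ev c) (ev c) = ε b * ε c * τ (ev b) (ev b) (ev c) (ev c) := by
    intro a b c ha hb hca hcb
    rcases eq_or_ne a b with rfl | hab
    · rfl
    · linear_combination ε c * h.pair_eq hε ha hb hab hca hcb hca hcb
  have L2 : ∀ {a b c : Fin 4}, a ∈ S → b ∈ S → c ≠ a → c ≠ b →
      ε c * ε a * τ (ev c) (ev c) (ev a) (ev a) = ε c * ε b * τ (ev c) (ev c) (ev b) (ev b) := by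
    intro a b c ha hb hca hcb
    rcases eq_or_ne a b with rfl | hab
    · rfl
    · have := h.swap₂₃.swap₁₂.swap₃₄.swap₂₃.pair_eq hε ha hb hab hca hcb hca hcb
      linear_combination ε c * this
  have e13 : ε 1 * ε 3 * τ (ev 1) (ev 1) (ev 3) (ev 3)
      = ε 1 * ε 2 * τ (ev 1) (ev 1) (ev 2) (ev 2) := L2 h₃ h₂ (by decide) (by decide)
  have e2 : ∀ {b : Fin 4}, b ∈ S → (2 : Fin 4) ≠ b →
      ε 2 * ε b * τ (ev 2) (ev 2) (ev b) (ev b)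
        = ε 1 * ε 2 * τ (ev 1) (ev 1) (ev 2) (ev 2) := by
    intro b hb h2
    rw [L2 hb h₃ h2 (by decide), L1 h₂ h₁ (by decide) (by decide), e13]
  rcases eq_or_ne a 2 with rfl | ha2
  · exact e2 hb hab
  rcases eq_or_ne b 2 with rfl | hb2
  · exact L1 ha h₁ ha2.symm (by decide)
  rw [L2 hb h₂ hab ha2, L1 ha h₁ ha2.symm (by decide)]

theorem quartic (h : IsotropicOn S ε τ) (hε : ∀ i, ε i * ε i = 1) (h₁ : (1 : Fin 4) ∈ S)
    (h₂ : (2 : Fin 4) ∈ S) (h₃ : (3 : Fin 4) ∈ S) {a : Fin 4} (ha : a ∈ S) :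
    τ (ev a) (ev a) (ev a) (ev a)
      = ε 1 * ε 2 * (τ (ev 1) (ev 1) (ev 2) (ev 2) + τ (ev 1) (ev 2) (ev 1) (ev 2)
        + τ (ev 1) (ev 2) (ev 2) (ev 1)) := by
  obtain ⟨b, hb, hab⟩ : ∃ b ∈ S, a ≠ b := by
    rcases eq_or_ne a 1 with rfl | h
    · exact ⟨2, h₂, by decide⟩
    · exact ⟨1, h₁, h⟩
  have c1 := h.pair_chain hε h₁ h₂ h₃ ha hb hab
  have c2 := h.pair_chain hε h₁ h₂ h₃ hb ha hab.symm
  have c3 := h.swap₂₃.pair_chain hε h₁ h₂ h₃ ha hb hab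
  have c4 := h.swap₂₃.pair_chain hε h₁ h₂ h₃ hb ha hab.symm
  have c5 := h.swap₃₄.swap₂₃.pair_chain hε h₁ h₂ h₃ ha hb hab
  have c6 := h.swap₃₄.swap₂₃.pair_chain hε h₁ h₂ h₃ hb ha hab.symm
  have i1 := h.plane hε ha hb hab (ev a) (ev a) (ev a) (ev a)
  have i2 := h.plane hε ha hb hab (ev b) (ev b) (ev b) (ev b)
  rw [refl_plane_left hε hab] at i1
  rw [refl_plane_right hε hab] at i2
  simp only [h.lin.add₁, h.lin.smul₁, h.lin.add₂, h.lin.smul₂, h.lin.add₃, h.lin.smul₃,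
    h.lin.add₄, h.lin.smul₄] at i1 i2
  have hba := hab.symm
  have o1 : τ (ev a) (ev a) (ev a) (ev b) = 0 := h.parity hε hb (by simp [hab])
  have o2 : τ (ev a) (ev a) (ev b) (ev a) = 0 := h.parity hε hb (by simp [hab])
  have o3 : τ (ev a) (ev b) (ev a) (ev a) = 0 := h.parity hε hb (by simp [hab])
  have o4 : τ (ev b) (ev a) (ev a) (ev a) = 0 := h.parity hε hb (by simp [hab])
  have o5 : τ (ev b) (ev b) (ev b) (ev a) = 0 := h.parity hε ha (by simp [hba])
  have o6 : τ (ev b) (ev b) (ev a) (ev b) = 0 := h.parity hε ha (by simp [hba])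
  have o7 : τ (ev b) (ev a) (ev b) (ev b) = 0 := h.parity hε ha (by simp [hba])
  have o8 : τ (ev a) (ev b) (ev b) (ev b) = 0 := h.parity hε ha (by simp [hba])
  rw [o1, o2, o3, o4, o5, o6, o7, o8] at i1 i2
  have hs : ε 1 * ε 2 * (τ (ev 1) (ev 1) (ev 2) (ev 2) + τ (ev 1) (ev 2) (ev 1) (ev 2)
        + τ (ev 1) (ev 2) (ev 2) (ev 1)) = ε a * ε b * (τ (ev a) (ev a) (ev b) (ev b)
        + τ (ev a) (ev b) (ev a) (ev b) + τ (ev a) (ev b) (ev b) (ev a)) := by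
    linear_combination -c1 - c3 - c5
  have k1 := c1.trans c2.symm
  have k2 := c3.trans c4.symm
  have k3 := c5.trans c6.symm
  rw [hs]
  clear c1 c2 c3 c4 c5 c6 hs o1 o2 o3 o4 o5 o6 o7 o8
  rcases mul_self_eq_one_iff.1 (hε a) with h | h <;>
  rcases mul_self_eq_one_iff.1 (hε b) with h' | h' <;> rw [h, h'] at i1 i2 k1 k2 k3 ⊢ <;>
    norm_num at i1 i2 k1 k2 k3 ⊢ <;> linarith

/-- Components of isotropic tensors of rank four. -/
theorem components (h : IsotropicOn S ε τ) (hε : ∀ i, ε i * ε i = 1) (h₁ : (1 : Fin 4) ∈ S)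
    (h₂ : (2 : Fin 4) ∈ S) (h₃ : (3 : Fin 4) ∈ S) {a b c d : Fin 4} (ha : a ∈ S) (hb : b ∈ S)
    (hc : c ∈ S) (hd : d ∈ S) :
    τ (ev a) (ev b) (ev c) (ev d)
      = ε 1 * ε 2 * (ε a * kd a b * (ε c * kd c d) * τ (ev 1) (ev 1) (ev 2) (ev 2)
        + ε a * kd a c * (ε b * kd b d) * τ (ev 1) (ev 2) (ev 1) (ev 2)
        + ε a * kd a d * (ε b * kd b c) * τ (ev 1) (ev 2) (ev 2) (ev 1)) := by
  unfold kd
  rcases eq_or_ne a b with rfl | hab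
  · rcases eq_or_ne c d with rfl | hcd
    · rcases eq_or_ne a c with rfl | hac
      · simp only [if_true, mul_one, hε, one_mul]
        exact h.quartic hε h₁ h₂ h₃ ha
      · have := h.pair_chain hε h₁ h₂ h₃ ha hc hac
        simp [hac]
        linear_combination ε a * ε c * this - τ (ev a) (ev a) (ev c) (ev c) *
          (ε c * ε c * hε a + hε c)
    · rw [if_neg hcd]
      rcases eq_or_ne c a with rfl | hca
      · rw [h.parity hε hd (by simp [hcd])]
        simp [hcd]
      · rw [h.parity hε hc (by simp [hca.symm, hcd.symm])]
        simp [hca.symm]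
  · rcases eq_or_ne c a with rfl | hca
    · rcases eq_or_ne d b with rfl | hdb
      · have := h.swap₂₃.pair_chain hε h₁ h₂ h₃ ha hb hab
        simp [hab]
        linear_combination ε c * ε d * this - τ (ev c) (ev d) (ev c) (ev d) *
          (ε c * ε c * hε d + hε c)
      · rw [h.parity hε hb (by simp [hdb, hab])]
        simp [hdb.symm, hab, hab.symm]
    · rcases eq_or_ne c b with rfl | hcb
      · rcases eq_or_ne d a with rfl | hda
        · have := h.swap₃₄.swap₂₃.pair_chain hε h₁ h₂ h₃ ha hb hab
          simp [hab]
          linear_combination ε d * ε c * this - τ (ev d) (ev c) (ev c) (ev d) *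
            (ε d * ε d * hε c + hε d)
        · rw [h.parity hε ha (by simp [hab.symm, hda])]
          simp [hab, hda.symm]
      · rcases eq_or_ne c d with rfl | hcd
        · rw [h.parity hε ha (by simp [hab.symm, hca])]
          simp [hab, hca.symm]
        · rw [h.parity hε hc (by simp [hca.symm, hcb.symm, hcd.symm])]
          simp [hca.symm, hcb.symm, hcd, hab]

end IsotropicOn

/-! ### Reflections as matrices -/

/-- The matrix of a reflection. -/
def reflM (ε n : Fin 4 → ℝ) : Matrix (Fin 4) (Fin 4) ℝ :=
  1 - (2 / ∑ i, ε i * n i * n i) • Matrix.vecMulVec n (fun j => ε j * n j)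

theorem reflM_mulVec (ε n v : Fin 4 → ℝ) : reflM ε n *ᵥ v = refl ε n v := by
  rw [reflM, Matrix.sub_mulVec, Matrix.one_mulVec, Matrix.smul_mulVec, Matrix.vecMulVec_mulVec,
    refl]
  funext i
  simp only [dotProduct, Pi.sub_apply, Pi.smul_apply, smul_eq_mul, MulOpposite.smul_eq_mul_unop,
    MulOpposite.unop_op]
  ring

theorem reflM_isometry {ε n : Fin 4 → ℝ} (hn : (∑ i, ε i * n i * n i) ≠ 0) :
    (reflM ε n)ᵀ * Matrix.diagonal ε * reflM ε n = Matrix.diagonal ε := by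
  have h1 : (Matrix.vecMulVec n (fun j => ε j * n j))ᵀ * Matrix.diagonal ε
      = Matrix.vecMulVec (fun j => ε j * n j) (fun j => ε j * n j) := by
    ext i j
    simp [Matrix.mul_diagonal, Matrix.vecMulVec_apply]
    ring
  have h2 : Matrix.diagonal ε * Matrix.vecMulVec n (fun j => ε j * n j)
      = Matrix.vecMulVec (fun j => ε j * n j) (fun j => ε j * n j) := by
    ext i j
    simp [Matrix.diagonal_mul, Matrix.vecMulVec_apply]
    ring
  have h3 : Matrix.vecMulVec (fun j => ε j * n j) (fun j => ε j * n j)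
      * Matrix.vecMulVec n (fun j => ε j * n j) = (∑ i, ε i * n i * n i) •
        Matrix.vecMulVec (fun j => ε j * n j) (fun j => ε j * n j) := by
    ext i j
    simp only [Matrix.mul_apply, Matrix.vecMulVec_apply, Matrix.smul_apply, smul_eq_mul,
      Finset.sum_mul]
    refine Finset.sum_congr rfl fun k _ => ?_
    ring
  rw [reflM, Matrix.transpose_sub, Matrix.transpose_one, Matrix.transpose_smul, Matrix.sub_mul,
    Matrix.one_mul, Matrix.smul_mul, h1, Matrix.mul_sub, Matrix.mul_one, Matrix.sub_mul,
    Matrix.mul_smul, h2, Matrix.smul_mul, Matrix.mul_smul, h3]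
  set N := ∑ i, ε i * n i * n i
  ext i j
  simp only [Matrix.sub_apply, Matrix.smul_apply, smul_eq_mul]
  field_simp
  ring

theorem isLorentz_reflM {n : Fin 4 → ℝ} (hn : (∑ i, et i * n i * n i) ≠ 0) :
    IsLorentz (reflM et n) := reflM_isometry hn

theorem reflM_mem_orthogonalGroup {n : Fin 4 → ℝ} (hn : (∑ i, (1 : ℝ) * n i * n i) ≠ 0) :
    reflM (fun _ => 1) n ∈ Matrix.orthogonalGroup (Fin 4) ℝ := by
  rw [Matrix.mem_orthogonalGroup_iff']
  have := reflM_isometry (ε := fun _ => 1) hn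
  rwa [Matrix.diagonal_one, Matrix.mul_one] at this

/-- The orthogonal group acts transitively on spheres. -/
theorem exists_orthogonal_mulVec_eq {v w : FieldSpace} (h : v ⬝ᵥ v = w ⬝ᵥ w) :
    ∃ O ∈ Matrix.orthogonalGroup (Fin 4) ℝ, O *ᵥ v = w := by
  rcases eq_or_ne v w with rfl | hne
  · exact ⟨1, one_mem _, Matrix.one_mulVec _⟩
  have e1 : ∑ i, (1 : ℝ) * (v - w) i * (v - w) i = 2 * (v ⬝ᵥ v - v ⬝ᵥ w) := by
    simp only [dotProduct, Fin.sum_univ_four, Pi.sub_apply] at h ⊢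
    linear_combination -h
  have hn : (∑ i, (1 : ℝ) * (v - w) i * (v - w) i) ≠ 0 := by
    intro h0
    refine hne (sub_eq_zero.1 (dotProduct_self_eq_zero.1 ?_))
    simpa [dotProduct] using h0
  refine ⟨_, reflM_mem_orthogonalGroup hn, ?_⟩
  have e2 : ∑ i, (1 : ℝ) * (v - w) i * v i = v ⬝ᵥ v - v ⬝ᵥ w := by
    simp only [dotProduct, Fin.sum_univ_four, Pi.sub_apply]
    ring
  rw [reflM_mulVec, refl, e2, e1, div_self (by rwa [e1] at hn)]
  simp

/-! ### Equivariant tensors of rank four -/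

/-- The general invariant four-linear form that depends on a vector. -/
def isoForm (k : Fin 10 → ℝ) (u v₁ v₂ v₃ v₄ : FieldSpace) : ℝ :=
  k 0 * ((v₁ ⬝ᵥ v₂) * (v₃ ⬝ᵥ v₄)) + k 1 * ((v₁ ⬝ᵥ v₃) * (v₂ ⬝ᵥ v₄))
  + k 2 * ((v₁ ⬝ᵥ v₄) * (v₂ ⬝ᵥ v₃))
  + k 3 * ((u ⬝ᵥ v₁) * (u ⬝ᵥ v₂) * (v₃ ⬝ᵥ v₄)) + k 4 * ((u ⬝ᵥ v₁) * (u ⬝ᵥ v₃) * (v₂ ⬝ᵥ v₄))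
  + k 5 * ((u ⬝ᵥ v₁) * (u ⬝ᵥ v₄) * (v₂ ⬝ᵥ v₃)) + k 6 * ((u ⬝ᵥ v₂) * (u ⬝ᵥ v₃) * (v₁ ⬝ᵥ v₄))
  + k 7 * ((u ⬝ᵥ v₂) * (u ⬝ᵥ v₄) * (v₁ ⬝ᵥ v₃)) + k 8 * ((u ⬝ᵥ v₃) * (u ⬝ᵥ v₄) * (v₁ ⬝ᵥ v₂))
  + k 9 * ((u ⬝ᵥ v₁) * (u ⬝ᵥ v₂) * (u ⬝ᵥ v₃) * (u ⬝ᵥ v₄))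

theorem fourLin_isoForm (k : Fin 10 → ℝ) (u : FieldSpace) : FourLin (isoForm k u) := by
  constructor <;> intros <;>
    simp only [isoForm, add_dotProduct, dotProduct_add, smul_dotProduct, dotProduct_smul,
      smul_eq_mul] <;> ring

theorem isoForm_mulVec {O : Matrix (Fin 4) (Fin 4) ℝ} (hO : O ∈ Matrix.orthogonalGroup (Fin 4) ℝ)
    (k : Fin 10 → ℝ) (u v₁ v₂ v₃ v₄ : FieldSpace) :
    isoForm k (O *ᵥ u) (O *ᵥ v₁) (O *ᵥ v₂) (O *ᵥ v₃) (O *ᵥ v₄) = isoForm k u v₁ v₂ v₃ v₄ := by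
  simp only [isoForm, orthogonal_dot hO]

/-- Smooth `O(4)`-equivariant four-linear forms on the fibre. -/
structure IsEquivariantForm
    (T : FieldSpace → FieldSpace → FieldSpace → FieldSpace → FieldSpace → ℝ) : Prop where
  lin : ∀ u, FourLin (T u)
  smooth : ∀ v₁ v₂ v₃ v₄, ContDiff ℝ ∞ (fun u => T u v₁ v₂ v₃ v₄)
  inv : ∀ O ∈ Matrix.orthogonalGroup (Fin 4) ℝ, ∀ u v₁ v₂ v₃ v₄,
    T (O *ᵥ u) (O *ᵥ v₁) (O *ᵥ v₂) (O *ᵥ v₃) (O *ᵥ v₄) = T u v₁ v₂ v₃ v₄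

theorem eq_of_eq_off_zero {f g : FieldSpace → ℝ} (hf : Continuous f) (hg : Continuous g)
    (h : ∀ u, u ≠ 0 → f u = g u) (u : FieldSpace) : f u = g u :=
  congrFun (Continuous.ext_on (dense_compl_singleton (0 : FieldSpace)) hf hg
    fun u hu => h u hu) u

theorem contDiff_coeff_dot {e : ℝ → ℝ} (he : ContDiffOn ℝ ∞ e (Ici 0)) :
    ContDiff ℝ ∞ (fun u : FieldSpace => e (u ⬝ᵥ u)) := by
  simpa using contDiff_coeff he 1 (u := id) contDiff_id

theorem dot_self_pos {u : FieldSpace} (hu : u ≠ 0) : 0 < u ⬝ᵥ u :=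
  lt_of_le_of_ne (dot_self_nonneg' u) fun h => hu (dotProduct_self_eq_zero.1 h.symm)

theorem fderiv_eq_sum_pd {g : Spacetime → ℝ} (x w : Spacetime) :
    fderiv ℝ g x w = ∑ i, w i * pd i g x := by
  conv_lhs => rw [eq_sum_ev w]
  simp [pd, ev]

theorem hasDerivAt_ray {g : Spacetime → ℝ} (hg : ContDiff ℝ ∞ g) (w : Spacetime) (s : ℝ) :
    HasDerivAt (fun s : ℝ => g (s • w)) (∑ i, w i * pd i g (s • w)) s := by
  rw [← fderiv_eq_sum_pd]
  refine ((hg.differentiable (by simp) _).hasFDerivAt).comp_hasDerivAt s ?_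
  simpa using (hasDerivAt_id s).smul_const w

theorem pd_eq_zero_of_hyperplane {g : Spacetime → ℝ} (hg : ContDiff ℝ ∞ g) {c i : Fin 4}
    (hci : c ≠ i) (h : ∀ u : Spacetime, u c = 0 → g u = 0) (u : Spacetime) (hu : u c = 0) :
    pd i g u = 0 := by
  refine pd_eq_of_hasDerivAt hg ?_
  rw [show (fun s => g (Function.update u i s)) = fun _ => (0 : ℝ) from
    funext fun s => h _ (by rw [Function.update_of_ne hci, hu])]
  exact hasDerivAt_const _ _

namespace IsEquivariantForm

variable {T : FieldSpace → FieldSpace → FieldSpace → FieldSpace → FieldSpace → ℝ}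

theorem isotropicOn (h : IsEquivariantForm T) (r : ℝ) :
    IsotropicOn {0}ᶜ (fun _ => 1) (T (r • ev 0)) := by
  refine ⟨h.lin _, fun n hn hne x y z w => ?_⟩
  have h0 : n 0 = 0 := hn 0 (by simp)
  have := h.inv _ (reflM_mem_orthogonalGroup hne) (r • ev 0) x y z w
  simp only [reflM_mulVec] at this
  rwa [show refl (fun _ => 1) n (r • ev 0) = r • ev 0 by
    have : ∑ i, (1 : ℝ) * n i * (r • ev 0) i = 0 := by
      simp [ev, Fin.sum_univ_four, h0]
    rw [refl, this]; simp] at this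

theorem parity (h : IsEquivariantForm T) {u : FieldSpace} {s : Fin 4} (hs : u s = 0)
    {a b c d : Fin 4}
    (hodd : (if a = s then (-1 : ℝ) else 1) * ((if b = s then (-1 : ℝ) else 1)
      * ((if c = s then (-1 : ℝ) else 1) * (if d = s then (-1 : ℝ) else 1))) = -1) :
    T u (ev a) (ev b) (ev c) (ev d) = 0 := by
  have hne : (∑ i, (1 : ℝ) * ev s i * ev s i) ≠ 0 := by simp [ev, Pi.single_apply]
  have h1 := h.inv _ (reflM_mem_orthogonalGroup hne) u (ev a) (ev b) (ev c) (ev d)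
  simp only [reflM_mulVec] at h1
  rw [show refl (fun _ => 1) (ev s) u = u by
    have : ∑ i, (1 : ℝ) * ev s i * u i = 0 := by
      simp [ev, Pi.single_apply, hs]
    rw [refl, this]; simp] at h1
  simp only [refl_ev_flip (ε := fun _ => 1) (fun _ => by norm_num), (h.lin u).smul₁,
    (h.lin u).smul₂, (h.lin u).smul₃, (h.lin u).smul₄] at h1
  have h2 : ∀ p q r t X : ℝ, p * (q * (r * (t * X))) = (p * (q * (r * t))) * X := fun _ _ _ _ _ => by
    ring
  rw [h2, hodd] at h1
  linarith

theorem neg (h : IsEquivariantForm T) (u v₁ v₂ v₃ v₄ : FieldSpace) :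
    T (-u) v₁ v₂ v₃ v₄ = T u v₁ v₂ v₃ v₄ := by
  have hO : (-1 : Matrix (Fin 4) (Fin 4) ℝ) ∈ Matrix.orthogonalGroup (Fin 4) ℝ := by
    rw [Matrix.mem_orthogonalGroup_iff']; simp
  have h1 := h.inv _ hO u v₁ v₂ v₃ v₄
  simp only [Matrix.neg_mulVec, Matrix.one_mulVec] at h1
  have e : ∀ v : FieldSpace, -v = (-1 : ℝ) • v := fun v => by simp
  rw [e v₁, e v₂, e v₃, e v₄, (h.lin _).smul₁, (h.lin _).smul₂, (h.lin _).smul₃,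
    (h.lin _).smul₄] at h1
  linarith

theorem contDiff_ray (h : IsEquivariantForm T) (w v₁ v₂ v₃ v₄ : FieldSpace) :
    ContDiff ℝ ∞ (fun s : ℝ => T (s • w) v₁ v₂ v₃ v₄) :=
  (h.smooth v₁ v₂ v₃ v₄).comp (contDiff_id.smul contDiff_const)

theorem even_ray (h : IsEquivariantForm T) (w v₁ v₂ v₃ v₄ : FieldSpace) (s : ℝ) :
    T (-s • w) v₁ v₂ v₃ v₄ = T (s • w) v₁ v₂ v₃ v₄ := by
  rw [neg_smul, h.neg]

theorem exists_isoForm_axis (h : IsEquivariantForm T) {r : ℝ} (hr : r ≠ 0) :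
    ∃ k : Fin 10 → ℝ, ∀ v₁ v₂ v₃ v₄, T (r • ev 0) v₁ v₂ v₃ v₄ = isoForm k (r • ev 0) v₁ v₂ v₃ v₄ := by
  have hi := h.isotropicOn r
  have hε : ∀ i : Fin 4, (fun _ : Fin 4 => (1 : ℝ)) i * (fun _ => 1) i = 1 := fun _ => by norm_num
  set τ := T (r • ev 0) with hτ
  set f₁ := τ (ev 1) (ev 1) (ev 2) (ev 2)
  set f₂ := τ (ev 1) (ev 2) (ev 1) (ev 2)
  set f₃ := τ (ev 1) (ev 2) (ev 2) (ev 1)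
  set g₁₂ := (τ (ev 0) (ev 0) (ev 1) (ev 1) - f₁) / r ^ 2 with h12
  set g₁₃ := (τ (ev 0) (ev 1) (ev 0) (ev 1) - f₂) / r ^ 2 with h13
  set g₁₄ := (τ (ev 0) (ev 1) (ev 1) (ev 0) - f₃) / r ^ 2 with h14
  set g₂₃ := (τ (ev 1) (ev 0) (ev 0) (ev 1) - f₃) / r ^ 2 with h23
  set g₂₄ := (τ (ev 1) (ev 0) (ev 1) (ev 0) - f₂) / r ^ 2 with h24
  set g₃₄ := (τ (ev 1) (ev 1) (ev 0) (ev 0) - f₁) / r ^ 2 with h34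
  set k₉ := (τ (ev 0) (ev 0) (ev 0) (ev 0) - f₁ - f₂ - f₃
    - r ^ 2 * (g₁₂ + g₁₃ + g₁₄ + g₂₃ + g₂₄ + g₃₄)) / r ^ 4 with h9
  have hr2 : r ^ 2 ≠ 0 := pow_ne_zero 2 hr
  have hr4 : r ^ 4 ≠ 0 := pow_ne_zero 4 hr
  rw [eq_div_iff hr2] at h12 h13 h14 h23 h24 h34
  rw [eq_div_iff hr4] at h9
  refine ⟨![f₁, f₂, f₃, g₁₂, g₁₃, g₁₄, g₂₃, g₂₄, g₃₄, k₉], ?_⟩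
  refine hi.lin.ext (fourLin_isoForm _ _) fun a b c d => ?_
  have hdot : ∀ i j : Fin 4, ev i ⬝ᵥ ev j = kd i j := by
    intro i j; simp [ev, kd, Pi.single_apply, eq_comm]
  have hu : ∀ j : Fin 4, (r • ev 0) ⬝ᵥ ev j = r * kd 0 j := by
    intro j; rw [smul_dotProduct, hdot]; rfl
  have hk : isoForm ![f₁, f₂, f₃, g₁₂, g₁₃, g₁₄, g₂₃, g₂₄, g₃₄, k₉] (r • ev 0) (ev a) (ev b)
      (ev c) (ev d) = f₁ * (kd a b * kd c d) + f₂ * (kd a c * kd b d) + f₃ * (kd a d * kd b c)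
      + g₁₂ * r ^ 2 * (kd 0 a * kd 0 b * kd c d) + g₁₃ * r ^ 2 * (kd 0 a * kd 0 c * kd b d)
      + g₁₄ * r ^ 2 * (kd 0 a * kd 0 d * kd b c) + g₂₃ * r ^ 2 * (kd 0 b * kd 0 c * kd a d)
      + g₂₄ * r ^ 2 * (kd 0 b * kd 0 d * kd a c) + g₃₄ * r ^ 2 * (kd 0 c * kd 0 d * kd a b)
      + k₉ * r ^ 4 * (kd 0 a * kd 0 b * kd 0 c * kd 0 d) := by
    simp only [isoForm, hdot, hu]
    simp only [Matrix.cons_val]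
    ring
  have h9' : k₉ * r ^ 4 = τ (ev 0) (ev 0) (ev 0) (ev 0) + f₁ + f₂ + f₃
      - τ (ev 0) (ev 0) (ev 1) (ev 1) - τ (ev 0) (ev 1) (ev 0) (ev 1)
      - τ (ev 0) (ev 1) (ev 1) (ev 0) - τ (ev 1) (ev 0) (ev 0) (ev 1)
      - τ (ev 1) (ev 0) (ev 1) (ev 0) - τ (ev 1) (ev 1) (ev 0) (ev 0) := by
    linear_combination h9 - h12 - h13 - h14 - h23 - h24 - h34
  rw [hk, h12, h13, h14, h23, h24, h34, h9']
  have P : ∀ {τ' : (Fin 4 → ℝ) → (Fin 4 → ℝ) → (Fin 4 → ℝ) → (Fin 4 → ℝ) → ℝ} {a b : Fin 4},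
      IsotropicOn {0}ᶜ (fun _ => 1) τ' → a ≠ 0 → b ≠ 0 →
      τ' (ev a) (ev b) (ev 0) (ev 0) = kd a b * τ' (ev 1) (ev 1) (ev 0) (ev 0) := by
    intro τ' a b hτ' ha hb
    rcases eq_or_ne a b with rfl | hab
    · rcases eq_or_ne a 1 with rfl | ha1
      · simp [kd]
      · have := hτ'.pair_eq hε (a := a) (b := 1) (c := 0) (d := 0) ha (by simp) ha1 ha.symm
          (by decide) ha.symm (by decide)
        simpa [kd] using this
    · rw [hτ'.parity hε (s := a) ha (by simp [hab.symm, ha.symm])]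
      simp [kd, hab]
  have Q : ∀ {τ' : (Fin 4 → ℝ) → (Fin 4 → ℝ) → (Fin 4 → ℝ) → (Fin 4 → ℝ) → ℝ} {b c d : Fin 4},
      IsotropicOn {0}ᶜ (fun _ => 1) τ' → b ≠ 0 → c ≠ 0 → d ≠ 0 →
      τ' (ev 0) (ev b) (ev c) (ev d) = 0 := by
    intro τ' b c d hτ' hb hc hd
    rcases eq_or_ne b c with rfl | hbc
    · exact hτ'.parity hε (s := d) hd (by by_cases h : b = d <;> simp [h, hd.symm])
    · rcases eq_or_ne b d with rfl | hbd
      · exact hτ'.parity hε (s := c) hc (by simp [hbc, hc.symm])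
      · exact hτ'.parity hε (s := b) hb (by simp [hbc.symm, hbd.symm, hb.symm])
  have R : ∀ {τ' : (Fin 4 → ℝ) → (Fin 4 → ℝ) → (Fin 4 → ℝ) → (Fin 4 → ℝ) → ℝ} {d : Fin 4},
      IsotropicOn {0}ᶜ (fun _ => 1) τ' → d ≠ 0 → τ' (ev 0) (ev 0) (ev 0) (ev d) = 0 :=
    fun hτ' hd => hτ'.parity hε (s := _) hd (by simp [hd.symm])
  have k0 : kd 0 0 = 1 := by simp [kd]
  have kl : ∀ {a : Fin 4}, a ≠ 0 → kd 0 a = 0 := fun h => by simp [kd, h.symm]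
  have kr : ∀ {a : Fin 4}, a ≠ 0 → kd a 0 = 0 := fun h => by simp [kd, h]
  rcases eq_or_ne a 0 with rfl | ha <;> rcases eq_or_ne b 0 with rfl | hb <;>
    rcases eq_or_ne c 0 with rfl | hc <;> rcases eq_or_ne d 0 with rfl | hd
  · simp only [k0]; ring
  · rw [R hi hd]; simp [kl hd, k0]
  · rw [R hi.swap₃₄ hc]; simp [kl hc, kr hc, k0]
  · rw [P hi.swap₁₂.swap₂₃.swap₁₂.swap₃₄.swap₂₃ hc hd]; simp [kl hc, kl hd, kr hc, k0]; ring
  · rw [R hi.swap₂₃.swap₃₄ hb]; simp [kl hb, kr hb, k0]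
  · rw [P hi.swap₁₂.swap₃₄.swap₂₃ hb hd]; simp [kl hb, kl hd, kr hb, k0]; ring
  · rw [P hi.swap₁₂.swap₂₃ hb hc]; simp [kl hb, kl hc, kr hb, kr hc, k0]; ring
  · rw [Q hi hb hc hd]; simp [kl hb, kl hc, kl hd, k0]
  · rw [R hi.swap₁₂.swap₂₃.swap₃₄ ha]; simp [kl ha, kr ha, k0]
  · rw [P hi.swap₃₄.swap₂₃ ha hd]; simp [kl ha, kl hd, kr ha, k0]; ring
  · rw [P hi.swap₂₃ ha hc]; simp [kl ha, kl hc, kr ha, kr hc, k0]; ring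
  · rw [Q hi.swap₁₂ ha hc hd]; simp [kl ha, kr ha, kl hc, kl hd, k0]
  · rw [P hi ha hb]; simp [kl ha, kl hb, kr ha, kr hb, k0]; ring
  · rw [Q hi.swap₂₃.swap₁₂ ha hb hd]; simp [kl ha, kr ha, kr hb, kl hb, kl hd, k0]
  · rw [Q hi.swap₃₄.swap₂₃.swap₁₂ ha hb hc]; simp [kl ha, kr ha, kl hb, kr hb, kl hc, kr hc, k0]
  · rw [hi.components hε (by simp) (by simp) (by simp) ha hb hc hd]
    simp only [kl ha, kl hb, kl hc, one_mul, f₁, f₂, f₃]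
    ring

theorem exists_isoForm (h : IsEquivariantForm T) :
    ∃ k : ℝ → Fin 10 → ℝ, ∀ u, u ≠ 0 → ∀ v₁ v₂ v₃ v₄,
      T u v₁ v₂ v₃ v₄ = isoForm (k (u ⬝ᵥ u)) u v₁ v₂ v₃ v₄ := by
  have h1 : ∀ t : ℝ, ∃ k : Fin 10 → ℝ, 0 < t → ∀ v₁ v₂ v₃ v₄,
      T (√t • ev 0) v₁ v₂ v₃ v₄ = isoForm k (√t • ev 0) v₁ v₂ v₃ v₄ := by
    intro t
    by_cases ht : 0 < t
    · obtain ⟨k, hk⟩ := h.exists_isoForm_axis (Real.sqrt_pos.2 ht).ne'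
      exact ⟨k, fun _ => hk⟩
    · exact ⟨0, fun h => absurd h ht⟩
  choose k hk using h1
  refine ⟨k, fun u hu v₁ v₂ v₃ v₄ => ?_⟩
  have hpos := dot_self_pos hu
  obtain ⟨O, hO, hOu⟩ := exists_orthogonal_mulVec_eq (v := √(u ⬝ᵥ u) • ev 0) (w := u) (by
    rw [smul_dotProduct, dotProduct_smul, smul_smul, Real.mul_self_sqrt hpos.le]
    simp [ev])
  have hv : ∀ v : FieldSpace, v = O *ᵥ (Oᵀ *ᵥ v) := fun v => by
    rw [Matrix.mulVec_mulVec, show O * Oᵀ = 1 from (Matrix.mem_orthogonalGroup_iff _ _).1 hO,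
      Matrix.one_mulVec]
  have h2 := h.inv O hO (√(u ⬝ᵥ u) • ev 0) (Oᵀ *ᵥ v₁) (Oᵀ *ᵥ v₂) (Oᵀ *ᵥ v₃) (Oᵀ *ᵥ v₄)
  rw [hk _ hpos, ← isoForm_mulVec hO] at h2
  simpa only [← hv, hOu] using h2

theorem exists_coeff_axis (h : IsEquivariantForm T) (a b c d : Fin 4) :
    ∃ g : ℝ → ℝ, ContDiffOn ℝ ∞ g (Ici 0) ∧
      ∀ r : ℝ, T (r • ev 0) (ev a) (ev b) (ev c) (ev d) = g (r ^ 2) :=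
  exists_coeff_of_even (h.contDiff_ray _ _ _ _ _) (h.even_ray _ _ _ _ _)

theorem exists_coeff_diagonal (h : IsEquivariantForm T) {a b c d : Fin 4}
    (hodd : (if a = 0 then (-1 : ℝ) else 1) * ((if b = 0 then (-1 : ℝ) else 1)
      * ((if c = 0 then (-1 : ℝ) else 1) * (if d = 0 then (-1 : ℝ) else 1))) = -1) :
    ∃ g : ℝ → ℝ, ContDiffOn ℝ ∞ g (Ici 0) ∧
      ∀ r : ℝ, T (r • (ev 0 + ev 1)) (ev a) (ev b) (ev c) (ev d) = r ^ 2 * g (r ^ 2) :=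
  exists_coeff_of_even_sq (h.contDiff_ray _ _ _ _ _) (h.even_ray _ _ _ _ _)
    (h.parity (s := 0) (by simp) hodd)

theorem exists_coeff_cube (h : IsEquivariantForm T) :
    ∃ g : ℝ → ℝ, ContDiffOn ℝ ∞ g (Ici 0) ∧
      ∀ r : ℝ, T (r • (fun _ => 1)) (ev 0) (ev 1) (ev 2) (ev 3) = r ^ 4 * g (r ^ 2) := by
  have hz : ∀ (c : Fin 4) (u : FieldSpace), u c = 0 → T u (ev 0) (ev 1) (ev 2) (ev 3) = 0 := by
    intro c u hu
    refine h.parity hu ?_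
    have hc : ∀ c : Fin 4, c = 0 ∨ c = 1 ∨ c = 2 ∨ c = 3 := by decide
    rcases hc c with rfl | rfl | rfl | rfl <;> simp
  have hs := h.smooth (ev 0) (ev 1) (ev 2) (ev 3)
  refine exists_coeff_of_even_pow_four (h.contDiff_ray _ _ _ _ _) (h.even_ray _ _ _ _ _)
    (hz 0 _ (by simp)) ?_
  set F : FieldSpace → ℝ := fun u => T u (ev 0) (ev 1) (ev 2) (ev 3) with hF
  set w : Spacetime := fun _ => 1
  have h1 : deriv (fun s : ℝ => F (s • w)) = fun s => (fun u => ∑ i, w i * pd i F u) (s • w) :=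
    funext fun s => (hasDerivAt_ray hs w s).deriv
  have hs1 : ContDiff ℝ ∞ (fun u => ∑ i, w i * pd i F u) :=
    ContDiff.sum fun i _ => contDiff_const.mul (contDiff_pd hs)
  change deriv (deriv (fun s : ℝ => F (s • w))) 0 = 0
  rw [h1, (hasDerivAt_ray hs1 w 0).deriv, zero_smul]
  refine Finset.sum_eq_zero fun j _ => ?_
  rw [pd_sum (fun i => contDiff_const.mul (contDiff_pd hs))]
  refine mul_eq_zero_of_right _ (Finset.sum_eq_zero fun i _ => ?_)
  rw [pd_const_mul _ (contDiff_pd hs)]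
  refine mul_eq_zero_of_right _ ?_
  obtain ⟨c, hci, hcj⟩ : ∃ c : Fin 4, c ≠ i ∧ c ≠ j := by
    revert i j; decide
  exact pd_eq_zero_of_hyperplane (contDiff_pd hs) hcj
    (pd_eq_zero_of_hyperplane hs hci (hz c)) 0 rfl

/-- Smooth equivariant four-linear forms have smooth coefficient functions. -/
theorem exists_coeffs (h : IsEquivariantForm T) :
    ∃ c : Fin 10 → ℝ → ℝ, SmoothCoeffs c ∧ ∀ u v₁ v₂ v₃ v₄,
      T u v₁ v₂ v₃ v₄ = isoForm (fun i => c i (u ⬝ᵥ u)) u v₁ v₂ v₃ v₄ := by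
  obtain ⟨k, hk⟩ := h.exists_isoForm
  obtain ⟨f₁, hf₁, h₁⟩ := h.exists_coeff_axis 1 1 2 2
  obtain ⟨f₂, hf₂, h₂⟩ := h.exists_coeff_axis 1 2 1 2
  obtain ⟨f₃, hf₃, h₃⟩ := h.exists_coeff_axis 1 2 2 1
  obtain ⟨g₁₂, hg₁₂, h₁₂⟩ := h.exists_coeff_diagonal (a := 0) (b := 1) (c := 2) (d := 2) (by simp)
  obtain ⟨g₁₃, hg₁₃, h₁₃⟩ := h.exists_coeff_diagonal (a := 0) (b := 2) (c := 1) (d := 2) (by simp)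
  obtain ⟨g₁₄, hg₁₄, h₁₄⟩ := h.exists_coeff_diagonal (a := 0) (b := 2) (c := 2) (d := 1) (by simp)
  obtain ⟨g₂₃, hg₂₃, h₂₃⟩ := h.exists_coeff_diagonal (a := 2) (b := 0) (c := 1) (d := 2) (by simp)
  obtain ⟨g₂₄, hg₂₄, h₂₄⟩ := h.exists_coeff_diagonal (a := 2) (b := 0) (c := 2) (d := 1) (by simp)
  obtain ⟨g₃₄, hg₃₄, h₃₄⟩ := h.exists_coeff_diagonal (a := 2) (b := 2) (c := 0) (d := 1) (by simp)
  obtain ⟨g, hg, h₀⟩ := h.exists_coeff_cube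
  have half : ∀ {e : ℝ → ℝ} {m : ℝ}, 0 < m → ContDiffOn ℝ ∞ e (Ici 0) →
      ContDiffOn ℝ ∞ (fun t => e (t / m)) (Ici 0) := fun hm he =>
    he.comp (contDiff_id.div_const _).contDiffOn fun t ht => div_nonneg ht hm.le
  let c : Fin 10 → ℝ → ℝ := ![f₁, f₂, f₃, fun t => g₁₂ (t / 2), fun t => g₁₃ (t / 2),
    fun t => g₁₄ (t / 2), fun t => g₂₃ (t / 2), fun t => g₂₄ (t / 2), fun t => g₃₄ (t / 2),
    fun t => g (t / 4)]
  have hc : SmoothCoeffs c := by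
    intro i
    fin_cases i
    exacts [hf₁, hf₂, hf₃, half two_pos hg₁₂, half two_pos hg₁₃, half two_pos hg₁₄,
      half two_pos hg₂₃, half two_pos hg₂₄, half two_pos hg₃₄, half four_pos hg]
  have hkc : ∀ t, 0 < t → ∀ i, k t i = c i t := by
    intro t ht
    have hr : √t ≠ 0 := (Real.sqrt_pos.2 ht).ne'
    have hr2 : √(t / 2) ≠ 0 := (Real.sqrt_pos.2 (by positivity)).ne'
    have hr4 : √(t / 4) ≠ 0 := (Real.sqrt_pos.2 (by positivity)).ne'
    have s1 : √t ^ 2 = t := Real.sq_sqrt ht.le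
    have s2 : √(t / 2) ^ 2 = t / 2 := Real.sq_sqrt (by positivity)
    have s4 : √(t / 4) ^ 2 = t / 4 := Real.sq_sqrt (by positivity)
    have n1 : (√t • ev 0 : FieldSpace) ≠ 0 := fun h => hr (by simpa [ev] using congrFun h 0)
    have n2 : (√(t / 2) • (ev 0 + ev 1) : FieldSpace) ≠ 0 := fun h =>
      hr2 (by simpa [ev] using congrFun h 0)
    have n4 : (√(t / 4) • (fun _ => 1) : FieldSpace) ≠ 0 := fun h =>
      hr4 (by simpa using congrFun h 0)
    have d1 : (√t • ev 0 : FieldSpace) ⬝ᵥ (√t • ev 0) = t := by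
      conv_rhs => rw [← s1]
      simp [ev, dotProduct, Fin.sum_univ_four]; ring
    have d2 : (√(t / 2) • (ev 0 + ev 1) : FieldSpace) ⬝ᵥ (√(t / 2) • (ev 0 + ev 1)) = t := by
      have : (√(t / 2) • (ev 0 + ev 1) : FieldSpace) ⬝ᵥ (√(t / 2) • (ev 0 + ev 1))
          = 2 * √(t / 2) ^ 2 := by
        simp [ev, dotProduct, Fin.sum_univ_four]; ring
      rw [this, s2]; ring
    have d4 : (√(t / 4) • (fun _ => 1) : FieldSpace) ⬝ᵥ (√(t / 4) • (fun _ => 1)) = t := by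
      have : (√(t / 4) • (fun _ => 1) : FieldSpace) ⬝ᵥ (√(t / 4) • (fun _ => 1))
          = 4 * √(t / 4) ^ 2 := by
        simp [dotProduct, Fin.sum_univ_four]; ring
      rw [this, s4]; ring
    have e1 := hk _ n1
    have e2 := hk _ n2
    have e4 := hk _ n4
    rw [d1] at e1
    rw [d2] at e2
    rw [d4] at e4
    have dv : ∀ i j : Fin 4, ev i ⬝ᵥ ev j = kd i j := by
      intro i j; simp [ev, kd, Pi.single_apply, eq_comm]
    have do' : ∀ j : Fin 4, (fun _ => 1) ⬝ᵥ ev j = 1 := by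
      intro j; simp [ev]
    have A : ∀ a b c d : Fin 4, ∀ {e : ℝ → ℝ}, (∀ r : ℝ, T (r • ev 0) (ev a) (ev b) (ev c) (ev d)
        = e (r ^ 2)) → e t = isoForm (k t) (√t • ev 0) (ev a) (ev b) (ev c) (ev d) := by
      intro a b c d e he
      rw [← e1, he, s1]
    have B : ∀ a b c d : Fin 4, ∀ {e : ℝ → ℝ}, (∀ r : ℝ, T (r • (ev 0 + ev 1)) (ev a) (ev b) (ev c)
        (ev d) = r ^ 2 * e (r ^ 2)) → t / 2 * e (t / 2)
          = isoForm (k t) (√(t / 2) • (ev 0 + ev 1)) (ev a) (ev b) (ev c) (ev d) := by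
      intro a b c d e he
      rw [← e2, he, s2]
    have C : t / 4 * (t / 4) * g (t / 4)
        = isoForm (k t) (√(t / 4) • (fun _ => 1)) (ev 0) (ev 1) (ev 2) (ev 3) := by
      rw [← e4, h₀, s4, show √(t / 4) ^ 4 = (√(t / 4) ^ 2) * (√(t / 4) ^ 2) by ring, s4]
    have B' : ∀ {x y : ℝ}, t / 2 * x = √(t / 2) * √(t / 2) * y → y = x := by
      intro x y hxy
      rw [← pow_two, s2] at hxy
      exact (mul_left_cancel₀ (by positivity) hxy).symm
    have C' : ∀ {x y : ℝ}, t / 4 * (t / 4) * x = √(t / 4) * √(t / 4) * √(t / 4) * √(t / 4) * y →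
        y = x := by
      intro x y hxy
      rw [show √(t / 4) * √(t / 4) * √(t / 4) * √(t / 4) = (√(t / 4) ^ 2) * (√(t / 4) ^ 2) by ring,
        s4] at hxy
      exact (mul_left_cancel₀ (by positivity) hxy).symm
    intro i
    fin_cases i
    · have := A _ _ _ _ h₁
      change k t 0 = f₁ t
      simpa [isoForm, dv, smul_dotProduct, add_dotProduct, kd] using this.symm
    · have := A _ _ _ _ h₂
      change k t 1 = f₂ t
      simpa [isoForm, dv, smul_dotProduct, add_dotProduct, kd] using this.symm
    · have := A _ _ _ _ h₃
      change k t 2 = f₃ t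
      simpa [isoForm, dv, smul_dotProduct, add_dotProduct, kd] using this.symm
    · refine B' ((B _ _ _ _ h₁₂).trans ?_)
      simp [isoForm, dv, smul_dotProduct, add_dotProduct, kd]; ring
    · refine B' ((B _ _ _ _ h₁₃).trans ?_)
      simp [isoForm, dv, smul_dotProduct, add_dotProduct, kd]; ring
    · refine B' ((B _ _ _ _ h₁₄).trans ?_)
      simp [isoForm, dv, smul_dotProduct, add_dotProduct, kd]; ring
    · refine B' ((B _ _ _ _ h₂₃).trans ?_)
      simp [isoForm, dv, smul_dotProduct, add_dotProduct, kd]; ring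
    · refine B' ((B _ _ _ _ h₂₄).trans ?_)
      simp [isoForm, dv, smul_dotProduct, add_dotProduct, kd]; ring
    · refine B' ((B _ _ _ _ h₃₄).trans ?_)
      simp [isoForm, dv, smul_dotProduct, add_dotProduct, kd]; ring
    · refine C' (C.trans ?_)
      simp [isoForm, dv, smul_dotProduct, do', kd]; ring
  clear_value c
  refine ⟨c, hc, fun u v₁ v₂ v₃ v₄ => ?_⟩
  revert u
  refine eq_of_eq_off_zero (h.smooth _ _ _ _).continuous ?_ fun u hu => ?_
  · have hcc : ∀ i, Continuous fun u : FieldSpace => c i (u ⬝ᵥ u) := fun i =>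
      (contDiff_coeff_dot (hc i)).continuous
    have hd : ∀ v : FieldSpace, Continuous fun u : FieldSpace => u ⬝ᵥ v := fun v => by
      unfold dotProduct
      fun_prop
    exact ((((((((((hcc 0).mul continuous_const).add
      ((hcc 1).mul continuous_const)).add
      ((hcc 2).mul continuous_const)).add
      ((hcc 3).mul (((hd v₁).mul (hd v₂)).mul continuous_const))).add
      ((hcc 4).mul (((hd v₁).mul (hd v₃)).mul continuous_const))).add
      ((hcc 5).mul (((hd v₁).mul (hd v₄)).mul continuous_const))).add
      ((hcc 6).mul (((hd v₂).mul (hd v₃)).mul continuous_const))).add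
      ((hcc 7).mul (((hd v₂).mul (hd v₄)).mul continuous_const))).add
      ((hcc 8).mul (((hd v₃).mul (hd v₄)).mul continuous_const))).add
      ((hcc 9).mul ((((hd v₁).mul (hd v₂)).mul (hd v₃)).mul (hd v₄)))
  · rw [hk u hu, show k (u ⬝ᵥ u) = fun i => c i (u ⬝ᵥ u) from
      funext (hkc _ (dot_self_pos hu))]

end IsEquivariantForm

/-! ### Equivariant tensors of lower rank -/

theorem continuous_coeff_dot {e : ℝ → ℝ} (he : ContDiffOn ℝ ∞ e (Ici 0)) :
    Continuous (fun u : FieldSpace => e (u ⬝ᵥ u)) := (contDiff_coeff_dot he).continuous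

theorem continuous_dot_right (v : FieldSpace) : Continuous fun u : FieldSpace => u ⬝ᵥ v := by
  unfold dotProduct
  fun_prop

theorem ev_dot_ev (i j : Fin 4) : ev i ⬝ᵥ ev j = kd i j := by
  simp [ev, kd, Pi.single_apply, eq_comm]

theorem sum_dot_ev (a b : FieldSpace) : ∑ i, (a ⬝ᵥ ev i) * (b ⬝ᵥ ev i) = a ⬝ᵥ b := by
  simp [ev, dotProduct, Pi.single_apply]

theorem exists_coeffs_rank_three {T : FieldSpace → FieldSpace → FieldSpace → FieldSpace → ℝ}
    (h : IsEquivariantForm (fun u v₁ v₂ v₃ v₄ => T u v₁ v₂ v₃ * (u ⬝ᵥ v₄)))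
    (hT : ∀ v₁ v₂ v₃, Continuous fun u => T u v₁ v₂ v₃) :
    ∃ c : Fin 4 → ℝ → ℝ, SmoothCoeffs c ∧ ∀ u v₁ v₂ v₃, T u v₁ v₂ v₃
      = c 0 (u ⬝ᵥ u) * ((u ⬝ᵥ v₁) * (v₂ ⬝ᵥ v₃)) + c 1 (u ⬝ᵥ u) * ((u ⬝ᵥ v₂) * (v₁ ⬝ᵥ v₃))
        + c 2 (u ⬝ᵥ u) * ((u ⬝ᵥ v₃) * (v₁ ⬝ᵥ v₂))
        + c 3 (u ⬝ᵥ u) * ((u ⬝ᵥ v₁) * (u ⬝ᵥ v₂) * (u ⬝ᵥ v₃)) := by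
  obtain ⟨k, hk, hkT⟩ := h.exists_coeffs
  refine ⟨![k 5, k 7, k 8, k 9], ?_, fun u v₁ v₂ v₃ => ?_⟩
  · intro i
    fin_cases i
    exacts [hk 5, hk 7, hk 8, hk 9]
  simp only [Matrix.cons_val]
  revert u
  refine eq_of_eq_off_zero (hT _ _ _) ?_ fun u hu => ?_
  · have c1 := fun i => continuous_coeff_dot (hk i)
    have c2 := continuous_dot_right
    exact ((((c1 5).mul ((c2 v₁).mul continuous_const)).add
      ((c1 7).mul ((c2 v₂).mul continuous_const))).add
      ((c1 8).mul ((c2 v₃).mul continuous_const))).add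
      ((c1 9).mul (((c2 v₁).mul (c2 v₂)).mul (c2 v₃)))
  · have hpos := dot_self_pos hu
    set r := √(u ⬝ᵥ u) with hr
    have hr0 : r ≠ 0 := (Real.sqrt_pos.2 hpos).ne'
    have hrr : (r • ev 0 : FieldSpace) ⬝ᵥ (r • ev 0) = u ⬝ᵥ u := by
      rw [smul_dotProduct, dotProduct_smul, ev_dot_ev, smul_smul, hr, Real.mul_self_sqrt hpos.le]
      simp [kd]
    have key : ∀ a b c : Fin 4,
        isoForm (fun i => k i (u ⬝ᵥ u)) (r • ev 0) (ev a) (ev b) (ev c) (ev 1) = 0 := by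
      intro a b c
      have := hkT (r • ev 0) (ev a) (ev b) (ev c) (ev 1)
      rw [hrr, smul_dotProduct, ev_dot_ev] at this
      rw [← this]
      simp [kd]
    have k0 : k 0 (u ⬝ᵥ u) = 0 := by
      simpa [isoForm, ev_dot_ev, smul_dotProduct, kd] using key 2 2 1
    have k1 : k 1 (u ⬝ᵥ u) = 0 := by
      simpa [isoForm, ev_dot_ev, smul_dotProduct, kd] using key 2 1 2
    have k2 : k 2 (u ⬝ᵥ u) = 0 := by
      simpa [isoForm, ev_dot_ev, smul_dotProduct, kd] using key 1 2 2
    have k3 : k 3 (u ⬝ᵥ u) = 0 := by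
      simpa [isoForm, ev_dot_ev, smul_dotProduct, kd, hr0, k0] using key 0 0 1
    have k4 : k 4 (u ⬝ᵥ u) = 0 := by
      simpa [isoForm, ev_dot_ev, smul_dotProduct, kd, hr0, k1] using key 0 1 0
    have k6 : k 6 (u ⬝ᵥ u) = 0 := by
      simpa [isoForm, ev_dot_ev, smul_dotProduct, kd, hr0, k2] using key 1 0 0
    have := hkT u v₁ v₂ v₃ u
    simp only [isoForm, k0, k1, k2, k3, k4, k6] at this
    refine mul_right_cancel₀ hpos.ne' (this.trans ?_)
    ring

theorem exists_coeffs_rank_two {T : FieldSpace → FieldSpace → FieldSpace → ℝ}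
    (h : IsEquivariantForm (fun u v₁ v₂ v₃ v₄ => T u v₁ v₂ * (v₃ ⬝ᵥ v₄))) :
    ∃ c : Fin 2 → ℝ → ℝ, SmoothCoeffs c ∧ ∀ u v₁ v₂, T u v₁ v₂
      = c 0 (u ⬝ᵥ u) * (v₁ ⬝ᵥ v₂) + c 1 (u ⬝ᵥ u) * ((u ⬝ᵥ v₁) * (u ⬝ᵥ v₂)) := by
  obtain ⟨k, hk, hkT⟩ := h.exists_coeffs
  refine ⟨![fun t => k 0 t + (k 1 t + k 2 t + t * k 8 t) / 4,
    fun t => k 3 t + (k 4 t + k 5 t + k 6 t + k 7 t + t * k 9 t) / 4], ?_, fun u v₁ v₂ => ?_⟩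
  · intro i
    fin_cases i
    · exact (hk 0).add ((((hk 1).add (hk 2)).add (contDiffOn_id.mul (hk 8))).div_const 4)
    · exact (hk 3).add ((((((hk 4).add (hk 5)).add (hk 6)).add (hk 7)).add
        (contDiffOn_id.mul (hk 9))).div_const 4)
  have h1 : ∑ i, T u v₁ v₂ * (ev i ⬝ᵥ ev i) = ∑ i, isoForm (fun j => k j (u ⬝ᵥ u)) u v₁ v₂
      (ev i) (ev i) := Finset.sum_congr rfl fun i _ => hkT u v₁ v₂ (ev i) (ev i)
  have h2 : ∑ i, T u v₁ v₂ * (ev i ⬝ᵥ ev i) = 4 * T u v₁ v₂ := by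
    simp [ev_dot_ev, kd]
  have h3 : ∑ i, isoForm (fun j => k j (u ⬝ᵥ u)) u v₁ v₂ (ev i) (ev i)
      = 4 * (k 0 (u ⬝ᵥ u) * (v₁ ⬝ᵥ v₂)) + (k 1 (u ⬝ᵥ u) + k 2 (u ⬝ᵥ u)) * (v₁ ⬝ᵥ v₂)
        + 4 * (k 3 (u ⬝ᵥ u) * ((u ⬝ᵥ v₁) * (u ⬝ᵥ v₂)))
        + (k 4 (u ⬝ᵥ u) + k 5 (u ⬝ᵥ u) + k 6 (u ⬝ᵥ u) + k 7 (u ⬝ᵥ u)) * ((u ⬝ᵥ v₁) * (u ⬝ᵥ v₂))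
        + k 8 (u ⬝ᵥ u) * ((u ⬝ᵥ u) * (v₁ ⬝ᵥ v₂))
        + k 9 (u ⬝ᵥ u) * ((u ⬝ᵥ u) * ((u ⬝ᵥ v₁) * (u ⬝ᵥ v₂))) := by
    rw [← sum_dot_ev u u, ← sum_dot_ev v₁ v₂, ← sum_dot_ev u v₁, ← sum_dot_ev u v₂]
    simp only [isoForm, ← sum_dot_ev u v₁, ← sum_dot_ev u v₂, ← sum_dot_ev v₁ v₂]
    simp only [ev_dot_ev, Fin.sum_univ_four, kd, if_true, mul_one]
    ring
  simp only [Matrix.cons_val]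
  linear_combination (h3 + h1 - h2) / 4

theorem exists_coeffs_rank_one {T : FieldSpace → FieldSpace → ℝ}
    (h : IsEquivariantForm (fun u v₁ v₂ v₃ v₄ => T u v₁ * (v₂ ⬝ᵥ v₃) * (u ⬝ᵥ v₄)))
    (hT : ∀ v, Continuous fun u => T u v) :
    ∃ c : ℝ → ℝ, ContDiffOn ℝ ∞ c (Ici 0) ∧ ∀ u v, T u v = c (u ⬝ᵥ u) * (u ⬝ᵥ v) := by
  obtain ⟨k, hk, hkT⟩ := exists_coeffs_rank_three h fun v₁ v₂ v₃ => (hT v₁).mul continuous_const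
  refine ⟨fun t => k 0 t + (k 1 t + k 2 t + t * k 3 t) / 4, ?_, fun u v => ?_⟩
  · exact (hk 0).add ((((hk 1).add (hk 2)).add (contDiffOn_id.mul (hk 3))).div_const 4)
  have h1 := Finset.sum_congr rfl fun i (_ : i ∈ (Finset.univ : Finset (Fin 4))) =>
    hkT u v (ev i) (ev i)
  have h2 : ∑ i, T u v * (ev i ⬝ᵥ ev i) = 4 * T u v := by
    simp [ev_dot_ev, kd]
  have h3 : ∑ i, (k 0 (u ⬝ᵥ u) * ((u ⬝ᵥ v) * (ev i ⬝ᵥ ev i))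
        + k 1 (u ⬝ᵥ u) * ((u ⬝ᵥ ev i) * (v ⬝ᵥ ev i))
        + k 2 (u ⬝ᵥ u) * ((u ⬝ᵥ ev i) * (v ⬝ᵥ ev i))
        + k 3 (u ⬝ᵥ u) * ((u ⬝ᵥ v) * (u ⬝ᵥ ev i) * (u ⬝ᵥ ev i)))
      = 4 * (k 0 (u ⬝ᵥ u) * (u ⬝ᵥ v)) + (k 1 (u ⬝ᵥ u) + k 2 (u ⬝ᵥ u)) * (u ⬝ᵥ v)
        + k 3 (u ⬝ᵥ u) * ((u ⬝ᵥ v) * (u ⬝ᵥ u)) := by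
    simp only [Finset.sum_add_distrib, ← Finset.mul_sum, sum_dot_ev, mul_assoc]
    simp [ev_dot_ev, kd]
    ring
  beta_reduce
  linear_combination (h3 + h1 - h2) / 4

theorem exists_coeff_rank_zero {T : FieldSpace → ℝ} (hT : ContDiff ℝ ∞ T)
    (h : ∀ O ∈ Matrix.orthogonalGroup (Fin 4) ℝ, ∀ u, T (O *ᵥ u) = T u) :
    ∃ c : ℝ → ℝ, ContDiffOn ℝ ∞ c (Ici 0) ∧ ∀ u, T u = c (u ⬝ᵥ u) := by
  have htr : ∀ u v : FieldSpace, u ⬝ᵥ u = v ⬝ᵥ v → T u = T v := by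
    intro u v huv
    obtain ⟨O, hO, rfl⟩ := exists_orthogonal_mulVec_eq huv
    exact (h O hO u).symm
  obtain ⟨g, hg, hg'⟩ := exists_coeff_of_even (f := fun r : ℝ => T (r • ev 0))
    (hT.comp (contDiff_id.smul contDiff_const)) fun r => htr _ _ (by simp)
  refine ⟨g, hg, fun u => ?_⟩
  have hs : √(u ⬝ᵥ u) ^ 2 = u ⬝ᵥ u := Real.sq_sqrt (dot_self_nonneg' u)
  rw [← hs, ← hg']
  refine htr _ _ ?_
  rw [smul_dotProduct, dotProduct_smul, ev_dot_ev, smul_smul, ← pow_two, hs]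
  simp [kd]

/-! ### Taylor coefficients along a curve -/

section quartic

theorem iteratedDeriv_add_zero {f g : ℝ → ℝ} (hf : ContDiff ℝ ∞ f) (hg : ContDiff ℝ ∞ g) (n : ℕ) :
    iteratedDeriv n (fun s => f s + g s) 0 = iteratedDeriv n f 0 + iteratedDeriv n g 0 :=
  iteratedDeriv_add (hf.of_le (by norm_cast; exact le_top)).contDiffAt
    (hg.of_le (by norm_cast; exact le_top)).contDiffAt

theorem contDiff_id_mul {f : ℝ → ℝ} (hf : ContDiff ℝ ∞ f) : ContDiff ℝ ∞ (fun s => s * f s) :=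
  contDiff_id.mul hf

theorem iteratedDeriv_id_mul {f : ℝ → ℝ} (hf : ContDiff ℝ ∞ f) (n : ℕ) :
    iteratedDeriv (n + 1) (fun s => s * f s) 0 = (n + 1) * iteratedDeriv n f 0 := by
  have hd : ∀ {f : ℝ → ℝ}, ContDiff ℝ ∞ f →
      deriv (fun s => s * f s) = fun s => f s + s * deriv f s := by
    intro f hf
    funext s
    have := ((hasDerivAt_id s).fun_mul (hf.differentiable (by simp) s).hasDerivAt).deriv
    simpa using this
  induction n generalizing f with
  | zero => rw [iteratedDeriv_succ', hd hf]; simp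
  | succ n ih =>
    rw [iteratedDeriv_succ', hd hf,
      iteratedDeriv_add_zero hf (contDiff_id_mul (contDiff_deriv hf)), ih (contDiff_deriv hf),
      ← iteratedDeriv_succ']
    push_cast
    ring

/-- The monomial curve. -/
def powCurve (s : ℝ) : Spacetime := ![s, s ^ 2, s ^ 3, s ^ 4]

theorem powCurve_zero : powCurve 0 = 0 := by
  funext i; fin_cases i <;> simp [powCurve]

theorem contDiff_powCurve : ContDiff ℝ ∞ powCurve := by
  refine contDiff_pi.2 fun i => ?_
  fin_cases i
  exacts [contDiff_id, contDiff_id.pow 2, contDiff_id.pow 3, contDiff_id.pow 4]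

theorem deriv_comp_powCurve {H : Spacetime → ℝ} (hH : ContDiff ℝ ∞ H) :
    deriv (fun s => H (powCurve s)) = fun s => pd 0 H (powCurve s)
      + (s * (2 * pd 1 H (powCurve s)) + (s * (s * (3 * pd 2 H (powCurve s)))
        + s * (s * (s * (4 * pd 3 H (powCurve s)))))) := by
  funext s
  have h1 : HasDerivAt powCurve ![1, 2 * s, 3 * s ^ 2, 4 * s ^ 3] s := by
    refine hasDerivAt_pi.2 fun i => ?_
    fin_cases i
    · exact hasDerivAt_id s
    · simpa [powCurve] using hasDerivAt_pow 2 s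
    · simpa [powCurve] using hasDerivAt_pow 3 s
    · simpa [powCurve] using hasDerivAt_pow 4 s
  have h2 := ((hH.differentiable (by simp) _).hasFDerivAt).comp_hasDerivAt s h1
  rw [fderiv_eq_sum_pd] at h2
  refine h2.deriv.trans ?_
  simp [Fin.sum_univ_four]
  ring

/-- Taylor coefficients of `H` along the monomial curve, up to factorials. -/
def curveJet (n : ℕ) (H : Spacetime → ℝ) : ℝ := iteratedDeriv n (fun s => H (powCurve s)) 0

theorem contDiff_curve {H : Spacetime → ℝ} (hH : ContDiff ℝ ∞ H) :
    ContDiff ℝ ∞ (fun s => H (powCurve s)) := hH.comp contDiff_powCurve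

theorem curveJet_succ {H : Spacetime → ℝ} (hH : ContDiff ℝ ∞ H) (n : ℕ) :
    curveJet (n + 1) H = curveJet n (pd 0 H)
      + (iteratedDeriv n (fun s => s * (2 * pd 1 H (powCurve s))) 0
        + (iteratedDeriv n (fun s => s * (s * (3 * pd 2 H (powCurve s)))) 0
        + iteratedDeriv n (fun s => s * (s * (s * (4 * pd 3 H (powCurve s))))) 0)) := by
  have c := fun i => contDiff_curve (contDiff_pd (μ := i) hH)
  have c1 : ContDiff ℝ ∞ (fun s => s * (2 * pd 1 H (powCurve s))) :=
    contDiff_id_mul (contDiff_const.mul (c 1))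
  have c2 : ContDiff ℝ ∞ (fun s => s * (s * (3 * pd 2 H (powCurve s)))) :=
    contDiff_id_mul (contDiff_id_mul (contDiff_const.mul (c 2)))
  have c3 : ContDiff ℝ ∞ (fun s => s * (s * (s * (4 * pd 3 H (powCurve s))))) :=
    contDiff_id_mul (contDiff_id_mul (contDiff_id_mul (contDiff_const.mul (c 3))))
  rw [curveJet, iteratedDeriv_succ', deriv_comp_powCurve hH,
    iteratedDeriv_add_zero (c 0) (c1.add (c2.add c3)),
    iteratedDeriv_add_zero c1 (c2.add c3), iteratedDeriv_add_zero c2 c3]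
  rfl

theorem curveJet_zero (H : Spacetime → ℝ) : curveJet 0 H = H 0 := by
  simp [curveJet, powCurve_zero]

variable {H : Spacetime → ℝ}

theorem curveJet_one (hH : ContDiff ℝ ∞ H) : curveJet 1 H = pd 0 H 0 := by
  rw [curveJet_succ hH]
  simp [curveJet_zero]

theorem iteratedDeriv_two_mul (hH : ContDiff ℝ ∞ H) (c : ℝ) (n : ℕ) :
    iteratedDeriv (n + 1) (fun s => s * (c * H (powCurve s))) 0
      = (n + 1) * (c * curveJet n H) := by
  rw [iteratedDeriv_id_mul (contDiff_const.mul (contDiff_curve hH)),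
    iteratedDeriv_const_mul_field]
  rfl

theorem curveJet_two (hH : ContDiff ℝ ∞ H) :
    curveJet 2 H = pd 0 (pd 0 H) 0 + 2 * pd 1 H 0 := by
  have c := fun i => contDiff_pd (μ := i) hH
  rw [curveJet_succ hH, curveJet_one (c 0), iteratedDeriv_two_mul (c 1),
    iteratedDeriv_id_mul (contDiff_id_mul (contDiff_const.mul (contDiff_curve (c 2)))),
    iteratedDeriv_id_mul (contDiff_id_mul (contDiff_id_mul
      (contDiff_const.mul (contDiff_curve (c 3)))))]
  simp [curveJet_zero]

theorem curveJet_three (hH : ContDiff ℝ ∞ H) :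
    curveJet 3 H = pd 0 (pd 0 (pd 0 H)) 0 + 2 * pd 1 (pd 0 H) 0 + 4 * pd 0 (pd 1 H) 0
      + 6 * pd 2 H 0 := by
  have c := fun i => contDiff_pd (μ := i) hH
  rw [curveJet_succ hH, curveJet_two (c 0), iteratedDeriv_two_mul (c 1),
    iteratedDeriv_id_mul (contDiff_id_mul (contDiff_const.mul (contDiff_curve (c 2)))),
    iteratedDeriv_id_mul (contDiff_id_mul (contDiff_id_mul
      (contDiff_const.mul (contDiff_curve (c 3))))), iteratedDeriv_two_mul (c 2),
    iteratedDeriv_id_mul (contDiff_id_mul (contDiff_const.mul (contDiff_curve (c 3)))),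
    curveJet_one (c 1), curveJet_zero]
  simp
  ring

theorem curveJet_four (hH : ContDiff ℝ ∞ H) :
    curveJet 4 H = pd 0 (pd 0 (pd 0 (pd 0 H))) 0 + 12 * pd 0 (pd 0 (pd 1 H)) 0
      + 12 * pd 1 (pd 1 H) 0 + 24 * pd 0 (pd 2 H) 0 + 24 * pd 3 H 0 := by
  have c := fun i => contDiff_pd (μ := i) hH
  rw [curveJet_succ hH, curveJet_three (c 0), iteratedDeriv_two_mul (c 1),
    iteratedDeriv_id_mul (contDiff_id_mul (contDiff_const.mul (contDiff_curve (c 2)))),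
    iteratedDeriv_id_mul (contDiff_id_mul (contDiff_id_mul
      (contDiff_const.mul (contDiff_curve (c 3))))), iteratedDeriv_two_mul (c 2),
    iteratedDeriv_id_mul (contDiff_id_mul (contDiff_const.mul (contDiff_curve (c 3)))),
    iteratedDeriv_two_mul (c 3), curveJet_two (c 1), curveJet_one (c 2), curveJet_zero]
  rw [pd_comm (μ := 1) (ν := 0) (c 0), pd_comm (μ := 2) (ν := 0) hH,
    show pd 1 (pd 0 H) = pd 0 (pd 1 H) from funext fun x => pd_comm hH]
  push_cast
  ring

/-- The even part of a polynomial of degree at most `4`. -/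
theorem even_part_of_polynomial {q : Polynomial ℝ} (hq : q.natDegree ≤ 4)
    (h : ∀ s, H (powCurve s) = q.eval s) :
    (H (powCurve 1) + H (powCurve (-1))) / 2 = curveJet 0 H + curveJet 2 H / 2
      + curveJet 4 H / 24 := by
  have e : ∀ s, q.eval s = q.coeff 0 + s * (q.coeff 1 + s * (q.coeff 2 + s * (q.coeff 3
      + s * q.coeff 4))) := by
    intro s
    rw [Polynomial.eval_eq_sum_range' (Nat.lt_succ_of_le hq)]
    simp [Finset.sum_range_succ]
    ring
  have hf : (fun s => H (powCurve s)) = fun s => q.coeff 0 + s * (q.coeff 1 + s * (q.coeff 2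
      + s * (q.coeff 3 + s * q.coeff 4))) := funext fun s => (h s).trans (e s)
  have c3 : ContDiff ℝ ∞ fun s : ℝ => s * q.coeff 4 := contDiff_id_mul contDiff_const
  have c2 : ContDiff ℝ ∞ fun s : ℝ => s * (q.coeff 3 + s * q.coeff 4) :=
    contDiff_id_mul (contDiff_const.add c3)
  have c1 : ContDiff ℝ ∞ fun s : ℝ => s * (q.coeff 2 + s * (q.coeff 3 + s * q.coeff 4)) :=
    contDiff_id_mul (contDiff_const.add c2)
  have c0 : ContDiff ℝ ∞ fun s : ℝ => s * (q.coeff 1 + s * (q.coeff 2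
      + s * (q.coeff 3 + s * q.coeff 4))) := contDiff_id_mul (contDiff_const.add c1)
  have j : ∀ n : ℕ, ∀ a : ℝ, ∀ f : ℝ → ℝ, ContDiff ℝ ∞ f →
      iteratedDeriv (n + 1) (fun s => a + f s) 0 = iteratedDeriv (n + 1) f 0 := by
    intro n a f hf
    rw [iteratedDeriv_add_zero contDiff_const hf]
    simp [iteratedDeriv_const]
  have j0 : curveJet 0 H = q.coeff 0 := by rw [curveJet, hf]; simp
  have j2 : curveJet 2 H = 2 * q.coeff 2 := by
    rw [curveJet, hf, j 1 _ _ c0, iteratedDeriv_id_mul (contDiff_const.add c1), j 0 _ _ c1,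
      iteratedDeriv_id_mul (contDiff_const.add c2), iteratedDeriv_zero]
    push_cast
    ring
  have j4 : curveJet 4 H = 24 * q.coeff 4 := by
    rw [curveJet, hf, j 3 _ _ c0, iteratedDeriv_id_mul (contDiff_const.add c1), j 2 _ _ c1,
      iteratedDeriv_id_mul (contDiff_const.add c2), j 1 _ _ c2,
      iteratedDeriv_id_mul (contDiff_const.add c3), j 0 _ _ c3,
      iteratedDeriv_id_mul contDiff_const, iteratedDeriv_zero]
    push_cast
    ring
  rw [h, h, e, e, j0, j2, j4]
  ring

end quartic

/-! ### Directional derivatives -/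

section dirD

variable {E : Type*} [NormedAddCommGroup E] [NormedSpace ℝ E] {F G : E → ℝ}

/-- Directional derivative. -/
def dirD (b : E) (F : E → ℝ) (x : E) : ℝ := fderiv ℝ F x b

theorem contDiff_dirD (hF : ContDiff ℝ ∞ F) (b : E) : ContDiff ℝ ∞ (dirD b F) := by
  unfold dirD
  exact (hF.fderiv_right (m := ∞) (by simp)).clm_apply contDiff_const

theorem pd_comp_line (hF : ContDiff ℝ ∞ F) (x : E) (b : Fin 4 → E) (i : Fin 4) :
    pd i (fun t : Spacetime => F (x + ∑ j, t j • b j))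
      = fun t => dirD (b i) F (x + ∑ j, t j • b j) := by
  funext t
  have h1 : HasFDerivAt (fun t : Spacetime => x + ∑ j, t j • b j)
      (∑ j, (ContinuousLinearMap.proj (R := ℝ) (φ := fun _ : Fin 4 => ℝ) j).smulRight (b j)) t := by
    refine HasFDerivAt.const_add _ (HasFDerivAt.fun_sum fun j _ => ?_)
    exact ((ContinuousLinearMap.proj (R := ℝ) (φ := fun _ : Fin 4 => ℝ) j).smulRight
      (b j)).hasFDerivAt
  have h2 := ((hF.differentiable (by simp) _).hasFDerivAt).comp t h1
  unfold pd
  rw [show (fun t : Spacetime => F (x + ∑ j, t j • b j)) = F ∘ fun t => x + ∑ j, t j • b j from rfl,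
    h2.fderiv]
  simp [dirD, Pi.single_apply, Finset.sum_apply]

theorem contDiff_comp_line (hF : ContDiff ℝ ∞ F) (x : E) (b : Fin 4 → E) :
    ContDiff ℝ ∞ (fun t : Spacetime => F (x + ∑ j, t j • b j)) :=
  hF.comp (contDiff_const.add (ContDiff.sum fun j _ =>
    (contDiff_comp_apply contDiff_id j).smul contDiff_const))

/-- Even part of a function that is polynomial along a monomial curve. -/
theorem even_part_of_curve (hF : ContDiff ℝ ∞ F) (x : E) (b : Fin 4 → E) {q : Polynomial ℝ}
    (hq : q.natDegree ≤ 4) (h : ∀ s, F (x + ∑ j, powCurve s j • b j) = q.eval s) :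
    (F (x + ∑ j, powCurve 1 j • b j) + F (x + ∑ j, powCurve (-1) j • b j)) / 2
      = F x + (dirD (b 0) (dirD (b 0) F) x / 2 + dirD (b 1) F x)
        + (dirD (b 0) (dirD (b 0) (dirD (b 0) (dirD (b 0) F))) x / 24
          + dirD (b 0) (dirD (b 0) (dirD (b 1) F)) x / 2 + dirD (b 1) (dirD (b 1) F) x / 2
          + dirD (b 0) (dirD (b 2) F) x + dirD (b 3) F x) := by
  have hc := contDiff_comp_line hF x b
  have hd := fun i => contDiff_dirD hF (b i)
  rw [even_part_of_polynomial (H := fun t : Spacetime => F (x + ∑ j, t j • b j)) hq h,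
    curveJet_zero, curveJet_two hc, curveJet_four hc]
  simp only [pd_comp_line hF, pd_comp_line (hd _),
    pd_comp_line (contDiff_dirD (hd _) _), pd_comp_line (contDiff_dirD (contDiff_dirD (hd _) _) _)]
  simp
  ring

end dirD

/-! ### Higher derivatives as multilinear forms -/

section dd

variable {E : Type*} [NormedAddCommGroup E] [NormedSpace ℝ E]

/-- Second derivative. -/
def dd2 (l : E → ℝ) (x b c : E) : ℝ := fderiv ℝ (fderiv ℝ l) x b c

/-- Third derivative. -/
def dd3 (l : E → ℝ) (x b c d : E) : ℝ := fderiv ℝ (fderiv ℝ (fderiv ℝ l)) x b c d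

/-- Fourth derivative. -/
def dd4 (l : E → ℝ) (x b c d e : E) : ℝ :=
  fderiv ℝ (fderiv ℝ (fderiv ℝ (fderiv ℝ l))) x b c d e

theorem fderiv_apply_eq {G : Type*} [NormedAddCommGroup G] [NormedSpace ℝ G]
    {Φ : E → (E →L[ℝ] G)} (hΦ : ContDiff ℝ ∞ Φ) (x b c : E) :
    fderiv ℝ (fun y => Φ y c) x b = fderiv ℝ Φ x b c := by
  rw [fderiv_clm_apply (hΦ.differentiable (by simp) x) (differentiableAt_const c)]
  simp

variable {l : E → ℝ}

theorem dd2_eq (hl : ContDiff ℝ ∞ l) (b c : E) :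
    (fun x => dd2 l x b c) = dirD b (dirD c l) :=
  funext fun x => (fderiv_apply_eq (hl.fderiv_right (m := ∞) (by simp)) x b c).symm

theorem dd3_eq (hl : ContDiff ℝ ∞ l) (b c d : E) :
    (fun x => dd3 l x b c d) = dirD b (dirD c (dirD d l)) := by
  have h1 : ContDiff ℝ ∞ (fderiv ℝ l) := hl.fderiv_right (m := ∞) (by simp)
  have h2 : ContDiff ℝ ∞ (fderiv ℝ (fderiv ℝ l)) := h1.fderiv_right (m := ∞) (by simp)
  rw [← dd2_eq hl]
  funext x
  simp only [dirD, dd2, dd3]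
  rw [fderiv_apply_eq (Φ := fun y => fderiv ℝ (fderiv ℝ l) y c) (h2.clm_apply contDiff_const),
    fderiv_apply_eq h2]

set_option maxSynthPendingDepth 4 in
theorem dd4_eq (hl : ContDiff ℝ ∞ l) (b c d e : E) :
    (fun x => dd4 l x b c d e) = dirD b (dirD c (dirD d (dirD e l))) := by
  have h1 : ContDiff ℝ ∞ (fderiv ℝ l) := hl.fderiv_right (m := ∞) (by simp)
  have h2 : ContDiff ℝ ∞ (fderiv ℝ (fderiv ℝ l)) := h1.fderiv_right (m := ∞) (by simp)
  have h3 : ContDiff ℝ ∞ (fderiv ℝ (fderiv ℝ (fderiv ℝ l))) := h2.fderiv_right (m := ∞) (by simp)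
  rw [← dd3_eq hl]
  funext x
  simp only [dirD, dd3, dd4]
  rw [fderiv_apply_eq (Φ := fun y => fderiv ℝ (fderiv ℝ (fderiv ℝ l)) y c d)
      ((h3.clm_apply contDiff_const).clm_apply contDiff_const),
    fderiv_apply_eq (Φ := fun y => fderiv ℝ (fderiv ℝ (fderiv ℝ l)) y c)
      (h3.clm_apply contDiff_const), fderiv_apply_eq h3]

theorem contDiff_dd2 (hl : ContDiff ℝ ∞ l) (b c : E) : ContDiff ℝ ∞ fun x => dd2 l x b c := by
  rw [dd2_eq hl]
  exact contDiff_dirD (contDiff_dirD hl _) _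

theorem contDiff_dd3 (hl : ContDiff ℝ ∞ l) (b c d : E) :
    ContDiff ℝ ∞ fun x => dd3 l x b c d := by
  rw [dd3_eq hl]
  exact contDiff_dirD (contDiff_dirD (contDiff_dirD hl _) _) _

theorem contDiff_dd4 (hl : ContDiff ℝ ∞ l) (b c d e : E) :
    ContDiff ℝ ∞ fun x => dd4 l x b c d e := by
  rw [dd4_eq hl]
  exact contDiff_dirD (contDiff_dirD (contDiff_dirD (contDiff_dirD hl _) _) _) _

section congr

variable {x x' : E} {b b' : Fin 4 → E}

theorem line_zero (x : E) (b : Fin 4 → E) : x + ∑ j, (0 : Spacetime) j • b j = x := by simp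

theorem dirD_congr_line (hl : ContDiff ℝ ∞ l)
    (h : ∀ t : Spacetime, l (x + ∑ j, t j • b j) = l (x' + ∑ j, t j • b' j)) :
    dirD (b 0) l x = dirD (b' 0) l x' := by
  have h1 := congrFun (pd_comp_line hl x b 0) 0
  rw [show (fun t : Spacetime => l (x + ∑ j, t j • b j)) = fun t => l (x' + ∑ j, t j • b' j) from
    funext h, pd_comp_line hl x' b'] at h1
  simpa using h1.symm

theorem dd2_congr_line (hl : ContDiff ℝ ∞ l)
    (h : ∀ t : Spacetime, l (x + ∑ j, t j • b j) = l (x' + ∑ j, t j • b' j)) :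
    dd2 l x (b 0) (b 1) = dd2 l x' (b' 0) (b' 1) := by
  have e : ∀ (x : E) (b : Fin 4 → E), dd2 l x (b 0) (b 1)
      = pd 0 (pd 1 (fun t : Spacetime => l (x + ∑ j, t j • b j))) 0 := by
    intro x b
    rw [pd_comp_line hl, pd_comp_line (contDiff_dirD hl _), ← dd2_eq hl]
    simp only [line_zero]
  rw [e, e, funext h]

theorem dd3_congr_line (hl : ContDiff ℝ ∞ l)
    (h : ∀ t : Spacetime, l (x + ∑ j, t j • b j) = l (x' + ∑ j, t j • b' j)) :
    dd3 l x (b 0) (b 1) (b 2) = dd3 l x' (b' 0) (b' 1) (b' 2) := by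
  have e : ∀ (x : E) (b : Fin 4 → E), dd3 l x (b 0) (b 1) (b 2)
      = pd 0 (pd 1 (pd 2 (fun t : Spacetime => l (x + ∑ j, t j • b j)))) 0 := by
    intro x b
    rw [pd_comp_line hl, pd_comp_line (contDiff_dirD hl _),
      pd_comp_line (contDiff_dirD (contDiff_dirD hl _) _), ← dd3_eq hl]
    simp only [line_zero]
  rw [e, e, funext h]

theorem dd4_congr_line (hl : ContDiff ℝ ∞ l)
    (h : ∀ t : Spacetime, l (x + ∑ j, t j • b j) = l (x' + ∑ j, t j • b' j)) :
    dd4 l x (b 0) (b 1) (b 2) (b 3) = dd4 l x' (b' 0) (b' 1) (b' 2) (b' 3) := by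
  have e : ∀ (x : E) (b : Fin 4 → E), dd4 l x (b 0) (b 1) (b 2) (b 3)
      = pd 0 (pd 1 (pd 2 (pd 3 (fun t : Spacetime => l (x + ∑ j, t j • b j))))) 0 := by
    intro x b
    rw [pd_comp_line hl, pd_comp_line (contDiff_dirD hl _),
      pd_comp_line (contDiff_dirD (contDiff_dirD hl _) _),
      pd_comp_line (contDiff_dirD (contDiff_dirD (contDiff_dirD hl _) _) _), ← dd4_eq hl]
    simp only [line_zero]
  rw [e, e, funext h]

end congr

end dd

/-! ### Invariant functions of polynomial fields -/

/-- Polynomials in the spacetime coordinates. -/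
abbrev Poly := MvPolynomial (Fin 4) ℝ

/-- Linear polynomials. -/
def lin (ξ : Fin 4 → ℝ) : Poly := ∑ i, ξ i • MvPolynomial.X i

theorem lin_add (ξ ξ' : Fin 4 → ℝ) : lin (ξ + ξ') = lin ξ + lin ξ' := by
  simp [lin, add_smul, Finset.sum_add_distrib]

theorem lin_smul (c : ℝ) (ξ : Fin 4 → ℝ) : lin (c • ξ) = c • lin ξ := by
  simp [lin, Finset.smul_sum, smul_smul]

theorem lin_ev (i : Fin 4) : lin (ev i) = MvPolynomial.X i := by
  simp [lin, ev, Pi.single_apply, ite_smul]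

theorem eval_lin (ξ y : Fin 4 → ℝ) : MvPolynomial.eval y (lin ξ) = ξ ⬝ᵥ y := by
  simp [lin, dotProduct, MvPolynomial.smul_eval]

theorem eval_lin_mulVec (M : Matrix (Fin 4) (Fin 4) ℝ) (ξ y : Fin 4 → ℝ) :
    MvPolynomial.eval y (lin (M *ᵥ ξ)) = MvPolynomial.eval (Mᵀ *ᵥ y) (lin ξ) := by
  rw [eval_lin, eval_lin, Matrix.mulVec_transpose, dotProduct_comm, Matrix.dotProduct_mulVec,
    dotProduct_comm]

/-- A smooth function on a space to which polynomial fields are mapped linearly, invariant under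
internal and Lorentz transformations of the fields. -/
structure IsInvariantModel {E : Type*} [NormedAddCommGroup E] [NormedSpace ℝ E]
    (J : Poly →ₗ[ℝ] FieldSpace →ₗ[ℝ] E) (l : E → ℝ) : Prop where
  smooth : ContDiff ℝ ∞ l
  internal : ∀ O ∈ Matrix.orthogonalGroup (Fin 4) ℝ, ∀ (u : FieldSpace) (p : Fin 4 → Poly)
    (v : Fin 4 → FieldSpace) (t : Spacetime),
    l (J 1 (O *ᵥ u) + ∑ j, t j • J (p j) (O *ᵥ v j)) = l (J 1 u + ∑ j, t j • J (p j) (v j))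
  lorentz : ∀ M, IsLorentz M → ∀ (u : FieldSpace) (p p' : Fin 4 → Poly),
    (∀ j y, MvPolynomial.eval y (p' j) = MvPolynomial.eval (M *ᵥ y) (p j)) →
    ∀ (v : Fin 4 → FieldSpace) (t : Spacetime),
    l (J 1 u + ∑ j, t j • J (p' j) (v j)) = l (J 1 u + ∑ j, t j • J (p j) (v j))

namespace IsInvariantModel

variable {E : Type*} [NormedAddCommGroup E] [NormedSpace ℝ E]
  {J : Poly →ₗ[ℝ] FieldSpace →ₗ[ℝ] E} {l : E → ℝ}

theorem contDiff_const_field (J : Poly →ₗ[ℝ] FieldSpace →ₗ[ℝ] E) (p : Poly) :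
    ContDiff ℝ ∞ (fun u => J p u) := (J p).toContinuousLinearMap.contDiff

/-! #### Dependence on the fibre directions -/

theorem equivariant_four (h : IsInvariantModel J l) (p₁ p₂ p₃ p₄ : Poly) :
    IsEquivariantForm fun u v₁ v₂ v₃ v₄ =>
      dd4 l (J 1 u) (J p₁ v₁) (J p₂ v₂) (J p₃ v₃) (J p₄ v₄) where
  lin u := by constructor <;> intros <;> simp [dd4]
  smooth v₁ v₂ v₃ v₄ := (contDiff_dd4 h.smooth _ _ _ _).comp (contDiff_const_field J 1)
  inv O hO u v₁ v₂ v₃ v₄ := dd4_congr_line (b := fun j => J (![p₁, p₂, p₃, p₄] j)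
    (O *ᵥ (![v₁, v₂, v₃, v₄] j))) (b' := fun j => J (![p₁, p₂, p₃, p₄] j)
    (![v₁, v₂, v₃, v₄] j)) h.smooth (h.internal O hO u _ _)

theorem equivariant_three (h : IsInvariantModel J l) (p₁ p₂ p₃ : Poly) :
    IsEquivariantForm fun u v₁ v₂ v₃ v₄ =>
      dd3 l (J 1 u) (J p₁ v₁) (J p₂ v₂) (J p₃ v₃) * (u ⬝ᵥ v₄) where
  lin u := by constructor <;> intros <;> simp [dd3] <;> ring
  smooth v₁ v₂ v₃ v₄ := ((contDiff_dd3 h.smooth _ _ _).comp (contDiff_const_field J 1)).mul (by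
    unfold dotProduct; fun_prop)
  inv O hO u v₁ v₂ v₃ v₄ := by
    rw [orthogonal_dot hO]
    exact congrArg (· * _) (dd3_congr_line (b := fun j => J (![p₁, p₂, p₃, 0] j)
      (O *ᵥ (![v₁, v₂, v₃, 0] j))) (b' := fun j => J (![p₁, p₂, p₃, 0] j)
      (![v₁, v₂, v₃, 0] j)) h.smooth (h.internal O hO u _ _))

theorem equivariant_two (h : IsInvariantModel J l) (p₁ p₂ : Poly) :
    IsEquivariantForm fun u v₁ v₂ v₃ v₄ =>
      dd2 l (J 1 u) (J p₁ v₁) (J p₂ v₂) * (v₃ ⬝ᵥ v₄) where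
  lin u := by constructor <;> intros <;> simp [dd2] <;> ring
  smooth v₁ v₂ v₃ v₄ := ((contDiff_dd2 h.smooth _ _).comp (contDiff_const_field J 1)).mul
    contDiff_const
  inv O hO u v₁ v₂ v₃ v₄ := by
    rw [orthogonal_dot hO]
    exact congrArg (· * _) (dd2_congr_line (b := fun j => J (![p₁, p₂, 0, 0] j)
      (O *ᵥ (![v₁, v₂, 0, 0] j))) (b' := fun j => J (![p₁, p₂, 0, 0] j)
      (![v₁, v₂, 0, 0] j)) h.smooth (h.internal O hO u _ _))

theorem equivariant_one (h : IsInvariantModel J l) (p : Poly) :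
    IsEquivariantForm fun u v₁ v₂ v₃ v₄ =>
      dirD (J p v₁) l (J 1 u) * (v₂ ⬝ᵥ v₃) * (u ⬝ᵥ v₄) where
  lin u := by constructor <;> intros <;> simp [dirD] <;> ring
  smooth v₁ v₂ v₃ v₄ := (((contDiff_dirD h.smooth _).comp (contDiff_const_field J 1)).mul
    contDiff_const).mul (by unfold dotProduct; fun_prop)
  inv O hO u v₁ v₂ v₃ v₄ := by
    rw [orthogonal_dot hO, orthogonal_dot hO]
    exact congrArg (· * _ * _) (dirD_congr_line (b := fun j => J (![p, 0, 0, 0] j)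
      (O *ᵥ (![v₁, 0, 0, 0] j))) (b' := fun j => J (![p, 0, 0, 0] j)
      (![v₁, 0, 0, 0] j)) h.smooth (h.internal O hO u _ _))

theorem coeffs_four (h : IsInvariantModel J l) (p₁ p₂ p₃ p₄ : Poly) :
    ∃ c : Fin 10 → ℝ → ℝ, SmoothCoeffs c ∧ ∀ u v₁ v₂ v₃ v₄,
      dd4 l (J 1 u) (J p₁ v₁) (J p₂ v₂) (J p₃ v₃) (J p₄ v₄)
        = isoForm (fun i => c i (u ⬝ᵥ u)) u v₁ v₂ v₃ v₄ :=
  (h.equivariant_four p₁ p₂ p₃ p₄).exists_coeffs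

theorem coeffs_three (h : IsInvariantModel J l) (p₁ p₂ p₃ : Poly) :
    ∃ c : Fin 4 → ℝ → ℝ, SmoothCoeffs c ∧ ∀ u v₁ v₂ v₃,
      dd3 l (J 1 u) (J p₁ v₁) (J p₂ v₂) (J p₃ v₃)
      = c 0 (u ⬝ᵥ u) * ((u ⬝ᵥ v₁) * (v₂ ⬝ᵥ v₃)) + c 1 (u ⬝ᵥ u) * ((u ⬝ᵥ v₂) * (v₁ ⬝ᵥ v₃))
        + c 2 (u ⬝ᵥ u) * ((u ⬝ᵥ v₃) * (v₁ ⬝ᵥ v₂))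
        + c 3 (u ⬝ᵥ u) * ((u ⬝ᵥ v₁) * (u ⬝ᵥ v₂) * (u ⬝ᵥ v₃)) :=
  exists_coeffs_rank_three
    (T := fun u v₁ v₂ v₃ => dd3 l (J 1 u) (J p₁ v₁) (J p₂ v₂) (J p₃ v₃))
    (h.equivariant_three p₁ p₂ p₃) fun _ _ _ =>
    ((contDiff_dd3 h.smooth _ _ _).comp (contDiff_const_field J 1)).continuous

theorem coeffs_two (h : IsInvariantModel J l) (p₁ p₂ : Poly) :
    ∃ c : Fin 2 → ℝ → ℝ, SmoothCoeffs c ∧ ∀ u v₁ v₂, dd2 l (J 1 u) (J p₁ v₁) (J p₂ v₂)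
      = c 0 (u ⬝ᵥ u) * (v₁ ⬝ᵥ v₂) + c 1 (u ⬝ᵥ u) * ((u ⬝ᵥ v₁) * (u ⬝ᵥ v₂)) :=
  exists_coeffs_rank_two (T := fun u v₁ v₂ => dd2 l (J 1 u) (J p₁ v₁) (J p₂ v₂))
    (h.equivariant_two p₁ p₂)

theorem coeffs_one (h : IsInvariantModel J l) (p : Poly) :
    ∃ c : ℝ → ℝ, ContDiffOn ℝ ∞ c (Ici 0) ∧ ∀ u v,
      dirD (J p v) l (J 1 u) = c (u ⬝ᵥ u) * (u ⬝ᵥ v) :=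
  exists_coeffs_rank_one (T := fun u v => dirD (J p v) l (J 1 u)) (h.equivariant_one p) fun _ =>
    ((contDiff_dirD h.smooth _).comp (contDiff_const_field J 1)).continuous

theorem coeffs_zero (h : IsInvariantModel J l) :
    ∃ c : ℝ → ℝ, ContDiffOn ℝ ∞ c (Ici 0) ∧ ∀ u, l (J 1 u) = c (u ⬝ᵥ u) :=
  exists_coeff_rank_zero (T := fun u => l (J 1 u)) (h.smooth.comp (contDiff_const_field J 1))
    fun O hO u => by
      simpa using h.internal O hO u 0 0 0

/-! #### Dependence on the spacetime directions -/

theorem reflM_eval {n : Fin 4 → ℝ} (hn : (∑ i, et i * n i * n i) ≠ 0) :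
    ∃ M, IsLorentz M ∧ ∀ ξ y : Fin 4 → ℝ, MvPolynomial.eval y (lin (refl et n ξ))
      = MvPolynomial.eval (M *ᵥ y) (lin ξ) :=
  ⟨(reflM et n)ᵀ, by
    have := (isLorentz_reflM hn).transpose
    rwa [IsLorentz, Matrix.transpose_transpose], fun ξ y => by
    rw [← reflM_mulVec, eval_lin_mulVec]⟩

theorem isotropic_four (h : IsInvariantModel J l) (u v₁ v₂ v₃ v₄ : FieldSpace) :
    IsotropicOn univ et fun ξ₁ ξ₂ ξ₃ ξ₄ =>
      dd4 l (J 1 u) (J (lin ξ₁) v₁) (J (lin ξ₂) v₂) (J (lin ξ₃) v₃) (J (lin ξ₄) v₄) where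
  lin := by constructor <;> intros <;> simp [dd4, lin_add, lin_smul]
  inv n _ hn x y z w := by
    obtain ⟨M, hM, he⟩ := reflM_eval hn
    refine dd4_congr_line (b := fun j => J (![lin (refl et n x), lin (refl et n y),
      lin (refl et n z), lin (refl et n w)] j) (![v₁, v₂, v₃, v₄] j))
      (b' := fun j => J (![lin x, lin y, lin z, lin w] j)
      (![v₁, v₂, v₃, v₄] j)) h.smooth (h.lorentz M hM u _ _ (fun j y => ?_) _)
    fin_cases j <;> simp [he]

theorem isotropic_three (h : IsInvariantModel J l) (u v₁ v₂ v₃ : FieldSpace) :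
    IsotropicOn univ et fun ξ₁ ξ₂ ξ₃ ξ₄ =>
      dd3 l (J 1 u) (J (lin ξ₁) v₁) (J (lin ξ₂) v₂) (J (lin ξ₃ * lin ξ₄) v₃) where
  lin := by constructor <;> intros <;> simp [dd3, lin_add, lin_smul, add_mul, mul_add]
  inv n _ hn x y z w := by
    obtain ⟨M, hM, he⟩ := reflM_eval hn
    refine dd3_congr_line (b := fun j => J (![lin (refl et n x), lin (refl et n y),
      lin (refl et n z) * lin (refl et n w), 0] j) (![v₁, v₂, v₃, 0] j))
      (b' := fun j => J (![lin x, lin y, lin z * lin w, 0] j)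
      (![v₁, v₂, v₃, 0] j)) h.smooth (h.lorentz M hM u _ _ (fun j y => ?_) _)
    fin_cases j <;> simp [he]

theorem isotropic_two_two (h : IsInvariantModel J l) (u v₁ v₂ : FieldSpace) :
    IsotropicOn univ et fun ξ₁ ξ₂ ξ₃ ξ₄ =>
      dd2 l (J 1 u) (J (lin ξ₁ * lin ξ₂) v₁) (J (lin ξ₃ * lin ξ₄) v₂) where
  lin := by constructor <;> intros <;> simp [dd2, lin_add, lin_smul, add_mul, mul_add]
  inv n _ hn x y z w := by
    obtain ⟨M, hM, he⟩ := reflM_eval hn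
    refine dd2_congr_line (b := fun j => J (![lin (refl et n x) * lin (refl et n y),
      lin (refl et n z) * lin (refl et n w), 0, 0] j) (![v₁, v₂, 0, 0] j))
      (b' := fun j => J (![lin x * lin y, lin z * lin w, 0, 0] j)
      (![v₁, v₂, 0, 0] j)) h.smooth (h.lorentz M hM u _ _ (fun j y => ?_) _)
    fin_cases j <;> simp [he]

theorem isotropic_one_three (h : IsInvariantModel J l) (u v₁ v₂ : FieldSpace) :
    IsotropicOn univ et fun ξ₁ ξ₂ ξ₃ ξ₄ =>
      dd2 l (J 1 u) (J (lin ξ₁) v₁) (J (lin ξ₂ * lin ξ₃ * lin ξ₄) v₂) where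
  lin := by constructor <;> intros <;> simp [dd2, lin_add, lin_smul, add_mul, mul_add]
  inv n _ hn x y z w := by
    obtain ⟨M, hM, he⟩ := reflM_eval hn
    refine dd2_congr_line (b := fun j => J (![lin (refl et n x), lin (refl et n y) *
      lin (refl et n z) * lin (refl et n w), 0, 0] j) (![v₁, v₂, 0, 0] j))
      (b' := fun j => J (![lin x, lin y * lin z * lin w, 0, 0] j)
      (![v₁, v₂, 0, 0] j)) h.smooth (h.lorentz M hM u _ _ (fun j y => ?_) _)
    fin_cases j <;> simp [he]

theorem isotropic_one (h : IsInvariantModel J l) (u v : FieldSpace) :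
    IsotropicOn univ et fun ξ₁ ξ₂ ξ₃ ξ₄ =>
      dirD (J (lin ξ₁ * lin ξ₂ * lin ξ₃ * lin ξ₄) v) l (J 1 u) where
  lin := by constructor <;> intros <;> simp [dirD, lin_add, lin_smul, add_mul, mul_add]
  inv n _ hn x y z w := by
    obtain ⟨M, hM, he⟩ := reflM_eval hn
    refine dirD_congr_line (b := fun j => J (![lin (refl et n x) * lin (refl et n y) *
      lin (refl et n z) * lin (refl et n w), 0, 0, 0] j) (![v, 0, 0, 0] j))
      (b' := fun j => J (![lin x * lin y * lin z * lin w, 0, 0, 0] j)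
      (![v, 0, 0, 0] j)) h.smooth (h.lorentz M hM u _ _ (fun j y => ?_) _)
    fin_cases j <;> simp [he]

/-- The Minkowski product. -/
def mdot' (ξ ξ' : Fin 4 → ℝ) : ℝ := ∑ i, et i * ξ i * ξ' i

theorem mdot'_refl {n : Fin 4 → ℝ} (hn : (∑ i, et i * n i * n i) ≠ 0) (x y : Fin 4 → ℝ) :
    mdot' (refl et n x) (refl et n y) = mdot' x y := by
  simp only [mdot', refl, Pi.sub_apply, Pi.smul_apply, smul_eq_mul]
  set N := ∑ i, et i * n i * n i with hN
  simp only [Fin.sum_univ_four] at hN ⊢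
  field_simp
  rw [hN]
  ring

theorem isotropic_quadratic_two (h : IsInvariantModel J l) (u v₁ v₂ : FieldSpace) :
    IsotropicOn univ et fun ξ₁ ξ₂ ξ₃ ξ₄ =>
      dd2 l (J 1 u) (J (lin ξ₁) v₁) (J (lin ξ₂) v₂) * mdot' ξ₃ ξ₄ where
  lin := by
    constructor <;> intros <;>
    simp [dd2, lin_add, lin_smul, mdot', Fin.sum_univ_four] <;> ring
  inv n _ hn x y z w := by
    obtain ⟨M, hM, he⟩ := reflM_eval hn
    rw [mdot'_refl hn]
    congr 1
    refine dd2_congr_line (b := fun j => J (![lin (refl et n x), lin (refl et n y), 0, 0] j)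
      (![v₁, v₂, 0, 0] j))
      (b' := fun j => J (![lin x, lin y, 0, 0] j)
      (![v₁, v₂, 0, 0] j)) h.smooth (h.lorentz M hM u _ _ (fun j y => ?_) _)
    fin_cases j <;> simp [he]

theorem isotropic_quadratic_one (h : IsInvariantModel J l) (u v : FieldSpace) :
    IsotropicOn univ et fun ξ₁ ξ₂ ξ₃ ξ₄ =>
      dirD (J (lin ξ₁ * lin ξ₂) v) l (J 1 u) * mdot' ξ₃ ξ₄ where
  lin := by
    constructor <;> intros <;>
    simp [dirD, lin_add, lin_smul, mdot', Fin.sum_univ_four, add_mul, mul_add] <;> ring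
  inv n _ hn x y z w := by
    obtain ⟨M, hM, he⟩ := reflM_eval hn
    rw [mdot'_refl hn]
    congr 1
    refine dirD_congr_line (b := fun j => J (![lin (refl et n x) * lin (refl et n y), 0, 0, 0] j)
      (![v, 0, 0, 0] j))
      (b' := fun j => J (![lin x * lin y, 0, 0, 0] j)
      (![v, 0, 0, 0] j)) h.smooth (h.lorentz M hM u _ _ (fun j y => ?_) _)
    fin_cases j <;> simp [he]

end IsInvariantModel

/-! ### Jets of polynomial fields -/

section jetLinear

variable {f g : Spacetime → FieldSpace} (r : ℕ) (x : Spacetime)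

theorem contDiffAt_nat (hf : ContDiff ℝ ∞ f) (m : ℕ) : ContDiffAt ℝ m f x :=
  (hf.of_le (by norm_cast; exact le_top)).contDiffAt

theorem jet_add (hf : ContDiff ℝ ∞ f) (hg : ContDiff ℝ ∞ g) :
    jet r (fun y => f y + g y) x = jet r f x + jet r g x :=
  funext fun m => fun_iteratedFDeriv_add_apply (contDiffAt_nat x hf m) (contDiffAt_nat x hg m)

theorem jet_smul (hf : ContDiff ℝ ∞ f) (c : ℝ) :
    jet r (fun y => c • f y) x = c • jet r f x :=
  funext fun m => iteratedFDeriv_const_smul_apply' (contDiffAt_nat x hf m)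

theorem jet_sum {F : Fin 4 → Spacetime → FieldSpace} (hF : ∀ i, ContDiff ℝ ∞ (F i)) :
    jet r (fun y => ∑ i, F i y) x = ∑ i, jet r (F i) x := by
  funext m
  rw [Finset.sum_apply]
  exact iteratedFDeriv_fun_sum_apply fun i _ => contDiffAt_nat x (hF i) m

end jetLinear

theorem contDiff_eval (p : Poly) : ContDiff ℝ ∞ fun y : Spacetime => MvPolynomial.eval y p := by
  induction p using MvPolynomial.induction_on with
  | C a => simpa using contDiff_const
  | add p q hp hq => simpa using hp.add hq
  | mul_X p i hp => simpa using hp.mul (contDiff_apply ℝ ℝ i)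

/-- The field `y ↦ p(y) v`. -/
def polyField (p : Poly) (v : FieldSpace) : Spacetime → FieldSpace :=
  fun y => MvPolynomial.eval y p • v

theorem contDiff_polyField (p : Poly) (v : FieldSpace) : ContDiff ℝ ∞ (polyField p v) :=
  (contDiff_eval p).smul contDiff_const

/-- The jet at the origin of the field `y ↦ p(y) v`. -/
def polyJet (r : ℕ) : Poly →ₗ[ℝ] FieldSpace →ₗ[ℝ] JetSpace r :=
  LinearMap.mk₂ ℝ (fun p v => jet r (polyField p v) 0)
    (fun p p' v => by
      rw [← jet_add r 0 (contDiff_polyField p v) (contDiff_polyField p' v)]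
      congr 1; funext y; simp [polyField, add_smul])
    (fun c p v => by
      rw [← jet_smul r 0 (contDiff_polyField p v)]
      congr 1; funext y; simp [polyField, MvPolynomial.smul_eval, mul_smul])
    (fun p v v' => by
      rw [← jet_add r 0 (contDiff_polyField p v) (contDiff_polyField p v')]
      congr 1; funext y; simp [polyField])
    (fun c p v => by
      rw [← jet_smul r 0 (contDiff_polyField p v)]
      congr 1; funext y; simp [polyField, smul_comm c])

theorem polyJet_apply (r : ℕ) (p : Poly) (v : FieldSpace) :
    polyJet r p v = jet r (polyField p v) 0 := rfl

/-- The field `y ↦ u + t_0 p_0(y) v_0 + … + t_3 p_3(y) v_3`. -/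
def combField (u : FieldSpace) (p : Fin 4 → Poly) (v : Fin 4 → FieldSpace) (t : Spacetime) :
    Spacetime → FieldSpace := fun y => u + ∑ j, t j • polyField (p j) (v j) y

section combField

variable (u : FieldSpace) (p : Fin 4 → Poly) (v : Fin 4 → FieldSpace) (t : Spacetime)

theorem contDiff_sum_smul {F : Fin 4 → Spacetime → FieldSpace} (hF : ∀ i, ContDiff ℝ ∞ (F i))
    (c : Fin 4 → ℝ) : ContDiff ℝ ∞ fun y => ∑ i, c i • F i y :=
  ContDiff.sum fun i _ => (hF i).const_smul (c i)

theorem contDiff_combField : ContDiff ℝ ∞ (combField u p v t) :=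
  contDiff_const.add (contDiff_sum_smul (fun _ => contDiff_polyField _ _) t)

theorem jet_combField (r : ℕ) :
    jet r (combField u p v t) 0 = polyJet r 1 u + ∑ j, t j • polyJet r (p j) (v j) := by
  unfold combField
  rw [jet_add r 0 contDiff_const (contDiff_sum_smul (fun _ => contDiff_polyField _ _) t),
    jet_sum r 0 (F := fun i y => t i • polyField (p i) (v i) y)
      fun i => (contDiff_polyField _ _).const_smul (t i)]
  congr 1
  · rw [polyJet_apply]; congr 1; funext y; simp [polyField]
  · exact Finset.sum_congr rfl fun j _ => jet_smul r 0 (contDiff_polyField _ _) _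

end combField

theorem IsInvariantLagrangian.isInvariantModel {L : Lagrangian} (hL : IsInvariantLagrangian L)
    {r : ℕ} {l : JetSpace r → ℝ} (hl : ContDiff ℝ ∞ l)
    (h : ∀ φ : Spacetime → FieldSpace, ContDiff ℝ ∞ φ → ∀ x, L φ x = l (jet r φ x)) :
    IsInvariantModel (polyJet r) l where
  smooth := hl
  internal O hO u p v t := by
    rw [← jet_combField, ← jet_combField, ← h _ (contDiff_combField _ _ _ _),
      ← h _ (contDiff_combField _ _ _ _), ← hL.internal O hO _ (contDiff_combField u p v t)]
    congr 1
    funext y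
    simp [combField, polyField, Matrix.mulVec_add, Matrix.mulVec_smul, Fin.sum_univ_four]
  lorentz M hM u p p' hp v t := by
    rw [← jet_combField, ← jet_combField, ← h _ (contDiff_combField _ _ _ _),
      ← h _ (contDiff_combField _ _ _ _)]
    have := hL.poincare M hM 0 _ (contDiff_combField u p v t) 0
    rw [Matrix.mulVec_zero, add_zero] at this
    rw [← this]
    congr 1
    funext y
    simp [combField, polyField, hp]

/-! ### Taylor polynomials -/

/-- The homogeneous part of degree `k` of the Taylor polynomial at the origin. -/
def taylorHom : ℕ → (Spacetime → FieldSpace) → Spacetime → FieldSpace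
  | 0, ψ => fun _ => ψ 0
  | k + 1, ψ => fun y => (1 / ((k : ℝ) + 1)) • ∑ μ, y μ • taylorHom k (pdv μ ψ) y

theorem contDiff_taylorHom (k : ℕ) (ψ : Spacetime → FieldSpace) :
    ContDiff ℝ ∞ (taylorHom k ψ) := by
  induction k generalizing ψ with
  | zero => exact contDiff_const
  | succ k ih =>
    exact (ContDiff.sum fun μ _ => (contDiff_apply ℝ ℝ μ).smul (ih (pdv μ ψ))).const_smul
      (1 / ((k : ℝ) + 1))

theorem taylorHom_smul (k : ℕ) (ψ : Spacetime → FieldSpace) (s : ℝ) (y : Spacetime) :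
    taylorHom k ψ (s • y) = s ^ k • taylorHom k ψ y := by
  induction k generalizing ψ with
  | zero => simp [taylorHom]
  | succ k ih =>
    simp only [taylorHom, ih, Finset.smul_sum, smul_smul, Pi.smul_apply, smul_eq_mul]
    refine Finset.sum_congr rfl fun μ _ => ?_
    congr 1
    ring

theorem taylorHom_succ_zero (k : ℕ) (ψ : Spacetime → FieldSpace) : taylorHom (k + 1) ψ 0 = 0 := by
  simp [taylorHom]

theorem pdv_coord_smul {F : Fin 4 → Spacetime → FieldSpace} (hF : ∀ i, ContDiff ℝ ∞ (F i)) (c : ℝ)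
    (ρ : Fin 4) (y : Spacetime) :
    pdv ρ (fun y => c • ∑ μ, y μ • F μ y) y
      = c • (F ρ y + ∑ μ, y μ • pdv ρ (F μ) y) := by
  funext i
  have h1 : ∀ μ, ContDiff ℝ ∞ fun y : Spacetime => y μ * F μ y i := fun μ =>
    (contDiff_apply ℝ ℝ μ).mul (contDiff_comp_apply (hF μ) i)
  simp only [pdv, Finset.sum_apply, Pi.smul_apply, smul_eq_mul, Pi.add_apply]
  rw [pd_const_mul _ (ContDiff.sum fun μ _ => h1 μ), pd_sum h1]
  congr 1
  rw [Finset.sum_congr rfl fun μ _ => pd_mul (contDiff_apply ℝ ℝ μ) (contDiff_comp_apply (hF μ) i)]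
  simp [pd_coord, Finset.sum_add_distrib]

theorem pdv_taylorHom_succ {ψ : Spacetime → FieldSpace} (hψ : ContDiff ℝ ∞ ψ) (k : ℕ) (ρ : Fin 4) :
    pdv ρ (taylorHom (k + 1) ψ) = taylorHom k (pdv ρ ψ) := by
  induction k generalizing ψ with
  | zero =>
    funext y
    have := pdv_coord_smul (F := fun μ _ => pdv μ ψ 0) (fun _ => contDiff_const) (1 / ((0 : ℕ) + 1)) ρ y
    simp only [taylorHom]
    rw [this]
    have h0 : ∀ v : FieldSpace, pdv ρ (fun _ => v) y = 0 := fun v => funext fun i => pd_const _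
    simp [h0]
  | succ k ih =>
    funext y
    have := pdv_coord_smul (F := fun μ => taylorHom (k + 1) (pdv μ ψ))
      (fun _ => contDiff_taylorHom _ _) (1 / (((k + 1 : ℕ) : ℝ) + 1)) ρ y
    rw [taylorHom, this]
    simp only [fun μ => ih (contDiff_pdv (μ := μ) hψ)]
    have e : ∀ μ, pdv ρ (pdv μ ψ) = pdv μ (pdv ρ ψ) := fun μ => funext fun _ => pdv_comm hψ
    simp only [e]
    have h2 : (∑ μ, y μ • taylorHom k (pdv μ (pdv ρ ψ)) y)
        = ((k : ℝ) + 1) • taylorHom (k + 1) (pdv ρ ψ) y := by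
      have : ((k : ℝ) + 1) ≠ 0 := by positivity
      simp only [taylorHom, smul_smul]
      field_simp
      simp
    rw [h2]
    have : ((k : ℝ) + 1 + 1) ≠ 0 := by positivity
    push_cast
    rw [show ∀ v : FieldSpace, v + ((k : ℝ) + 1) • v = ((k : ℝ) + 1 + 1) • v from
      fun v => by module, smul_smul, one_div, inv_mul_cancel₀ this, one_smul]

/-- The Taylor polynomial at the origin. -/
def taylorPoly (n : ℕ) (ψ : Spacetime → FieldSpace) (y : Spacetime) : FieldSpace :=
  ∑ k ∈ Finset.range (n + 1), taylorHom k ψ y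

theorem contDiff_taylorPoly (n : ℕ) (ψ : Spacetime → FieldSpace) :
    ContDiff ℝ ∞ (taylorPoly n ψ) :=
  ContDiff.sum fun k _ => contDiff_taylorHom k ψ

theorem taylorPoly_zero (n : ℕ) (ψ : Spacetime → FieldSpace) : taylorPoly n ψ 0 = ψ 0 := by
  rw [taylorPoly, Finset.sum_range_succ']
  simp [taylorHom_succ_zero, taylorHom]

theorem pdv_taylorPoly {ψ : Spacetime → FieldSpace} (hψ : ContDiff ℝ ∞ ψ) (n : ℕ) (ρ : Fin 4) :
    pdv ρ (taylorPoly (n + 1) ψ) = taylorPoly n (pdv ρ ψ) := by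
  funext y i
  simp only [taylorPoly, Finset.sum_range_succ' _ (n + 1), Finset.sum_apply, Pi.add_apply, pdv]
  rw [pd_add (ContDiff.sum fun k _ => contDiff_comp_apply (contDiff_taylorHom (k + 1) ψ) i)
    (contDiff_comp_apply (contDiff_taylorHom 0 ψ) i)]
  rw [pd_sum fun k => contDiff_comp_apply (contDiff_taylorHom (k + 1) ψ) i]
  have h0 : pd ρ (fun y => taylorHom 0 ψ y i) y = 0 := pd_const _
  rw [h0, add_zero]
  exact Finset.sum_congr rfl fun k _ => congrFun (congrFun (pdv_taylorHom_succ hψ k ρ) y) i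

theorem fderiv_eq_sum_pdv {χ : Spacetime → FieldSpace} (hχ : ContDiff ℝ ∞ χ) (y w : Spacetime) :
    fderiv ℝ χ y w = ∑ μ, w μ • pdv μ χ y := by
  funext i
  have := fderiv_eq_sum_pd (g := fun y => χ y i) y w
  rw [Finset.sum_apply]
  rw [fderiv_apply (hχ.differentiable (by simp) y)] at this
  exact this

theorem iteratedFDeriv_succ_eq_sum {χ : Spacetime → FieldSpace} (hχ : ContDiff ℝ ∞ χ) (m : ℕ)
    (x : Spacetime) (w : Fin (m + 1) → Spacetime) :
    iteratedFDeriv ℝ (m + 1) χ x w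
      = ∑ μ, w (Fin.last m) μ • iteratedFDeriv ℝ m (pdv μ χ) x (Fin.init w) := by
  have h1 : ContDiff ℝ ∞ (fun y => fderiv ℝ χ y) := hχ.fderiv_right (m := ∞) (by simp)
  rw [iteratedFDeriv_succ_apply_right]
  have h2 := (ContinuousLinearMap.apply ℝ FieldSpace (w (Fin.last m))).iteratedFDeriv_comp_left
    (f := fun y => fderiv ℝ χ y) (x := x) (n := ∞) h1.contDiffAt (i := m) (by norm_cast; exact le_top)
  have h3 : (ContinuousLinearMap.apply ℝ FieldSpace (w (Fin.last m))) ∘ (fun y => fderiv ℝ χ y)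
      = fun y => ∑ μ, w (Fin.last m) μ • pdv μ χ y :=
    funext fun y => fderiv_eq_sum_pdv hχ y _
  rw [h3] at h2
  have h4 := congrArg (fun T => T (Fin.init w)) h2
  simp only [ContinuousLinearMap.compContinuousMultilinearMap_coe, Function.comp_apply,
    ContinuousLinearMap.apply_apply] at h4
  rw [← h4, iteratedFDeriv_fun_sum_apply (f := fun μ y => w (Fin.last m) μ • pdv μ χ y) fun μ _ =>
    contDiffAt_nat x ((contDiff_pdv (μ := μ) hχ).const_smul (w (Fin.last m) μ)) m]
  rw [ContinuousMultilinearMap.sum_apply]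
  exact Finset.sum_congr rfl fun μ _ => by
    rw [iteratedFDeriv_const_smul_apply' (contDiffAt_nat x (contDiff_pdv (μ := μ) hχ) m)]
    rfl

theorem iteratedFDeriv_taylorPoly {ψ : Spacetime → FieldSpace} (hψ : ContDiff ℝ ∞ ψ) {m n : ℕ}
    (hmn : m ≤ n) : iteratedFDeriv ℝ m (taylorPoly n ψ) 0 = iteratedFDeriv ℝ m ψ 0 := by
  induction m generalizing n ψ with
  | zero => ext w; simp [taylorPoly_zero]
  | succ m ih =>
    obtain ⟨n, rfl⟩ : ∃ k, n = k + 1 := ⟨n - 1, by omega⟩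
    ext1 w
    rw [iteratedFDeriv_succ_eq_sum hψ, iteratedFDeriv_succ_eq_sum (contDiff_taylorPoly _ _)]
    exact Finset.sum_congr rfl fun μ _ => by
      rw [pdv_taylorPoly hψ, ih (contDiff_pdv hψ) (by omega)]

/-! ### Expansion of an invariant Lagrangian in derivatives of the field -/

open Asymptotics Filter in
theorem isBigO_jet_taylor {φ : Spacetime → FieldSpace} (hφ : ContDiff ℝ ∞ φ) {r : ℕ}
    {l : JetSpace r → ℝ} (hl : ContDiff ℝ ∞ l) :
    (fun s : ℝ => l (jet r (fun y => φ (s • y)) 0)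
      - l (jet r (fun y => taylorPoly 4 φ (s • y)) 0)) =O[nhds 0] fun s : ℝ => s ^ 5 := by
  have hj : ∀ {ψ : Spacetime → FieldSpace}, ContDiff ℝ ∞ ψ → ∀ s : ℝ,
      jet r (fun y => ψ (s • y)) 0
        = fun m : Fin (r + 1) => s ^ (m : ℕ) • iteratedFDeriv ℝ (m : ℕ) ψ 0 := by
    intro ψ hψ s
    funext m
    have := congrFun (iteratedFDeriv_comp_const_smul (i := (m : ℕ)) s
      (hψ.of_le (by norm_cast; exact le_top))) 0
    simp only [smul_zero] at this
    exact this
  have hc : ∀ {ψ : Spacetime → FieldSpace}, ContDiff ℝ ∞ ψ →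
      Continuous fun s : ℝ => jet r (fun y => ψ (s • y)) 0 := by
    intro ψ hψ
    simp only [hj hψ]
    fun_prop
  have hT := contDiff_taylorPoly 4 φ
  have h0 : jet r (fun y => taylorPoly 4 φ ((0 : ℝ) • y)) 0
      = jet r (fun y => φ ((0 : ℝ) • y)) 0 := by
    simp [taylorPoly_zero]
  have hs := (hl.contDiffAt (x := jet r (fun y => φ ((0 : ℝ) • y)) 0)).hasStrictFDerivAt
    (by simp)
  have ht : Tendsto (fun s : ℝ => (jet r (fun y => φ (s • y)) 0,
      jet r (fun y => taylorPoly 4 φ (s • y)) 0)) (nhds 0)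
      (nhds (jet r (fun y => φ ((0 : ℝ) • y)) 0, jet r (fun y => φ ((0 : ℝ) • y)) 0)) := by
    have := ((hc hφ).prodMk (hc hT)).tendsto 0
    rwa [h0] at this
  refine (hs.isBigO_sub.comp_tendsto ht).trans ?_
  refine isBigO_pi.2 fun m => ?_
  simp only [Function.comp_def, hj hφ, hj hT, Pi.sub_apply, ← smul_sub]
  rcases le_or_gt (m : ℕ) 4 with hm | hm
  · rw [iteratedFDeriv_taylorPoly hφ hm]
    simpa using isBigO_zero _ _
  · refine IsBigO.of_bound ‖iteratedFDeriv ℝ (m : ℕ) φ 0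
      - iteratedFDeriv ℝ (m : ℕ) (taylorPoly 4 φ) 0‖ ?_
    filter_upwards [Metric.ball_mem_nhds (0 : ℝ) one_pos] with s hs
    rw [norm_smul, mul_comm, norm_pow, norm_pow]
    refine mul_le_mul_of_nonneg_left ?_ (norm_nonneg _)
    exact pow_le_pow_of_le_one (norm_nonneg _) (by simpa using (mem_ball_zero_iff.1 hs).le) hm

theorem jet_taylorHom_zero (r : ℕ) (φ : Spacetime → FieldSpace) :
    jet r (taylorHom 0 φ) 0 = polyJet r 1 (φ 0) := by
  rw [polyJet_apply]
  congr 1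
  funext y
  simp [taylorHom, polyField]

theorem jet_coord_smul_sum (r : ℕ) {F : Fin 4 → Spacetime → FieldSpace}
    (hF : ∀ i, ContDiff ℝ ∞ (F i)) (c : ℝ) :
    jet r (fun y => c • ∑ μ, F μ y) 0 = c • ∑ μ, jet r (F μ) 0 := by
  rw [jet_smul r 0 (f := fun y => ∑ μ, F μ y) (ContDiff.sum fun μ _ => hF μ), jet_sum r 0 hF]

open MvPolynomial in
theorem jet_poly_smul_taylorHom (r : ℕ) (p : Poly) (ψ : Spacetime → FieldSpace) (k : ℕ) :
    jet r (fun y => eval y p • taylorHom (k + 1) ψ y) 0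
      = (1 / ((k : ℝ) + 1)) • ∑ μ, jet r (fun y => eval y (p * X μ) • taylorHom k (pdv μ ψ) y) 0 := by
  rw [← jet_coord_smul_sum r (F := fun μ y => eval y (p * X μ) • taylorHom k (pdv μ ψ) y)
    fun μ => (contDiff_eval (p * X μ)).smul (contDiff_taylorHom k _)]
  congr 1
  funext y
  simp only [taylorHom, Finset.smul_sum, smul_smul, map_mul, eval_X]
  refine Finset.sum_congr rfl fun μ _ => ?_
  congr 1
  ring

open MvPolynomial in
theorem jet_poly_smul_taylorHom_zero (r : ℕ) (p : Poly) (ψ : Spacetime → FieldSpace) :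
    jet r (fun y => eval y p • taylorHom 0 ψ y) 0 = polyJet r p (ψ 0) := rfl

section jets

variable (r : ℕ) {φ : Spacetime → FieldSpace}

open MvPolynomial

theorem jet_taylorHom_eq (k : ℕ) (φ : Spacetime → FieldSpace) :
    jet r (taylorHom k φ) 0 = jet r (fun y => eval y (1 : Poly) • taylorHom k φ y) 0 := by
  simp

theorem jet_taylorHom_one : jet r (taylorHom 1 φ) 0 = ∑ μ, polyJet r (X μ) (d1 φ 0 μ) := by
  rw [jet_taylorHom_eq, jet_poly_smul_taylorHom]
  simp only [jet_poly_smul_taylorHom_zero]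
  simp
  rfl

theorem jet_taylorHom_two (hφ : ContDiff ℝ ∞ φ) : jet r (taylorHom 2 φ) 0
    = (1 / 2 : ℝ) • ∑ μ, ∑ ν, polyJet r (X μ * X ν) (d2 φ 0 μ ν) := by
  rw [jet_taylorHom_eq, jet_poly_smul_taylorHom]
  simp only [jet_poly_smul_taylorHom, jet_poly_smul_taylorHom_zero]
  simp only [← Finset.smul_sum, smul_smul, one_mul]
  have e : ∀ μ ν, pdv ν (pdv μ φ) 0 = d2 φ 0 μ ν := fun μ ν => d2_comm hφ 0 ν μ
  simp only [e]
  norm_num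

theorem jet_taylorHom_three (hφ : ContDiff ℝ ∞ φ) : jet r (taylorHom 3 φ) 0
    = (1 / 6 : ℝ) • ∑ μ, ∑ ν, ∑ ρ, polyJet r (X μ * X ν * X ρ) (d3 φ 0 μ ν ρ) := by
  rw [jet_taylorHom_eq, jet_poly_smul_taylorHom]
  simp only [jet_poly_smul_taylorHom, jet_poly_smul_taylorHom_zero]
  simp only [← Finset.smul_sum, smul_smul, one_mul]
  have e : ∀ μ ν ρ, pdv ρ (pdv ν (pdv μ φ)) 0 = d3 φ 0 μ ν ρ := fun μ ν ρ => by
    rw [d3_comm_left hφ, d3_comm_right hφ, d3_comm_left hφ]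
    rfl
  simp only [e]
  norm_num

theorem jet_taylorHom_four (hφ : ContDiff ℝ ∞ φ) : jet r (taylorHom 4 φ) 0
    = (1 / 24 : ℝ) • ∑ μ, ∑ ν, ∑ ρ, ∑ σ,
      polyJet r (X μ * X ν * X ρ * X σ) (d4 φ 0 μ ν ρ σ) := by
  rw [jet_taylorHom_eq, jet_poly_smul_taylorHom]
  simp only [jet_poly_smul_taylorHom, jet_poly_smul_taylorHom_zero]
  simp only [← Finset.smul_sum, smul_smul, one_mul]
  have e : ∀ μ ν ρ σ, pdv σ (pdv ρ (pdv ν (pdv μ φ))) 0 = d4 φ 0 μ ν ρ σ := fun μ ν ρ σ => by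
    rw [d4_comm_left hφ, d4_comm_mid hφ, d4_comm_right hφ, d4_comm_left hφ, d4_comm_mid hφ,
      d4_comm_left hφ]
    rfl
  simp only [e]
  norm_num

end jets

section sums

variable {E ι : Type*} [NormedAddCommGroup E] [NormedSpace ℝ E] [Fintype ι] (l : E → ℝ)
  (x : E) (f : ι → E) (c : ℝ) (b d e k : E)

theorem dirD_sum : dirD (∑ i, f i) l x = ∑ i, dirD (f i) l x := by simp [dirD]
theorem dirD_smul : dirD (c • b) l x = c * dirD b l x := by simp [dirD]
theorem dd2_sum_left : dd2 l x (∑ i, f i) b = ∑ i, dd2 l x (f i) b := by simp [dd2, sum_apply]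
theorem dd2_sum_right : dd2 l x b (∑ i, f i) = ∑ i, dd2 l x b (f i) := by simp [dd2]
theorem dd2_smul_left : dd2 l x (c • b) d = c * dd2 l x b d := by simp [dd2]
theorem dd2_smul_right : dd2 l x b (c • d) = c * dd2 l x b d := by simp [dd2]
theorem dd3_sum_left : dd3 l x (∑ i, f i) b d = ∑ i, dd3 l x (f i) b d := by
  simp [dd3, sum_apply]
theorem dd3_sum_mid : dd3 l x b (∑ i, f i) d = ∑ i, dd3 l x b (f i) d := by
  simp [dd3, sum_apply]
theorem dd3_sum_right : dd3 l x b d (∑ i, f i) = ∑ i, dd3 l x b d (f i) := by simp [dd3]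
theorem dd3_smul_right : dd3 l x b d (c • e) = c * dd3 l x b d e := by simp [dd3]
theorem dd4_sum_one : dd4 l x (∑ i, f i) b d e = ∑ i, dd4 l x (f i) b d e := by
  simp [dd4, sum_apply]
theorem dd4_sum_two : dd4 l x b (∑ i, f i) d e = ∑ i, dd4 l x b (f i) d e := by
  simp [dd4, sum_apply]
theorem dd4_sum_three : dd4 l x b d (∑ i, f i) e = ∑ i, dd4 l x b d (f i) e := by
  simp [dd4, sum_apply]
theorem dd4_sum_four : dd4 l x b d e (∑ i, f i) = ∑ i, dd4 l x b d e (f i) := by simp [dd4]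

end sums

section expansion

variable {E : Type*} [NormedAddCommGroup E] [NormedSpace ℝ E]

/-- The terms with two derivatives of the expansion of an invariant function of the jet. -/
def quadraticPart (J : Poly →ₗ[ℝ] FieldSpace →ₗ[ℝ] E) (l : E → ℝ) : Lagrangian := fun φ x =>
  1 / 2 * ∑ μ, ∑ ν, dd2 l (J 1 (φ x)) (J (lin (ev μ)) (d1 φ x μ)) (J (lin (ev ν)) (d1 φ x ν))
  + 1 / 2 * ∑ μ, ∑ ν, dirD (J (lin (ev μ) * lin (ev ν)) (d2 φ x μ ν)) l (J 1 (φ x))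

/-- The terms with four derivatives of the expansion of an invariant function of the jet. -/
def quarticPart (J : Poly →ₗ[ℝ] FieldSpace →ₗ[ℝ] E) (l : E → ℝ) : Lagrangian := fun φ x =>
  1 / 24 * ∑ μ, ∑ ν, ∑ ρ, ∑ σ, dd4 l (J 1 (φ x)) (J (lin (ev μ)) (d1 φ x μ))
      (J (lin (ev ν)) (d1 φ x ν)) (J (lin (ev ρ)) (d1 φ x ρ)) (J (lin (ev σ)) (d1 φ x σ))
  + 1 / 4 * ∑ μ, ∑ ν, ∑ ρ, ∑ σ, dd3 l (J 1 (φ x)) (J (lin (ev μ)) (d1 φ x μ))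
      (J (lin (ev ν)) (d1 φ x ν)) (J (lin (ev ρ) * lin (ev σ)) (d2 φ x ρ σ))
  + 1 / 8 * ∑ μ, ∑ ν, ∑ ρ, ∑ σ, dd2 l (J 1 (φ x)) (J (lin (ev μ) * lin (ev ν)) (d2 φ x μ ν))
      (J (lin (ev ρ) * lin (ev σ)) (d2 φ x ρ σ))
  + 1 / 6 * ∑ μ, ∑ ν, ∑ ρ, ∑ σ, dd2 l (J 1 (φ x)) (J (lin (ev μ)) (d1 φ x μ))
      (J (lin (ev ν) * lin (ev ρ) * lin (ev σ)) (d3 φ x ν ρ σ))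
  + 1 / 24 * ∑ μ, ∑ ν, ∑ ρ, ∑ σ,
      dirD (J (lin (ev μ) * lin (ev ν) * lin (ev ρ) * lin (ev σ)) (d4 φ x μ ν ρ σ)) l (J 1 (φ x))

end expansion

theorem isLorentz_neg_one : IsLorentz (-1) := by simp [IsLorentz]

namespace IsInvariantLagrangian

variable {L : Lagrangian} {r : ℕ} {l : JetSpace r → ℝ}

theorem expansion_zero (hL : IsInvariantLagrangian L) (hl : ContDiff ℝ ∞ l)
    (h : ∀ φ : Spacetime → FieldSpace, ContDiff ℝ ∞ φ → ∀ x, L φ x = l (jet r φ x))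
    {φ : Spacetime → FieldSpace} (hφ : ContDiff ℝ ∞ φ) :
    L φ 0 = l (polyJet r 1 (φ 0)) + quadraticPart (polyJet r) l φ 0
      + quarticPart (polyJet r) l φ 0 := by
  have hT := contDiff_taylorPoly 4 φ
  have hscale : ∀ {ψ : Spacetime → FieldSpace}, ContDiff ℝ ∞ ψ → ∀ s : ℝ,
      ContDiff ℝ ∞ fun y => ψ (s • y) := fun hψ s => hψ.comp (contDiff_id.const_smul s)
  obtain ⟨q, hq, hqφ⟩ := hL.atMostFour φ hφ 0
  obtain ⟨q', hq', hqT⟩ := hL.atMostFour _ hT 0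
  simp only [zero_add, sub_zero] at hqφ hqT
  have hqq : q - q' = 0 := by
    refine polynomial_eq_zero_of_isBigO ((Polynomial.natDegree_sub_le _ _).trans (max_le hq hq')) ?_
    refine (isBigO_jet_taylor hφ hl).congr_left fun s => ?_
    rw [← h _ (hscale hφ s), ← h _ (hscale hT s), hqφ, hqT, Polynomial.eval_sub]
  have hval : L φ 0 = q'.eval 1 := by
    rw [← sub_eq_zero.1 hqq, ← hqφ 1]
    simp
  set b : Fin 4 → JetSpace r := fun j => jet r (taylorHom (j + 1) φ) 0 with hb
  have hcurve : ∀ s, l (polyJet r 1 (φ 0) + ∑ j, powCurve s j • b j) = q'.eval s := by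
    intro s
    rw [← hqT s, h _ (hscale hT s)]
    congr 1
    have e : (fun y => taylorPoly 4 φ (s • y))
        = fun y => taylorHom 0 φ y + ∑ j : Fin 4, powCurve s j • taylorHom (j + 1) φ y := by
      funext y
      simp [taylorPoly, taylorHom_smul, Finset.sum_range_succ, Fin.sum_univ_four, powCurve]
      abel
    rw [e, jet_add r 0 (contDiff_taylorHom 0 φ)
      (contDiff_sum_smul (fun j => contDiff_taylorHom (j + 1) φ) _), jet_taylorHom_zero,
      jet_sum r 0 (F := fun j y => powCurve s j • taylorHom (j + 1) φ y)
        fun j => (contDiff_taylorHom _ φ).const_smul _]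
    congr 1
    exact Finset.sum_congr rfl fun j _ => (jet_smul r 0 (contDiff_taylorHom _ φ) _).symm
  have hneg : q'.eval (-1) = q'.eval 1 := by
    rw [← hqT, ← hqT]
    have := hL.poincare (-1) isLorentz_neg_one 0 _ hT 0
    rw [Matrix.mulVec_zero, add_zero] at this
    simpa [Matrix.neg_mulVec] using this
  have key := even_part_of_curve hl (polyJet r 1 (φ 0)) b hq' hcurve
  rw [hcurve, hcurve, hneg, add_self_div_two, ← hval] at key
  rw [key]
  have e0 : b 0 = ∑ μ, polyJet r (lin (ev μ)) (d1 φ 0 μ) := by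
    simp only [lin_ev]; exact jet_taylorHom_one r
  have e1 : b 1 = (1 / 2 : ℝ) • ∑ μ, ∑ ν, polyJet r (lin (ev μ) * lin (ev ν)) (d2 φ 0 μ ν) := by
    simp only [lin_ev]; exact jet_taylorHom_two r hφ
  have e2 : b 2 = (1 / 6 : ℝ) • ∑ μ, ∑ ν, ∑ ρ,
      polyJet r (lin (ev μ) * lin (ev ν) * lin (ev ρ)) (d3 φ 0 μ ν ρ) := by
    simp only [lin_ev]; exact jet_taylorHom_three r hφ
  have e3 : b 3 = (1 / 24 : ℝ) • ∑ μ, ∑ ν, ∑ ρ, ∑ σ,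
      polyJet r (lin (ev μ) * lin (ev ν) * lin (ev ρ) * lin (ev σ)) (d4 φ 0 μ ν ρ σ) := by
    simp only [lin_ev]; exact jet_taylorHom_four r hφ
  have p2 : ∀ b c, dirD b (dirD c l) (polyJet r 1 (φ 0)) = dd2 l (polyJet r 1 (φ 0)) b c :=
    fun b c => (congrFun (dd2_eq hl b c) _).symm
  have p3 : ∀ b c d, dirD b (dirD c (dirD d l)) (polyJet r 1 (φ 0))
      = dd3 l (polyJet r 1 (φ 0)) b c d := fun b c d => (congrFun (dd3_eq hl b c d) _).symm
  have p4 : ∀ b c d e, dirD b (dirD c (dirD d (dirD e l))) (polyJet r 1 (φ 0))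
      = dd4 l (polyJet r 1 (φ 0)) b c d e := fun b c d e =>
    (congrFun (dd4_eq hl b c d e) _).symm
  simp only [p2, p3, p4, e0, e1, e2, e3, quadraticPart, quarticPart, dd2_smul_left,
    dd2_smul_right, dd3_smul_right, dirD_smul, dirD_sum]
  simp only [dd2_sum_left, dd3_sum_left, dd4_sum_one]
  simp only [dd2_sum_right, dd3_sum_mid, dd4_sum_two]
  simp only [dd3_sum_right, dd4_sum_three]
  simp only [dd4_sum_four, dd2_smul_left, dd2_smul_right, dd3_smul_right, ← Finset.mul_sum]
  ring

theorem expansion (hL : IsInvariantLagrangian L) : ∃ (r : ℕ) (l : JetSpace r → ℝ),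
    IsInvariantModel (polyJet r) l ∧ ∀ φ : Spacetime → FieldSpace, ContDiff ℝ ∞ φ → ∀ x,
      L φ x = l (polyJet r 1 (φ x)) + quadraticPart (polyJet r) l φ x
        + quarticPart (polyJet r) l φ x := by
  obtain ⟨r, l, hl, h⟩ := hL.isLocal
  refine ⟨r, l, hL.isInvariantModel hl h, fun φ hφ x => ?_⟩
  have ht : ∀ {ψ : Spacetime → FieldSpace}, ContDiff ℝ ∞ ψ →
      ContDiff ℝ ∞ fun y => ψ (y + x) := fun hψ => hψ.comp (contDiff_id.add contDiff_const)
  have hp := hL.poincare 1 isLorentz_one x φ hφ 0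
  simp only [Matrix.one_mulVec, zero_add] at hp
  rw [← hp, expansion_zero hL hl h (ht hφ)]
  have hpdv : ∀ {ψ : Spacetime → FieldSpace}, ContDiff ℝ ∞ ψ → ∀ μ y,
      pdv μ (fun y => ψ (y + x)) y = pdv μ ψ (y + x) := fun hψ μ y => by
    have := pdv_affine hψ 1 x μ y
    simpa [Matrix.one_apply] using this
  have e1 : ∀ y μ, d1 (fun y => φ (y + x)) y μ = d1 φ (y + x) μ := fun y μ => hpdv hφ μ y
  have e2 : ∀ y μ ν, d2 (fun y => φ (y + x)) y μ ν = d2 φ (y + x) μ ν := fun y μ ν => by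
    change _ = pdv μ (fun y => d1 φ y ν) (y + x)
    rw [← hpdv (contDiff_d1 hφ ν)]
    exact congrArg (pdv μ · y) (funext fun y => e1 y ν)
  have e3 : ∀ y μ ν ρ, d3 (fun y => φ (y + x)) y μ ν ρ = d3 φ (y + x) μ ν ρ := fun y μ ν ρ => by
    rw [d3, d3, ← hpdv (contDiff_d2 hφ ν ρ)]
    exact congrArg (pdv μ · y) (funext fun y => e2 y ν ρ)
  have e4 : ∀ y μ ν ρ σ, d4 (fun y => φ (y + x)) y μ ν ρ σ = d4 φ (y + x) μ ν ρ σ :=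
    fun y μ ν ρ σ => by
    rw [d4, d4, ← hpdv (contDiff_d3 hφ ν ρ σ)]
    exact congrArg (pdv μ · y) (funext fun y => e3 y ν ρ σ)
  simp only [quadraticPart, quarticPart, e1, e2, e3, e4, zero_add]

end IsInvariantLagrangian

/-! ### Classification of the terms of the expansion -/

/-- The operators with at most four derivatives. -/
def opList : Fin 22 → Lagrangian :=
  ![fun _ _ => 1, opA, opB, opE, opBoxBox, opGradBox, opGradBoxField, opBoxSq,
    fun φ x => opE φ x ^ 2, op1, op2, op3, op4, op20, op21, op5, op6, op7, op22, op8, op9, op10]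

/-- Combinations of the operators whose coefficients are functions of `φ·φ`. -/
def IsOpSum (L : Lagrangian) : Prop :=
  ∃ c : Fin 22 → ℝ → ℝ, SmoothCoeffs c ∧ ∀ φ : Spacetime → FieldSpace, ContDiff ℝ ∞ φ → ∀ x,
    L φ x = ∑ k, c k (φ x ⬝ᵥ φ x) * opList k φ x

namespace IsOpSum

variable {L L' : Lagrangian}

theorem congr (h : IsOpSum L)
    (e : ∀ φ : Spacetime → FieldSpace, ContDiff ℝ ∞ φ → ∀ x, L' φ x = L φ x) : IsOpSum L' := by
  obtain ⟨c, hc, h⟩ := h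
  exact ⟨c, hc, fun φ hφ x => by rw [e φ hφ, h φ hφ]⟩

theorem add (h : IsOpSum L) (h' : IsOpSum L') : IsOpSum fun φ x => L φ x + L' φ x := by
  obtain ⟨c, hc, h⟩ := h
  obtain ⟨c', hc', h'⟩ := h'
  refine ⟨fun k t => c k t + c' k t, fun k => (hc k).add (hc' k), fun φ hφ x => ?_⟩
  simp only [h φ hφ, h' φ hφ, add_mul, Finset.sum_add_distrib]

theorem const_mul (h : IsOpSum L) (a : ℝ) : IsOpSum fun φ x => a * L φ x := by
  obtain ⟨c, hc, h⟩ := h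
  refine ⟨fun k t => a * c k t, fun k => contDiffOn_const.mul (hc k), fun φ hφ x => ?_⟩
  simp only [h φ hφ, Finset.mul_sum, mul_assoc]

theorem op {c : ℝ → ℝ} (hc : ContDiffOn ℝ ∞ c (Ici 0)) (k : Fin 22) :
    IsOpSum fun φ x => c (φ x ⬝ᵥ φ x) * opList k φ x := by
  refine ⟨fun j t => if j = k then c t else 0, fun j => ?_, fun φ _ x => by simp⟩
  by_cases h : j = k
  · simpa [h] using hc
  · simpa [h] using contDiffOn_const

end IsOpSum

theorem dsum_add (F G : Fin 4 → Fin 4 → ℝ) :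
    (dsum fun a b => F a b + G a b) = dsum F + dsum G := by
  simp only [dsum, mul_add, Finset.sum_add_distrib]

theorem sum_isotropic (F₁ F₂ F₃ : Fin 4 → Fin 4 → Fin 4 → Fin 4 → ℝ) :
    (∑ a, ∑ b, ∑ c, ∑ d, et 1 * et 2 * (et a * kd a b * (et c * kd c d) * F₁ a b c d
      + et a * kd a c * (et b * kd b d) * F₂ a b c d
      + et a * kd a d * (et b * kd b c) * F₃ a b c d))
      = (dsum fun a b => F₁ a a b b) + (dsum fun a b => F₂ a b a b)
        + dsum fun a b => F₃ a b b a := by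
  have h12 : et 1 * et 2 = 1 := by simp [et]
  simp only [h12, one_mul, Finset.sum_add_distrib, dsum]
  congr 1
  · congr 1
    · simp [kd]
    · refine Finset.sum_congr rfl fun a _ => Finset.sum_congr rfl fun b _ => ?_
      simp [kd]
  · refine Finset.sum_congr rfl fun a _ => Finset.sum_congr rfl fun b _ => ?_
    simp [kd]

section ops

variable {φ : Spacetime → FieldSpace} (x : Spacetime)

theorem op5_dsum : op5 φ x
    = dsum fun a b => (d1 φ x a ⬝ᵥ d1 φ x a) * (d1 φ x b ⬝ᵥ d1 φ x b) := by
  rw [op5, opA_sum, sq, Finset.sum_mul_sum]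
  exact Finset.sum_congr rfl fun _ _ => Finset.sum_congr rfl fun _ _ => by ring

theorem op8_dsum : op8 φ x
    = dsum fun a b => (d1 φ x a ⬝ᵥ d1 φ x a) * (d1 φ x b ⬝ᵥ φ x) ^ 2 := by
  rw [op8, opA_sum, opB_sum, Finset.sum_mul_sum]
  exact Finset.sum_congr rfl fun _ _ => Finset.sum_congr rfl fun _ _ => by ring

theorem op10_dsum : op10 φ x
    = dsum fun a b => (d1 φ x a ⬝ᵥ φ x) ^ 2 * (d1 φ x b ⬝ᵥ φ x) ^ 2 := by
  rw [op10, opB_sum, sq, Finset.sum_mul_sum]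
  exact Finset.sum_congr rfl fun _ _ => Finset.sum_congr rfl fun _ _ => by ring

theorem op6_dsum : op6 φ x = dsum fun a b => (d1 φ x a ⬝ᵥ d1 φ x b) ^ 2 := by
  rw [op6_eq]
  exact Finset.sum_congr rfl fun _ _ => Finset.sum_congr rfl fun _ _ => by ring

theorem op9_dsum : op9 φ x = dsum fun a b =>
    (d1 φ x a ⬝ᵥ d1 φ x b) * (d1 φ x a ⬝ᵥ φ x) * (d1 φ x b ⬝ᵥ φ x) := by
  rw [op9_eq]
  exact Finset.sum_congr rfl fun _ _ => Finset.sum_congr rfl fun _ _ => by ring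

theorem op1_dsum : op1 φ x = dsum fun a b => d2 φ x a b ⬝ᵥ d2 φ x a b := by
  rw [op1_eq]
  exact Finset.sum_congr rfl fun _ _ => Finset.sum_congr rfl fun _ _ => by ring

theorem op2_dsum : op2 φ x = dsum fun a b => (d2 φ x a b ⬝ᵥ φ x) ^ 2 := by
  rw [op2_eq]
  exact Finset.sum_congr rfl fun _ _ => Finset.sum_congr rfl fun _ _ => by ring

theorem op4_dsum : op4 φ x
    = dsum fun a b => (d2 φ x a b ⬝ᵥ φ x) * (d1 φ x a ⬝ᵥ d1 φ x b) := by
  rw [op4_eq]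
  exact Finset.sum_congr rfl fun _ _ => Finset.sum_congr rfl fun _ _ => by ring

theorem op7_dsum : op7 φ x
    = dsum fun a b => (d2 φ x a b ⬝ᵥ φ x) * (d1 φ x a ⬝ᵥ φ x) * (d1 φ x b ⬝ᵥ φ x) := by
  rw [op7_eq]
  exact Finset.sum_congr rfl fun _ _ => Finset.sum_congr rfl fun _ _ => by ring

theorem op20_dsum : op20 φ x
    = dsum fun a b => (d2 φ x b b ⬝ᵥ φ x) * (d1 φ x a ⬝ᵥ d1 φ x a) := by
  rw [op20, opA_sum, opE_eq, mul_comm, Finset.sum_mul_sum]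
  exact Finset.sum_congr rfl fun _ _ => Finset.sum_congr rfl fun _ _ => by ring

theorem op22_dsum : op22 φ x
    = dsum fun a b => (d2 φ x b b ⬝ᵥ φ x) * (d1 φ x a ⬝ᵥ φ x) ^ 2 := by
  rw [op22, opB_sum, opE_eq, mul_comm, Finset.sum_mul_sum]
  exact Finset.sum_congr rfl fun _ _ => Finset.sum_congr rfl fun _ _ => by ring

theorem opE_sq_dsum : opE φ x ^ 2
    = dsum fun a b => (d2 φ x a a ⬝ᵥ φ x) * (d2 φ x b b ⬝ᵥ φ x) := by
  rw [opE_eq, sq, Finset.sum_mul_sum]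
  exact Finset.sum_congr rfl fun _ _ => Finset.sum_congr rfl fun _ _ => by ring

end ops

/-- Contraction of isotropic forms depending on the indices. -/
theorem sum_components {τ : Fin 4 → Fin 4 → Fin 4 → Fin 4 →
      (Fin 4 → ℝ) → (Fin 4 → ℝ) → (Fin 4 → ℝ) → (Fin 4 → ℝ) → ℝ}
    (h : ∀ a b c d, IsotropicOn univ et (τ a b c d)) :
    ∑ a, ∑ b, ∑ c, ∑ d, τ a b c d (ev a) (ev b) (ev c) (ev d)
      = (dsum fun a b => τ a a b b (ev 1) (ev 1) (ev 2) (ev 2))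
        + (dsum fun a b => τ a b a b (ev 1) (ev 2) (ev 1) (ev 2))
        + dsum fun a b => τ a b b a (ev 1) (ev 2) (ev 2) (ev 1) := by
  rw [← sum_isotropic (fun a b c d => τ a b c d (ev 1) (ev 1) (ev 2) (ev 2))
    (fun a b c d => τ a b c d (ev 1) (ev 2) (ev 1) (ev 2))
    (fun a b c d => τ a b c d (ev 1) (ev 2) (ev 2) (ev 1))]
  exact Finset.sum_congr rfl fun a _ => Finset.sum_congr rfl fun b _ =>
    Finset.sum_congr rfl fun c _ => Finset.sum_congr rfl fun d _ =>
    (h a b c d).components et_mul_self (mem_univ _) (mem_univ _) (mem_univ _) (mem_univ _)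
      (mem_univ _) (mem_univ _) (mem_univ _)

section forms

theorem isOpSum_isoForm {k : Fin 10 → ℝ → ℝ} (hk : SmoothCoeffs k) :
    IsOpSum fun φ x => dsum fun a b => isoForm (fun i => k i (φ x ⬝ᵥ φ x)) (φ x)
      (d1 φ x a) (d1 φ x a) (d1 φ x b) (d1 φ x b) := by
  refine ((((IsOpSum.op (hk 0) 15).add (IsOpSum.op ((hk 1).add (hk 2)) 16)).add
    (IsOpSum.op ((hk 3).add (hk 8)) 19)).add ((IsOpSum.op ((((hk 4).add (hk 5)).add
    (hk 6)).add (hk 7)) 20).add (IsOpSum.op (hk 9) 21))).congr fun φ _ x => ?_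
  have e8 : op8 φ x = dsum fun b a => (d1 φ x a ⬝ᵥ d1 φ x a) * (d1 φ x b ⬝ᵥ φ x) ^ 2 := by
    rw [op8_dsum, dsum_swap]
  change _ = k 0 _ * op5 φ x + _ * op6 φ x + (k 3 _ + k 8 _) * op8 φ x
    + (_ * op9 φ x + _ * op10 φ x)
  rw [add_mul (k 3 _), e8]
  nth_rw 2 [← e8]
  rw [op5_dsum, op6_dsum, op8_dsum, op9_dsum, op10_dsum]
  simp only [← dsum_const_mul, ← dsum_add]
  refine dsum_congr fun a b => ?_
  simp only [isoForm, dotProduct_comm (φ x)]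
  ring

theorem smoothCoeffs_perm {ι κ : Type} {k : ι → ℝ → ℝ} (hk : SmoothCoeffs k) (s : κ → ι) :
    SmoothCoeffs (fun i => k (s i)) := fun i => hk (s i)

theorem isOpSum_isoForm_alternating {k : Fin 10 → ℝ → ℝ} (hk : SmoothCoeffs k) :
    IsOpSum fun φ x => dsum fun a b => isoForm (fun i => k i (φ x ⬝ᵥ φ x)) (φ x)
      (d1 φ x a) (d1 φ x b) (d1 φ x a) (d1 φ x b) := by
  refine (isOpSum_isoForm (smoothCoeffs_perm hk ![1, 0, 2, 4, 3, 5, 6, 8, 7, 9])).congr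
    fun φ _ x => dsum_congr fun a b => ?_
  simp [isoForm, dotProduct_comm (d1 φ x b) (d1 φ x a)]
  ring

theorem isOpSum_isoForm_nested {k : Fin 10 → ℝ → ℝ} (hk : SmoothCoeffs k) :
    IsOpSum fun φ x => dsum fun a b => isoForm (fun i => k i (φ x ⬝ᵥ φ x)) (φ x)
      (d1 φ x a) (d1 φ x b) (d1 φ x b) (d1 φ x a) := by
  refine (isOpSum_isoForm (smoothCoeffs_perm hk ![2, 1, 0, 5, 4, 3, 8, 7, 6, 9])).congr
    fun φ _ x => dsum_congr fun a b => ?_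
  simp [isoForm, dotProduct_comm (d1 φ x b) (d1 φ x a)]
  ring

/-- The general rank-three form. -/
def isoForm₃ (c : Fin 4 → ℝ) (u v₁ v₂ v₃ : FieldSpace) : ℝ :=
  c 0 * ((u ⬝ᵥ v₁) * (v₂ ⬝ᵥ v₃)) + c 1 * ((u ⬝ᵥ v₂) * (v₁ ⬝ᵥ v₃))
    + c 2 * ((u ⬝ᵥ v₃) * (v₁ ⬝ᵥ v₂)) + c 3 * ((u ⬝ᵥ v₁) * (u ⬝ᵥ v₂) * (u ⬝ᵥ v₃))

theorem isOpSum_isoForm₃ {k : Fin 4 → ℝ → ℝ} (hk : SmoothCoeffs k) :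
    IsOpSum fun φ x => dsum fun a b => isoForm₃ (fun i => k i (φ x ⬝ᵥ φ x)) (φ x)
      (d1 φ x a) (d1 φ x a) (d2 φ x b b) := by
  refine (((IsOpSum.op ((hk 0).add (hk 1)) 14).add (IsOpSum.op (hk 2) 13)).add
    (IsOpSum.op (hk 3) 18)).congr fun φ _ x => ?_
  change _ = _ * op21 φ x + _ * op20 φ x + _ * op22 φ x
  rw [op21_eq', op20_dsum, op22_dsum]
  simp only [← dsum_const_mul, ← dsum_add]
  refine dsum_congr fun a b => ?_
  simp only [isoForm₃, dotProduct_comm (φ x), dotProduct_comm (d1 φ x a) (d2 φ x b b)]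
  ring

theorem isOpSum_isoForm₃_alternating {k : Fin 4 → ℝ → ℝ} (hk : SmoothCoeffs k) :
    IsOpSum fun φ x => dsum fun a b => isoForm₃ (fun i => k i (φ x ⬝ᵥ φ x)) (φ x)
      (d1 φ x a) (d1 φ x b) (d2 φ x a b) := by
  refine ((((IsOpSum.op (hk 0) 11).add (IsOpSum.op (hk 1) 11)).add (IsOpSum.op (hk 2) 12)).add
    (IsOpSum.op (hk 3) 17)).congr fun φ hφ x => ?_
  change _ = k 0 _ * op3 φ x + k 1 _ * op3 φ x + _ * op4 φ x + _ * op7 φ x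
  have e3 : op3 φ x = dsum fun a b => (d2 φ x a b ⬝ᵥ d1 φ x a) * (d1 φ x b ⬝ᵥ φ x) := op3_eq φ x
  rw [e3]
  nth_rw 1 [← e3]
  rw [op3_eq' x hφ, op4_dsum, op7_dsum]
  simp only [← dsum_const_mul, ← dsum_add]
  refine dsum_congr fun a b => ?_
  simp only [isoForm₃, dotProduct_comm (φ x), dotProduct_comm (d1 φ x _) (d2 φ x a b)]
  ring

end forms

section parts

variable {E : Type*} [NormedAddCommGroup E] [NormedSpace ℝ E]
  {J : Poly →ₗ[ℝ] FieldSpace →ₗ[ℝ] E} {l : E → ℝ}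

theorem isOpSum_four (h : IsInvariantModel J l) : IsOpSum fun φ x => ∑ μ, ∑ ν, ∑ ρ, ∑ σ,
    dd4 l (J 1 (φ x)) (J (lin (ev μ)) (d1 φ x μ)) (J (lin (ev ν)) (d1 φ x ν))
      (J (lin (ev ρ)) (d1 φ x ρ)) (J (lin (ev σ)) (d1 φ x σ)) := by
  obtain ⟨c₁, hc₁, e₁⟩ := h.coeffs_four (lin (ev 1)) (lin (ev 1)) (lin (ev 2)) (lin (ev 2))
  obtain ⟨c₂, hc₂, e₂⟩ := h.coeffs_four (lin (ev 1)) (lin (ev 2)) (lin (ev 1)) (lin (ev 2))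
  obtain ⟨c₃, hc₃, e₃⟩ := h.coeffs_four (lin (ev 1)) (lin (ev 2)) (lin (ev 2)) (lin (ev 1))
  refine (((isOpSum_isoForm hc₁).add (isOpSum_isoForm_alternating hc₂)).add
    (isOpSum_isoForm_nested hc₃)).congr fun φ _ x => ?_
  refine (sum_components fun a b c d =>
    h.isotropic_four (φ x) (d1 φ x a) (d1 φ x b) (d1 φ x c) (d1 φ x d)).trans ?_
  simp only [e₁, e₂, e₃]

theorem isOpSum_three (h : IsInvariantModel J l) : IsOpSum fun φ x => ∑ μ, ∑ ν, ∑ ρ, ∑ σ,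
    dd3 l (J 1 (φ x)) (J (lin (ev μ)) (d1 φ x μ)) (J (lin (ev ν)) (d1 φ x ν))
      (J (lin (ev ρ) * lin (ev σ)) (d2 φ x ρ σ)) := by
  obtain ⟨c₁, hc₁, e₁⟩ := h.coeffs_three (lin (ev 1)) (lin (ev 1)) (lin (ev 2) * lin (ev 2))
  obtain ⟨c₂, hc₂, e₂⟩ := h.coeffs_three (lin (ev 1)) (lin (ev 2)) (lin (ev 1) * lin (ev 2))
  obtain ⟨c₃, hc₃, e₃⟩ := h.coeffs_three (lin (ev 1)) (lin (ev 2)) (lin (ev 2) * lin (ev 1))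
  refine (((isOpSum_isoForm₃ hc₁).add (isOpSum_isoForm₃_alternating hc₂)).add
    (isOpSum_isoForm₃_alternating hc₃)).congr fun φ hφ x => ?_
  refine (sum_components fun a b c d =>
    h.isotropic_three (φ x) (d1 φ x a) (d1 φ x b) (d2 φ x c d)).trans ?_
  simp only [e₁, e₂, e₃, isoForm₃]
  congr 1
  exact dsum_congr fun a b => by rw [d2_comm hφ x b a]

theorem isOpSum_two_two (h : IsInvariantModel J l) : IsOpSum fun φ x => ∑ μ, ∑ ν, ∑ ρ, ∑ σ,
    dd2 l (J 1 (φ x)) (J (lin (ev μ) * lin (ev ν)) (d2 φ x μ ν))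
      (J (lin (ev ρ) * lin (ev σ)) (d2 φ x ρ σ)) := by
  obtain ⟨c₁, hc₁, e₁⟩ := h.coeffs_two (lin (ev 1) * lin (ev 1)) (lin (ev 2) * lin (ev 2))
  obtain ⟨c₂, hc₂, e₂⟩ := h.coeffs_two (lin (ev 1) * lin (ev 2)) (lin (ev 1) * lin (ev 2))
  obtain ⟨c₃, hc₃, e₃⟩ := h.coeffs_two (lin (ev 1) * lin (ev 2)) (lin (ev 2) * lin (ev 1))
  refine (((IsOpSum.op (hc₁ 0) 7).add (IsOpSum.op (hc₁ 1) 8)).add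
    ((IsOpSum.op ((hc₂ 0).add (hc₃ 0)) 9).add (IsOpSum.op ((hc₂ 1).add (hc₃ 1)) 10))).congr
    fun φ hφ x => ?_
  refine (sum_components fun a b c d =>
    h.isotropic_two_two (φ x) (d2 φ x a b) (d2 φ x c d)).trans ?_
  change _ = _ * opBoxSq φ x + _ * opE φ x ^ 2 + (_ * op1 φ x + _ * op2 φ x)
  rw [opBoxSq, opE_sq_dsum, op1_dsum, op2_dsum]
  simp only [e₁, e₂, e₃, ← dsum_const_mul, ← dsum_add]
  refine dsum_congr fun a b => ?_
  simp only [dotProduct_comm (φ x), d2_comm hφ x b a]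
  ring

theorem isOpSum_one_three (h : IsInvariantModel J l) : IsOpSum fun φ x => ∑ μ, ∑ ν, ∑ ρ, ∑ σ,
    dd2 l (J 1 (φ x)) (J (lin (ev μ)) (d1 φ x μ))
      (J (lin (ev ν) * lin (ev ρ) * lin (ev σ)) (d3 φ x ν ρ σ)) := by
  obtain ⟨c₁, hc₁, e₁⟩ := h.coeffs_two (lin (ev 1)) (lin (ev 1) * lin (ev 2) * lin (ev 2))
  obtain ⟨c₂, hc₂, e₂⟩ := h.coeffs_two (lin (ev 1)) (lin (ev 2) * lin (ev 1) * lin (ev 2))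
  obtain ⟨c₃, hc₃, e₃⟩ := h.coeffs_two (lin (ev 1)) (lin (ev 2) * lin (ev 2) * lin (ev 1))
  refine ((IsOpSum.op (((hc₁ 0).add (hc₂ 0)).add (hc₃ 0)) 5).add
    (IsOpSum.op (((hc₁ 1).add (hc₂ 1)).add (hc₃ 1)) 6)).congr fun φ hφ x => ?_
  refine (sum_components fun a b c d =>
    h.isotropic_one_three (φ x) (d1 φ x a) (d3 φ x b c d)).trans ?_
  change _ = _ * opGradBox φ x + _ * opGradBoxField φ x
  rw [opGradBox, opGradBoxField]
  simp only [e₁, e₂, e₃, ← dsum_const_mul, ← dsum_add]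
  refine dsum_congr fun a b => ?_
  rw [d3_comm_right hφ x b b a, d3_comm_left hφ x b a b]
  simp only [dotProduct_comm (φ x), dotProduct_comm (d1 φ x a) (d3 φ x _ _ _)]
  ring

theorem isOpSum_one (h : IsInvariantModel J l) : IsOpSum fun φ x => ∑ μ, ∑ ν, ∑ ρ, ∑ σ,
    dirD (J (lin (ev μ) * lin (ev ν) * lin (ev ρ) * lin (ev σ)) (d4 φ x μ ν ρ σ)) l
      (J 1 (φ x)) := by
  obtain ⟨c₁, hc₁, e₁⟩ := h.coeffs_one (lin (ev 1) * lin (ev 1) * lin (ev 2) * lin (ev 2))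
  obtain ⟨c₂, hc₂, e₂⟩ := h.coeffs_one (lin (ev 1) * lin (ev 2) * lin (ev 1) * lin (ev 2))
  obtain ⟨c₃, hc₃, e₃⟩ := h.coeffs_one (lin (ev 1) * lin (ev 2) * lin (ev 2) * lin (ev 1))
  refine (IsOpSum.op ((hc₁.add hc₂).add hc₃) 4).congr fun φ hφ x => ?_
  refine (sum_components fun a b c d => h.isotropic_one (φ x) (d4 φ x a b c d)).trans ?_
  change _ = _ * opBoxBox φ x
  rw [opBoxBox]
  simp only [e₁, e₂, e₃, ← dsum_const_mul, ← dsum_add]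
  refine dsum_congr fun a b => ?_
  rw [d4_comm_right hφ x a b b a, d4_comm_mid hφ x a b a b]
  simp only [dotProduct_comm (φ x)]
  ring

open IsInvariantModel in
theorem mdot'_ev (a b : Fin 4) : mdot' (ev a) (ev b) = if a = b then et a else 0 := by
  simp [mdot', ev, Pi.single_apply, eq_comm]
  split_ifs with h
  · rw [h]
  · rfl

theorem isOpSum_quadratic_two (h : IsInvariantModel J l) : IsOpSum fun φ x => ∑ μ, ∑ ν,
    dd2 l (J 1 (φ x)) (J (lin (ev μ)) (d1 φ x μ)) (J (lin (ev ν)) (d1 φ x ν)) := by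
  obtain ⟨c, hc, e⟩ := h.coeffs_two (lin (ev 1)) (lin (ev 1))
  refine ((IsOpSum.op (hc 0).neg 1).add (IsOpSum.op (hc 1).neg 2)).congr fun φ _ x => ?_
  have key : ∀ μ ν, dd2 l (J 1 (φ x)) (J (lin (ev μ)) (d1 φ x μ)) (J (lin (ev ν)) (d1 φ x ν))
      = -(et μ * kd μ ν * dd2 l (J 1 (φ x)) (J (lin (ev 1)) (d1 φ x μ))
        (J (lin (ev 1)) (d1 φ x ν))) := fun μ ν => by
    have := (h.isotropic_quadratic_two (φ x) (d1 φ x μ) (d1 φ x ν)).components et_mul_self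
      (mem_univ 1) (mem_univ 2) (mem_univ 3) (mem_univ μ) (mem_univ ν) (mem_univ 1) (mem_univ 1)
    simp [mdot'_ev, kd, et] at this
    simp only [kd, et]
    split_ifs at this ⊢ <;> simp_all <;> linarith
  simp only [key, e, kd]
  change _ = _ * opA φ x + _ * opB φ x
  rw [opA_sum, opB_sum]
  simp only [Finset.mul_sum, ← Finset.sum_add_distrib]
  refine Finset.sum_congr rfl fun μ _ => ?_
  simp [dotProduct_comm (φ x)]
  ring

theorem isOpSum_quadratic_one (h : IsInvariantModel J l) : IsOpSum fun φ x => ∑ μ, ∑ ν,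
    dirD (J (lin (ev μ) * lin (ev ν)) (d2 φ x μ ν)) l (J 1 (φ x)) := by
  obtain ⟨c, hc, e⟩ := h.coeffs_one (lin (ev 1) * lin (ev 1))
  refine (IsOpSum.op hc.neg 3).congr fun φ _ x => ?_
  have key : ∀ μ ν, dirD (J (lin (ev μ) * lin (ev ν)) (d2 φ x μ ν)) l (J 1 (φ x))
      = -(et μ * kd μ ν * dirD (J (lin (ev 1) * lin (ev 1)) (d2 φ x μ ν)) l (J 1 (φ x))) :=
    fun μ ν => by
    have := (h.isotropic_quadratic_one (φ x) (d2 φ x μ ν)).components et_mul_self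
      (mem_univ 1) (mem_univ 2) (mem_univ 3) (mem_univ μ) (mem_univ ν) (mem_univ 1) (mem_univ 1)
    simp [mdot'_ev, kd, et] at this
    simp only [kd, et]
    split_ifs at this ⊢ <;> simp_all <;> linarith
  simp only [key, e, kd]
  change _ = _ * opE φ x
  rw [opE_eq]
  simp only [Finset.mul_sum]
  refine Finset.sum_congr rfl fun μ _ => ?_
  simp [dotProduct_comm (φ x)]
  ring

end parts

/-- Every invariant Lagrangian with at most four derivatives is a combination of the operators. -/
theorem IsInvariantLagrangian.isOpSum {L : Lagrangian} (hL : IsInvariantLagrangian L) :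
    IsOpSum L := by
  obtain ⟨r, l, h, e⟩ := hL.expansion
  obtain ⟨c, hc, ec⟩ := h.coeffs_zero
  have h0 : IsOpSum fun φ x => l (polyJet r 1 (φ x)) := (IsOpSum.op hc 0).congr fun φ _ x => by
    change _ = _ * (1 : ℝ)
    rw [ec, mul_one]
  refine ((h0.add (((isOpSum_quadratic_two h).const_mul (1 / 2)).add
    ((isOpSum_quadratic_one h).const_mul (1 / 2)))).add
    ((((((isOpSum_four h).const_mul (1 / 24)).add ((isOpSum_three h).const_mul (1 / 4))).add
    ((isOpSum_two_two h).const_mul (1 / 8))).add ((isOpSum_one_three h).const_mul (1 / 6))).add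
    ((isOpSum_one h).const_mul (1 / 24)))).congr fun φ hφ x => ?_
  rw [e φ hφ]
  rfl

/-! ### Completeness -/

theorem sum_opList (c : Fin 22 → ℝ) (φ : Spacetime → FieldSpace) (x : Spacetime) :
    ∑ k, c k * opList k φ x = c 0 + c 1 * opA φ x + c 2 * opB φ x + c 3 * opE φ x
      + c 4 * opBoxBox φ x + c 5 * opGradBox φ x + c 6 * opGradBoxField φ x + c 7 * opBoxSq φ x
      + c 8 * opE φ x ^ 2 + c 9 * op1 φ x + c 10 * op2 φ x + c 11 * op3 φ x + c 12 * op4 φ x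
      + c 13 * op20 φ x + c 14 * op21 φ x + c 15 * op5 φ x + c 16 * op6 φ x + c 17 * op7 φ x
      + c 18 * op22 φ x + c 19 * op8 φ x + c 20 * op9 φ x + c 21 * op10 φ x := by
  simp only [Fin.sum_univ_castSucc, Finset.univ_eq_empty, Finset.sum_empty, zero_add]
  conv_rhs => rw [show c 0 = c 0 * (1 : ℝ) from (mul_one _).symm]
  rfl

/-- A metric whose Lagrangian is a given combination of the operators that depend on at most two
derivatives of the field and at most linearly on `□φ`. -/
def metricCoeffsOf (Λ : ℝ) (c : Fin 22 → ℝ → ℝ) : MetricLabel → ℝ → ℝ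
  | .V => fun t => - c 0 (Λ ^ 2 * t) / Λ ^ 4
  | .C0 => fun t => 2 * c 1 (Λ ^ 2 * t)
  | .C1 => fun t => 2 * Λ ^ 2 * c 2 (Λ ^ 2 * t)
  | .E => fun t => c 3 (Λ ^ 2 * t)
  | .A0 => fun t => 2 * Λ ^ 2 * c 9 (Λ ^ 2 * t)
  | .A1 => fun t => 2 * Λ ^ 4 * c 10 (Λ ^ 2 * t)
  | .F11 => fun t => Λ ^ 4 * c 11 (Λ ^ 2 * t)
  | .F10 => fun t => Λ ^ 4 * c 12 (Λ ^ 2 * t)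
  | .F20 => fun t => Λ ^ 4 * c 13 (Λ ^ 2 * t)
  | .F21 => fun t => Λ ^ 4 * c 14 (Λ ^ 2 * t)
  | .D0 => fun t => 2 * Λ ^ 4 * c 15 (Λ ^ 2 * t)
  | .D1 => fun t => 2 * Λ ^ 4 * c 16 (Λ ^ 2 * t)
  | .F12 => fun t => Λ ^ 6 * c 17 (Λ ^ 2 * t)
  | .F22 => fun t => Λ ^ 6 * c 18 (Λ ^ 2 * t)
  | .D2 => fun t => 2 * Λ ^ 6 * c 19 (Λ ^ 2 * t)
  | .D3 => fun t => 2 * Λ ^ 6 * c 20 (Λ ^ 2 * t)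
  | .D4 => fun t => 2 * Λ ^ 8 * c 21 (Λ ^ 2 * t)
  | _ => 0

theorem smoothCoeffs_metricCoeffsOf (Λ : ℝ) {c : Fin 22 → ℝ → ℝ} (hc : SmoothCoeffs c) :
    SmoothCoeffs (metricCoeffsOf Λ c) := by
  have h : ∀ k, ContDiffOn ℝ ∞ (fun t => c k (Λ ^ 2 * t)) (Ici 0) := fun k =>
    (hc k).comp (contDiffOn_const.mul contDiffOn_id) fun t (ht : 0 ≤ t) =>
      mul_nonneg (sq_nonneg Λ) ht
  intro l
  cases l <;> simp only [metricCoeffsOf, div_eq_mul_inv]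
  all_goals
    repeat' first
      | exact h _
      | exact contDiffOn_const
      | apply ContDiffOn.neg
      | apply ContDiffOn.mul

theorem jetLagrangian_metricCoeffsOf (Λ : ℝ) (hΛ : Λ ≠ 0) {c : Fin 22 → ℝ → ℝ}
    (h : ∀ k, 4 ≤ k → k ≤ 8 → ∀ t, 0 ≤ t → c k t = 0) {φ : Spacetime → FieldSpace}
    (hφ : ContDiff ℝ ∞ φ) (x : Spacetime) :
    jetLagrangian (higgsMetric Λ (metricCoeffsOf Λ c)) φ x
      = ∑ k, c k (φ x ⬝ᵥ φ x) * opList k φ x := by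
  have ht : Λ ^ 2 * tt φ x Λ = φ x ⬝ᵥ φ x := by unfold tt; field_simp
  have h0 : ∀ k, 4 ≤ k → k ≤ 8 → c k (φ x ⬝ᵥ φ x) = 0 :=
    fun k hk hk' => h k hk hk' _ (dot_self_nonneg' _)
  rw [jetLagrangian_higgsMetric Λ _ x hΛ hφ, sum_opList (fun k => c k (φ x ⬝ᵥ φ x))]
  simp only [pulledBackForm, metricCoeffsOf, Pi.zero_apply, ht, h0 4 (by decide) (by decide),
    h0 5 (by decide) (by decide), h0 6 (by decide) (by decide), h0 7 (by decide) (by decide),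
    h0 8 (by decide) (by decide)]
  field_simp
  ring

section complete

variable (c : Fin 22 → ℝ → ℝ)

/-- Coefficient of `∂_μ□φ·∂^μφ` after integrating by parts the terms with two boxes. -/
def gradBoxCoeff (t : ℝ) : ℝ := c 5 t - c 4 t - c 7 t

/-- Coefficient of `(∂_μ□φ·φ)(∂^μφ·φ)` after integrating by parts the terms with two boxes. -/
def gradBoxFieldCoeff (t : ℝ) : ℝ := c 6 t - 2 * dt (c 4) t - c 8 t

/-- Coefficients after integrating by parts all terms with more than two derivatives of a field
and all terms with two boxes. -/
def boxReduced : Fin 22 → ℝ → ℝ :=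
  ![c 0, c 1, c 2, c 3, 0, 0, 0, 0, 0, fun t => c 9 t - gradBoxCoeff c t,
    fun t => c 10 t - gradBoxFieldCoeff c t,
    fun t => c 11 t - 2 * dt (gradBoxCoeff c) t - gradBoxFieldCoeff c t,
    fun t => c 12 t - gradBoxFieldCoeff c t,
    fun t => c 13 t - c 8 t, fun t => c 14 t - 2 * dt (c 7) t - c 8 t, c 15, c 16,
    fun t => c 17 t - 2 * dt (gradBoxFieldCoeff c) t, fun t => c 18 t - 2 * dt (c 8) t, c 19, c 20,
    c 21]

variable {c}

theorem contDiffOn_gradBoxCoeff (hc : SmoothCoeffs c) :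
    ContDiffOn ℝ ∞ (gradBoxCoeff c) (Ici 0) :=
  ((hc 5).sub (hc 4)).sub (hc 7)

theorem contDiffOn_gradBoxFieldCoeff (hc : SmoothCoeffs c) :
    ContDiffOn ℝ ∞ (gradBoxFieldCoeff c) (Ici 0) :=
  ((hc 6).sub (contDiffOn_const.mul (ContDiffOn.dt (hc 4)))).sub (hc 8)

theorem smoothCoeffs_boxReduced (hc : SmoothCoeffs c) : SmoothCoeffs (boxReduced c) := by
  have hg := contDiffOn_gradBoxCoeff hc
  have hh := contDiffOn_gradBoxFieldCoeff hc
  have h2 : ∀ {e : ℝ → ℝ}, ContDiffOn ℝ ∞ e (Ici 0) →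
      ContDiffOn ℝ ∞ (fun t => 2 * dt e t) (Ici 0) := fun he =>
    contDiffOn_const.mul (ContDiffOn.dt he)
  intro k
  fin_cases k
  exacts [hc 0, hc 1, hc 2, hc 3, contDiffOn_const, contDiffOn_const, contDiffOn_const,
    contDiffOn_const, contDiffOn_const, (hc 9).sub hg, (hc 10).sub hh,
    ((hc 11).sub (h2 hg)).sub hh, (hc 12).sub hh, (hc 13).sub (hc 8),
    ((hc 14).sub (h2 (hc 7))).sub (hc 8), hc 15, hc 16, (hc 17).sub (h2 hh),
    (hc 18).sub (h2 (hc 8)), hc 19, hc 20, hc 21]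

theorem ibp_boxReduced (hc : SmoothCoeffs c) :
    IBPEquiv (fun φ x => ∑ k, c k (φ x ⬝ᵥ φ x) * opList k φ x)
      (fun φ x => ∑ k, boxReduced c k (φ x ⬝ᵥ φ x) * opList k φ x) := by
  refine ((((ibp_opBoxBox (hc 4) 1).add (ibp_opBoxSq (hc 7) 1)).add (ibp_opE_sq (hc 8) 1)).add
    ((ibp_opGradBox (contDiffOn_gradBoxCoeff hc) 1).add
      (ibp_opGradBoxField (contDiffOn_gradBoxFieldCoeff hc) 1))).congr fun φ _ x => ?_
  have ht : tt φ x 1 = φ x ⬝ᵥ φ x := by simp [tt]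
  simp only [ht]
  rw [sum_opList (fun k => c k (φ x ⬝ᵥ φ x)), sum_opList (fun k => boxReduced c k (φ x ⬝ᵥ φ x))]
  change _ - (c 0 _ + c 1 _ * opA φ x + c 2 _ * opB φ x + c 3 _ * opE φ x
      + 0 * opBoxBox φ x + 0 * opGradBox φ x + 0 * opGradBoxField φ x + 0 * opBoxSq φ x
      + 0 * opE φ x ^ 2 + (c 9 _ - gradBoxCoeff c _) * op1 φ x
      + (c 10 _ - gradBoxFieldCoeff c _) * op2 φ x
      + (c 11 _ - 2 * dt (gradBoxCoeff c) _ - gradBoxFieldCoeff c _) * op3 φ x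
      + (c 12 _ - gradBoxFieldCoeff c _) * op4 φ x
      + (c 13 _ - c 8 _) * op20 φ x + (c 14 _ - 2 * dt (c 7) _ - c 8 _) * op21 φ x
      + c 15 _ * op5 φ x + c 16 _ * op6 φ x
      + (c 17 _ - 2 * dt (gradBoxFieldCoeff c) _) * op7 φ x
      + (c 18 _ - 2 * dt (c 8) _) * op22 φ x + c 19 _ * op8 φ x + c 20 _ * op9 φ x
      + c 21 _ * op10 φ x) = _
  generalize φ x ⬝ᵥ φ x = t
  have hg : gradBoxCoeff c t = c 5 t - c 4 t - c 7 t := rfl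
  have hh : gradBoxFieldCoeff c t = c 6 t - 2 * dt (c 4) t - c 8 t := rfl
  generalize dt (gradBoxCoeff c) t = g'
  generalize dt (gradBoxFieldCoeff c) t = h'
  rw [hg, hh]
  ring

end complete

theorem green_complete (Λ : ℝ) (hΛ : Λ ≠ 0) {L : Lagrangian} (hL : IsInvariantLagrangian L) :
    ∃ f, SmoothCoeffs f ∧ IBPEquiv L (greenLagrangian Λ f) := by
  obtain ⟨c, hc, e⟩ := hL.isOpSum
  have hr := smoothCoeffs_boxReduced hc
  have hm := smoothCoeffs_metricCoeffsOf Λ hr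
  refine ⟨_, smoothCoeffs_reducedCoeffs Λ hm, (IBPEquiv.of_eq e).trans
    ((ibp_boxReduced hc).trans (IBPEquiv.trans (IBPEquiv.of_eq fun φ hφ x =>
      (jetLagrangian_metricCoeffsOf Λ hΛ (fun k hk hk' t _ => ?_) hφ x).symm)
      (ibp_jetLagrangian Λ hΛ hm)))⟩
  revert hk hk'
  fin_cases k <;> simp [boxReduced]

/-! ### Lagrangians of metrics, before integration by parts -/

theorem pdv_polyField (μ : Fin 4) (p : Poly) (v : FieldSpace) :
    pdv μ (polyField p v) = polyField (MvPolynomial.pderiv μ p) v := by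
  have key : ∀ p : Poly, ∀ y, pd μ (fun y => MvPolynomial.eval y p) y
      = MvPolynomial.eval y (MvPolynomial.pderiv μ p) := by
    intro p
    induction p using MvPolynomial.induction_on with
    | C a => intro y; simp [pd_const]
    | add p q hp hq =>
      intro y
      simp only [map_add]
      rw [pd_add (contDiff_eval p) (contDiff_eval q), hp, hq]
    | mul_X p i hp =>
      intro y
      simp only [map_mul, MvPolynomial.eval_X, Derivation.leibniz, map_add, smul_eq_mul]
      rw [pd_mul (contDiff_eval p) (contDiff_apply ℝ ℝ i), hp, pd_coord]
      rcases eq_or_ne i μ with rfl | h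
      · simp; ring
      · simp [MvPolynomial.pderiv_X_of_ne h.symm, MvPolynomial.pderiv_X_of_ne h, h, mul_comm]
  funext y i
  simp only [pdv, polyField, Pi.smul_apply, smul_eq_mul, mul_comm _ (v i)]
  rw [pd_const_mul _ (contDiff_eval p), key]

theorem pdv_combField (μ : Fin 4) (u : FieldSpace) (p : Fin 4 → Poly) (v : Fin 4 → FieldSpace)
    (t : Spacetime) :
    pdv μ (combField u p v t) = combField 0 (fun j => MvPolynomial.pderiv μ (p j)) v t := by
  have h0 : ∀ y, pdv μ (fun _ => u) y = 0 := fun y => funext fun i => pd_const _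
  funext y
  have h1 := pdv_sum_smul (f := fun j => polyField (p j) (v j))
    (fun j => contDiff_polyField _ _) t μ y
  simp only [pdv_polyField] at h1
  simp only [combField, zero_add]
  rw [← h1]
  funext i
  simp only [pdv, combField, Pi.add_apply]
  rw [pd_add contDiff_const (contDiff_comp_apply (contDiff_sum_smul
    (fun j => contDiff_polyField (p j) (v j)) t) i), pd_const, zero_add]

section combFieldJets

variable (u : FieldSpace) (p : Fin 4 → Poly) (v : Fin 4 → FieldSpace) (t y : Spacetime)

open MvPolynomial

theorem d1_combField (μ : Fin 4) :
    d1 (combField u p v t) y μ = combField 0 (fun j => pderiv μ (p j)) v t y := by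
  rw [← pdv_combField]; rfl

theorem d2_combField (μ ν : Fin 4) : d2 (combField u p v t) y μ ν
    = combField 0 (fun j => pderiv μ (pderiv ν (p j))) v t y := by
  rw [← pdv_combField, ← pdv_combField]; rfl

theorem d3_combField (μ ν ρ : Fin 4) : d3 (combField u p v t) y μ ν ρ
    = combField 0 (fun j => pderiv μ (pderiv ν (pderiv ρ (p j)))) v t y := by
  rw [← pdv_combField, ← pdv_combField, ← pdv_combField]; rfl

theorem d4_combField (μ ν ρ σ : Fin 4) : d4 (combField u p v t) y μ ν ρ σ
    = combField 0 (fun j => pderiv μ (pderiv ν (pderiv ρ (pderiv σ (p j))))) v t y := by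
  rw [← pdv_combField, ← pdv_combField, ← pdv_combField, ← pdv_combField]; rfl

end combFieldJets

theorem tangent_eq_mkJ1 (φ : Spacetime → FieldSpace) (x : Spacetime) (ρ : Fin 4) :
    tangent φ x ρ = mkJ1 (Pi.single ρ 1) (d1 φ x ρ) (d2 φ x ρ) := by
  funext I
  rcases I with μ | i | q
  · exact congrFun (xc_tangent φ x ρ) μ
  · rfl
  · rfl

theorem jetLagrangian_eq_of_jet (g : JetTensor) (φ : Spacetime → FieldSpace) (x : Spacetime) :
    jetLagrangian g φ x = (1 / 2) * ∑ ρ, et ρ * tform (g (mkJ1 x (φ x) (d1 φ x)))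
      (mkJ1 (Pi.single ρ 1) (d1 φ x ρ) (d2 φ x ρ))
      (mkJ1 (Pi.single ρ 1) (d1 φ x ρ) (d2 φ x ρ)) := by
  rw [jetLagrangian_eq]
  simp only [tangent_eq_mkJ1, j1]

theorem coeffs_eq_zero_of_forall {C D : ℝ → ℝ} (hD : ContDiffOn ℝ ∞ D (Ici 0))
    (h : ∀ u a b : FieldSpace, C (u ⬝ᵥ u) * (a ⬝ᵥ b) + D (u ⬝ᵥ u) * ((a ⬝ᵥ u) * (b ⬝ᵥ u)) = 0)
    (t : ℝ) (ht : 0 ≤ t) : C t = 0 ∧ D t = 0 := by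
  have hC : ∀ t, 0 ≤ t → C t = 0 := fun t ht => by
    have := h (√t • ev 0) (ev 1) (ev 1)
    simpa [ev, Real.mul_self_sqrt ht] using this
  refine ⟨hC t ht, eq_zero_of_pos hD (fun t ht => ?_) t ht⟩
  have := h (√t • ev 0) (ev 0) (ev 0)
  simpa [ev, Real.mul_self_sqrt ht.le, hC t ht.le, ht.ne'] using this

section metric

variable {g : JetTensor} {c : Fin 22 → ℝ → ℝ}

open MvPolynomial in
theorem coeff_identity_high
    (h : ∀ φ : Spacetime → FieldSpace, ContDiff ℝ ∞ φ → ∀ x,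
      jetLagrangian g φ x = ∑ k, c k (φ x ⬝ᵥ φ x) * opList k φ x) (u w a z : FieldSpace) :
    c 4 (u ⬝ᵥ u) * (24 * (z ⬝ᵥ u)) + c 5 (u ⬝ᵥ u) * (6 * (a ⬝ᵥ w))
      + c 6 (u ⬝ᵥ u) * (6 * ((a ⬝ᵥ u) * (w ⬝ᵥ u))) = 0 := by
  set ψ : Spacetime → Spacetime → FieldSpace := fun t =>
    combField u ![X 0, X 0 * (X 0 * X 0), X 0 * (X 0 * (X 0 * X 0)), 0] ![w, a, z, 0] t with hψ
  have hs : ∀ t, ContDiff ℝ ∞ (ψ t) := fun t => contDiff_combField _ _ _ _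
  have e0 : ∀ t, ψ t 0 = u := fun t => by simp [hψ, combField, polyField, Fin.sum_univ_four]
  have e1 : ∀ t, d1 (ψ t) 0 = fun μ => if μ = 0 then t 0 • w else 0 := fun t => funext fun μ => by
    rw [hψ, d1_combField]
    fin_cases μ <;>
      simp [combField, polyField, Fin.sum_univ_four, Derivation.leibniz, pderiv_X]
  have e2 : ∀ t, d2 (ψ t) 0 = 0 := fun t => funext fun μ => funext fun ν => by
    rw [hψ, d2_combField]
    fin_cases μ <;> fin_cases ν <;>
      simp [combField, polyField, Fin.sum_univ_four, Derivation.leibniz, pderiv_X]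
  have e3 : ∀ t μ ν, d3 (ψ t) 0 μ ν ν = if μ = 0 ∧ ν = 0 then (6 * t 1) • a else 0 :=
    fun t μ ν => by
    rw [hψ, d3_combField]
    fin_cases μ <;> fin_cases ν <;>
      simp [combField, polyField, Fin.sum_univ_four, Derivation.leibniz, pderiv_X] <;>
      module
  have e4 : ∀ t μ ν, d4 (ψ t) 0 μ μ ν ν = if μ = 0 ∧ ν = 0 then (24 * t 2) • z else 0 :=
    fun t μ ν => by
    rw [hψ, d4_combField]
    fin_cases μ <;> fin_cases ν <;>
      simp [combField, polyField, Fin.sum_univ_four, Derivation.leibniz, pderiv_X] <;>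
      module
  have hL : jetLagrangian g (ψ ![1, 1, 1, 0]) 0 = jetLagrangian g (ψ ![1, 0, 0, 0]) 0 := by
    simp only [jetLagrangian_eq_of_jet, e0, e1, e2]
    simp
  rw [h _ (hs _), h _ (hs _), sum_opList (fun k => c k (ψ ![1, 1, 1, 0] 0 ⬝ᵥ ψ ![1, 1, 1, 0] 0)),
    sum_opList (fun k => c k (ψ ![1, 0, 0, 0] 0 ⬝ᵥ ψ ![1, 0, 0, 0] 0))] at hL
  have r1 : d1 (ψ ![1, 1, 1, 0]) 0 = d1 (ψ ![1, 0, 0, 0]) 0 := by simp [e1]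
  simp only [op1_eq, op2_eq, op3_eq, op4_eq, op5, op6_eq, op7_eq, op8, op9_eq, op10, op20, op21_eq,
    op22, opA_sum, opB_sum, opE_eq, opBoxSq, r1, e2, e0] at hL
  have hBB : ∀ t, opBoxBox (ψ t) 0 = 24 * t 2 * (z ⬝ᵥ u) := fun t => by
    simp [opBoxBox, e4, e0, dsum, Fin.sum_univ_four, et]
  have hGB : ∀ t, opGradBox (ψ t) 0 = 6 * t 1 * t 0 * (a ⬝ᵥ w) := fun t => by
    simp [opGradBox, e3, e1, dsum, Fin.sum_univ_four, et]; ring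
  have hGF : ∀ t, opGradBoxField (ψ t) 0 = 6 * t 1 * t 0 * ((a ⬝ᵥ u) * (w ⬝ᵥ u)) := fun t => by
    simp [opGradBoxField, e3, e1, e0, dsum, Fin.sum_univ_four, et]; ring
  simp only [hBB, hGB, hGF] at hL
  simp at hL
  linarith

open MvPolynomial in
theorem coeff_identity_boxes
    (h : ∀ φ : Spacetime → FieldSpace, ContDiff ℝ ∞ φ → ∀ x,
      jetLagrangian g φ x = ∑ k, c k (φ x ⬝ᵥ φ x) * opList k φ x)
    (h4 : ∀ t, 0 ≤ t → c 4 t = 0) (u a b : FieldSpace) :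
    c 7 (u ⬝ᵥ u) * (a ⬝ᵥ b) + c 8 (u ⬝ᵥ u) * ((a ⬝ᵥ u) * (b ⬝ᵥ u)) = 0 := by
  set ψ : Spacetime → Spacetime → FieldSpace := fun t =>
    combField u ![X 0 * X 0, X 1 * X 1, 0, 0] ![a, b, 0, 0] t with hψ
  have hs : ∀ t, ContDiff ℝ ∞ (ψ t) := fun t => contDiff_combField _ _ _ _
  have e0 : ∀ t, ψ t 0 = u := fun t => by simp [hψ, combField, polyField, Fin.sum_univ_four]
  have e1 : ∀ t, d1 (ψ t) 0 = 0 := fun t => funext fun μ => by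
    rw [hψ, d1_combField]
    fin_cases μ <;>
      simp [combField, polyField, Fin.sum_univ_four, Derivation.leibniz, pderiv_X]
  have e2 : ∀ t, d2 (ψ t) 0 = ![![(2 * t 0) • a, 0, 0, 0], ![0, (2 * t 1) • b, 0, 0], 0, 0] :=
    fun t => funext fun μ => funext fun ν => by
    rw [hψ, d2_combField]
    fin_cases μ <;> fin_cases ν <;>
      simp [combField, polyField, Fin.sum_univ_four, Derivation.leibniz, pderiv_X] <;>
      module
  have hL : jetLagrangian g (ψ ![1, 1, 0, 0]) 0 + jetLagrangian g (ψ 0) 0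
      = jetLagrangian g (ψ ![1, 0, 0, 0]) 0 + jetLagrangian g (ψ ![0, 1, 0, 0]) 0 := by
    simp only [jetLagrangian_eq_of_jet, e0, e1, e2, Fin.sum_univ_four]
    simp
    ring
  have hv : ∀ t : Spacetime, jetLagrangian g (ψ t) 0 = c 0 (u ⬝ᵥ u)
      + c 3 (u ⬝ᵥ u) * (2 * t 0 * (a ⬝ᵥ u) - 2 * t 1 * (b ⬝ᵥ u))
      + c 7 (u ⬝ᵥ u) * (4 * t 0 ^ 2 * (a ⬝ᵥ a) + 4 * t 1 ^ 2 * (b ⬝ᵥ b) - 8 * t 0 * t 1 * (a ⬝ᵥ b))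
      + c 8 (u ⬝ᵥ u) * (2 * t 0 * (a ⬝ᵥ u) - 2 * t 1 * (b ⬝ᵥ u)) ^ 2
      + c 9 (u ⬝ᵥ u) * (4 * t 0 ^ 2 * (a ⬝ᵥ a) + 4 * t 1 ^ 2 * (b ⬝ᵥ b))
      + c 10 (u ⬝ᵥ u) * (4 * t 0 ^ 2 * (a ⬝ᵥ u) ^ 2 + 4 * t 1 ^ 2 * (b ⬝ᵥ u) ^ 2) := fun t => by
    rw [h _ (hs _), sum_opList (fun k => c k (ψ t 0 ⬝ᵥ ψ t 0))]
    simp only [op1_eq, op2_eq, op3_eq, op4_eq, op5, op6_eq, op7_eq, op8, op9_eq, op10, op20,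
      op21_eq, op22, opA_sum, opB_sum, opE_eq, opBoxSq, opGradBox, opGradBoxField, dsum, e1, e2, e0,
      h4 _ (dot_self_nonneg' u), Fin.sum_univ_four]
    simp [et, dotProduct_comm b a]
    ring
  simp only [hv] at hL
  simp at hL
  linarith

end metric

theorem exists_metric_coeffs (Λ : ℝ) (hΛ : Λ ≠ 0) {g : JetTensor} (hg : IsInvariantJetMetric g) :
    ∃ c, SmoothCoeffs c ∧ ∀ φ : Spacetime → FieldSpace, ContDiff ℝ ∞ φ → ∀ x,
      jetLagrangian g φ x = jetLagrangian (higgsMetric Λ c) φ x := by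
  obtain ⟨c, hc, h⟩ := hg.isInvariantLagrangian.isOpSum
  have h56 := coeffs_eq_zero_of_forall (C := c 5) (hc 6) fun u a w => by
    have := coeff_identity_high h u w a 0
    rw [zero_dotProduct] at this
    linarith
  have h4 : ∀ t, 0 ≤ t → c 4 t = 0 := eq_zero_of_pos (hc 4) fun t ht => by
    have := coeff_identity_high h (√t • ev 0) 0 0 (ev 0)
    simpa [ev, Real.mul_self_sqrt ht.le, ht.ne', Real.sqrt_ne_zero'.2 ht] using this
  have h78 := coeffs_eq_zero_of_forall (C := c 7) (hc 8) (coeff_identity_boxes h h4)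
  refine ⟨_, smoothCoeffs_metricCoeffsOf Λ hc, fun φ hφ x => ?_⟩
  rw [jetLagrangian_metricCoeffsOf Λ hΛ (fun k hk hk' t ht => ?_) hφ, h φ hφ]
  have h5 := h56 t ht
  have h7 := h78 t ht
  have h4 := h4 t ht
  revert hk hk'
  fin_cases k <;> simp_all

end

end HiggsJet

theorem mainTheorem2 (Λ : ℝ) (hΛ : 0 < Λ) :
    -- every member of the family is an invariant metric with at most four derivatives
    (∀ c, SmoothCoeffs c → IsInvariantJetMetric (higgsMetric Λ c)) ∧
    -- the family is the most general one, as far as the Lagrangian is concerned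
    (∀ g, IsInvariantJetMetric g → ∃ c, SmoothCoeffs c ∧
      ∀ φ, ContDiff ℝ ∞ φ → ∀ x,
        jetLagrangian g φ x = jetLagrangian (higgsMetric Λ c) φ x) ∧
    -- the pulled-back Lagrangian
    (∀ c, SmoothCoeffs c → ∀ φ, ContDiff ℝ ∞ φ → ∀ x,
      jetLagrangian (higgsMetric Λ c) φ x = pulledBackForm Λ c φ x) ∧
    -- the four leftover terms are redundant under integration by parts
    (∀ e : ℝ → ℝ, ContDiffOn ℝ ∞ e (Ici 0) →
      IBPEquiv (fun φ x => opE φ x * e (tt φ x Λ))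
        (fun φ x => - opA φ x * e (tt φ x Λ) - 2 * opB φ x / Λ ^ 2 * dt e (tt φ x Λ)) ∧
      IBPEquiv (fun φ x => op20 φ x * e (tt φ x Λ))
        (fun φ x => - op5 φ x * e (tt φ x Λ) - 2 * op3 φ x * e (tt φ x Λ)
          - 2 * op8 φ x / Λ ^ 2 * dt e (tt φ x Λ)) ∧
      IBPEquiv (fun φ x => op21 φ x * e (tt φ x Λ))
        (fun φ x => - op3 φ x * e (tt φ x Λ) - op4 φ x * e (tt φ x Λ)
          - op6 φ x * e (tt φ x Λ) - 2 * op9 φ x / Λ ^ 2 * dt e (tt φ x Λ)) ∧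
      IBPEquiv (fun φ x => op22 φ x * e (tt φ x Λ))
        (fun φ x => - op8 φ x * e (tt φ x Λ) - 2 * op7 φ x * e (tt φ x Λ)
          - 2 * op9 φ x * e (tt φ x Λ) - 2 * op10 φ x / Λ ^ 2 * dt e (tt φ x Λ))) ∧
    -- the Lagrangian after integration by parts
    (∀ c, SmoothCoeffs c → SmoothCoeffs (reducedCoeffs Λ c) ∧
      IBPEquiv (jetLagrangian (higgsMetric Λ c)) (greenLagrangian Λ (reducedCoeffs Λ c))) ∧
    -- the box-free Lagrangians form a complete set without redundancies
    IsGreenBasis (greenLagrangian Λ) ∧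
    -- every box-free Lagrangian is obtained, with the four leftover terms switched off
    (∀ f, SmoothCoeffs f → ∃ c, SmoothCoeffs c ∧
      c .E = 0 ∧ c .F20 = 0 ∧ c .F21 = 0 ∧ c .F22 = 0 ∧
      ∀ φ, ContDiff ℝ ∞ φ → ∀ x,
        jetLagrangian (higgsMetric Λ c) φ x = greenLagrangian Λ f φ x) ∧
    -- if `F_1` is not identically zero, the metric can be taken generically non-degenerate
    (∀ f, SmoothCoeffs f → (∃ t, 0 ≤ t ∧ f .F1 t ≠ 0) → ∃ c, SmoothCoeffs c ∧
      (∃ p, (higgsMetric Λ c p).det ≠ 0) ∧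
      IBPEquiv (jetLagrangian (higgsMetric Λ c)) (greenLagrangian Λ f)) := 
  ⟨fun _ hc => isInvariantJetMetric_higgsMetric Λ hc,
    fun _ hg => exists_metric_coeffs Λ hΛ.ne' hg,
    fun c _ _ hφ x => jetLagrangian_higgsMetric Λ c x hΛ.ne' hφ,
    fun _ he => ⟨ibp_opE he Λ, ibp_op20 he Λ, ibp_op21 he Λ, ibp_op22 he Λ⟩,
    fun _ hc => ⟨smoothCoeffs_reducedCoeffs Λ hc, ibp_jetLagrangian Λ hΛ.ne' hc⟩,
    { invariant := fun _ hf => isInvariantLagrangian_greenLagrangian Λ hΛ.ne' hf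
      complete := fun _ hL => green_complete Λ hΛ.ne' hL
      nonredundant := fun _ hf hT l t ht => green_nonredundant hΛ hf hT l t ht },
    fun f hf => ⟨greenMetricCoeffs Λ f, smoothCoeffs_greenMetricCoeffs Λ hf, rfl, rfl, rfl, rfl,
      fun _ hφ x => jetLagrangian_greenMetricCoeffs Λ hΛ.ne' f hφ x⟩,
    fun _ hf h => exists_nondegenerate Λ hΛ hf h⟩
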